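/- Let $\nu\ge 1/4$ and $|\theta|\le\min(1,2\sqrt\nu-1)$, and put $\alpha=1/\sqrt\nu$. For $\tau\in\mathbb R$ and $n\ge 2$ let $X_1,\dots,X_n$ be independent random variables, each having the strictly stable law with characteristic function $$\hat g(k;\nu,\theta,\tau)=\exp\Big\{-\exp\big\{\nu^{-1/2}\big(\log|k|+\tau-i\tfrac{\pi}{2}\theta\,\mathrm{sign}\,k\big)+\mathbf C(\nu^{-1/2}-1)\big\}\Big\}\quad(k\ne0),\qquad \hat g(0;\nu,\theta,\tau)=1,$$ where $\mathbf C$ is the Euler constant. Put $U_j=\mathrm{sign}\,X_j$, $V_j=\log|X_j|$ and, for a sample $Z_1,\dots,Z_n$, $A_Z=\frac1n\sum_j Z_j$, $B_Z^2=\frac1{n-1}\sum_j(Z_j-A_Z)^2$. Define $$\tilde\theta=A_U,\qquad \hat\nu=\frac{6}{\pi^2}B_V^2-\frac32B_U^2+1,\qquad \tilde\nu=\max\big(\hat\nu,(1+|\tilde\theta|)^2/4\big),\qquad \tilde\alpha=1/\sqrt{\tilde\nu}.$$ Then: (i) $\tilde\alpha$ is an asymptotically unbiased estimate of $\alpha$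 of order $1/\sqrt n$: there is a constant $C$, depending only on $\nu$ and $\theta$, such that $|\mathbb E\tilde\alpha-\alpha|\le C/\sqrt n$ for all $n\ge2$, all $\tau$ and all such samples. (ii) For all $n\ge2$ and all such samples, $\mathbb E(\hat\nu-\nu)^2<\infty$ and $$\mathbb E(\tilde\alpha-\alpha)^2\le\frac{\mathbb E(\hat\nu-\nu)^2}{4\nu^3}+\frac{12}{n\nu^{3/2}}\sqrt{\mathbb E(\hat\nu-\nu)^2}\Big(P_3^2+\frac{\sqrt{P_3'}}{n^{1/8}}\Big)+144\Big(\frac{P_3^4}{n^2}+\frac{P_3'}{n^{9/4}}\Big).$$ Here, with $\zeta$ the zeta function and $$D=\tfrac{\pi^2}{4}(1-\theta^2)+\tfrac{\pi^2}{6}(\nu-1),\quad Q_4=\tfrac{1-\theta^4}{8}+\tfrac{\nu^2-1}{15},\quad Q_6=\tfrac{1-\theta^6}{32}+\tfrac{\nu^3-1}{63},\quad Q_8=\tfrac{17(1-\theta^8)}{128}+\tfrac{\nu^4-1}{15},$$ $$R_3=\zeta(3)(\nu^{3/2}-1),\qquad R_5=\zeta(5)(\nu^{5/2}-1),$$ the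 expressions in the bound are $$P_3=3\sqrt[4]{3}\,\sqrt{\theta^2(1-\theta^2)}+\frac{6\sqrt[4]{3}}{\pi^2}\sqrt{\pi^4Q_4+3D^2},$$ $$P_3'=n^{1/4}\Big(P_3+\tfrac32\big(|P_1|/n\big)^{1/4}+\tfrac{6}{\pi^2}\big(|P_2|/n\big)^{1/4}\Big)^4-n^{1/4}P_3^4,$$ $$\begin{aligned}P_1={}&16(15\theta^2-71\theta^4+26\theta^6-45\theta^8)+\tfrac{12}{n-1}(5-96\theta^2+302\theta^4-356\theta^6+155\theta^8)\\&+\tfrac{4}{(n-1)^2}(-33+436\theta^2-1238\theta^4+1300\theta^6-465\theta^8)+\tfrac{16}{(n-1)^3}(5-52\theta^2+134\theta^4-132\theta^6+45\theta^8),\end{aligned}$$ $$\begin{aligned}P_2={}&4\big\{18D^4+39D^2\pi^4Q_4+96R_3^2D+8\pi^8Q_4^2+48\pi^6Q_6D+384R_3R_5+2\pi^8Q_8\big\}\\&+\tfrac{12}{n-1}\big\{15D^4+25D^2\pi^4Q_4+16\pi^6Q_6D+32R_3^2D+2\pi^8Q_4^2\big\}\\&+\tfrac{12}{(n-1)^2}\big\{-32R_3^2D-128R_3R_5+12D^2\pi^4Q_4+13D^4\big\}+\tfrac{8}{(n-1)^3}\big\{\pi^8Q_4^2+6D^4-48R_3^2D\big\}.\end{aligned}$$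 -/

import Mathlib

open MeasureTheory ProbabilityTheory

noncomputable section

namespace StableEstimation

/-- The characteristic function of the strictly stable law with parameters `ν, θ, τ`
(the logarithmic parametrization): for `k ≠ 0` it is
`exp (-exp (ν^(-1/2) (log |k| + τ - i (π/2) θ sign k) + C (ν^(-1/2) - 1)))`, with `C` the
Euler constant, and at `k = 0` it has its limit value `1`. -/
def stableCharFun (ν θ τ k : ℝ) : ℂ :=
  if k = 0 then 1 else
    Complex.exp (-Complex.exp
      ((((Real.sqrt ν)⁻¹ : ℝ) : ℂ) *
          (((Real.log |k| + τ : ℝ) : ℂ) - Complex.I * ((Real.pi / 2 * θ * Real.sign k : ℝ) : ℂ))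
        + ((Real.eulerMascheroniConstant * ((Real.sqrt ν)⁻¹ - 1) : ℝ) : ℂ)))

/-- `X 0, …, X (n-1)` are independent random variables, each of them having the strictly stable
law with parameters `ν, θ, τ`. -/
structure IsStableSample {Ω : Type*} [MeasurableSpace Ω] (P : Measure Ω) (ν θ τ : ℝ) {n : ℕ}
    (X : Fin n → Ω → ℝ) : Prop where
  measurable : ∀ i, Measurable (X i)
  indep : iIndepFun X P
  charFun_eq : ∀ i k, charFun (P.map (X i)) k = stableCharFun ν θ τ k

/-! ### The estimators, as functions of the observed values `x 0, …, x (n-1)` -/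

/-- The sample mean `A`. -/
def sampleMean {n : ℕ} (x : Fin n → ℝ) : ℝ := (∑ j, x j) / (n : ℝ)

/-- The sample variance `B²`. -/
def sampleVar {n : ℕ} (x : Fin n → ℝ) : ℝ :=
  (∑ j, (x j - sampleMean x) ^ 2) / ((n : ℝ) - 1)

/-- The signs `U_j` of the observations. -/
def signs {n : ℕ} (x : Fin n → ℝ) : Fin n → ℝ := fun j => Real.sign (x j)

/-- The log-moduli `V_j` of the observations. -/
def logAbs {n : ℕ} (x : Fin n → ℝ) : Fin n → ℝ := fun j => Real.log |x j|

/-- The estimator of `θ`. -/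
def thetaTilde {n : ℕ} (x : Fin n → ℝ) : ℝ := sampleMean (signs x)

/-- The preliminary estimator `ν̂` of `ν`. -/
def nuHat {n : ℕ} (x : Fin n → ℝ) : ℝ :=
  6 / Real.pi ^ 2 * sampleVar (logAbs x) - 3 / 2 * sampleVar (signs x) + 1

/-- The truncated estimator `ν̃` of `ν`. -/
def nuTilde {n : ℕ} (x : Fin n → ℝ) : ℝ := max (nuHat x) ((1 + |thetaTilde x|) ^ 2 / 4)

/-- The estimator `α̃ = 1 / √ν̃` of the characteristic exponent. -/
def alphaTilde {n : ℕ} (x : Fin n → ℝ) : ℝ := 1 / Real.sqrt (nuTilde x)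

/-! ### The explicit expressions in the bound -/

/-- `ζ(s)` as a real number. -/
def zetaR (s : ℕ) : ℝ := (riemannZeta (s : ℂ)).re

/-- `DV`, the variance of `log |X|`. -/
def DV (ν θ : ℝ) : ℝ := Real.pi ^ 2 / 4 * (1 - θ ^ 2) + Real.pi ^ 2 / 6 * (ν - 1)

/-- `(1 - θ⁴) / 8 + (ν² - 1) / 15`. -/
def Q4 (ν θ : ℝ) : ℝ := (1 - θ ^ 4) / 8 + (ν ^ 2 - 1) / 15

/-- `(1 - θ⁶) / 32 + (ν³ - 1) / 63`. -/
def Q6 (ν θ : ℝ) : ℝ := (1 - θ ^ 6) / 32 + (ν ^ 3 - 1) / 63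

/-- `17 (1 - θ⁸) / 128 + (ν⁴ - 1) / 15`. -/
def Q8 (ν θ : ℝ) : ℝ := 17 * (1 - θ ^ 8) / 128 + (ν ^ 4 - 1) / 15

/-- `ζ(3) (ν^(3/2) - 1)`. -/
def R3 (ν : ℝ) : ℝ := zetaR 3 * (ν ^ (3 / 2 : ℝ) - 1)

/-- `ζ(5) (ν^(5/2) - 1)`. -/
def R5 (ν : ℝ) : ℝ := zetaR 5 * (ν ^ (5 / 2 : ℝ) - 1)

def P1 (θ : ℝ) (n : ℕ) : ℝ :=
  16 * (15 * θ ^ 2 - 71 * θ ^ 4 + 26 * θ ^ 6 - 45 * θ ^ 8)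
  + 12 / ((n : ℝ) - 1) * (5 - 96 * θ ^ 2 + 302 * θ ^ 4 - 356 * θ ^ 6 + 155 * θ ^ 8)
  + 4 / ((n : ℝ) - 1) ^ 2 * (-33 + 436 * θ ^ 2 - 1238 * θ ^ 4 + 1300 * θ ^ 6 - 465 * θ ^ 8)
  + 16 / ((n : ℝ) - 1) ^ 3 * (5 - 52 * θ ^ 2 + 134 * θ ^ 4 - 132 * θ ^ 6 + 45 * θ ^ 8)

def P2 (ν θ : ℝ) (n : ℕ) : ℝ :=
  4 * (18 * DV ν θ ^ 4 + 39 * DV ν θ ^ 2 * Real.pi ^ 4 * Q4 ν θ + 96 * R3 ν ^ 2 * DV ν θ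
      + 8 * Real.pi ^ 8 * Q4 ν θ ^ 2 + 48 * Real.pi ^ 6 * Q6 ν θ * DV ν θ
      + 384 * R3 ν * R5 ν + 2 * Real.pi ^ 8 * Q8 ν θ)
  + 12 / ((n : ℝ) - 1) *
      (15 * DV ν θ ^ 4 + 25 * DV ν θ ^ 2 * Real.pi ^ 4 * Q4 ν θ
        + 16 * Real.pi ^ 6 * Q6 ν θ * DV ν θ + 32 * R3 ν ^ 2 * DV ν θ
        + 2 * Real.pi ^ 8 * Q4 ν θ ^ 2)
  + 12 / ((n : ℝ) - 1) ^ 2 *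
      (-32 * R3 ν ^ 2 * DV ν θ - 128 * R3 ν * R5 ν
        + 12 * DV ν θ ^ 2 * Real.pi ^ 4 * Q4 ν θ + 13 * DV ν θ ^ 4)
  + 8 / ((n : ℝ) - 1) ^ 3 *
      (Real.pi ^ 8 * Q4 ν θ ^ 2 + 6 * DV ν θ ^ 4 - 48 * R3 ν ^ 2 * DV ν θ)

def P3 (ν θ : ℝ) : ℝ :=
  3 * (3 : ℝ) ^ (1 / 4 : ℝ) * Real.sqrt (θ ^ 2 * (1 - θ ^ 2))
  + 6 * (3 : ℝ) ^ (1 / 4 : ℝ) / Real.pi ^ 2 *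
      Real.sqrt (Real.pi ^ 4 * Q4 ν θ + 3 * DV ν θ ^ 2)

/-- The expression `P₃'`. -/
def P3' (ν θ : ℝ) (n : ℕ) : ℝ :=
  (n : ℝ) ^ (1 / 4 : ℝ) *
      (P3 ν θ + 3 / 2 * (|P1 θ n| / (n : ℝ)) ^ (1 / 4 : ℝ)
        + 6 / Real.pi ^ 2 * (|P2 ν θ n| / (n : ℝ)) ^ (1 / 4 : ℝ)) ^ 4
  - (n : ℝ) ^ (1 / 4 : ℝ) * P3 ν θ ^ 4

/-- The bound for the quadratic deviation of `α̃`, where `m` stands for `E (ν̂ - ν)²`. -/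
def mseBound (ν θ : ℝ) (n : ℕ) (m : ℝ) : ℝ :=
  m / (4 * ν ^ 3)
  + 12 / ((n : ℝ) * ν ^ (3 / 2 : ℝ)) * Real.sqrt m *
      (P3 ν θ ^ 2 + Real.sqrt (P3' ν θ n) / (n : ℝ) ^ (1 / 8 : ℝ))
  + 144 * (P3 ν θ ^ 4 / (n : ℝ) ^ 2 + P3' ν θ n / (n : ℝ) ^ (9 / 4 : ℝ))

end StableEstimation

end

/-! Let a = √ν, let u be the centred sign of X and v the logarithm of |X|, centred and multiplied by
√6/π. The proof has three layers.

The law of (u, v). Integrating the characteristic function against k^(s-1) gives E |X|^(-s) exp(iπs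
sign X / 2) for 0 < s < 1 in terms of Gamma functions (`integral_rpow_neg_mul_cexp_sign`). Real and
imaginary parts yield two identities for moment generating functions, which extend to a
neighbourhood of s = 0 by analyticity. In the product M(s)M(-s) the reflection formula removes the
Gamma factors and the scale τ drops out, so only sines and cosines remain (`LogLaw`). Taylor
coefficients give the even moments of v and the mixed moments with the sign. The odd cumulants,
which carry ζ(3) and ζ(5), are never computed: the third moment enters only through the sixth, where
Cauchy–Schwarz suffices. If |θ| = √ν the law is a point mass and the same identities hold trivially.
Exchanging signs reduces everything to θ ≥ 0.

The estimator of ν. The deviation ν̂ - ν equals z₁ + r, where z₁ is the sample mean of y = v² - D +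
3θu, with D = E v², and r is a degenerate U-statistic (Hoeffding's decomposition, `estimators_eq`).
The two parts are orthogonal in L²; z₁ has order n^(-1/2) and r has order 1/n. By `le_mseBound` the
asserted bound is at least (√m + 24a³S²/n)² / (4a⁶), where m = E(ν̂ - ν)² and S = `sBound`; the term
with P₂ is not needed. It remains to bound the L² norm of e = 2a³(α̃ - α) by √m + 24a³S²/n.
Pointwise, |e| is at most |ν̃ - ν| plus 3(z₁)₋² + (8a³ - 1)|r| (`abs_errAt_le`). The norm of this
excess has order 1/n and is controlled by exponential moments, because -y is bounded above.

The truncation. The real difficulty is that replacing ν̂ by ν̃ might increase the second moment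
already in order 1/n, whereas only order n^(-3/2) is affordable. Put κ = (1+θ)/2, so that κ² ≤ ν is
the boundary of the parameter domain. There are four cases (`PairLaw.l2_err_le_sqrt_add`). If a ≥ 1
the truncation level lies below ν and truncation only helps. If θ ≥ 3/5 the truncated deviation is
close to max(z₁, κδ - (a² - κ²)), with δ = θ̃ - θ. The increase of its square over z₁² is bounded by
(κδ + z₁) times a positive part of κδ - z₁, and an association argument with one observation
resampled shows that this product has nonpositive mean. If θ ≤ 3/5 and n ≤ 200, a crude bound is
absorbed by the constants. If θ ≤ 3/5 and n ≥ 200, the increase is at most losses caused by δ alone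
minus half the truncated second moment of κδ - z₁. The losses are estimated by sub-Gaussian tails,
the gain from below by Lindeberg's replacement and the normal law, and the gain wins up to order
n^(-3/2). Expansion of both sides in powers of n^(-1/2) then finishes the proof (`expansion_le`).

The bias bound needs only the first layer, the decomposition and a crude L² bound for ν̃ - ν. -/

noncomputable section

namespace StableEstimation

open Filter Topology Set
open scoped ENNReal NNReal

/-! ### Negative moments from the characteristic function -/

/-- The Gamma integral with a complex rate. -/
lemma integral_rpow_mul_cexp_neg_mul_Ioi {s : ℝ} (hs : 0 < s) {z : ℂ} (hz : 0 < z.re) :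
    ∫ t : ℝ in Ioi 0, ((t ^ (s - 1) : ℝ) : ℂ) * Complex.exp (-(z * t)) =
      Complex.Gamma s * (1 / z) ^ (s : ℂ) := by
  -- Seen as the complex moment generating function of -t under the density t^(s-1), the integral is
  -- analytic in the rate.
  set ρ : Measure ℝ := (volume.restrict (Ioi (0 : ℝ))).withDensity
    (fun t => ENNReal.ofReal (t ^ (s - 1))) with hρ
  have hmeas : Measurable (fun t : ℝ => ENNReal.ofReal (t ^ (s - 1))) := by fun_prop
  have hcm : ∀ w : ℂ, complexMGF (fun t : ℝ => -t) ρ w =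
      ∫ t : ℝ in Ioi 0, ((t ^ (s - 1) : ℝ) : ℂ) * Complex.exp (-(w * t)) := by
    intro w
    rw [complexMGF, hρ, integral_withDensity_eq_integral_toReal_smul hmeas
      (ae_of_all _ fun _ => ENNReal.ofReal_lt_top)]
    refine setIntegral_congr_fun measurableSet_Ioi fun t ht => ?_
    have : (0 : ℝ) ≤ t ^ (s - 1) := Real.rpow_nonneg (le_of_lt ht) _
    simp [ENNReal.toReal_ofReal this]
  have hint : ∀ r : ℝ, 0 < r → r ∈ integrableExpSet (fun t : ℝ => -t) ρ := by
    intro r hr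
    simp only [integrableExpSet, mem_ofPred_eq]
    rw [hρ, integrable_withDensity_iff hmeas (ae_of_all _ fun _ => ENNReal.ofReal_lt_top)]
    have h := integrableOn_rpow_mul_exp_neg_mul_rpow (p := 1) (s := s - 1) (b := r)
      (by linarith) one_pos hr
    refine h.congr_fun (fun t ht => ?_) measurableSet_Ioi
    have : (0 : ℝ) ≤ t ^ (s - 1) := Real.rpow_nonneg (le_of_lt ht) _
    simp [ENNReal.toReal_ofReal this, mul_comm]
  have hopen : IsOpen {w : ℂ | 0 < w.re} := isOpen_lt continuous_const Complex.continuous_re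
  have hF : AnalyticOnNhd ℂ (complexMGF (fun t : ℝ => -t) ρ) {w : ℂ | 0 < w.re} := by
    intro w hw
    refine analyticAt_complexMGF ?_
    exact mem_interior.2 ⟨Ioi 0, fun r hr => hint r hr, isOpen_Ioi, hw⟩
  have hG : AnalyticOnNhd ℂ (fun w : ℂ => Complex.Gamma s * (1 / w) ^ (s : ℂ))
      {w : ℂ | 0 < w.re} := by
    refine DifferentiableOn.analyticOnNhd (fun w hw => ?_) hopen
    have hw0 : w ≠ 0 := by rintro rfl; simp at hw
    have hsl : (1 / w) ∈ Complex.slitPlane := by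
      left
      rw [one_div, Complex.inv_re]
      exact div_pos hw (Complex.normSq_pos.2 hw0)
    refine DifferentiableAt.differentiableWithinAt ?_
    refine DifferentiableAt.const_mul ?_ _
    refine DifferentiableAt.cpow ?_ (differentiableAt_const _) hsl
    exact (differentiableAt_const _).div differentiableAt_id hw0
  have hconv : IsPreconnected {w : ℂ | 0 < w.re} := (convex_halfSpace_re_gt 0).isPreconnected
  -- Identity theorem: the formula is known for real rates, and the points 1 + 1/(n+1) accumulate at
  -- 1.
  have hEq := hF.eqOn_of_preconnected_of_frequently_eq hG hconv (z₀ := 1) (by simp) (by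
    have h1 : Tendsto (fun n : ℕ => (((1 : ℝ) + 1 / ((n : ℝ) + 1) : ℝ) : ℂ)) atTop (𝓝[≠] 1) := by
      refine tendsto_nhdsWithin_iff.2 ⟨?_, ?_⟩
      · have := (tendsto_one_div_add_atTop_nhds_zero_nat (𝕜 := ℝ)).const_add 1
        have h2 := (Complex.continuous_ofReal.tendsto _).comp this
        simpa [Function.comp_def] using h2
      · refine Eventually.of_forall fun n => ?_
        have : (0 : ℝ) < 1 / ((n : ℝ) + 1) := by positivity
        simp only [mem_compl_iff, mem_singleton_iff]
        intro h
        have : ((1 : ℝ) + 1 / ((n : ℝ) + 1)) = 1 := by exact_mod_cast h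
        linarith
    refine h1.frequently (Eventually.frequently (Eventually.of_forall fun n => ?_))
    have hr : (0 : ℝ) < 1 + 1 / ((n : ℝ) + 1) := by positivity
    set r : ℝ := 1 + 1 / ((n : ℝ) + 1)
    rw [hcm]
    have := Complex.integral_cpow_mul_exp_neg_mul_Ioi (a := s) (by simpa using hs) hr
    rw [mul_comm (Complex.Gamma _), ← this]
    refine setIntegral_congr_fun measurableSet_Ioi fun t ht => ?_
    rw [Complex.ofReal_cpow (le_of_lt ht)]
    simp)
  rw [← hcm]
  exact hEq hz

/-- The negative moments of `ε - i x` in terms of the characteristic function. -/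
lemma integral_cpow_neg_eq_integral_charFun (μ : Measure ℝ) [IsProbabilityMeasure μ]
    {s ε : ℝ} (hs : 0 < s) (hε : 0 < ε) :
    Complex.Gamma s * ∫ x : ℝ, (1 / ((ε : ℂ) - Complex.I * x)) ^ (s : ℂ) ∂μ =
      ∫ k : ℝ in Ioi 0, ((k ^ (s - 1) : ℝ) : ℂ) * Complex.exp (-(ε * k)) * charFun μ k := by
  have h1 : ∀ x : ℝ, Complex.Gamma s * (1 / ((ε : ℂ) - Complex.I * x)) ^ (s : ℂ) =
      ∫ k : ℝ in Ioi 0, ((k ^ (s - 1) : ℝ) : ℂ) * Complex.exp (-(((ε : ℂ) - Complex.I * x) * k)) :=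
    fun x => (integral_rpow_mul_cexp_neg_mul_Ioi hs (by simpa using hε)).symm
  rw [← integral_const_mul]
  simp_rw [h1]
  rw [integral_integral_swap]
  · refine setIntegral_congr_fun measurableSet_Ioi fun k hk => ?_
    rw [charFun_apply_real, ← integral_const_mul]
    congr 1
    ext x
    rw [mul_assoc, ← Complex.exp_add]
    congr 2
    ring
  · have hb : Integrable (fun k : ℝ => k ^ (s - 1) * Real.exp (-ε * k ^ (1 : ℝ)))
        (volume.restrict (Ioi 0)) :=
      integrableOn_rpow_mul_exp_neg_mul_rpow (by linarith) one_pos hε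
    have hb2 : Integrable (fun q : ℝ × ℝ => q.2 ^ (s - 1) * Real.exp (-ε * q.2 ^ (1 : ℝ)))
        (μ.prod (volume.restrict (Ioi 0))) := by
      simpa using (integrable_const (μ := μ) (1 : ℝ)).mul_prod hb
    refine hb2.mono (by fun_prop) ?_
    have : ∀ᵐ q ∂(μ.prod (volume.restrict (Ioi (0 : ℝ)))), q.2 ∈ Ioi (0 : ℝ) := by
      have := (Measure.quasiMeasurePreserving_snd (μ := μ)
        (ν := volume.restrict (Ioi (0 : ℝ)))).ae (ae_restrict_mem measurableSet_Ioi)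
      exact this
    filter_upwards [this] with q hq
    have hq0 : (0 : ℝ) ≤ q.2 ^ (s - 1) := Real.rpow_nonneg (le_of_lt hq) _
    simp only [Function.uncurry, norm_mul, Complex.norm_real, Complex.norm_exp, Real.rpow_one]
    simp [abs_of_nonneg hq0]


/-- The Gamma integral with a stretched exponential and a complex rate `exp L`. -/
lemma integral_rpow_mul_cexp_neg_exp_mul_rpow {s α : ℝ} (hs : 0 < s) (hα : 0 < α) {L : ℂ}
    (hL : |L.im| < Real.pi / 2) :
    ∫ k : ℝ in Ioi 0, ((k ^ (s - 1) : ℝ) : ℂ) * Complex.exp (-(Complex.exp L * ((k ^ α : ℝ) : ℂ))) =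
      (1 / α : ℝ) * (Complex.Gamma (s / α : ℝ) * Complex.exp (-((s / α : ℝ) * L))) := by
  have hre : 0 < (Complex.exp L).re := by
    rw [Complex.exp_re]
    refine mul_pos (Real.exp_pos _) (Real.cos_pos_of_mem_Ioo ?_)
    rw [abs_lt] at hL
    exact hL
  have hp : (1 / Complex.exp L) ^ ((s / α : ℝ) : ℂ) = Complex.exp (-((s / α : ℝ) * L)) := by
    rw [one_div, ← Complex.exp_neg, Complex.cpow_def_of_ne_zero (Complex.exp_ne_zero _),
      Complex.log_exp]
    · ring_nf
    · rw [Complex.neg_im]; rw [abs_lt] at hL; linarith [Real.pi_pos]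
    · rw [Complex.neg_im]; rw [abs_lt] at hL; linarith [Real.pi_pos]
  rw [← hp, ← integral_rpow_mul_cexp_neg_mul_Ioi (div_pos hs hα) hre,
    ← integral_comp_rpow_Ioi_of_pos (g := fun k : ℝ => ((k ^ (s / α - 1) : ℝ) : ℂ) *
      Complex.exp (-(Complex.exp L * k))) hα, ← integral_const_mul]
  refine setIntegral_congr_fun measurableSet_Ioi fun k hk => ?_
  have hk : (0 : ℝ) < k := hk
  have : k ^ (s - 1) = (1 / α) * (α * k ^ (α - 1)) * (k ^ α) ^ (s / α - 1) := by
    rw [← Real.rpow_mul hk.le, ← mul_assoc, one_div, inv_mul_cancel₀ hα.ne', one_mul,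
      ← Real.rpow_add hk]
    congr 1
    field_simp
    ring
  rw [this, Complex.real_smul]
  push_cast
  ring

/-- A uniform bound for the regularized negative moments when the characteristic function is
dominated by an integrable function. -/
lemma measure_singleton_zero_and_integrable_rpow_neg (μ : Measure ℝ) [IsProbabilityMeasure μ]
    {s C : ℝ} (hs : 0 < s) (hs1 : s < 1)
    (hC : ∀ ε : ℝ, 0 < ε → ‖∫ x : ℝ, (1 / ((ε : ℂ) - Complex.I * x)) ^ (s : ℂ) ∂μ‖ ≤ C) :
    μ {0} = 0 ∧ Integrable (fun x : ℝ => |x| ^ (-s)) μ := by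
  have hcos : 0 < Real.cos (Real.pi * s / 2) :=
    Real.cos_pos_of_mem_Ioo ⟨by nlinarith [Real.pi_pos], by nlinarith [Real.pi_pos]⟩
  have hz : ∀ ε : ℝ, 0 < ε → ∀ x : ℝ, 0 < (1 / ((ε : ℂ) - Complex.I * x)).re := by
    intro ε hε x
    have hre : ((ε : ℂ) - Complex.I * x).re = ε := by simp
    have h0 : ((ε : ℂ) - Complex.I * x) ≠ 0 := by
      intro h; rw [h] at hre; simp at hre; linarith
    rw [one_div, Complex.inv_re, hre]
    exact div_pos hε (Complex.normSq_pos.2 h0)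
  -- The base lies in the right half-plane, so the argument of its power is at most πs/2 < π/2. The
  -- real part thus controls the modulus, and a bound for the complex integral becomes one for the
  -- absolute moment.
  have hle : ∀ ε : ℝ, 0 < ε → ∀ x : ℝ, ‖1 / ((ε : ℂ) - Complex.I * x)‖ ^ s *
      Real.cos (Real.pi * s / 2) ≤ ((1 / ((ε : ℂ) - Complex.I * x)) ^ (s : ℂ)).re := by
    intro ε hε x
    set z := 1 / ((ε : ℂ) - Complex.I * x) with hzdef
    have hz0 : z ≠ 0 := by intro h; have := hz ε hε x; rw [← hzdef, h] at this; simp at this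
    rw [Complex.cpow_def_of_ne_zero hz0, Complex.exp_re]
    have h1 : (Complex.log z * (s : ℂ)).re = Real.log ‖z‖ * s := by simp [Complex.log_re]
    have h2 : (Complex.log z * (s : ℂ)).im = z.arg * s := by simp [Complex.log_im]
    rw [h1, h2, Real.rpow_def_of_pos (norm_pos_iff.2 hz0)]
    refine mul_le_mul_of_nonneg_left ?_ (Real.exp_pos _).le
    rw [← Real.cos_abs (z.arg * s)]
    have harg : |z.arg| ≤ Real.pi / 2 := Complex.abs_arg_le_pi_div_two_iff.2 (hz ε hε x).le
    refine Real.cos_le_cos_of_nonneg_of_le_pi (abs_nonneg _) (by nlinarith [Real.pi_pos]) ?_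
    rw [abs_mul, abs_of_pos hs]
    nlinarith
  have hint : ∀ ε : ℝ, 0 < ε →
      Integrable (fun x : ℝ => (1 / ((ε : ℂ) - Complex.I * x)) ^ (s : ℂ)) μ := by
    intro ε hε
    refine Integrable.of_bound (C := (1 / ε) ^ s)
      (Measurable.pow_const (by fun_prop) _).aestronglyMeasurable (ae_of_all _ fun x => ?_)
    rw [Complex.norm_cpow_real]
    refine Real.rpow_le_rpow (norm_nonneg _) ?_ hs.le
    rw [norm_div, norm_one]
    refine one_div_le_one_div_of_le hε ?_
    have := Complex.abs_re_le_norm ((ε : ℂ) - Complex.I * x)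
    simp at this
    exact (le_abs_self _).trans this
  have hlint : ∀ ε : ℝ, 0 < ε →
      ∫⁻ x : ℝ, ENNReal.ofReal (‖1 / ((ε : ℂ) - Complex.I * x)‖ ^ s) ∂μ ≤
        ENNReal.ofReal (C / Real.cos (Real.pi * s / 2)) := by
    intro ε hε
    have hi : Integrable (fun x : ℝ => ‖1 / ((ε : ℂ) - Complex.I * x)‖ ^ s) μ := by
      refine (hint ε hε).norm.congr (ae_of_all _ fun x => ?_)
      simp only [Complex.norm_cpow_real]
    rw [← ofReal_integral_eq_lintegral_ofReal hi (ae_of_all _ fun x => by positivity)]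
    refine ENNReal.ofReal_le_ofReal ?_
    rw [le_div_iff₀ hcos, ← integral_mul_const]
    calc _ ≤ ∫ x : ℝ, ((1 / ((ε : ℂ) - Complex.I * x)) ^ (s : ℂ)).re ∂μ :=
          integral_mono (hi.mul_const _) (hint ε hε).re (hle ε hε)
      _ = (∫ x : ℝ, (1 / ((ε : ℂ) - Complex.I * x)) ^ (s : ℂ) ∂μ).re := integral_re (hint ε hε)
      _ ≤ _ := (Complex.re_le_norm _).trans (hC ε hε)
  set e : ℕ → ℝ := fun n => 1 / ((n : ℝ) + 1) with he
  have hepos : ∀ n, 0 < e n := fun n => by simp only [he]; positivity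
  have het : Tendsto e atTop (𝓝 0) := tendsto_one_div_add_atTop_nhds_zero_nat
  set F : ℕ → ℝ → ENNReal := fun n x => ENNReal.ofReal (‖1 / ((e n : ℂ) - Complex.I * x)‖ ^ s)
    with hF
  have hfatou : ∫⁻ x, liminf (fun n => F n x) atTop ∂μ ≤
      ENNReal.ofReal (C / Real.cos (Real.pi * s / 2)) := by
    refine (lintegral_liminf_le fun n => by fun_prop).trans ?_
    refine liminf_le_of_frequently_le' (Eventually.frequently (Eventually.of_forall fun n => ?_))
    exact hlint _ (hepos n)
  have hfin : ∀ᵐ x ∂μ, liminf (fun n => F n x) atTop < ⊤ := by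
    refine ae_lt_top' ?_ (ne_top_of_le_ne_top ENNReal.ofReal_ne_top hfatou)
    exact (Measurable.liminf fun n => by fun_prop).aemeasurable
  -- At x = 0 the integrands ε^(-s) blow up, so the finite Fatou bound excludes an atom at 0.
  have h0lim : liminf (fun n => F n 0) atTop = ⊤ := by
    refine Tendsto.liminf_eq ?_
    refine ENNReal.tendsto_ofReal_atTop.comp ?_
    have h1 : Tendsto (fun n : ℕ => ((n : ℝ) + 1) ^ s) atTop atTop :=
      (tendsto_rpow_atTop hs).comp (tendsto_atTop_add_const_right _ _ tendsto_natCast_atTop_atTop)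
    refine h1.congr fun n => ?_
    congr 1
    have : (0 : ℝ) < (n : ℝ) + 1 := by positivity
    simp [he]
    rw [← Complex.ofReal_natCast, ← Complex.ofReal_one, ← Complex.ofReal_add, Complex.norm_real,
      Real.norm_of_nonneg this.le]
  have hne : ∀ x : ℝ, x ≠ 0 → liminf (fun n => F n x) atTop = ENNReal.ofReal (|x| ^ (-s)) := by
    intro x hx
    refine Tendsto.liminf_eq ?_
    refine ENNReal.tendsto_ofReal ?_
    have h1 : Tendsto (fun n => ‖1 / ((e n : ℂ) - Complex.I * x)‖) atTop (𝓝 (|x|⁻¹)) := by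
      have h2 : Tendsto (fun n => ((e n : ℂ) - Complex.I * x)) atTop (𝓝 ((0 : ℝ) - Complex.I * x)) :=
        ((Complex.continuous_ofReal.tendsto _).comp het).sub_const _
      have h3 := (tendsto_const_nhds (x := (1 : ℂ))).div h2 (by simp [hx])
      have h4 := h3.norm
      have h5 : ‖1 / (((0 : ℝ) : ℂ) - Complex.I * x)‖ = |x|⁻¹ := by simp
      rw [h5] at h4
      exact h4
    have h5 := h1.rpow_const (p := s) (Or.inr hs.le)
    rwa [Real.inv_rpow (abs_nonneg _), ← Real.rpow_neg (abs_nonneg _)] at h5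
  have hz0 : μ {0} = 0 := by
    by_contra hne0
    rw [ae_iff] at hfin
    refine hne0 (measure_mono_null ?_ hfin)
    intro x hx
    rw [mem_singleton_iff.1 hx]
    simp [h0lim]
  refine ⟨hz0, ?_⟩
  refine ⟨(Measurable.pow_const (by fun_prop) _).aestronglyMeasurable, ?_⟩
  have hae : ∀ᵐ x ∂μ, x ≠ 0 := by
    rw [ae_iff]; simpa using hz0
  rw [hasFiniteIntegral_iff_ofReal (ae_of_all _ fun x => by positivity)]
  calc _ = ∫⁻ x, liminf (fun n => F n x) atTop ∂μ :=
        lintegral_congr_ae (hae.mono fun x hx => (hne x hx).symm)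
    _ < ⊤ := hfatou.trans_lt ENNReal.ofReal_lt_top

/-- The negative moments of a law whose characteristic function is `exp (-exp L * k ^ α)` on the
positive half-line. -/
lemma integral_rpow_neg_mul_cexp_sign (μ : Measure ℝ) [IsProbabilityMeasure μ] {α : ℝ} {L : ℂ}
    (hα : 0 < α) (hL : |L.im| < Real.pi / 2)
    (hφ : ∀ k : ℝ, 0 < k → charFun μ k = Complex.exp (-(Complex.exp L * ((k ^ α : ℝ) : ℂ))))
    {s : ℝ} (hs : 0 < s) (hs1 : s < 1) :
    μ {0} = 0 ∧ Integrable (fun x : ℝ => |x| ^ (-s)) μ ∧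
      Complex.Gamma s * ∫ x : ℝ, ((|x| ^ (-s) : ℝ) : ℂ) *
          Complex.exp (((Real.pi * s / 2 * Real.sign x : ℝ) : ℂ) * Complex.I) ∂μ =
        (1 / α : ℝ) * (Complex.Gamma (s / α : ℝ) * Complex.exp (-((s / α : ℝ) * L))) := by
  have hre : 0 < (Complex.exp L).re := by
    rw [Complex.exp_re]
    refine mul_pos (Real.exp_pos _) (Real.cos_pos_of_mem_Ioo ?_)
    rw [abs_lt] at hL
    exact hL
  have hΓ : Complex.Gamma s ≠ 0 := by
    rw [Complex.Gamma_ofReal]; exact_mod_cast (Real.Gamma_pos_of_pos hs).ne'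
  have hbound : Integrable (fun k : ℝ => k ^ (s - 1) * Real.exp (-(Complex.exp L).re * k ^ α))
      (volume.restrict (Ioi 0)) :=
    integrableOn_rpow_mul_exp_neg_mul_rpow (by linarith) hα hre
  have hpt : ∀ ε : ℝ, 0 ≤ ε → ∀ k ∈ Ioi (0 : ℝ),
      ‖((k ^ (s - 1) : ℝ) : ℂ) * Complex.exp (-(ε * k)) * charFun μ k‖ ≤
        k ^ (s - 1) * Real.exp (-(Complex.exp L).re * k ^ α) := by
    intro ε hε k hk
    have hk0 : (0 : ℝ) < k := hk
    rw [hφ k hk, norm_mul, norm_mul, Complex.norm_real, Complex.norm_exp, Complex.norm_exp,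
      Real.norm_of_nonneg (Real.rpow_nonneg hk0.le _)]
    have h1 : (-((ε : ℂ) * k)).re = -(ε * k) := by simp
    have h2 : (-(Complex.exp L * ((k ^ α : ℝ) : ℂ))).re = -(Complex.exp L).re * k ^ α := by simp
    rw [h1, h2]
    refine mul_le_mul_of_nonneg_right ?_ (Real.exp_pos _).le
    refine mul_le_of_le_one_right (Real.rpow_nonneg hk0.le _) ?_
    rw [Real.exp_le_one_iff]
    have := mul_nonneg hε hk0.le
    linarith
  set C0 := ∫ k : ℝ in Ioi 0, k ^ (s - 1) * Real.exp (-(Complex.exp L).re * k ^ α) with hC0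
  have hC : ∀ ε : ℝ, 0 < ε →
      ‖∫ x : ℝ, (1 / ((ε : ℂ) - Complex.I * x)) ^ (s : ℂ) ∂μ‖ ≤ C0 / ‖Complex.Gamma s‖ := by
    intro ε hε
    rw [le_div_iff₀ (norm_pos_iff.2 hΓ), mul_comm, ← norm_mul,
      integral_cpow_neg_eq_integral_charFun μ hs hε]
    refine norm_integral_le_of_norm_le hbound ?_
    exact (ae_restrict_mem measurableSet_Ioi).mono fun k hk => hpt ε hε.le k hk
  obtain ⟨hz0, hint⟩ := measure_singleton_zero_and_integrable_rpow_neg μ hs hs1 hC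
  refine ⟨hz0, hint, ?_⟩
  have hae : ∀ᵐ x ∂μ, x ≠ 0 := by
    rw [ae_iff]; simpa using hz0
  set e : ℕ → ℝ := fun n => 1 / ((n : ℝ) + 1) with he
  have hepos : ∀ n, 0 < e n := fun n => by simp only [he]; positivity
  have het : Tendsto e atTop (𝓝 0) := tendsto_one_div_add_atTop_nhds_zero_nat
  have hlim1 : Tendsto (fun n => ∫ x : ℝ, (1 / ((e n : ℂ) - Complex.I * x)) ^ (s : ℂ) ∂μ) atTop
      (𝓝 (∫ x : ℝ, ((|x| ^ (-s) : ℝ) : ℂ) *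
          Complex.exp (((Real.pi * s / 2 * Real.sign x : ℝ) : ℂ) * Complex.I) ∂μ)) := by
    refine tendsto_integral_of_dominated_convergence (fun x : ℝ => |x| ^ (-s))
      (fun n => (Measurable.pow_const (by fun_prop) _).aestronglyMeasurable) hint
      (fun n => hae.mono fun x hx => ?_) (hae.mono fun x hx => ?_)
    · rw [Complex.norm_cpow_real, Real.rpow_neg (abs_nonneg _), ← Real.inv_rpow (abs_nonneg _)]
      refine Real.rpow_le_rpow (norm_nonneg _) ?_ hs.le
      rw [norm_div, norm_one, one_div]
      refine inv_anti₀ (abs_pos.2 hx) ?_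
      have := Complex.abs_im_le_norm ((e n : ℂ) - Complex.I * x)
      simpa using this
    · have h2 : Tendsto (fun n => ((e n : ℂ) - Complex.I * x)) atTop
          (𝓝 ((0 : ℝ) - Complex.I * x)) :=
        ((Complex.continuous_ofReal.tendsto _).comp het).sub_const _
      have h3 := (tendsto_const_nhds (x := (1 : ℂ))).div h2 (by simp [hx])
      -- The limit of the base is i/x. Its argument is ±π/2 with the sign of x, which produces the
      -- factor exp(iπs sign x / 2).
      have hval : (1 : ℂ) / (((0 : ℝ) : ℂ) - Complex.I * x) = ((x⁻¹ : ℝ) : ℂ) * Complex.I := by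
        have : (x : ℂ) ≠ 0 := by exact_mod_cast hx
        push_cast
        rw [zero_sub, div_eq_iff (by simp [hx])]
        field_simp
        simp
      rw [hval] at h3
      have hsl : ((x⁻¹ : ℝ) : ℂ) * Complex.I ∈ Complex.slitPlane := by
        right; simp [hx]
      have h4 := h3.cpow (tendsto_const_nhds (x := (s : ℂ))) hsl
      have hfin : (((x⁻¹ : ℝ) : ℂ) * Complex.I) ^ (s : ℂ) = ((|x| ^ (-s) : ℝ) : ℂ) *
          Complex.exp (((Real.pi * s / 2 * Real.sign x : ℝ) : ℂ) * Complex.I) := by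
        have hnz : ((x⁻¹ : ℝ) : ℂ) * Complex.I ≠ 0 := by simp [hx]
        have hnorm : ‖((x⁻¹ : ℝ) : ℂ) * Complex.I‖ = |x|⁻¹ := by simp
        have harg : (((x⁻¹ : ℝ) : ℂ) * Complex.I).arg = Real.pi / 2 * Real.sign x := by
          rcases lt_or_gt_of_ne hx with h | h
          · rw [Real.sign_of_neg h, mul_neg_one, ← neg_div]
            have : ((x⁻¹ : ℝ) : ℂ) * Complex.I = ((-x⁻¹ : ℝ) : ℂ) * (-Complex.I) := by
              push_cast; ring
            rw [this, Complex.arg_real_mul _ (by simpa using h), Complex.arg_neg_I]; ring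
          · rw [Real.sign_of_pos h, mul_one, Complex.arg_real_mul _ (by simpa using h),
              Complex.arg_I]
        rw [Complex.cpow_def_of_ne_zero hnz, Complex.log, hnorm, harg,
          Real.rpow_def_of_pos (abs_pos.2 hx), Real.log_inv, Complex.ofReal_exp, ← Complex.exp_add]
        congr 1
        push_cast
        ring
      rw [hfin] at h4
      exact h4
  have hlim2 : Tendsto (fun n => ∫ k : ℝ in Ioi 0,
      ((k ^ (s - 1) : ℝ) : ℂ) * Complex.exp (-((e n : ℂ) * k)) * charFun μ k) atTop
      (𝓝 (∫ k : ℝ in Ioi 0, ((k ^ (s - 1) : ℝ) : ℂ) *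
        Complex.exp (-(Complex.exp L * ((k ^ α : ℝ) : ℂ))))) := by
    refine tendsto_integral_of_dominated_convergence _ (fun n => ?_) hbound
      (fun n => (ae_restrict_mem measurableSet_Ioi).mono fun k hk => hpt _ (hepos n).le k hk)
      ((ae_restrict_mem measurableSet_Ioi).mono fun k hk => ?_)
    · exact ((Measurable.complex_ofReal (Measurable.pow_const (by fun_prop) _)).mul
        (by fun_prop)).aestronglyMeasurable.mul measurable_charFun.aestronglyMeasurable
    · rw [hφ k hk]
      refine Tendsto.mul_const _ ?_
      have h1 : Tendsto (fun n => Complex.exp (-((e n : ℂ) * k))) atTop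
          (𝓝 (Complex.exp (-(((0 : ℝ) : ℂ) * k)))) := by
        refine (Complex.continuous_exp.tendsto _).comp (Tendsto.neg (Tendsto.mul_const _ ?_))
        exact (Complex.continuous_ofReal.tendsto _).comp het
      simpa using h1.const_mul (((k ^ (s - 1) : ℝ) : ℂ))
  rw [← integral_rpow_mul_cexp_neg_exp_mul_rpow hs hα hL]
  refine tendsto_nhds_unique (hlim1.const_mul _) ?_
  refine hlim2.congr fun n => ?_
  exact (integral_cpow_neg_eq_integral_charFun μ hs (hepos n)).symm

/-- Power moments of small order from the behaviour of the characteristic function at `0`. -/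
lemma integrable_abs_rpow_of_charFun (μ : Measure ℝ) [IsProbabilityMeasure μ] {α C p : ℝ}
    (hα : 0 < α) (hC : ∀ k, ‖1 - charFun μ k‖ ≤ C * |k| ^ α) (hp : 0 < p) (hpα : p < α) :
    Integrable (fun x : ℝ => |x| ^ p) μ := by
  have hC0 : 0 ≤ C := by simpa using (norm_nonneg _).trans (hC 1)
  -- The mean of 1 - φ over |k| ≤ 2/r dominates the tail beyond r, so the Hölder bound at 0 becomes
  -- a power tail.
  have htail : ∀ r : ℝ, 0 < r → μ.real {x | r < |x|} ≤ 2 * C * 2 ^ α * r ^ (-α) := by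
    intro r hr
    have h1 : ‖∫ t in (-2 * r⁻¹)..(2 * r⁻¹), 1 - charFun μ t‖ ≤
        C * (2 * r⁻¹) ^ α * |2 * r⁻¹ - -2 * r⁻¹| := by
      refine intervalIntegral.norm_integral_le_of_norm_le_const fun t ht => ?_
      refine (hC t).trans (mul_le_mul_of_nonneg_left ?_ hC0)
      refine Real.rpow_le_rpow (abs_nonneg _) ?_ hα.le
      have h2 : (-2 * r⁻¹) ≤ 2 * r⁻¹ := by have := inv_pos.2 hr; linarith
      rw [uIoc_of_le h2] at ht
      rw [abs_le]
      constructor <;> linarith [ht.1, ht.2]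
    refine (measureReal_abs_gt_le_integral_charFun hr).trans ?_
    have h3 : |2 * r⁻¹ - -2 * r⁻¹| = 4 * r⁻¹ := by
      rw [abs_of_pos] <;> [ring; (have := inv_pos.2 hr; linarith)]
    rw [h3, Real.mul_rpow (by norm_num) (inv_nonneg.2 hr.le), Real.inv_rpow hr.le,
      ← Real.rpow_neg hr.le] at h1
    calc _ ≤ 2⁻¹ * r * (C * (2 ^ α * r ^ (-α)) * (4 * r⁻¹)) := by gcongr
      _ = _ := by field_simp; ring
  refine ⟨(Measurable.pow_const (by fun_prop) _).aestronglyMeasurable, ?_⟩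
  rw [hasFiniteIntegral_iff_ofReal (ae_of_all _ fun x => by positivity),
    lintegral_rpow_eq_lintegral_meas_le_mul μ (ae_of_all _ fun x => abs_nonneg x)
      (by fun_prop) hp]
  refine ENNReal.mul_lt_top ENNReal.ofReal_lt_top ?_
  have hcover : Ioi (0 : ℝ) = Ioc 0 1 ∪ Ioi 1 := (Ioc_union_Ioi_eq_Ioi zero_le_one).symm
  rw [hcover]
  refine (lintegral_union_le _ _ _).trans_lt (ENNReal.add_lt_top.2 ⟨?_, ?_⟩)
  · have hi : IntegrableOn (fun t : ℝ => t ^ (p - 1)) (Ioc 0 1) :=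
      (intervalIntegrable_iff_integrableOn_Ioc_of_le zero_le_one).1
        (intervalIntegral.intervalIntegrable_rpow' (by linarith))
    refine lt_of_le_of_lt (setLIntegral_mono' measurableSet_Ioc fun t ht => ?_)
      hi.lintegral_lt_top
    exact mul_le_of_le_one_left zero_le prob_le_one
  · have hi : IntegrableOn (fun t : ℝ => 2 * C * 2 ^ α * 2 ^ α * t ^ (p - α - 1)) (Ioi 1) :=
      (integrableOn_Ioi_rpow_of_lt (by linarith) one_pos).const_mul _
    refine lt_of_le_of_lt (setLIntegral_mono' measurableSet_Ioi fun t ht => ?_)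
      hi.lintegral_lt_top
    have ht0 : (0 : ℝ) < t := one_pos.trans ht
    have h1 : μ {a | t ≤ |a|} ≤ ENNReal.ofReal (2 * C * 2 ^ α * (t / 2) ^ (-α)) := by
      refine (measure_mono (t := {x | t / 2 < |x|}) fun a ha => ?_).trans ?_
      · simp only [mem_ofPred_eq] at ha ⊢; linarith
      · rw [← ofReal_measureReal]
        exact ENNReal.ofReal_le_ofReal (htail _ (by positivity))
    refine (mul_le_mul_left h1 _).trans ?_
    rw [← ENNReal.ofReal_mul (by positivity)]
    refine ENNReal.ofReal_le_ofReal (le_of_eq ?_)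
    rw [Real.div_rpow ht0.le (by norm_num), Real.rpow_neg (by norm_num : (0 : ℝ) ≤ 2),
      show p - α - 1 = -α + (p - 1) by ring, Real.rpow_add ht0]
    field_simp

/-- Mean value inequality on the left half-plane, which is convex and where the derivative of exp
has modulus at most 1. -/
lemma norm_one_sub_cexp_neg_le {w : ℂ} (hw : 0 ≤ w.re) : ‖1 - Complex.exp (-w)‖ ≤ ‖w‖ := by
  have := (convex_halfSpace_re_le (0 : ℝ)).norm_image_sub_le_of_norm_hasDerivWithin_le
    (f := Complex.exp) (f' := Complex.exp) (C := 1) (x := -w) (y := 0)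
    (fun z _ => (Complex.hasDerivAt_exp z).hasDerivWithinAt)
    (fun z hz => by rw [Complex.norm_exp]; exact Real.exp_le_one_iff.2 hz)
    (by simpa using hw) (by simp)
  simpa using this

/-- Both sides equal π a s by Euler's reflection formula. This is what eliminates the Gamma
functions from the product of the moment generating functions at s and -s. -/
lemma gamma_reflection_mul {a s : ℝ}
    (h1 : |s| < 1) (h2 : |a * s| < 1) :
    Real.Gamma (1 + a * s) * Real.Gamma (1 - a * s) * Real.sin (Real.pi * (a * s)) =
      a * (Real.Gamma (1 + s) * Real.Gamma (1 - s)) * Real.sin (Real.pi * s) := by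
  have key : ∀ x : ℝ, |x| < 1 → Real.Gamma (1 + x) * Real.Gamma (1 - x) *
      Real.sin (Real.pi * x) = Real.pi * x := by
    intro x hx
    rcases eq_or_ne x 0 with rfl | hx0
    · simp
    have hsin : Real.sin (Real.pi * x) ≠ 0 := by
      rw [abs_lt] at hx
      rw [Ne, Real.sin_eq_zero_iff_of_lt_of_lt (by nlinarith [Real.pi_pos])
        (by nlinarith [Real.pi_pos])]
      exact mul_ne_zero Real.pi_ne_zero hx0
    rw [add_comm 1 x, Real.Gamma_add_one hx0, mul_assoc x, Real.Gamma_mul_Gamma_one_sub]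
    rw [mul_assoc, div_mul_cancel₀ _ hsin, mul_comm]
  rw [key _ h2, mul_assoc, key s h1]
  ring


/-! ### Trigonometric identities for the moment generating function of the log-modulus -/

lemma analyticAt_realGamma {x : ℝ} (hx : 0 < x) : AnalyticAt ℝ Real.Gamma x := by
  have hopen : IsOpen {w : ℂ | 0 < w.re} := isOpen_lt continuous_const Complex.continuous_re
  have h : AnalyticOnNhd ℂ Complex.Gamma {w : ℂ | 0 < w.re} := by
    refine DifferentiableOn.analyticOnNhd (fun w hw => ?_) hopen
    refine (Complex.differentiableAt_Gamma w fun m hm => ?_).differentiableWithinAt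
    rw [hm] at hw
    simp only [mem_ofPred_eq, Complex.neg_re, Complex.natCast_re, Left.neg_pos_iff] at hw
    exact absurd hw (not_lt.2 (Nat.cast_nonneg m))
  have h2 := (h (x : ℂ) (by simpa using hx)).re_ofReal
  simpa [Complex.Gamma_ofReal] using h2

/-- The normalized logarithm of the modulus. -/
def logNorm (ℓ x : ℝ) : ℝ := Real.sqrt 6 / Real.pi * (Real.log |x| - ℓ)

/-- The facts about the law of `X` from which all moments of `(sign X, log |X|)` follow. -/
structure LogLaw (μ : Measure ℝ) (a θ ℓ : ℝ) : Prop where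
  zero : μ {0} = 0
  exp : 0 ∈ interior (integrableExpSet (logNorm ℓ) μ)
  mean : ∫ x, logNorm ℓ x ∂μ = 0
  even : ∀ᶠ s in 𝓝 (0 : ℝ), mgf (logNorm ℓ) μ s * mgf (logNorm ℓ) μ (-s) *
      (Real.sin (Real.sqrt 6 * a * s) * Real.cos (Real.sqrt 6 / 2 * s)) =
    2 * a * (Real.sin (Real.sqrt 6 / 2 * s) * Real.cos (Real.sqrt 6 / 2 * θ * s) ^ 2)
  cross : ∀ᶠ s in 𝓝 (0 : ℝ),
    (mgf (logNorm ℓ) (μ.restrict (Ioi 0)) s - mgf (logNorm ℓ) (μ.restrict (Iio 0)) s) *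
      (Real.sin (Real.sqrt 6 / 2 * s) * Real.cos (Real.sqrt 6 / 2 * θ * s)) =
    mgf (logNorm ℓ) μ s * (Real.cos (Real.sqrt 6 / 2 * s) * Real.sin (Real.sqrt 6 / 2 * θ * s))

lemma mgf_logNorm (ρ : Measure ℝ) (ℓ s : ℝ) :
    mgf (logNorm ℓ) ρ s = Real.exp (-(Real.sqrt 6 / Real.pi * s * ℓ)) *
      mgf (fun x => Real.log |x|) ρ (Real.sqrt 6 / Real.pi * s) := by
  rw [mgf, mgf, ← integral_const_mul]
  congr 1
  ext x
  rw [← Real.exp_add]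
  simp only [logNorm]
  ring_nf

/-- Passage from the unnormalized identities for `log |X|` to `LogLaw`. -/
lemma logLaw_of_log (μ : Measure ℝ) [IsProbabilityMeasure μ] {a θ : ℝ} (h0 : μ {0} = 0)
    (hexp : 0 ∈ interior (integrableExpSet (fun x => Real.log |x|) μ))
    (heven : ∀ᶠ s in 𝓝 (0 : ℝ), mgf (fun x => Real.log |x|) μ s *
        mgf (fun x => Real.log |x|) μ (-s) *
        (Real.sin (Real.pi * a * s) * Real.cos (Real.pi / 2 * s)) =
      2 * a * (Real.sin (Real.pi / 2 * s) * Real.cos (Real.pi / 2 * θ * s) ^ 2))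
    (hcross : ∀ᶠ s in 𝓝 (0 : ℝ),
      (mgf (fun x => Real.log |x|) (μ.restrict (Ioi 0)) s -
          mgf (fun x => Real.log |x|) (μ.restrict (Iio 0)) s) *
        (Real.sin (Real.pi / 2 * s) * Real.cos (Real.pi / 2 * θ * s)) =
      mgf (fun x => Real.log |x|) μ s *
        (Real.cos (Real.pi / 2 * s) * Real.sin (Real.pi / 2 * θ * s))) :
    LogLaw μ a θ (∫ x, Real.log |x| ∂μ) := by
  have hπ := Real.pi_pos
  have hc0 : (0 : ℝ) < Real.sqrt 6 / Real.pi := by positivity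
  set c := Real.sqrt 6 / Real.pi with hc
  have hcπ : c * Real.pi = Real.sqrt 6 := by rw [hc]; field_simp
  set ℓ := ∫ x, Real.log |x| ∂μ with hℓ
  have ht : Tendsto (fun s : ℝ => c * s) (𝓝 0) (𝓝 0) := by
    have : Continuous fun s : ℝ => c * s := by fun_prop
    simpa using this.tendsto 0
  refine ⟨h0, ?_, ?_, ?_, ?_⟩
  · have hnear : ∀ᶠ s in 𝓝 (0 : ℝ), s ∈ integrableExpSet (fun x => Real.log |x|) μ :=
      mem_interior_iff_mem_nhds.1 hexp
    rw [mem_interior_iff_mem_nhds]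
    filter_upwards [ht.eventually hnear] with s hs
    simp only [integrableExpSet, mem_ofPred_eq] at hs ⊢
    refine (hs.const_mul (Real.exp (-(c * s * ℓ)))).congr (ae_of_all _ fun x => ?_)
    simp only [logNorm]
    rw [← Real.exp_add, ← hc]
    congr 1
    ring
  · have hi : Integrable (fun x : ℝ => Real.log |x|) μ := by
      simpa using integrable_pow_of_mem_interior_integrableExpSet hexp 1
    simp only [logNorm]
    rw [integral_const_mul, integral_sub hi (integrable_const _)]
    simp [hℓ]
  · filter_upwards [ht.eventually heven] with s hs
    rw [mgf_logNorm, mgf_logNorm]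
    have e1 : Real.exp (-(c * s * ℓ)) * Real.exp (-(c * -s * ℓ)) = 1 := by
      rw [← Real.exp_add]; simp
    have e2 : Real.sqrt 6 * a * s = Real.pi * a * (c * s) := by rw [← hcπ]; ring
    have e3 : Real.sqrt 6 / 2 * s = Real.pi / 2 * (c * s) := by rw [← hcπ]; ring
    have e4 : Real.sqrt 6 / 2 * θ * s = Real.pi / 2 * θ * (c * s) := by rw [← hcπ]; ring
    have e5 : c * -s = -(c * s) := by ring
    rw [e2, e3, e4, ← hs, e5]
    rw [e5] at e1
    linear_combination (mgf (fun x => Real.log |x|) μ (c * s) *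
        mgf (fun x => Real.log |x|) μ (-(c * s)) *
        (Real.sin (Real.pi * a * (c * s)) * Real.cos (Real.pi / 2 * (c * s)))) * e1
  · filter_upwards [ht.eventually hcross] with s hs
    rw [mgf_logNorm, mgf_logNorm, mgf_logNorm]
    have e3 : Real.sqrt 6 / 2 * s = Real.pi / 2 * (c * s) := by rw [← hcπ]; ring
    have e4 : Real.sqrt 6 / 2 * θ * s = Real.pi / 2 * θ * (c * s) := by rw [← hcπ]; ring
    rw [e3, e4]
    linear_combination Real.exp (-(c * s * ℓ)) * hs

lemma measurable_realSign : Measurable Real.sign := by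
  have : Real.sign = fun r : ℝ => if r < 0 then (-1 : ℝ) else if 0 < r then 1 else 0 := by
    ext r; rfl
  rw [this]
  exact Measurable.ite measurableSet_Iio measurable_const
    (Measurable.ite measurableSet_Ioi measurable_const measurable_const)

/-- The exponent of the stable characteristic function on the positive half-line. -/
def stableExponent (a θ τ : ℝ) : ℂ :=
  ((a⁻¹ * τ + Real.eulerMascheroniConstant * (a⁻¹ - 1) : ℝ) : ℂ) +
    ((-(a⁻¹ * (Real.pi / 2 * θ)) : ℝ) : ℂ) * Complex.I

lemma stableCharFun_of_pos {ν θ τ k : ℝ} (hk : 0 < k) :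
    stableCharFun ν θ τ k = Complex.exp (-(Complex.exp (stableExponent (Real.sqrt ν) θ τ) *
      ((k ^ (Real.sqrt ν)⁻¹ : ℝ) : ℂ))) := by
  rw [stableCharFun, if_neg hk.ne', Real.rpow_def_of_pos hk, Complex.ofReal_exp, ← Complex.exp_add,
    Real.sign_of_pos hk, abs_of_pos hk, stableExponent]
  congr 3
  push_cast
  ring

/-- The Hölder bound at 0 provides positive moments of small order. Together with the negative ones
they put 0 in the interior of the set of finite exponential moments of log |X|. Negative k are
reached by conjugation. -/
lemma norm_one_sub_charFun_le (μ : Measure ℝ) [IsProbabilityMeasure μ] {α : ℝ} {L : ℂ}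
    (hα : 0 < α) (hL : |L.im| < Real.pi / 2)
    (hφ : ∀ k : ℝ, 0 < k → charFun μ k = Complex.exp (-(Complex.exp L * ((k ^ α : ℝ) : ℂ))))
    (k : ℝ) : ‖1 - charFun μ k‖ ≤ ‖Complex.exp L‖ * |k| ^ α := by
  have hre : 0 < (Complex.exp L).re := by
    rw [Complex.exp_re]
    refine mul_pos (Real.exp_pos _) (Real.cos_pos_of_mem_Ioo ?_)
    rw [abs_lt] at hL
    exact hL
  have hpos : ∀ k : ℝ, 0 < k → ‖1 - charFun μ k‖ ≤ ‖Complex.exp L‖ * |k| ^ α := by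
    intro k hk
    rw [hφ k hk]
    refine (norm_one_sub_cexp_neg_le ?_).trans ?_
    · rw [Complex.re_mul_ofReal]; positivity
    · rw [norm_mul, Complex.norm_real, Real.norm_of_nonneg (by positivity), abs_of_pos hk]
  rcases lt_trichotomy k 0 with h | h | h
  · have := hpos (-k) (by linarith)
    rw [charFun_neg, abs_neg] at this
    rw [← Complex.norm_conj]
    simpa using this
  · subst h
    simp [Real.zero_rpow hα.ne']
  · exact hpos k h

lemma integrableExpSet_log_mem_iff {μ : Measure ℝ} (h0 : μ {0} = 0) (t : ℝ) :
    t ∈ integrableExpSet (fun x => Real.log |x|) μ ↔ Integrable (fun x : ℝ => |x| ^ t) μ := by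
  have hae : ∀ᵐ x ∂μ, x ≠ 0 := by rw [ae_iff]; simpa using h0
  refine integrable_congr (hae.mono fun x hx => ?_)
  simp only
  rw [Real.rpow_def_of_pos (abs_pos.2 hx), mul_comm]

lemma mgf_log_eq_integral_rpow {μ : Measure ℝ} (h0 : μ {0} = 0) (t : ℝ) :
    mgf (fun x => Real.log |x|) μ t = ∫ x, |x| ^ t ∂μ := by
  have hae : ∀ᵐ x ∂μ, x ≠ 0 := by rw [ae_iff]; simpa using h0
  refine integral_congr_ae (hae.mono fun x hx => ?_)
  simp only
  rw [Real.rpow_def_of_pos (abs_pos.2 hx), mul_comm]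

lemma integral_sign_mul_rpow {μ : Measure ℝ} [IsProbabilityMeasure μ] (h0 : μ {0} = 0) {t : ℝ}
    (hi : Integrable (fun x : ℝ => |x| ^ t) μ) :
    ∫ x, Real.sign x * |x| ^ t ∂μ = mgf (fun x => Real.log |x|) (μ.restrict (Ioi 0)) t -
      mgf (fun x => Real.log |x|) (μ.restrict (Iio 0)) t := by
  have h1 : ∀ s : Set ℝ, (μ.restrict s) {0} = 0 := fun s =>
    le_antisymm ((Measure.restrict_le_self _).trans h0.le) zero_le
  rw [mgf_log_eq_integral_rpow (h1 _), mgf_log_eq_integral_rpow (h1 _),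
    ← integral_indicator measurableSet_Ioi, ← integral_indicator measurableSet_Iio,
    ← integral_sub (hi.indicator measurableSet_Ioi) (hi.indicator measurableSet_Iio)]
  congr 1
  ext x
  rcases lt_trichotomy x 0 with h | h | h
  · simp [h, Real.sign_of_neg h, not_lt.2 h.le, indicator]
  · simp [h]
  · simp [h, Real.sign_of_pos h, not_lt.2 h.le, indicator]

/-- The two real identities for the negative moments. -/
lemma neg_moment_identities (μ : Measure ℝ) [IsProbabilityMeasure μ] {a θ τ : ℝ} (ha : 0 < a)
    (hθ : |θ| < a)
    (hφ : ∀ k : ℝ, 0 < k → charFun μ k = Complex.exp (-(Complex.exp (stableExponent a θ τ) *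
      ((k ^ a⁻¹ : ℝ) : ℂ)))) {s : ℝ} (hs : 0 < s) (hs1 : s < 1) :
    μ {0} = 0 ∧ Integrable (fun x : ℝ => |x| ^ (-s)) μ ∧
    Real.Gamma (1 + s) * mgf (fun x => Real.log |x|) μ (-s) * Real.cos (Real.pi / 2 * s) =
      Real.Gamma (1 + a * s) *
        Real.exp (-(s * (τ + Real.eulerMascheroniConstant * (1 - a)))) *
          Real.cos (Real.pi / 2 * θ * s) ∧
    Real.Gamma (1 + s) * (mgf (fun x => Real.log |x|) (μ.restrict (Ioi 0)) (-s) -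
          mgf (fun x => Real.log |x|) (μ.restrict (Iio 0)) (-s)) * Real.sin (Real.pi / 2 * s) =
      Real.Gamma (1 + a * s) *
        Real.exp (-(s * (τ + Real.eulerMascheroniConstant * (1 - a)))) *
          Real.sin (Real.pi / 2 * θ * s) := by
  have hL : |(stableExponent a θ τ).im| < Real.pi / 2 := by
    have : (stableExponent a θ τ).im = -(a⁻¹ * (Real.pi / 2 * θ)) := by
      simp [stableExponent]
    rw [this, abs_neg, abs_mul, abs_mul, abs_of_pos (inv_pos.2 ha),
      abs_of_pos (by positivity : 0 < Real.pi / 2)]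
    rw [inv_mul_lt_iff₀ ha]
    nlinarith [Real.pi_pos]
  obtain ⟨h0, hi, heq⟩ := integral_rpow_neg_mul_cexp_sign μ (inv_pos.2 ha) hL hφ hs hs1
  refine ⟨h0, hi, ?_⟩
  have hae : ∀ᵐ x ∂μ, x ≠ 0 := by rw [ae_iff]; simpa using h0
  have hsign : Integrable (fun x : ℝ => Real.sign x * |x| ^ (-s)) μ := by
    refine hi.mono' (measurable_realSign.mul
      (Measurable.pow_const (by fun_prop) _)).aestronglyMeasurable (ae_of_all _ fun x => ?_)
    rw [norm_mul]
    refine (mul_le_of_le_one_left (norm_nonneg _) ?_).trans (le_of_eq ?_)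
    · rcases Real.sign_apply_eq x with h | h | h <;> simp [h]
    · rw [Real.norm_of_nonneg (by positivity)]
  have hsplit : ∫ x : ℝ, ((|x| ^ (-s) : ℝ) : ℂ) *
        Complex.exp (((Real.pi * s / 2 * Real.sign x : ℝ) : ℂ) * Complex.I) ∂μ =
      ((∫ x : ℝ, |x| ^ (-s) ∂μ) * Real.cos (Real.pi / 2 * s) : ℝ) +
      ((∫ x : ℝ, Real.sign x * |x| ^ (-s) ∂μ) * Real.sin (Real.pi / 2 * s) : ℝ) * Complex.I := by
    rw [← integral_mul_const, ← integral_mul_const, ← integral_complex_ofReal,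
      ← integral_complex_ofReal, ← integral_mul_const, ← integral_add]
    · refine integral_congr_ae (hae.mono fun x hx => ?_)
      simp only
      rw [Complex.exp_mul_I, ← Complex.ofReal_cos, ← Complex.ofReal_sin]
      rcases lt_or_gt_of_ne hx with h | h
      · rw [Real.sign_of_neg h, mul_neg_one, Real.cos_neg, Real.sin_neg,
          show Real.pi * s / 2 = Real.pi / 2 * s by ring]
        push_cast; ring
      · rw [Real.sign_of_pos h, mul_one, show Real.pi * s / 2 = Real.pi / 2 * s by ring]
        push_cast; ring
    · exact (hi.mul_const _).ofReal
    · exact (hsign.mul_const _).ofReal.mul_const _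
  have hrhs : Complex.exp (-(((s / a⁻¹ : ℝ) : ℂ) * stableExponent a θ τ)) =
      ((Real.exp (-(s * (τ + Real.eulerMascheroniConstant * (1 - a)))) *
          Real.cos (Real.pi / 2 * θ * s) : ℝ) : ℂ) +
      ((Real.exp (-(s * (τ + Real.eulerMascheroniConstant * (1 - a)))) *
          Real.sin (Real.pi / 2 * θ * s) : ℝ) : ℂ) * Complex.I := by
    have : -(((s / a⁻¹ : ℝ) : ℂ) * stableExponent a θ τ) =
        ((-(s * (τ + Real.eulerMascheroniConstant * (1 - a))) : ℝ) : ℂ) +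
          ((Real.pi / 2 * θ * s : ℝ) : ℂ) * Complex.I := by
      have ha' : (a : ℂ) ≠ 0 := by exact_mod_cast ha.ne'
      rw [stableExponent]
      push_cast
      field_simp
      ring
    rw [this, Complex.exp_add, Complex.exp_mul_I, ← Complex.ofReal_cos, ← Complex.ofReal_sin,
      ← Complex.ofReal_exp]
    push_cast
    ring
  rw [hsplit, hrhs, Complex.Gamma_ofReal, Complex.Gamma_ofReal] at heq
  have hs' : s / a⁻¹ = a * s := by field_simp
  rw [hs'] at heq
  have hre := congrArg Complex.re heq
  have him := congrArg Complex.im heq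
  simp only [Complex.re_ofReal_mul, Complex.im_ofReal_mul, Complex.add_re, Complex.add_im,
    Complex.ofReal_re, Complex.ofReal_im, Complex.I_re, Complex.I_im] at hre him
  rw [← integral_sign_mul_rpow h0 hi, mgf_log_eq_integral_rpow h0, add_comm 1 s,
    Real.Gamma_add_one hs.ne', add_comm 1 (a * s), Real.Gamma_add_one (mul_pos ha hs).ne']
  have hinv : 1 / a⁻¹ = a := by field_simp
  rw [hinv] at hre him
  constructor
  · linear_combination s * hre
  · linear_combination s * him

/-- The non-degenerate stable laws satisfy `LogLaw`. -/
lemma logLaw_of_charFun (μ : Measure ℝ) [IsProbabilityMeasure μ] {a θ τ : ℝ} (ha : 0 < a)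
    (hθ : |θ| < a)
    (hφ : ∀ k : ℝ, 0 < k → charFun μ k = Complex.exp (-(Complex.exp (stableExponent a θ τ) *
      ((k ^ a⁻¹ : ℝ) : ℂ)))) :
    LogLaw μ a θ (∫ x, Real.log |x| ∂μ) := by
  have hL : |(stableExponent a θ τ).im| < Real.pi / 2 := by
    have : (stableExponent a θ τ).im = -(a⁻¹ * (Real.pi / 2 * θ)) := by
      simp [stableExponent]
    rw [this, abs_neg, abs_mul, abs_mul, abs_of_pos (inv_pos.2 ha),
      abs_of_pos (by positivity : 0 < Real.pi / 2)]
    rw [inv_mul_lt_iff₀ ha]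
    nlinarith [Real.pi_pos]
  have hid := fun {s : ℝ} (hs : 0 < s) (hs1 : s < 1) =>
    neg_moment_identities μ ha hθ hφ hs hs1
  have h0 : μ {0} = 0 := (hid (s := 1 / 2) (by norm_num) (by norm_num)).1
  set V : ℝ → ℝ := fun x => Real.log |x| with hV
  -- The moments of order t < 0 come from the identities for negative moments, those of order t > 0
  -- from the tail bound with exponent 1/a.
  have hset : Ioo (-1) a⁻¹ ⊆ integrableExpSet V μ := by
    intro t ht
    rw [integrableExpSet_log_mem_iff h0]
    rcases lt_trichotomy t 0 with h | h | h
    · have := (hid (s := -t) (by linarith) (by linarith [ht.1])).2.1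
      simpa using this
    · subst h; simp
    · exact integrable_abs_rpow_of_charFun μ (inv_pos.2 ha)
        (norm_one_sub_charFun_le μ (inv_pos.2 ha) hL hφ) h ht.2
  have hint : 0 ∈ interior (integrableExpSet V μ) :=
    mem_interior.2 ⟨_, hset, isOpen_Ioo, by norm_num, by positivity⟩
  have hintr : ∀ S : Set ℝ, 0 ∈ interior (integrableExpSet V (μ.restrict S)) := fun S =>
    interior_mono (fun t ht => Integrable.restrict ht) hint
  have han : AnalyticAt ℝ (mgf V μ) 0 := analyticAt_mgf hint
  have hanr : ∀ S : Set ℝ, AnalyticAt ℝ (mgf V (μ.restrict S)) 0 := fun S =>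
    analyticAt_mgf (hintr S)
  have hneg : AnalyticAt ℝ (fun s : ℝ => -s) 0 := by fun_prop
  have han' : AnalyticAt ℝ (fun s => mgf V μ (-s)) 0 :=
    AnalyticAt.fun_comp (g := mgf V μ) (by simpa using han) hneg
  have hanr' : ∀ S : Set ℝ, AnalyticAt ℝ (fun s => mgf V (μ.restrict S) (-s)) 0 := fun S =>
    AnalyticAt.fun_comp (g := mgf V (μ.restrict S)) (by simpa using hanr S) hneg
  have hΓ : ∀ b : ℝ, AnalyticAt ℝ (fun s : ℝ => Real.Gamma (1 + b * s)) 0 := fun b =>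
    AnalyticAt.fun_comp (g := Real.Gamma) (f := fun s : ℝ => 1 + b * s)
      (by simpa using analyticAt_realGamma one_pos) (by fun_prop)
  have hsin : ∀ b : ℝ, AnalyticAt ℝ (fun s : ℝ => Real.sin (b * s)) 0 := fun b =>
    Real.analyticAt_sin.fun_comp (by fun_prop)
  have hcos : ∀ b : ℝ, AnalyticAt ℝ (fun s : ℝ => Real.cos (b * s)) 0 := fun b =>
    Real.analyticAt_cos.fun_comp (by fun_prop)
  -- The identities are known only for 0 < s < 1, but this set accumulates at 0. Analytic functions
  -- that agree there agree in a full neighbourhood of 0, so negative s are admissible as well.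
  have hfreq : ∀ p : ℝ → Prop, (∀ s, 0 < s → s < 1 → p s) → ∃ᶠ s in 𝓝[≠] (0 : ℝ), p s := by
    intro p hp
    have h1 : ∀ᶠ s in 𝓝[>] (0 : ℝ), p s := by
      filter_upwards [Ioo_mem_nhdsGT (zero_lt_one' ℝ)] with s hs using hp s hs.1 hs.2
    exact h1.frequently.filter_mono (nhdsWithin_mono _ fun s hs => ne_of_gt hs)
  set c := τ + Real.eulerMascheroniConstant * (1 - a) with hc
  have hE : AnalyticAt ℝ (fun s : ℝ => Real.exp (-(s * c))) 0 := by fun_prop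
  have hA : ∀ᶠ s in 𝓝 (0 : ℝ), Real.Gamma (1 + 1 * s) * mgf V μ (-s) *
      Real.cos (Real.pi / 2 * s) =
      Real.Gamma (1 + a * s) * Real.exp (-(s * c)) * Real.cos (Real.pi / 2 * θ * s) := by
    refine (AnalyticAt.frequently_eq_iff_eventually_eq
      (((hΓ 1).mul han').mul (hcos _)) (((hΓ a).mul hE).mul (hcos _))).1 (hfreq _ ?_)
    intro s hs hs1
    simp only [Pi.mul_apply, one_mul]
    exact (hid hs hs1).2.2.1
  have hX : ∀ᶠ s in 𝓝 (0 : ℝ), (mgf V (μ.restrict (Ioi 0)) (-s) - mgf V (μ.restrict (Iio 0)) (-s)) *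
        (Real.sin (Real.pi / 2 * s) * Real.cos (Real.pi / 2 * θ * s)) =
      mgf V μ (-s) * (Real.cos (Real.pi / 2 * s) * Real.sin (Real.pi / 2 * θ * s)) := by
    refine (AnalyticAt.frequently_eq_iff_eventually_eq
      (((hanr' _).sub (hanr' _)).mul ((hsin _).mul (hcos _)))
      (han'.mul ((hcos _).mul (hsin _)))).1 (hfreq _ ?_)
    intro s hs hs1
    obtain ⟨-, -, e1, e2⟩ := hid hs hs1
    have hΓ0 : Real.Gamma (1 + s) ≠ 0 := (Real.Gamma_pos_of_pos (by linarith)).ne'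
    refine mul_left_cancel₀ hΓ0 ?_
    simp only [Pi.mul_apply, Pi.sub_apply]
    linear_combination Real.cos (Real.pi / 2 * θ * s) * e2 - Real.sin (Real.pi / 2 * θ * s) * e1
  have hnegt : Tendsto (fun s : ℝ => -s) (𝓝 0) (𝓝 0) := by
    simpa using (continuous_neg (G := ℝ)).tendsto 0
  have hsmall : ∀ b : ℝ, ∀ᶠ s in 𝓝 (0 : ℝ), |b * s| < 1 := fun b => by
    have h1 : Tendsto (fun s : ℝ => |b * s|) (𝓝 0) (𝓝 0) := by
      have : Continuous fun s : ℝ => |b * s| := by fun_prop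
      simpa using this.tendsto 0
    exact h1.eventually (gt_mem_nhds one_pos)
  refine logLaw_of_log μ h0 hint ?_ ?_
  · filter_upwards [hA, hnegt.eventually hA, hsmall 1, hsmall a] with s h1 h2 h3 h4
    have hrefl := gamma_reflection_mul (a := a) (s := s) (by simpa using h3) h4
    have hpos : ∀ x : ℝ, |x| < 1 → 0 < Real.Gamma (1 + x) := fun x hx =>
      Real.Gamma_pos_of_pos (by rw [abs_lt] at hx; linarith)
    have p1 := hpos (1 * s) h3
    have p2 : 0 < Real.Gamma (1 + 1 * -s) := hpos _ (by rw [mul_neg, abs_neg]; exact h3)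
    have hcs : 0 < Real.cos (Real.pi / 2 * s) := by
      rw [one_mul, abs_lt] at h3
      exact Real.cos_pos_of_mem_Ioo ⟨by nlinarith [Real.pi_pos], by nlinarith [Real.pi_pos]⟩
    simp only [neg_neg, mul_neg, Real.cos_neg] at h2
    rw [mul_neg] at p2
    have hee : Real.exp (-(s * c)) * Real.exp (-(-s * c)) = 1 := by
      rw [← Real.exp_add]; simp
    have hdouble : Real.sin (Real.pi * s) =
        2 * Real.sin (Real.pi / 2 * s) * Real.cos (Real.pi / 2 * s) := by
      rw [← Real.sin_two_mul]; ring_nf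
    have hsin_eq : Real.sin (Real.pi * a * s) = Real.sin (Real.pi * (a * s)) := by ring_nf
    rw [hsin_eq]
    have q : 1 + -(1 * s) = 1 - s := by ring
    have q' : 1 + 1 * s = 1 + s := by ring
    have q'' : 1 + -(a * s) = 1 - a * s := by ring
    rw [q'] at h1 p1
    rw [q, q''] at h2
    rw [q] at p2
    rw [hdouble] at hrefl
    refine mul_left_cancel₀ (mul_pos (mul_pos p1 p2) hcs).ne' ?_
    -- In the product of the identities at s and -s the exponentials, and with them τ and the Euler
    -- constant, cancel.
    have h12 := congrArg₂ (· * ·) h1 h2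
    linear_combination Real.sin (Real.pi * (a * s)) * h12 +
      Real.cos (Real.pi / 2 * θ * s) ^ 2 * hrefl + (Real.Gamma (1 + a * s) *
        Real.Gamma (1 - a * s) * Real.cos (Real.pi / 2 * θ * s) ^ 2 *
        Real.sin (Real.pi * (a * s))) * hee
  · filter_upwards [hnegt.eventually hX] with s hs
    simp only [neg_neg, mul_neg, Real.cos_neg, Real.sin_neg] at hs
    linear_combination -hs

/-- The point masses `±exp ℓ` satisfy `LogLaw`. -/
lemma logLaw_dirac {θ ℓ : ℝ} (hθ : |θ| = 1) :
    LogLaw (Measure.dirac (θ * Real.exp ℓ)) 1 θ ℓ := by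
  have hlog : Real.log |θ * Real.exp ℓ| = ℓ := by
    rw [abs_mul, hθ, one_mul, abs_of_pos (Real.exp_pos _), Real.log_exp]
  have hv : logNorm ℓ (θ * Real.exp ℓ) = 0 := by rw [logNorm, hlog]; simp
  have hne : θ * Real.exp ℓ ≠ 0 := by
    refine mul_ne_zero ?_ (Real.exp_pos _).ne'
    intro h; rw [h] at hθ; simp at hθ
  have hm : ∀ s, mgf (logNorm ℓ) (Measure.dirac (θ * Real.exp ℓ)) s = 1 := fun s => by
    rw [mgf, integral_dirac, hv]; simp
  refine ⟨by simp [hne], ?_, ?_, ?_, ?_⟩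
  · have : integrableExpSet (logNorm ℓ) (Measure.dirac (θ * Real.exp ℓ)) = univ := by
      refine eq_univ_of_forall fun t => ?_
      exact integrable_dirac (by simp)
    rw [this]; simp
  · rw [integral_dirac, hv]
  · refine Eventually.of_forall fun s => ?_
    rw [hm, hm]
    have h1 : Real.sin (Real.sqrt 6 * 1 * s) =
        2 * Real.sin (Real.sqrt 6 / 2 * s) * Real.cos (Real.sqrt 6 / 2 * s) := by
      rw [← Real.sin_two_mul]; ring_nf
    have h2 : Real.cos (Real.sqrt 6 / 2 * θ * s) = Real.cos (Real.sqrt 6 / 2 * s) := by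
      rcases (abs_eq one_pos.le).1 hθ with h | h <;> rw [h] <;> simp
    rw [h1, h2]; ring
  · refine Eventually.of_forall fun s => ?_
    rw [hm]
    rcases (abs_eq one_pos.le).1 hθ with h | h
    · subst h
      have hp : 1 * Real.exp ℓ ∈ Ioi (0 : ℝ) := by simp [Real.exp_pos]
      have hn : 1 * Real.exp ℓ ∉ Iio (0 : ℝ) := by simp [(Real.exp_pos ℓ).le]
      rw [restrict_dirac' measurableSet_Ioi, if_pos hp, restrict_dirac' measurableSet_Iio, if_neg hn, hm,
        mgf_zero_measure]
      simp [mul_comm]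
    · subst h
      have hp : -1 * Real.exp ℓ ∉ Ioi (0 : ℝ) := by simp [(Real.exp_pos ℓ).le]
      have hn : -1 * Real.exp ℓ ∈ Iio (0 : ℝ) := by simp [Real.exp_pos]
      rw [restrict_dirac' measurableSet_Ioi, if_neg hp, restrict_dirac' measurableSet_Iio, if_pos hn, hm,
        mgf_zero_measure]
      simp [mul_comm]

/-- Every strictly stable law satisfies `LogLaw`. -/
theorem exists_logLaw (μ : Measure ℝ) [IsProbabilityMeasure μ] {ν θ τ : ℝ} (hν : 1 / 4 ≤ ν)
    (hθ : |θ| ≤ min 1 (2 * Real.sqrt ν - 1)) (hφ : ∀ k, charFun μ k = stableCharFun ν θ τ k) :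
    ∃ ℓ, LogLaw μ (Real.sqrt ν) θ ℓ := by
  have ha : 0 < Real.sqrt ν := Real.sqrt_pos.2 (by linarith)
  have h1 := hθ.trans (min_le_left _ _)
  have h2 := hθ.trans (min_le_right _ _)
  rcases lt_or_ge |θ| (Real.sqrt ν) with h | h
  · refine ⟨_, logLaw_of_charFun μ (τ := τ) ha h fun k hk => ?_⟩
    rw [hφ, stableCharFun_of_pos hk]
  -- From √ν ≤ |θ| ≤ min(1, 2√ν - 1) follows √ν = |θ| = 1: the exponent of the characteristic
  -- function is purely imaginary and X is a constant.
  · have hs : Real.sqrt ν = 1 := by linarith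
    have ht : |θ| = 1 := by linarith
    refine ⟨τ, ?_⟩
    rw [hs]
    have : μ = Measure.dirac (θ * Real.exp τ) := by
      refine Measure.ext_of_charFun (funext fun k => ?_)
      rw [hφ, charFun_dirac, stableCharFun]
      split_ifs with hk
      · simp [hk]
      · rw [hs]
        congr 1
        have hk' : 0 < |k| := abs_pos.2 hk
        have : (((1⁻¹ : ℝ) : ℂ) * (((Real.log |k| + τ : ℝ) : ℂ) -
            Complex.I * ((Real.pi / 2 * θ * Real.sign k : ℝ) : ℂ)) +
            ((Real.eulerMascheroniConstant * (1⁻¹ - 1) : ℝ) : ℂ)) =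
            ((Real.log |k| + τ : ℝ) : ℂ) + ((-(Real.pi / 2 * (θ * Real.sign k)) : ℝ) : ℂ) *
              Complex.I := by
          push_cast; norm_num; ring
        rw [this, Complex.exp_add, ← Complex.ofReal_exp, Real.exp_add, Real.exp_log hk',
          Complex.exp_mul_I, ← Complex.ofReal_cos, ← Complex.ofReal_sin, Real.cos_neg,
          Real.sin_neg]
        have hc : θ * Real.sign k = 1 ∨ θ * Real.sign k = -1 := by
          rcases (abs_eq one_pos.le).1 ht with h | h <;>
          rcases Real.sign_apply_eq_of_ne_zero k hk with h' | h' <;> simp [h, h']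
        have hx : θ * Real.exp τ * k = θ * Real.sign k * (|k| * Real.exp τ) := by
          rcases lt_or_gt_of_ne hk with h | h
          · rw [Real.sign_of_neg h, abs_of_neg h]; ring
          · rw [Real.sign_of_pos h, abs_of_pos h]; ring
        have hin : inner ℝ (θ * Real.exp τ) k = θ * Real.exp τ * k := by
          simp [mul_comm]
        rw [hin, hx]
        rcases hc with hc | hc <;> rw [hc]
        · simp
        · simp
    rw [this]
    exact logLaw_dirac ht

/-! ### Moments of the normalized log-modulus -/

/-- The variance of the normalized log-modulus. -/
def dHat (a θ : ℝ) : ℝ := 3 / 2 * (1 - θ ^ 2) + a ^ 2 - 1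

/-- The fourth cumulant of the normalized log-modulus. -/
def hHat (a θ : ℝ) : ℝ := 9 / 2 * (1 - θ ^ 4) + 12 / 5 * (a ^ 4 - 1)

/-- The sixth cumulant of the symmetrized normalized log-modulus, halved. -/
def kHat (a θ : ℝ) : ℝ := 54 * (1 - θ ^ 6) + 192 / 7 * (a ^ 6 - 1)

/-- The fourth moment of the normalized log-modulus. -/
def aHat (a θ : ℝ) : ℝ := hHat a θ + 3 * dHat a θ ^ 2

lemma iteratedDeriv_sin_zero :
    iteratedDeriv 0 Real.sin 0 = 0 ∧ iteratedDeriv 1 Real.sin 0 = 1 ∧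
    iteratedDeriv 2 Real.sin 0 = 0 ∧ iteratedDeriv 3 Real.sin 0 = -1 ∧
    iteratedDeriv 4 Real.sin 0 = 0 ∧ iteratedDeriv 5 Real.sin 0 = 1 ∧
    iteratedDeriv 6 Real.sin 0 = 0 ∧ iteratedDeriv 7 Real.sin 0 = -1 := by
  refine ⟨?_, ?_, ?_, ?_, ?_, ?_, ?_, ?_⟩ <;>
    simp [Real.iteratedDeriv_add_one_sin, Real.iteratedDeriv_add_one_cos]

/-- A combination of three sine functions, as occurs in products of trigonometric functions. -/
def sinSum (c₁ c₂ c₃ b₁ b₂ b₃ s : ℝ) : ℝ :=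
  c₁ * Real.sin (b₁ * s) + c₂ * Real.sin (b₂ * s) + c₃ * Real.sin (b₃ * s)

lemma contDiff_sinSum (c₁ c₂ c₃ b₁ b₂ b₃ : ℝ) {n : WithTop ℕ∞} :
    ContDiff ℝ n (sinSum c₁ c₂ c₃ b₁ b₂ b₃) := by
  unfold sinSum
  fun_prop

lemma iteratedDeriv_sinSum_zero (c₁ c₂ c₃ b₁ b₂ b₃ : ℝ) (n : ℕ) :
    iteratedDeriv n (sinSum c₁ c₂ c₃ b₁ b₂ b₃) 0 =
      (c₁ * b₁ ^ n + c₂ * b₂ ^ n + c₃ * b₃ ^ n) * iteratedDeriv n Real.sin 0 := by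
  have h : ∀ b : ℝ, iteratedDeriv n (fun s => Real.sin (b * s)) 0 =
      b ^ n * iteratedDeriv n Real.sin 0 := fun b => by
    rw [iteratedDeriv_comp_const_mul Real.contDiff_sin]
    simp
  have hc : ∀ b : ℝ, ContDiffAt ℝ n (fun s => Real.sin (b * s)) 0 := fun b => by fun_prop
  unfold sinSum
  simp (discharger := fun_prop) only [iteratedDeriv_fun_add, iteratedDeriv_const_mul_field, h]
  ring

section Moments

variable {μ : Measure ℝ} {a θ ℓ : ℝ}

lemma LogLaw.integrable_pow (h : LogLaw μ a θ ℓ) (n : ℕ) :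
    Integrable (fun x => logNorm ℓ x ^ n) μ :=
  integrable_pow_of_mem_interior_integrableExpSet h.exp n

lemma LogLaw.exp_restrict (h : LogLaw μ a θ ℓ) (S : Set ℝ) :
    0 ∈ interior (integrableExpSet (logNorm ℓ) (μ.restrict S)) :=
  interior_mono (fun _ ht => Integrable.restrict ht) h.exp

lemma iteratedDeriv_mgf_mul_mgf_neg {f : ℝ → ℝ} (hf : AnalyticAt ℝ f 0) (n : ℕ) :
    iteratedDeriv n (fun s => f s * f (-s)) 0 = ∑ i ∈ Finset.range (n + 1),
      (n.choose i : ℝ) * iteratedDeriv i f 0 * ((-1) ^ (n - i) * iteratedDeriv (n - i) f 0) := by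
  have hneg : AnalyticAt ℝ (fun s => f (-s)) 0 :=
    AnalyticAt.fun_comp (g := f) (by simpa using hf) (by fun_prop)
  rw [iteratedDeriv_fun_mul hf.contDiffAt hneg.contDiffAt]
  simp [iteratedDeriv_comp_neg]

/-- The even identity in terms of Taylor coefficients. -/
lemma LogLaw.even_iteratedDeriv (h : LogLaw μ a θ ℓ) (n : ℕ) :
    ∑ i ∈ Finset.range (n + 1), (n.choose i : ℝ) *
      (∑ j ∈ Finset.range (i + 1), (i.choose j : ℝ) * (∫ x, logNorm ℓ x ^ j ∂μ) *
        ((-1) ^ (i - j) * ∫ x, logNorm ℓ x ^ (i - j) ∂μ)) *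
      ((1 / 2 * (Real.sqrt 6 * (a + 1 / 2)) ^ (n - i) +
        1 / 2 * (Real.sqrt 6 * (a - 1 / 2)) ^ (n - i) + 0 * 0 ^ (n - i)) *
          iteratedDeriv (n - i) Real.sin 0) =
    (a * (Real.sqrt 6 / 2) ^ n + a / 2 * (Real.sqrt 6 / 2 * (1 + 2 * θ)) ^ n +
      a / 2 * (Real.sqrt 6 / 2 * (1 - 2 * θ)) ^ n) * iteratedDeriv n Real.sin 0 := by
  have hf := analyticAt_mgf h.exp
  have hneg : AnalyticAt ℝ (fun s => mgf (logNorm ℓ) μ (-s)) 0 :=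
    AnalyticAt.fun_comp (g := mgf (logNorm ℓ) μ) (by simpa using hf) (by fun_prop)
  have heq : (fun s => (mgf (logNorm ℓ) μ s * mgf (logNorm ℓ) μ (-s)) *
      sinSum (1 / 2) (1 / 2) 0 (Real.sqrt 6 * (a + 1 / 2)) (Real.sqrt 6 * (a - 1 / 2)) 0 s) =ᶠ[𝓝 0]
      sinSum a (a / 2) (a / 2) (Real.sqrt 6 / 2) (Real.sqrt 6 / 2 * (1 + 2 * θ))
        (Real.sqrt 6 / 2 * (1 - 2 * θ)) := by
    filter_upwards [h.even] with s hs
    -- Products of trigonometric functions are turned into sums of sines, whose derivatives at 0 are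
    -- explicit.
    have e1 : sinSum (1 / 2) (1 / 2) 0 (Real.sqrt 6 * (a + 1 / 2)) (Real.sqrt 6 * (a - 1 / 2)) 0 s =
        Real.sin (Real.sqrt 6 * a * s) * Real.cos (Real.sqrt 6 / 2 * s) := by
      rw [sinSum, show Real.sqrt 6 * (a + 1 / 2) * s = Real.sqrt 6 * a * s + Real.sqrt 6 / 2 * s by
        ring, show Real.sqrt 6 * (a - 1 / 2) * s = Real.sqrt 6 * a * s - Real.sqrt 6 / 2 * s by ring,
        Real.sin_add, Real.sin_sub]
      ring
    have e2 : sinSum a (a / 2) (a / 2) (Real.sqrt 6 / 2) (Real.sqrt 6 / 2 * (1 + 2 * θ))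
        (Real.sqrt 6 / 2 * (1 - 2 * θ)) s =
        2 * a * (Real.sin (Real.sqrt 6 / 2 * s) * Real.cos (Real.sqrt 6 / 2 * θ * s) ^ 2) := by
      rw [sinSum, show Real.sqrt 6 / 2 * (1 + 2 * θ) * s =
        Real.sqrt 6 / 2 * s + 2 * (Real.sqrt 6 / 2 * θ * s) by ring,
        show Real.sqrt 6 / 2 * (1 - 2 * θ) * s =
        Real.sqrt 6 / 2 * s - 2 * (Real.sqrt 6 / 2 * θ * s) by ring,
        Real.sin_add, Real.sin_sub, Real.cos_two_mul]
      ring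
    simp only [e1, e2]
    exact hs
  have := heq.iteratedDeriv_eq n
  rw [iteratedDeriv_fun_mul ((hf.fun_mul hneg).contDiffAt) (contDiff_sinSum ..).contDiffAt,
    iteratedDeriv_sinSum_zero] at this
  simp only [iteratedDeriv_sinSum_zero, iteratedDeriv_mgf_mul_mgf_neg hf,
    iteratedDeriv_mgf_zero h.exp, Pi.pow_apply] at this
  exact this

/-- Taylor coefficients of the cross identity, multiplied by 2 so that the trigonometric products
become sums and differences of two sines. -/
lemma LogLaw.cross_iteratedDeriv (h : LogLaw μ a θ ℓ) (n : ℕ) :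
    ∑ i ∈ Finset.range (n + 1), (n.choose i : ℝ) *
      ((∫ x in Ioi 0, logNorm ℓ x ^ i ∂μ) - ∫ x in Iio 0, logNorm ℓ x ^ i ∂μ) *
      (((Real.sqrt 6 / 2 * (1 + θ)) ^ (n - i) + (Real.sqrt 6 / 2 * (1 - θ)) ^ (n - i)) *
          iteratedDeriv (n - i) Real.sin 0) =
    ∑ i ∈ Finset.range (n + 1), (n.choose i : ℝ) * (∫ x, logNorm ℓ x ^ i ∂μ) *
      (((Real.sqrt 6 / 2 * (1 + θ)) ^ (n - i) - (Real.sqrt 6 / 2 * (1 - θ)) ^ (n - i)) *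
          iteratedDeriv (n - i) Real.sin 0) := by
  have hf := analyticAt_mgf h.exp
  have hp := analyticAt_mgf (h.exp_restrict (Ioi 0))
  have hm := analyticAt_mgf (h.exp_restrict (Iio 0))
  have heq : (fun s => (mgf (logNorm ℓ) (μ.restrict (Ioi 0)) s -
        mgf (logNorm ℓ) (μ.restrict (Iio 0)) s) *
      sinSum 1 1 0 (Real.sqrt 6 / 2 * (1 + θ)) (Real.sqrt 6 / 2 * (1 - θ)) 0 s) =ᶠ[𝓝 0]
      (fun s => mgf (logNorm ℓ) μ s *
        sinSum 1 (-1) 0 (Real.sqrt 6 / 2 * (1 + θ)) (Real.sqrt 6 / 2 * (1 - θ)) 0 s) := by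
    filter_upwards [h.cross] with s hs
    simp only [sinSum]
    rw [show Real.sqrt 6 / 2 * (1 + θ) * s = Real.sqrt 6 / 2 * s + Real.sqrt 6 / 2 * θ * s by ring,
      show Real.sqrt 6 / 2 * (1 - θ) * s = Real.sqrt 6 / 2 * s - Real.sqrt 6 / 2 * θ * s by ring,
      Real.sin_add, Real.sin_sub]
    linear_combination 2 * hs
  have := heq.iteratedDeriv_eq n
  have hd : ∀ i, iteratedDeriv i (fun s => mgf (logNorm ℓ) (μ.restrict (Ioi 0)) s -
        mgf (logNorm ℓ) (μ.restrict (Iio 0)) s) 0 =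
      (∫ x in Ioi 0, logNorm ℓ x ^ i ∂μ) - ∫ x in Iio 0, logNorm ℓ x ^ i ∂μ := fun i => by
    rw [iteratedDeriv_fun_sub hp.contDiffAt hm.contDiffAt, iteratedDeriv_mgf_zero (h.exp_restrict _),
      iteratedDeriv_mgf_zero (h.exp_restrict _)]
    rfl
  rw [iteratedDeriv_fun_mul ((hp.fun_sub hm).contDiffAt) (contDiff_sinSum ..).contDiffAt,
    iteratedDeriv_fun_mul hf.contDiffAt (contDiff_sinSum ..).contDiffAt] at this
  simp only [iteratedDeriv_sinSum_zero, hd, iteratedDeriv_mgf_zero h.exp, Pi.pow_apply] at this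
  convert this using 3
  · simp
  · simp [sub_eq_add_neg]

lemma sqrt_six_pow : Real.sqrt 6 ^ 2 = 6 ∧ Real.sqrt 6 ^ 3 = 6 * Real.sqrt 6 ∧
    Real.sqrt 6 ^ 5 = 36 * Real.sqrt 6 ∧ Real.sqrt 6 ^ 7 = 216 * Real.sqrt 6 := by
  have h : Real.sqrt 6 ^ 2 = 6 := Real.sq_sqrt (by norm_num)
  refine ⟨h, ?_, ?_, ?_⟩
  · linear_combination Real.sqrt 6 * h
  · linear_combination Real.sqrt 6 * (Real.sqrt 6 ^ 2 + 6) * h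
  · linear_combination Real.sqrt 6 * (Real.sqrt 6 ^ 4 + 6 * Real.sqrt 6 ^ 2 + 36) * h

/-- The sine factor vanishes to first order at 0, so the coefficient of order 3 determines the
second moment. Likewise orders 5 and 7 lead to the fourth and sixth moments. -/
lemma LogLaw.integral_sq [IsProbabilityMeasure μ] (h : LogLaw μ a θ ℓ) (ha : 0 < a) :
    ∫ x, logNorm ℓ x ^ 2 ∂μ = dHat a θ := by
  have e := h.even_iteratedDeriv 3
  obtain ⟨d0, d1, d2, d3, -, -, -, -⟩ := iteratedDeriv_sin_zero
  obtain ⟨q2, q3, -, -⟩ := sqrt_six_pow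
  have hm := h.mean
  simp only [Finset.sum_range_succ, Finset.sum_range_zero, d0, d1, d2, d3, Nat.choose,
    Nat.sub_self, Nat.sub_zero, pow_zero, pow_one, hm, mul_pow, div_pow, q3,
    integral_const, probReal_univ, smul_eq_mul, Nat.reduceSub, Nat.reduceAdd] at e
  have hne : Real.sqrt 6 * a ≠ 0 := by positivity
  refine mul_left_cancel₀ hne ?_
  norm_num at e
  rw [dHat]
  linear_combination 1 / 6 * e

lemma LogLaw.integral_pow_four [IsProbabilityMeasure μ] (h : LogLaw μ a θ ℓ) (ha : 0 < a) :
    ∫ x, logNorm ℓ x ^ 4 ∂μ = aHat a θ := by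
  have e := h.even_iteratedDeriv 5
  obtain ⟨d0, d1, d2, d3, d4, d5, -, -⟩ := iteratedDeriv_sin_zero
  obtain ⟨q2, q3, q5, -⟩ := sqrt_six_pow
  have hm := h.mean
  have h2 := h.integral_sq ha
  simp only [Finset.sum_range_succ, Finset.sum_range_zero, d0, d1, d2, d3, d4, d5, Nat.choose,
    Nat.sub_self, Nat.sub_zero, pow_zero, pow_one, hm, h2, mul_pow, div_pow, q3, q5,
    integral_const, probReal_univ, smul_eq_mul, Nat.reduceSub, Nat.reduceAdd] at e
  have hne : Real.sqrt 6 * a ≠ 0 := by positivity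
  refine mul_left_cancel₀ hne ?_
  norm_num at e
  rw [aHat, hHat]
  simp only [dHat] at e ⊢
  linear_combination 1 / 10 * e

/-- The even identity determines even cumulants only, so the square of the third moment stays
undetermined here. -/
lemma LogLaw.integral_pow_six_eq [IsProbabilityMeasure μ] (h : LogLaw μ a θ ℓ) (ha : 0 < a) :
    ∫ x, logNorm ℓ x ^ 6 ∂μ = kHat a θ + 30 * hHat a θ * dHat a θ + 60 * dHat a θ ^ 3 -
      15 * aHat a θ * dHat a θ + 10 * (∫ x, logNorm ℓ x ^ 3 ∂μ) ^ 2 := by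
  have e := h.even_iteratedDeriv 7
  obtain ⟨d0, d1, d2, d3, d4, d5, d6, d7⟩ := iteratedDeriv_sin_zero
  obtain ⟨q2, q3, q5, q7⟩ := sqrt_six_pow
  have hm := h.mean
  have h2 := h.integral_sq ha
  have h4 := h.integral_pow_four ha
  simp only [Finset.sum_range_succ, Finset.sum_range_zero, d0, d1, d2, d3, d4, d5, d6, d7,
    Nat.choose, Nat.sub_self, Nat.sub_zero, pow_zero, pow_one, hm, h2, h4, mul_pow, div_pow, q3,
    q5, q7,
    integral_const, probReal_univ, smul_eq_mul, Nat.reduceSub, Nat.reduceAdd] at e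
  have hne : Real.sqrt 6 * a ≠ 0 := by positivity
  refine mul_left_cancel₀ hne ?_
  norm_num at e
  simp only [aHat, kHat, hHat, dHat] at e ⊢
  linear_combination 1 / 14 * e

/-- Bound for the sixth moment of the normalized log-modulus. -/
def cSix (a θ : ℝ) : ℝ := kHat a θ + 25 * hHat a θ * dHat a θ + 35 * dHat a θ ^ 3

/-- With V the normalized log-modulus, D and A its second and fourth moments, the second moment of
V² - D - cV is nonnegative for every c. The optimal c gives m₃² ≤ D(A - D²), and the remaining terms
combine to the defining expression of `cSix`. -/
lemma LogLaw.integral_pow_six_le [IsProbabilityMeasure μ] (h : LogLaw μ a θ ℓ) (ha : 0 < a) :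
    ∫ x, logNorm ℓ x ^ 6 ∂μ ≤ cSix a θ := by
  have h2 := h.integral_sq ha
  have h4 := h.integral_pow_four ha
  have hi := h.integrable_pow
  set D := dHat a θ with hD
  set A := aHat a θ with hA
  have hD0 : 0 ≤ D := by rw [← h2]; positivity
  have key : (∫ x, logNorm ℓ x ^ 3 ∂μ) ^ 2 ≤ D * (A - D ^ 2) := by
    set m3 := ∫ x, logNorm ℓ x ^ 3 ∂μ with hm3
    have hquad : ∀ c : ℝ, 0 ≤ A - D ^ 2 - 2 * c * m3 + c ^ 2 * D := by
      intro c
      have h1 : ∫ x, (logNorm ℓ x ^ 2 - D - c * logNorm ℓ x) ^ 2 ∂μ =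
          A - D ^ 2 - 2 * c * m3 + c ^ 2 * D := by
        have : ∀ x, (logNorm ℓ x ^ 2 - D - c * logNorm ℓ x) ^ 2 = logNorm ℓ x ^ 4 +
            (-(2 * c)) * logNorm ℓ x ^ 3 + (c ^ 2 - 2 * D) * logNorm ℓ x ^ 2 +
            (2 * c * D) * logNorm ℓ x ^ 1 + D ^ 2 * logNorm ℓ x ^ 0 := fun x => by ring
        simp_rw [this]
        rw [integral_add, integral_add, integral_add, integral_add, integral_const_mul,
          integral_const_mul, integral_const_mul, integral_const_mul, h4, h2]
        · simp only [pow_one, h.mean, pow_zero, integral_const, probReal_univ,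
            smul_eq_mul, ← hm3]
          ring
        all_goals fun_prop (disch := exact hi _)
      rw [← h1]
      positivity
    rcases hD0.eq_or_lt with h0 | h0
    · have q0 := hquad 0
      rw [← h0] at hquad q0 ⊢
      have hm30 : m3 = 0 := by
        by_contra hne
        -- If D = 0 the quadratic is linear in c, and this c makes it negative unless m₃ vanishes.
        have q1 := hquad ((A + 1) / m3)
        have : 2 * ((A + 1) / m3) * m3 = 2 * (A + 1) := by field_simp
        rw [this] at q1
        linarith
      simp [hm30]
    · have q1 := hquad (m3 / D)
      have : A - D ^ 2 - 2 * (m3 / D) * m3 + (m3 / D) ^ 2 * D = A - D ^ 2 - m3 ^ 2 / D := by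
        field_simp; ring
      rw [this, sub_nonneg, div_le_iff₀ h0] at q1
      linarith
  rw [h.integral_pow_six_eq ha, cSix]
  rw [← hD, ← hA]
  have hAe : A = hHat a θ + 3 * D ^ 2 := by rw [hA, hD, aHat]
  rw [hAe] at key ⊢
  nlinarith

/-- These are E sign X and E(sign X · V²), read off from the coefficients of order 1 and 3. No other
mixed moment is computed. -/
lemma LogLaw.cross_moments [IsProbabilityMeasure μ] (h : LogLaw μ a θ ℓ) (ha : 0 < a) :
    ((∫ x in Ioi 0, logNorm ℓ x ^ 0 ∂μ) - ∫ x in Iio 0, logNorm ℓ x ^ 0 ∂μ = θ) ∧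
    ((∫ x in Ioi 0, logNorm ℓ x ^ 2 ∂μ) - ∫ x in Iio 0, logNorm ℓ x ^ 2 ∂μ =
      θ * (dHat a θ - (1 - θ ^ 2))) := by
  have e1 := h.cross_iteratedDeriv 1
  have e3 := h.cross_iteratedDeriv 3
  obtain ⟨d0, d1, d2, d3, -⟩ := iteratedDeriv_sin_zero
  obtain ⟨-, q3, -⟩ := sqrt_six_pow
  have hm := h.mean
  have h2 := h.integral_sq ha
  set n : ℕ → ℝ := fun i => (∫ x in Ioi 0, logNorm ℓ x ^ i ∂μ) - ∫ x in Iio 0, logNorm ℓ x ^ i ∂μ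
    with hn
  have hn' : ∀ i, (∫ x in Ioi 0, logNorm ℓ x ^ i ∂μ) - ∫ x in Iio 0, logNorm ℓ x ^ i ∂μ = n i :=
    fun i => rfl
  have h0 : ∫ x, logNorm ℓ x ^ 0 ∂μ = 1 := by simp
  have hm1 : ∫ x, logNorm ℓ x ^ 1 ∂μ = 0 := by simpa using hm
  simp only [hn'] at e1 e3 ⊢
  simp only [Finset.sum_range_succ, Finset.sum_range_zero, d0, d1, d2, d3, Nat.choose,
    Nat.sub_self, Nat.sub_zero, hm1, h0, h2, mul_pow, div_pow, q3,
    Nat.reduceSub, Nat.reduceAdd] at e1 e3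
  have hne : Real.sqrt 6 ≠ 0 := by positivity
  norm_num at e1 e3
  have r0 : n 0 = θ := by
    refine mul_left_cancel₀ hne ?_
    linear_combination e1
  rw [r0] at e3
  refine ⟨r0, mul_left_cancel₀ hne ?_⟩
  linear_combination 1 / 3 * e3

end Moments

/-! ### Functions with finite moments and their L² norms -/

section Tame

variable {α β : Type*} [MeasurableSpace α] [MeasurableSpace β]

/-- A function all of whose moments are finite. -/
@[fun_prop]
def Tame (f : α → ℝ) (μ : Measure α) : Prop := ∀ p : ℝ≥0∞, p ≠ ∞ → MemLp f p μ

variable {μ : Measure α} {f g : α → ℝ}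

lemma Tame.integrable (hf : Tame f μ) : Integrable f μ :=
  memLp_one_iff_integrable.1 (hf 1 (by simp))

lemma Tame.aestronglyMeasurable (hf : Tame f μ) : AEStronglyMeasurable f μ :=
  hf.integrable.aestronglyMeasurable

@[fun_prop]
lemma Tame.add (hf : Tame f μ) (hg : Tame g μ) : Tame (fun x => f x + g x) μ :=
  fun p hp => (hf p hp).add (hg p hp)

@[fun_prop]
lemma Tame.sub (hf : Tame f μ) (hg : Tame g μ) : Tame (fun x => f x - g x) μ :=
  fun p hp => (hf p hp).sub (hg p hp)

@[fun_prop]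
lemma Tame.neg (hf : Tame f μ) : Tame (fun x => -f x) μ :=
  fun p hp => (hf p hp).neg

@[fun_prop]
lemma Tame.const [IsFiniteMeasure μ] (c : ℝ) : Tame (fun _ : α => c) μ :=
  fun _ _ => memLp_const c

@[fun_prop]
lemma Tame.mul (hf : Tame f μ) (hg : Tame g μ) : Tame (fun x => f x * g x) μ := by
  intro p hp
  have h2 : 2 * p ≠ ∞ := ENNReal.mul_ne_top (by simp) hp
  have : ENNReal.HolderTriple (2 * p) (2 * p) p := by
    refine ⟨?_⟩
    rcases eq_or_ne p 0 with rfl | h0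
    · simp
    rw [ENNReal.mul_inv (by simp) (by simp), ← two_mul, ← mul_assoc,
      ENNReal.mul_inv_cancel (by simp) (by simp), one_mul]
  exact (hg _ h2).mul (hf _ h2)

@[fun_prop]
lemma Tame.pow (hf : Tame f μ) [IsFiniteMeasure μ] (k : ℕ) : Tame (fun x => f x ^ k) μ := by
  induction k with
  | zero => simpa using Tame.const (μ := μ) 1
  | succ k ih => simpa only [pow_succ] using ih.mul hf

@[fun_prop]
lemma Tame.div_const (hf : Tame f μ) [IsFiniteMeasure μ] (c : ℝ) : Tame (fun x => f x / c) μ := by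
  simpa only [div_eq_mul_inv] using hf.mul (Tame.const (μ := μ) c⁻¹)

@[fun_prop]
lemma Tame.abs (hf : Tame f μ) : Tame (fun x => |f x|) μ :=
  fun p hp => (hf p hp).norm

@[fun_prop]
lemma Tame.max (hf : Tame f μ) (hg : Tame g μ) : Tame (fun x => max (f x) (g x)) μ :=
  fun p hp => (hf p hp).sup (hg p hp)

@[fun_prop]
lemma Tame.sum {ι : Type*} (s : Finset ι) {F : ι → α → ℝ} (h : ∀ i, Tame (F i) μ) :
    Tame (fun x => ∑ i ∈ s, F i x) μ :=
  fun p hp => by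
    have := memLp_finsetSum s fun i _ => h i p hp
    exact this

lemma Tame.mono (hg : Tame g μ) (hf : AEStronglyMeasurable f μ) (h : ∀ x, |f x| ≤ |g x|) :
    Tame f μ :=
  fun p hp => (hg p hp).mono hf (ae_of_all _ h)

lemma Tame.of_bound [IsFiniteMeasure μ] (hf : AEStronglyMeasurable f μ) (c : ℝ)
    (h : ∀ x, |f x| ≤ c) : Tame f μ :=
  (Tame.const (μ := μ) c).mono hf fun x => (h x).trans (le_abs_self c)

lemma Tame.comp {ν : Measure β} {φ : β → α} (hf : Tame f μ) (h : MeasurePreserving φ ν μ) :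
    Tame (fun x => f (φ x)) ν :=
  fun p hp => (hf p hp).comp_measurePreserving h

lemma tame_of_integrable_pow [IsFiniteMeasure μ] (hf : AEStronglyMeasurable f μ)
    (h : ∀ k : ℕ, Integrable (fun x => f x ^ k) μ) : Tame f μ := by
  intro p hp
  obtain ⟨k, hk⟩ := ENNReal.exists_nat_gt hp
  have h2k : MemLp f ((2 * (k + 1) : ℕ) : ℝ≥0∞) μ := by
    have h1 := h (2 * (k + 1))
    rw [← integrable_norm_rpow_iff hf (by positivity) (ENNReal.natCast_ne_top _)]
    refine h1.congr (ae_of_all _ fun x => ?_)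
    simp only [ENNReal.toReal_natCast, Real.rpow_natCast, Real.norm_eq_abs]
    rw [pow_mul, pow_mul, sq_abs]
  refine h2k.mono_exponent (hk.le.trans ?_)
  exact_mod_cast (by omega : k ≤ 2 * (k + 1))

/-! ### The `L²` norm -/

/-- The `L²` norm of a real function. -/
def l2 (f : α → ℝ) (μ : Measure α) : ℝ := Real.sqrt (∫ x, f x ^ 2 ∂μ)

lemma l2_nonneg : 0 ≤ l2 f μ := Real.sqrt_nonneg _

lemma l2_sq : l2 f μ ^ 2 = ∫ x, f x ^ 2 ∂μ := Real.sq_sqrt (integral_nonneg fun _ => sq_nonneg _)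

lemma l2_const_mul (c : ℝ) : l2 (fun x => c * f x) μ = |c| * l2 f μ := by
  rw [l2, l2]
  simp_rw [mul_pow]
  rw [integral_const_mul, Real.sqrt_mul (sq_nonneg c), Real.sqrt_sq_eq_abs]

variable [IsFiniteMeasure μ]

lemma integral_mul_le_l2 (hf : Tame f μ) (hg : Tame g μ) : ∫ x, f x * g x ∂μ ≤ l2 f μ * l2 g μ := by
  have h1 : ∀ c : ℝ, 0 ≤ l2 g μ ^ 2 * (c * c) + -(2 * ∫ x, f x * g x ∂μ) * c + l2 f μ ^ 2 := by
    intro c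
    have : l2 g μ ^ 2 * (c * c) + -(2 * ∫ x, f x * g x ∂μ) * c + l2 f μ ^ 2 =
        ∫ x, (f x - c * g x) ^ 2 ∂μ := by
      have e : ∀ x, (f x - c * g x) ^ 2 = f x ^ 2 + (-(2 * c)) * (f x * g x) + c ^ 2 * g x ^ 2 :=
        fun x => by ring
      simp_rw [e]
      rw [integral_add, integral_add, integral_const_mul, integral_const_mul, l2_sq, l2_sq]
      · ring
      all_goals exact Tame.integrable (by fun_prop)
    rw [this]
    exact integral_nonneg fun x => sq_nonneg _
  have h2 := discrim_le_zero h1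
  rw [discrim] at h2
  refine (le_abs_self _).trans (abs_le_of_sq_le_sq ?_ (mul_nonneg l2_nonneg l2_nonneg))
  nlinarith

lemma l2_add_le (hf : Tame f μ) (hg : Tame g μ) : l2 (fun x => f x + g x) μ ≤ l2 f μ + l2 g μ := by
  refine Real.sqrt_le_iff.2 ⟨add_nonneg l2_nonneg l2_nonneg, ?_⟩
  have e : ∀ x, (f x + g x) ^ 2 = f x ^ 2 + 2 * (f x * g x) + g x ^ 2 := fun x => by ring
  simp_rw [e]
  rw [integral_add, integral_add, integral_const_mul]
  · have := integral_mul_le_l2 hf hg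
    have h1 := l2_sq (f := f) (μ := μ)
    have h2 := l2_sq (f := g) (μ := μ)
    nlinarith
  all_goals exact Tame.integrable (by fun_prop)

lemma l2_mono (hf : Tame f μ) (hg : Tame g μ) (h : ∀ x, |f x| ≤ |g x|) : l2 f μ ≤ l2 g μ := by
  refine Real.sqrt_le_sqrt (integral_mono (hf.pow 2).integrable (hg.pow 2).integrable fun x => ?_)
  exact sq_le_sq.2 (h x)

lemma l2_mul_sq_le (hf : Tame f μ) (hg : Tame g μ) :
    l2 (fun x => f x * g x) μ ^ 2 ≤ l2 (fun x => f x ^ 2) μ * l2 (fun x => g x ^ 2) μ := by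
  rw [l2_sq]
  simp_rw [mul_pow]
  exact integral_mul_le_l2 (hf.pow 2) (hg.pow 2)

/-- Minkowski's inequality in L⁴, written for squares and their L² norms. -/
lemma l2_add_sq_le (hf : Tame f μ) (hg : Tame g μ) {p q : ℝ} (hp : 0 ≤ p) (hq : 0 ≤ q)
    (hfp : l2 (fun x => f x ^ 2) μ ≤ p ^ 2) (hgq : l2 (fun x => g x ^ 2) μ ≤ q ^ 2) :
    l2 (fun x => (f x + g x) ^ 2) μ ≤ (p + q) ^ 2 := by
  have e : ∀ x, (f x + g x) ^ 2 = (f x ^ 2 + 2 * (f x * g x)) + g x ^ 2 := fun x => by ring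
  simp_rw [e]
  have h1 : l2 (fun x => f x * g x) μ ≤ p * q := by
    refine (le_abs_self _).trans (abs_le_of_sq_le_sq ?_ (mul_nonneg hp hq))
    calc _ ≤ _ := l2_mul_sq_le hf hg
      _ ≤ p ^ 2 * q ^ 2 := mul_le_mul hfp hgq l2_nonneg (sq_nonneg _)
      _ = _ := by ring
  have h2 := l2_add_le (f := fun x => f x ^ 2 + 2 * (f x * g x)) (g := fun x => g x ^ 2) (μ := μ)
    (by fun_prop) (by fun_prop)
  have h3 := l2_add_le (f := fun x => f x ^ 2) (g := fun x => 2 * (f x * g x)) (μ := μ)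
    (by fun_prop) (by fun_prop)
  rw [l2_const_mul, abs_of_pos two_pos] at h3
  nlinarith

end Tame

/-! ### Product measures -/

section Resample

variable {α : Type*} [MeasurableSpace α] {n : ℕ} (ρ : Measure α) [IsProbabilityMeasure ρ]

lemma measurePreserving_update (i : Fin n) :
    MeasurePreserving (fun q : (Fin n → α) × α => Function.update q.1 i q.2)
      ((Measure.pi fun _ : Fin n => ρ).prod ρ) (Measure.pi fun _ : Fin n => ρ) := by
  have hm : Measurable fun q : (Fin n → α) × α => Function.update q.1 i q.2 := by
    rw [measurable_pi_iff]
    intro j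
    by_cases h : j = i
    · subst h; simpa using measurable_snd
    · simp only [Function.update_of_ne h]; fun_prop
  refine ⟨hm, ?_⟩
  symm
  refine Measure.pi_eq fun s hs => ?_
  rw [Measure.map_apply hm (MeasurableSet.univ_pi hs)]
  have : (fun q : (Fin n → α) × α => Function.update q.1 i q.2) ⁻¹' (univ.pi s) =
      (univ.pi (Function.update s i univ)) ×ˢ (s i) := by
    ext q
    simp only [mem_preimage, mem_univ_pi, mem_prod]
    constructor
    · intro h
      refine ⟨fun j => ?_, by simpa using h i⟩
      by_cases hj : j = i
      · subst hj; simp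
      · simpa [Function.update_of_ne hj] using h j
    · rintro ⟨h1, h2⟩ j
      by_cases hj : j = i
      · subst hj; simpa using h2
      · simpa [Function.update_of_ne hj] using h1 j
  rw [this, Measure.prod_prod, Measure.pi_pi]
  rw [← Finset.mul_prod_erase _ _ (Finset.mem_univ i),
    ← Finset.mul_prod_erase (Finset.univ) (fun j => ρ (s j)) (Finset.mem_univ i)]
  simp only [Function.update_self, measure_univ, one_mul]
  rw [mul_comm]
  congr 1
  refine Finset.prod_congr rfl fun j hj => ?_
  rw [Function.update_of_ne (Finset.ne_of_mem_erase hj)]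

/-- Resampling one coordinate does not change the integral. -/
lemma integral_resample (i : Fin n) {F : (Fin n → α) → ℝ}
    (hF : Integrable F (Measure.pi fun _ => ρ)) :
    ∫ x, F x ∂(Measure.pi fun _ => ρ) =
      ∫ x, (∫ y, F (Function.update x i y) ∂ρ) ∂(Measure.pi fun _ => ρ) := by
  have h := measurePreserving_update (n := n) ρ i
  have h1 : ∫ q, F (Function.update q.1 i q.2) ∂((Measure.pi fun _ : Fin n => ρ).prod ρ) =
      ∫ x, F x ∂(Measure.pi fun _ => ρ) := by
    have hF' : AEStronglyMeasurable F (((Measure.pi fun _ : Fin n => ρ).prod ρ).map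
        (fun q : (Fin n → α) × α => Function.update q.1 i q.2)) := by
      rw [h.map_eq]; exact hF.aestronglyMeasurable
    rw [← integral_map h.measurable.aemeasurable hF', h.map_eq]
  rw [← h1]
  exact integral_prod _ (h.integrable_comp_of_integrable hF)

lemma Tame.eval {g : α → ℝ} (hg : Tame g ρ) (i : Fin n) :
    Tame (fun x : Fin n → α => g (x i)) (Measure.pi fun _ => ρ) :=
  hg.comp (measurePreserving_eval (fun _ : Fin n => ρ) i)

lemma integral_eval (g : α → ℝ) (hg : AEStronglyMeasurable g ρ) (i : Fin n) :
    ∫ x : Fin n → α, g (x i) ∂(Measure.pi fun _ => ρ) = ∫ y, g y ∂ρ := by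
  have h := measurePreserving_eval (fun _ : Fin n => ρ) i
  conv_rhs => rw [← h.map_eq]
  rw [integral_map h.measurable.aemeasurable (by rwa [h.map_eq])]

end Resample

/-! ### The joint law of the sign and the normalized log-modulus -/

/-- The sign of an observation as a real number. -/
def sg (b : Bool) : ℝ := if b then 1 else -1

lemma sg_sq (b : Bool) : sg b ^ 2 = 1 := by cases b <;> simp [sg]

lemma abs_sg (b : Bool) : |sg b| = 1 := by cases b <;> simp [sg]

@[fun_prop]
lemma measurable_sg : Measurable sg := measurable_of_countable _

/-- The properties of the joint law of the sign and the normalized log-modulus. -/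
structure PairLaw (ρ : Measure (Bool × ℝ)) (a θ : ℝ) : Prop where
  tame : Tame (fun p => p.2) ρ
  eU : ∫ p, sg p.1 ∂ρ = θ
  eV : ∫ p, p.2 ∂ρ = 0
  eV2 : ∫ p, p.2 ^ 2 ∂ρ = dHat a θ
  eV4 : ∫ p, p.2 ^ 4 ∂ρ = aHat a θ
  eV6 : ∫ p, p.2 ^ 6 ∂ρ ≤ cSix a θ
  eUV2 : ∫ p, sg p.1 * p.2 ^ 2 ∂ρ = θ * (dHat a θ - (1 - θ ^ 2))

/-- The sign and the normalized log-modulus of a number. -/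
def pairOf (ℓ x : ℝ) : Bool × ℝ := (decide (0 < x), logNorm ℓ x)

lemma measurable_pairOf (ℓ : ℝ) : Measurable (pairOf ℓ) := by
  refine Measurable.prodMk ?_ ?_
  · refine measurable_to_bool ?_
    have : (fun x : ℝ => decide (0 < x)) ⁻¹' {true} = Ioi 0 := by ext x; simp
    rw [this]
    exact measurableSet_Ioi
  · exact ((Real.measurable_log.comp measurable_id.abs).sub_const _).const_mul _

lemma LogLaw.pairLaw {μ : Measure ℝ} [IsProbabilityMeasure μ] {a θ ℓ : ℝ} (h : LogLaw μ a θ ℓ)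
    (ha : 0 < a) : PairLaw (μ.map (pairOf ℓ)) a θ := by
  have hm := measurable_pairOf ℓ
  have hv : ∀ k : ℕ, ∫ p, p.2 ^ k ∂(μ.map (pairOf ℓ)) = ∫ x, logNorm ℓ x ^ k ∂μ := fun k => by
    rw [integral_map hm.aemeasurable (by fun_prop)]
    rfl
  -- The Boolean sign assigns the point 0 to the negative side, which is harmless because 0 carries
  -- no mass.
  have hI : ∀ k : ℕ, ∫ x in Iio 0, logNorm ℓ x ^ k ∂μ = ∫ x in Iic 0, logNorm ℓ x ^ k ∂μ :=
    fun k => setIntegral_congr_set (Iio_ae_eq_Iic' h.zero)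
  have hsv : ∀ k : ℕ, ∫ p, sg p.1 * p.2 ^ k ∂(μ.map (pairOf ℓ)) =
      (∫ x in Ioi 0, logNorm ℓ x ^ k ∂μ) - ∫ x in Iio 0, logNorm ℓ x ^ k ∂μ := fun k => by
    rw [integral_map hm.aemeasurable
      (Measurable.aestronglyMeasurable (by fun_prop)), hI,
      ← integral_indicator measurableSet_Ioi, ← integral_indicator measurableSet_Iic,
      ← integral_sub ((h.integrable_pow k).indicator measurableSet_Ioi)
        ((h.integrable_pow k).indicator measurableSet_Iic)]
    congr 1
    ext x
    rcases lt_or_ge 0 x with hx | hx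
    · simp [pairOf, sg, hx, not_le.2 hx]
    · simp [pairOf, sg, hx, not_lt.2 hx]
  obtain ⟨c0, c2⟩ := h.cross_moments ha
  have e0 := hsv 0
  refine ⟨?_, ?_, ?_, ?_, ?_, ?_, ?_⟩
  · have : IsProbabilityMeasure (μ.map (pairOf ℓ)) := Measure.isProbabilityMeasure_map hm.aemeasurable
    refine tame_of_integrable_pow (by fun_prop) fun k => ?_
    rw [integrable_map_measure (by fun_prop) hm.aemeasurable]
    exact h.integrable_pow k
  · rw [← c0, ← e0]; simp
  · have := hv 1
    simp only [pow_one] at this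
    rw [this, h.mean]
  · rw [hv, h.integral_sq ha]
  · rw [hv, h.integral_pow_four ha]
  · rw [hv]; exact h.integral_pow_six_le ha
  · rw [hsv, c2]

section Facts

variable {ρ : Measure (Bool × ℝ)} [IsProbabilityMeasure ρ] {a θ : ℝ}

/-- Exchange of the signs. -/
def flip (p : Bool × ℝ) : Bool × ℝ := (!p.1, p.2)

lemma measurable_flip : Measurable flip :=
  ((measurable_of_countable (fun b : Bool => !b)).comp measurable_fst).prodMk measurable_snd

lemma sg_not (b : Bool) : sg (!b) = -sg b := by cases b <;> simp [sg]

lemma tame_sg : Tame (fun p : Bool × ℝ => sg p.1) ρ :=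
  Tame.of_bound (measurable_sg.comp measurable_fst).aestronglyMeasurable 1
    fun p => (abs_sg p.1).le

/-- Only even powers of θ enter the moments of the modulus, so passing to -X allows θ ≥ 0 to be
assumed. -/
lemma PairLaw.flip (h : PairLaw ρ a θ) : PairLaw (ρ.map flip) a (-θ) := by
  have hm := measurable_flip
  have hV : ∀ k : ℕ, ∫ p, p.2 ^ k ∂(ρ.map StableEstimation.flip) = ∫ p, p.2 ^ k ∂ρ := fun k => by
    rw [integral_map hm.aemeasurable (by fun_prop)]
    rfl
  have hU : ∀ k : ℕ, ∫ p, sg p.1 * p.2 ^ k ∂(ρ.map StableEstimation.flip) =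
      -∫ p, sg p.1 * p.2 ^ k ∂ρ := fun k => by
    rw [integral_map hm.aemeasurable
      (Measurable.aestronglyMeasurable (by fun_prop)),
      ← integral_neg]
    simp [StableEstimation.flip, sg_not]
  have e1 := hV 1
  have e0 := hU 0
  simp only [pow_one] at e1
  simp only [pow_zero, mul_one] at e0
  have hd : dHat a (-θ) = dHat a θ := by simp [dHat]
  have hh : hHat a (-θ) = hHat a θ := by simp [hHat, Even.neg_pow (by decide : Even 4)]
  have hA : aHat a (-θ) = aHat a θ := by simp [aHat, hd, hh]
  have hC : cSix a (-θ) = cSix a θ := by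
    simp [cSix, kHat, hd, hh, Even.neg_pow (by decide : Even 6)]
  refine ⟨?_, ?_, ?_, ?_, ?_, ?_, ?_⟩
  · have : IsProbabilityMeasure (ρ.map StableEstimation.flip) :=
      Measure.isProbabilityMeasure_map hm.aemeasurable
    refine tame_of_integrable_pow (by fun_prop) fun k => ?_
    rw [integrable_map_measure (by fun_prop) hm.aemeasurable]
    exact (h.tame.pow k).integrable
  · rw [e0, h.eU]
  · rw [e1, h.eV]
  · rw [hV, h.eV2, hd]
  · rw [hV, h.eV4, hA]
  · rw [hV, hC]; exact h.eV6
  · rw [hU, h.eUV2, hd]; ring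

/-- The centred sign. -/
def uu (θ : ℝ) (p : Bool × ℝ) : ℝ := sg p.1 - θ

/-- The linear part of the deviation of the estimator of `ν`. -/
def yy (a θ : ℝ) (p : Bool × ℝ) : ℝ := p.2 ^ 2 - dHat a θ + 3 * θ * uu θ p

/-- The variance of `yy`. -/
def sSq (a θ : ℝ) : ℝ := hHat a θ + 2 * dHat a θ ^ 2 + 3 * θ ^ 2 * (1 - θ ^ 2)

lemma uu_sq (p : Bool × ℝ) : uu θ p ^ 2 = 1 - θ ^ 2 - 2 * θ * uu θ p := by
  have := sg_sq p.1
  rw [uu]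
  linear_combination this

variable (ρ θ) in
@[fun_prop]
lemma tame_uu : Tame (uu θ) ρ := tame_sg.sub (Tame.const θ)

lemma PairLaw.tame_yy (h : PairLaw ρ a θ) : Tame (yy a θ) ρ := by
  have := h.tame
  unfold yy
  fun_prop

lemma PairLaw.int_uu (h : PairLaw ρ a θ) : ∫ p, uu θ p ∂ρ = 0 := by
  simp only [uu]
  rw [integral_sub tame_sg.integrable (integrable_const _), h.eU]
  simp

lemma PairLaw.int_uu_sq (h : PairLaw ρ a θ) : ∫ p, uu θ p ^ 2 ∂ρ = 1 - θ ^ 2 := by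
  simp_rw [uu_sq]
  rw [integral_sub (integrable_const _) ((tame_uu ρ θ).integrable.const_mul _), integral_const_mul,
    h.int_uu]
  simp

lemma PairLaw.int_uu_four (h : PairLaw ρ a θ) :
    ∫ p, uu θ p ^ 4 ∂ρ = (1 - θ ^ 2) * (1 + 3 * θ ^ 2) := by
  have e : ∀ p : Bool × ℝ, uu θ p ^ 4 = (1 - θ ^ 2) ^ 2 + (-(4 * θ * (1 - θ ^ 2))) * uu θ p +
      4 * θ ^ 2 * uu θ p ^ 2 := fun p => by
    rw [show uu θ p ^ 4 = (uu θ p ^ 2) ^ 2 by ring, uu_sq p]; linear_combination 4 * θ ^ 2 * uu_sq p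
  simp_rw [e]
  rw [integral_add, integral_add, integral_const_mul, integral_const_mul, h.int_uu, h.int_uu_sq]
  · simp; ring
  all_goals exact Tame.integrable (by fun_prop)

lemma PairLaw.int_vsq_uu (h : PairLaw ρ a θ) : ∫ p, p.2 ^ 2 * uu θ p ∂ρ = -(θ * (1 - θ ^ 2)) := by
  have ht := h.tame
  have hs := tame_sg (ρ := ρ)
  have e : ∀ p : Bool × ℝ, p.2 ^ 2 * uu θ p = sg p.1 * p.2 ^ 2 - θ * p.2 ^ 2 := fun p => by
    rw [uu]; ring
  simp_rw [e]
  rw [integral_sub, integral_const_mul, h.eUV2, h.eV2]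
  · ring
  all_goals exact Tame.integrable (by fun_prop)

lemma PairLaw.int_yy (h : PairLaw ρ a θ) : ∫ p, yy a θ p ∂ρ = 0 := by
  have ht := h.tame
  simp only [yy]
  rw [integral_add, integral_sub, integral_const_mul, h.int_uu, h.eV2]
  · simp
  all_goals exact Tame.integrable (by fun_prop)

lemma PairLaw.int_yy_uu (h : PairLaw ρ a θ) : ∫ p, yy a θ p * uu θ p ∂ρ = 2 * θ * (1 - θ ^ 2) := by
  have ht := h.tame
  have e : ∀ p : Bool × ℝ, yy a θ p * uu θ p = p.2 ^ 2 * uu θ p - dHat a θ * uu θ p +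
      3 * θ * uu θ p ^ 2 := fun p => by
    rw [yy]; ring
  simp_rw [e]
  rw [integral_add, integral_sub, integral_const_mul, integral_const_mul, h.int_uu, h.int_uu_sq,
    h.int_vsq_uu]
  · ring
  all_goals exact Tame.integrable (by fun_prop)

lemma PairLaw.int_yy_sq (h : PairLaw ρ a θ) : ∫ p, yy a θ p ^ 2 ∂ρ = sSq a θ := by
  have ht := h.tame
  have e : ∀ p : Bool × ℝ, yy a θ p ^ 2 = p.2 ^ 4 + (-(2 * dHat a θ)) * p.2 ^ 2 + dHat a θ ^ 2 +
      6 * θ * (p.2 ^ 2 * uu θ p) + (-(6 * θ * dHat a θ)) * uu θ p + 9 * θ ^ 2 * uu θ p ^ 2 :=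
    fun p => by rw [yy]; ring
  simp_rw [e]
  rw [integral_add, integral_add, integral_add, integral_add, integral_add, integral_const_mul,
    integral_const_mul, integral_const_mul, integral_const_mul, h.int_uu, h.int_uu_sq,
    h.int_vsq_uu, h.eV2, h.eV4]
  · simp [sSq, aHat]; ring
  all_goals exact Tame.integrable (by fun_prop)

end Facts

/-! ### Sums over the sample -/

section Sums

variable {α : Type*} {n : ℕ}

/-- The sum of `f` over the sample. -/
def Sm (f : α → ℝ) (x : Fin n → α) : ℝ := ∑ i, f (x i)

lemma Sm_update (f : α → ℝ) (x : Fin n → α) (i : Fin n) (y : α) :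
    Sm f (Function.update x i y) = Sm f x - f (x i) + f y := by
  rw [Sm, Sm, ← Finset.add_sum_erase _ _ (Finset.mem_univ i),
    ← Finset.add_sum_erase Finset.univ (fun j => f (x j)) (Finset.mem_univ i)]
  rw [Finset.sum_congr rfl fun j hj => by
    rw [Function.update_of_ne (Finset.ne_of_mem_erase hj)]]
  simp only [Function.update_self]
  ring

variable [MeasurableSpace α] (ρ : Measure α) [IsProbabilityMeasure ρ] {f g : α → ℝ}

lemma Tame.Sm (hf : Tame f ρ) :
    Tame (StableEstimation.Sm (n := n) f) (Measure.pi fun _ => ρ) := by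
  exact Tame.sum _ fun i => hf.eval ρ i

/-- Each observation is resampled inside the term that it contributes, so the inner integral is over
one variable with the rest of the sample frozen. The moments of sums follow from this, as does the
covariance argument for strong asymmetry. -/
lemma integral_Sm_mul (hf : Tame f ρ) {G : (Fin n → α) → ℝ} (hG : Tame G (Measure.pi fun _ => ρ)) :
    ∫ x, Sm f x * G x ∂(Measure.pi fun _ => ρ) =
      ∑ i, ∫ x, (∫ y, f y * G (Function.update x i y) ∂ρ) ∂(Measure.pi fun _ => ρ) := by
  have hfi : ∀ i : Fin n, Tame (fun x : Fin n → α => f (x i)) (Measure.pi fun _ => ρ) :=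
    fun i => hf.eval ρ i
  simp only [Sm, Finset.sum_mul]
  rw [integral_finsetSum _ fun i _ => ((hfi i).mul hG).integrable]
  refine Finset.sum_congr rfl fun i _ => ?_
  rw [integral_resample ρ i ((hfi i).mul hG).integrable]
  simp

lemma integral_Sm (hf : Tame f ρ) :
    ∫ x : Fin n → α, Sm f x ∂(Measure.pi fun _ => ρ) = n * ∫ y, f y ∂ρ := by
  simp only [Sm]
  rw [integral_finsetSum _ fun i _ => (hf.eval ρ i).integrable]
  simp [integral_eval ρ f hf.aestronglyMeasurable]

lemma integral_Sm_mul_Sm (hf : Tame f ρ) (hg : Tame g ρ) (h0 : ∫ y, f y ∂ρ = 0) :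
    ∫ x : Fin n → α, Sm f x * Sm g x ∂(Measure.pi fun _ => ρ) = n * ∫ y, f y * g y ∂ρ := by
  rw [integral_Sm_mul ρ hf (hg.Sm ρ)]
  have : ∀ (i : Fin n) (x : Fin n → α), ∫ y, f y * Sm g (Function.update x i y) ∂ρ =
      ∫ y, f y * g y ∂ρ := fun i x => by
    have e : ∀ y, f y * Sm g (Function.update x i y) =
        (Sm g x - g (x i)) * f y + f y * g y := fun y => by rw [Sm_update]; ring
    simp_rw [e]
    rw [integral_add (hf.integrable.const_mul _) (hf.mul hg).integrable, integral_const_mul, h0]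
    ring
  simp [this]

lemma integral_Sm_sq (hf : Tame f ρ) (h0 : ∫ y, f y ∂ρ = 0) :
    ∫ x : Fin n → α, Sm f x ^ 2 ∂(Measure.pi fun _ => ρ) = n * ∫ y, f y ^ 2 ∂ρ := by
  simp_rw [sq]
  exact integral_Sm_mul_Sm ρ hf hf h0

lemma integral_Sm_four (hf : Tame f ρ) (h0 : ∫ y, f y ∂ρ = 0) :
    ∫ x : Fin n → α, Sm f x ^ 4 ∂(Measure.pi fun _ => ρ) =
      3 * n * (n - 1) * (∫ y, f y ^ 2 ∂ρ) ^ 2 + n * ∫ y, f y ^ 4 ∂ρ := by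
  set π : Measure (Fin n → α) := Measure.pi fun _ => ρ with hπ
  have hS : Tame (Sm (n := n) f) π := hf.Sm ρ
  have hfi : ∀ i : Fin n, Tame (fun x : Fin n → α => f (x i)) π := fun i => hf.eval ρ i
  have e4 : ∀ x : Fin n → α, Sm f x ^ 4 = Sm f x * Sm f x ^ 3 := fun x => by ring
  simp_rw [e4]
  rw [integral_Sm_mul ρ hf (hS.pow 3)]
  have hin : ∀ (i : Fin n) (x : Fin n → α), ∫ y, f y * Sm f (Function.update x i y) ^ 3 ∂ρ =
      3 * (∫ y, f y ^ 2 ∂ρ) * (Sm f x - f (x i)) ^ 2 + 3 * (∫ y, f y ^ 3 ∂ρ) * (Sm f x - f (x i)) +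
        ∫ y, f y ^ 4 ∂ρ := fun i x => by
    have e : ∀ y, f y * Sm f (Function.update x i y) ^ 3 =
        (Sm f x - f (x i)) ^ 3 * f y + 3 * (Sm f x - f (x i)) ^ 2 * f y ^ 2 +
          3 * (Sm f x - f (x i)) * f y ^ 3 + f y ^ 4 := fun y => by rw [Sm_update]; ring
    simp_rw [e]
    rw [integral_add, integral_add, integral_add, integral_const_mul, integral_const_mul,
      integral_const_mul, h0]
    · ring
    all_goals exact Tame.integrable (by fun_prop)
  have hc1 : ∀ i : Fin n, ∫ x : Fin n → α, (Sm f x - f (x i)) ∂π = 0 := fun i => by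
    rw [integral_sub hS.integrable (hfi i).integrable, integral_Sm ρ hf,
      integral_eval ρ f hf.aestronglyMeasurable, h0]
    simp
  have hc2 : ∀ i : Fin n, ∫ x : Fin n → α, (Sm f x - f (x i)) ^ 2 ∂π =
      (n - 1) * ∫ y, f y ^ 2 ∂ρ := fun i => by
    have hcr : ∫ x : Fin n → α, f (x i) * Sm f x ∂π = ∫ y, f y ^ 2 ∂ρ := by
      rw [integral_resample ρ i ((hfi i).mul hS).integrable]
      have e : ∀ (x : Fin n → α) y, f (Function.update x i y i) * Sm f (Function.update x i y) =
          (Sm f x - f (x i)) * f y + f y ^ 2 := fun x y => by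
        rw [Sm_update, Function.update_self]; ring
      simp_rw [e]
      have : ∀ x : Fin n → α, ∫ y, ((Sm f x - f (x i)) * f y + f y ^ 2) ∂ρ = ∫ y, f y ^ 2 ∂ρ :=
        fun x => by
          rw [integral_add (hf.integrable.const_mul _) (hf.pow 2).integrable, integral_const_mul, h0]
          ring
      simp [this]
    have e : ∀ x : Fin n → α, (Sm f x - f (x i)) ^ 2 =
        Sm f x ^ 2 + (-2) * (f (x i) * Sm f x) + f (x i) ^ 2 := fun x => by ring
    simp_rw [e]
    have hfi' := hfi i
    rw [integral_add, integral_add, integral_const_mul, hcr, integral_Sm_sq ρ hf h0,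
      integral_eval ρ (fun y => f y ^ 2) (hf.pow 2).aestronglyMeasurable]
    · ring
    · exact (hS.pow 2).integrable
    · exact ((hfi'.mul hS).integrable.const_mul _)
    · exact (hS.pow 2).integrable.add ((hfi'.mul hS).integrable.const_mul _)
    · exact (hfi'.pow 2).integrable
  have hsum : ∀ i : Fin n, ∫ x, (∫ y, f y * Sm f (Function.update x i y) ^ 3 ∂ρ) ∂π =
      3 * (n - 1) * (∫ y, f y ^ 2 ∂ρ) ^ 2 + ∫ y, f y ^ 4 ∂ρ := fun i => by
    simp_rw [hin]
    have hfi' := hfi i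
    rw [integral_add, integral_add, integral_const_mul, integral_const_mul, hc1, hc2]
    · simp; ring
    · exact ((hS.sub hfi').pow 2).integrable.const_mul _
    · exact (hS.sub hfi').integrable.const_mul _
    · exact (((hS.sub hfi').pow 2).integrable.const_mul _).add ((hS.sub hfi').integrable.const_mul _)
    · exact integrable_const _
  rw [Finset.sum_congr rfl fun i _ => hsum i]
  simp
  ring

end Sums

/-! ### Hoeffding decomposition of the estimators -/

section Estimators

variable {n : ℕ}

/-- The kernel of the degenerate quadratic part of the estimator of `ν`. -/
def hh (θ : ℝ) (p q : Bool × ℝ) : ℝ := 3 / 2 * (uu θ p * uu θ q) - p.2 * q.2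

/-- The degenerate quadratic part of the deviation of the estimator of `ν`. -/
def rr (θ : ℝ) (x : Fin n → Bool × ℝ) : ℝ :=
  (∑ q ∈ (Finset.univ : Finset (Fin n)).offDiag, hh θ (x q.1) (x q.2)) / ((n : ℝ) * ((n : ℝ) - 1))

/-- The deviation of the estimator of `θ`. -/
def dl (θ : ℝ) (x : Fin n → Bool × ℝ) : ℝ := Sm (uu θ) x / n

/-- The linear part of the deviation of the estimator of `ν`. -/
def z1 (a θ : ℝ) (x : Fin n → Bool × ℝ) : ℝ := Sm (yy a θ) x / n

variable {ρ : Measure (Bool × ℝ)} [IsProbabilityMeasure ρ] {a θ : ℝ}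

lemma PairLaw.tame_hh (h : PairLaw ρ a θ) (i j : Fin n) :
    Tame (fun x : Fin n → Bool × ℝ => hh θ (x i) (x j)) (Measure.pi fun _ => ρ) := by
  have hu : ∀ i : Fin n, Tame (fun x : Fin n → Bool × ℝ => uu θ (x i)) (Measure.pi fun _ => ρ) :=
    fun i => (tame_uu ρ θ).eval ρ i
  have hv : ∀ i : Fin n, Tame (fun x : Fin n → Bool × ℝ => (x i).2) (Measure.pi fun _ => ρ) :=
    fun i => h.tame.eval ρ i
  exact ((Tame.const (3 / 2)).mul ((hu i).mul (hu j))).sub ((hv i).mul (hv j))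

lemma PairLaw.tame_rr (h : PairLaw ρ a θ) :
    Tame (rr (n := n) θ) (Measure.pi fun _ => ρ) := by
  have := Tame.sum (Finset.univ : Finset (Fin n)).offDiag fun q => h.tame_hh q.1 q.2
  exact this.div_const _

variable (ρ θ) in
lemma tame_dl : Tame (dl (n := n) θ) (Measure.pi fun _ => ρ) :=
  ((tame_uu ρ θ).Sm ρ).div_const _

lemma PairLaw.tame_z1 (h : PairLaw ρ a θ) : Tame (z1 (n := n) a θ) (Measure.pi fun _ => ρ) :=
  (h.tame_yy.Sm ρ).div_const _

lemma PairLaw.int_hh_left (h : PairLaw ρ a θ) (q : Bool × ℝ) : ∫ p, hh θ p q ∂ρ = 0 := by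
  have ht := h.tame
  have e : ∀ p, hh θ p q = 3 / 2 * uu θ q * uu θ p - q.2 * p.2 := fun p => by rw [hh]; ring
  simp_rw [e]
  rw [integral_sub, integral_const_mul, integral_const_mul, h.int_uu, h.eV]
  · simp
  all_goals exact Tame.integrable (by fun_prop)

lemma hh_comm (p q : Bool × ℝ) : hh θ p q = hh θ q p := by simp only [hh]; ring

/-- The kernel is orthogonal to functions which do not depend on one of its arguments. -/
lemma PairLaw.int_hh_mul (h : PairLaw ρ a θ) {i j : Fin n} (hij : i ≠ j)
    {G : (Fin n → Bool × ℝ) → ℝ} (hG : Tame G (Measure.pi fun _ => ρ))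
    (hi : ∀ x y, G (Function.update x i y) = G x) :
    ∫ x, hh θ (x i) (x j) * G x ∂(Measure.pi fun _ => ρ) = 0 := by
  rw [integral_resample ρ i ((h.tame_hh i j).mul hG).integrable]
  have e : ∀ (x : Fin n → Bool × ℝ) y, hh θ (Function.update x i y i) (Function.update x i y j) *
      G (Function.update x i y) = G x * hh θ y (x j) := fun x y => by
    rw [hi, Function.update_self, Function.update_of_ne hij.symm, mul_comm]
  simp_rw [e, integral_const_mul, h.int_hh_left]
  simp

/-- The exact value is smaller by 3(E uv)². The mixed moment E uv is not among the known ones, but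
it enters with a negative sign and can be dropped. -/
lemma PairLaw.int_hh_sq (h : PairLaw ρ a θ) {i j : Fin n} (hij : i ≠ j) :
    ∫ x, hh θ (x i) (x j) ^ 2 ∂(Measure.pi fun _ => ρ) ≤
      9 / 4 * (1 - θ ^ 2) ^ 2 + dHat a θ ^ 2 := by
  have ht := h.tame
  set c := ∫ p, uu θ p * p.2 ∂ρ with hc
  rw [integral_resample ρ i ((h.tame_hh i j).pow 2).integrable]
  have e : ∀ x : Fin n → Bool × ℝ, ∫ y, hh θ (Function.update x i y i) (Function.update x i y j) ^ 2
      ∂ρ = 9 / 4 * (1 - θ ^ 2) * uu θ (x j) ^ 2 + (-(3 * c)) * (uu θ (x j) * (x j).2) +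
        dHat a θ * (x j).2 ^ 2 := fun x => by
    have e2 : ∀ y, hh θ (Function.update x i y i) (Function.update x i y j) ^ 2 =
        9 / 4 * uu θ (x j) ^ 2 * uu θ y ^ 2 + (-(3 * (uu θ (x j) * (x j).2))) * (uu θ y * y.2) +
          (x j).2 ^ 2 * y.2 ^ 2 := fun y => by
      rw [Function.update_self, Function.update_of_ne hij.symm, hh]; ring
    simp_rw [e2]
    rw [integral_add, integral_add, integral_const_mul, integral_const_mul, integral_const_mul,
      h.int_uu_sq, ← hc, h.eV2]
    · ring
    all_goals exact Tame.integrable (by fun_prop)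
  simp_rw [e]
  rw [integral_eval ρ (fun p => 9 / 4 * (1 - θ ^ 2) * uu θ p ^ 2 + (-(3 * c)) * (uu θ p * p.2) +
        dHat a θ * p.2 ^ 2) (Tame.aestronglyMeasurable (by fun_prop))]
  rw [integral_add, integral_add, integral_const_mul, integral_const_mul, integral_const_mul,
      h.int_uu_sq, ← hc, h.eV2]
  · nlinarith [sq_nonneg c]
  all_goals exact Tame.integrable (by fun_prop)

/-- By degeneracy the kernels of two ordered pairs are orthogonal unless the pairs have the same
elements. Each of the n(n-1) pairs thus meets only itself and its transpose. -/
lemma PairLaw.int_rr_sq_le (h : PairLaw ρ a θ) (hn : 2 ≤ n) :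
    ∫ x, rr (n := n) θ x ^ 2 ∂(Measure.pi fun _ => ρ) ≤
      2 * (9 / 4 * (1 - θ ^ 2) ^ 2 + dHat a θ ^ 2) / ((n : ℝ) * ((n : ℝ) - 1)) := by
  set π : Measure (Fin n → Bool × ℝ) := Measure.pi fun _ => ρ with hπ
  set η := 9 / 4 * (1 - θ ^ 2) ^ 2 + dHat a θ ^ 2 with hη
  set O := (Finset.univ : Finset (Fin n)).offDiag with hO
  have hη0 : 0 ≤ η := by positivity
  have hn' : (2 : ℝ) ≤ n := by exact_mod_cast hn
  have hc : (0 : ℝ) < (n : ℝ) * ((n : ℝ) - 1) := by nlinarith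
  have hterm : ∀ p ∈ O, ∀ q ∈ O, ∫ x, hh θ (x p.1) (x p.2) * hh θ (x q.1) (x q.2) ∂π ≤
      if q = p ∨ q = p.swap then η else 0 := by
    intro p hp q hq
    rw [Finset.mem_offDiag] at hp hq
    by_cases h1 : p.1 = q.1 ∨ p.1 = q.2
    · by_cases h2 : p.2 = q.1 ∨ p.2 = q.2
      · have hqp : q = p ∨ q = p.swap := by
          rcases h1 with h1 | h1 <;> rcases h2 with h2 | h2
          · exact absurd (h1.trans h2.symm) hp.2.2
          · left; exact Prod.ext h1.symm h2.symm
          · right; exact Prod.ext h2.symm h1.symm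
          · exact absurd (h1.trans h2.symm) hp.2.2
        rw [if_pos hqp]
        refine le_trans (le_of_eq ?_) (h.int_hh_sq (n := n) hp.2.2)
        congr 1
        ext x
        rcases hqp with rfl | rfl
        · ring
        · rw [Prod.fst_swap, Prod.snd_swap, hh_comm (x p.2)]; ring
      · rw [not_or] at h2
        have e : ∀ x : Fin n → Bool × ℝ, hh θ (x p.1) (x p.2) * hh θ (x q.1) (x q.2) =
            hh θ (x p.2) (x p.1) * hh θ (x q.1) (x q.2) := fun x => by rw [hh_comm]
        simp_rw [e]
        rw [h.int_hh_mul (Ne.symm hp.2.2) (h.tame_hh q.1 q.2) fun x y => by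
          rw [Function.update_of_ne (Ne.symm h2.1), Function.update_of_ne (Ne.symm h2.2)]]
        split_ifs <;> simp [hη0]
    · rw [not_or] at h1
      rw [h.int_hh_mul hp.2.2 (h.tame_hh q.1 q.2) fun x y => by
          rw [Function.update_of_ne (Ne.symm h1.1), Function.update_of_ne (Ne.symm h1.2)]]
      split_ifs <;> simp [hη0]
  have hcard : ((O.card : ℕ) : ℝ) = (n : ℝ) * ((n : ℝ) - 1) := by
    rw [hO, Finset.offDiag_card, Finset.card_univ, Fintype.card_fin, Nat.cast_sub (Nat.le_mul_self n)]
    push_cast; ring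
  have hsum : ∫ x, (∑ q ∈ O, hh θ (x q.1) (x q.2)) ^ 2 ∂π ≤ 2 * η * ((n : ℝ) * ((n : ℝ) - 1)) := by
    simp_rw [sq, Finset.sum_mul_sum]
    rw [integral_finsetSum _ fun p _ => integrable_finsetSum _ fun q _ =>
      ((h.tame_hh p.1 p.2).mul (h.tame_hh q.1 q.2)).integrable]
    rw [← hcard, mul_comm, ← nsmul_eq_mul]
    refine Finset.sum_le_card_nsmul _ _ _ fun p hp => ?_
    rw [integral_finsetSum _ fun q _ => ((h.tame_hh p.1 p.2).mul (h.tame_hh q.1 q.2)).integrable]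
    refine (Finset.sum_le_sum fun q hq => hterm p hp q hq).trans ?_
    rw [← Finset.sum_filter, Finset.sum_const, nsmul_eq_mul]
    refine mul_le_mul_of_nonneg_right ?_ hη0
    have : (O.filter fun q => q = p ∨ q = p.swap) ⊆ {p, p.swap} := by
      intro q hq
      rw [Finset.mem_filter] at hq
      simpa using hq.2
    exact_mod_cast (Finset.card_le_card this).trans Finset.card_le_two
  have e : ∀ x : Fin n → Bool × ℝ, rr θ x ^ 2 =
      (∑ q ∈ O, hh θ (x q.1) (x q.2)) ^ 2 / ((n : ℝ) * ((n : ℝ) - 1)) ^ 2 := fun x => by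
    rw [rr, div_pow]
  simp_rw [e]
  rw [integral_div, div_le_div_iff₀ (by positivity) hc]
  nlinarith

/-- Orthogonality in Hoeffding's decomposition: a term of `z1` depends on one observation, so one
argument of the kernel is free and integrates to 0. -/
lemma PairLaw.int_z1_mul_rr (h : PairLaw ρ a θ) :
    ∫ x, z1 (n := n) a θ x * rr θ x ∂(Measure.pi fun _ => ρ) = 0 := by
  have hy := h.tame_yy
  have hyi : ∀ i : Fin n, Tame (fun x : Fin n → Bool × ℝ => yy a θ (x i)) (Measure.pi fun _ => ρ) :=
    fun i => hy.eval ρ i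
  have e : ∀ x : Fin n → Bool × ℝ, z1 a θ x * rr θ x =
      (∑ k, ∑ q ∈ (Finset.univ : Finset (Fin n)).offDiag, hh θ (x q.1) (x q.2) * yy a θ (x k)) /
        ((n : ℝ) * ((n : ℝ) * ((n : ℝ) - 1))) := fun x => by
    rw [z1, rr, Sm, div_mul_div_comm, Finset.sum_mul_sum]
    simp only [mul_comm (yy a θ _)]
  simp_rw [e]
  rw [integral_div, integral_finsetSum _ fun k _ => integrable_finsetSum _ fun q _ =>
      ((h.tame_hh q.1 q.2).mul (hyi k)).integrable, Finset.sum_eq_zero, zero_div]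
  intro k _
  rw [integral_finsetSum _ fun q _ => ((h.tame_hh q.1 q.2).mul (hyi k)).integrable,
    Finset.sum_eq_zero]
  intro q hq
  rw [Finset.mem_offDiag] at hq
  by_cases hk : q.1 = k
  · have e : ∀ x : Fin n → Bool × ℝ, hh θ (x q.1) (x q.2) * yy a θ (x k) =
            hh θ (x q.2) (x q.1) * yy a θ (x k) := fun x => by rw [hh_comm]
    simp_rw [e]
    refine h.int_hh_mul (Ne.symm hq.2.2) (hyi k) fun x y => ?_
    rw [Function.update_of_ne]
    rw [← hk]
    exact hq.2.2
  · refine h.int_hh_mul hq.2.2 (hyi k) fun x y => ?_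
    rw [Function.update_of_ne (Ne.symm hk)]

lemma PairLaw.int_z1_sq (h : PairLaw ρ a θ) (hn : 2 ≤ n) :
    ∫ x, z1 (n := n) a θ x ^ 2 ∂(Measure.pi fun _ => ρ) = sSq a θ / n := by
  have hn' : (n : ℝ) ≠ 0 := by positivity
  simp_rw [z1, div_pow]
  rw [integral_div, integral_Sm_sq ρ h.tame_yy h.int_yy, h.int_yy_sq]
  field_simp

lemma PairLaw.int_z1_add_rr_sq (h : PairLaw ρ a θ) (hn : 2 ≤ n) :
    ∫ x, (z1 (n := n) a θ x + rr θ x) ^ 2 ∂(Measure.pi fun _ => ρ) =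
      sSq a θ / n + ∫ x, rr (n := n) θ x ^ 2 ∂(Measure.pi fun _ => ρ) := by
  have hz := h.tame_z1 (n := n)
  have hr := h.tame_rr (n := n)
  have e : ∀ x : Fin n → Bool × ℝ, (z1 a θ x + rr θ x) ^ 2 =
      z1 a θ x ^ 2 + 2 * (z1 a θ x * rr θ x) + rr θ x ^ 2 := fun x => by ring
  simp_rw [e]
  rw [integral_add, integral_add, integral_const_mul, h.int_z1_mul_rr, h.int_z1_sq hn]
  · ring
  all_goals exact Tame.integrable (by fun_prop)

lemma PairLaw.int_dl_sq (h : PairLaw ρ a θ) (hn : 2 ≤ n) :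
    ∫ x, dl (n := n) θ x ^ 2 ∂(Measure.pi fun _ => ρ) = (1 - θ ^ 2) / n := by
  have hn' : (n : ℝ) ≠ 0 := by positivity
  simp_rw [dl, div_pow]
  rw [integral_div, integral_Sm_sq ρ (tame_uu ρ θ) h.int_uu, h.int_uu_sq]
  field_simp

lemma PairLaw.int_dl_four (h : PairLaw ρ a θ) (hn : 2 ≤ n) :
    ∫ x, dl (n := n) θ x ^ 4 ∂(Measure.pi fun _ => ρ) =
      (3 * (1 - θ ^ 2) ^ 2 + (1 - θ ^ 2) * (6 * θ ^ 2 - 2) / n) / n ^ 2 := by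
  have hn' : (n : ℝ) ≠ 0 := by positivity
  simp_rw [dl, div_pow]
  rw [integral_div, integral_Sm_four ρ (tame_uu ρ θ) h.int_uu, h.int_uu_sq, h.int_uu_four]
  field_simp
  ring

/-! ### The estimators in terms of the normalized sample -/

lemma sampleVar_eq (hn : 2 ≤ n) (w : Fin n → ℝ) :
    sampleVar w = (∑ i, w i ^ 2) / n -
      ((∑ i, w i) ^ 2 - ∑ i, w i ^ 2) / ((n : ℝ) * ((n : ℝ) - 1)) := by
  have hn' : (2 : ℝ) ≤ n := by exact_mod_cast hn
  have h1 : (n : ℝ) ≠ 0 := by positivity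
  have h2 : (n : ℝ) - 1 ≠ 0 := by linarith
  have e : ∑ j, (w j - sampleMean w) ^ 2 = ∑ j, w j ^ 2 - (∑ j, w j) ^ 2 / n := by
    have : ∀ j, (w j - sampleMean w) ^ 2 = w j ^ 2 - 2 * sampleMean w * w j + sampleMean w ^ 2 :=
      fun j => by ring
    simp_rw [this]
    rw [Finset.sum_add_distrib, Finset.sum_sub_distrib, ← Finset.mul_sum]
    simp [sampleMean]
    field_simp
    ring
  rw [sampleVar, e]
  field_simp
  ring

lemma sampleVar_affine (w : Fin n → ℝ) (hn : 2 ≤ n) (b c : ℝ) :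
    sampleVar (fun i => b * (w i - c)) = b ^ 2 * sampleVar w := by
  have h1 : (n : ℝ) ≠ 0 := by positivity
  have hm : sampleMean (fun i => b * (w i - c)) = b * (sampleMean w - c) := by
    simp only [sampleMean, ← Finset.mul_sum, Finset.sum_sub_distrib]
    simp
    field_simp
  simp only [sampleVar, hm]
  rw [← mul_div_assoc, Finset.mul_sum]
  congr 1
  refine Finset.sum_congr rfl fun i _ => ?_
  ring

lemma rr_eq (x : Fin n → Bool × ℝ) : rr θ x =
    (3 / 2 * ((Sm (uu θ) x) ^ 2 - Sm (fun p => uu θ p ^ 2) x) -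
      ((Sm (fun p => p.2) x) ^ 2 - Sm (fun p => p.2 ^ 2) x)) / ((n : ℝ) * ((n : ℝ) - 1)) := by
  have key : ∀ f : Bool × ℝ → ℝ, ∑ q ∈ (Finset.univ : Finset (Fin n)).offDiag,
      f (x q.1) * f (x q.2) = Sm f x ^ 2 - Sm (fun p => f p ^ 2) x := fun f => by
    have h1 : ∑ q ∈ (Finset.univ : Finset (Fin n)) ×ˢ (Finset.univ : Finset (Fin n)),
        f (x q.1) * f (x q.2) = Sm f x ^ 2 := by
      rw [sq, Sm, Finset.sum_mul_sum, Finset.sum_product]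
    have h2 := Finset.sum_diag (Finset.univ : Finset (Fin n)) fun q => f (x q.1) * f (x q.2)
    rw [← Finset.diag_union_offDiag, Finset.sum_union (Finset.disjoint_diag_offDiag _), h2] at h1
    rw [← h1, Sm]
    simp only [sq]
    ring
  rw [rr, ← key, ← key, Finset.mul_sum, ← Finset.sum_sub_distrib]
  simp only [hh]

/-- The estimators as functions of the signs and normalized log-moduli. -/
lemma estimators_eq (hn : 2 ≤ n) (ℓ : ℝ) (xs : Fin n → ℝ) (hx : ∀ i, xs i ≠ 0) :
    thetaTilde xs = θ + dl θ (fun i => pairOf ℓ (xs i)) ∧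
    nuHat xs = a ^ 2 + (z1 a θ (fun i => pairOf ℓ (xs i)) + rr θ (fun i => pairOf ℓ (xs i))) := by
  have hn' : (2 : ℝ) ≤ n := by exact_mod_cast hn
  have h1 : (n : ℝ) ≠ 0 := by positivity
  have h2 : (n : ℝ) - 1 ≠ 0 := by linarith
  set x : Fin n → Bool × ℝ := fun i => pairOf ℓ (xs i) with hxdef
  have hs : ∀ i, signs xs i = θ + uu θ (x i) := fun i => by
    rw [signs, uu, hxdef]
    rcases lt_or_gt_of_ne (hx i) with h | h
    · simp [pairOf, sg, Real.sign_of_neg h, not_lt.2 h.le]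
    · simp [pairOf, sg, Real.sign_of_pos h, h]
  have hθ : thetaTilde xs = θ + dl θ x := by
    simp only [thetaTilde, sampleMean, hs, dl, Sm, Finset.sum_add_distrib]
    simp
    field_simp
  refine ⟨hθ, ?_⟩
  have hV : 6 / Real.pi ^ 2 * sampleVar (logAbs xs) = sampleVar fun i => (x i).2 := by
    have : (fun i => (x i).2) = fun i => Real.sqrt 6 / Real.pi * (logAbs xs i - ℓ) := rfl
    rw [this, sampleVar_affine _ hn, div_pow, Real.sq_sqrt (by norm_num)]
  have hU : sampleVar (signs xs) = sampleVar fun i => uu θ (x i) := by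
    have : (fun i => uu θ (x i)) = fun i => 1 * (signs xs i - θ) := by
      ext i; rw [hs]; ring
    rw [this, sampleVar_affine _ hn]; ring
  rw [nuHat, hV, hU, sampleVar_eq hn, sampleVar_eq hn, rr_eq, z1]
  -- Since the sign squares to 1, u² is affine in u. This is the source of the summand 3θu in `yy`.
  have hu2 : Sm (fun p => uu θ p ^ 2) x = n * (1 - θ ^ 2) - 2 * θ * Sm (uu θ) x := by
    simp only [Sm, uu_sq, Finset.sum_sub_distrib, ← Finset.mul_sum]
    simp
    ring
  have hy : Sm (yy a θ) x = Sm (fun p => p.2 ^ 2) x - n * dHat a θ + 3 * θ * Sm (uu θ) x := by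
    simp only [Sm, yy, Finset.sum_add_distrib, Finset.sum_sub_distrib, ← Finset.mul_sum]
    simp
  have e1 : ∑ i, uu θ (x i) ^ 2 = Sm (fun p => uu θ p ^ 2) x := rfl
  have e2 : ∑ i, (x i).2 ^ 2 = Sm (fun p => p.2 ^ 2) x := rfl
  have e3 : ∑ i, uu θ (x i) = Sm (uu θ) x := rfl
  have e4 : ∑ i, (x i).2 = Sm (fun p => p.2) x := rfl
  rw [e1, e2, e3, e4, hy, hu2, dHat]
  field_simp
  ring

end Estimators

/-! ### Deterministic bounds for the deviation of the estimator of `α` -/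

/-- The normalized error of `1 / b` as an estimate of `1 / a`. -/
def errAt (a b : ℝ) : ℝ := 2 * a ^ 3 * (1 / b - 1 / a)

lemma abs_errAt_le_of_le {a b : ℝ} (ha : 0 < a) (hab : a ≤ b) : |errAt a b| ≤ b ^ 2 - a ^ 2 := by
  have hb : 0 < b := ha.trans_le hab
  have e : errAt a b = -(2 * a ^ 2 / (b * (a + b)) * (b ^ 2 - a ^ 2)) := by
    rw [errAt]; field_simp; ring
  have h0 : 0 ≤ b ^ 2 - a ^ 2 := by nlinarith
  rw [e, abs_neg, abs_of_nonneg (by positivity)]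
  refine mul_le_of_le_one_left h0 ?_
  rw [div_le_one (by positivity)]
  nlinarith

/-- Second order expansion in b² with exact remainder. The remainder coefficient (2a+b)/(b(a+b)²) is
largest at a = b = 1/2, where it equals 3. -/
lemma errAt_le_of_ge {a b : ℝ} (ha : 1 / 2 ≤ a) (hb : 1 / 2 ≤ b) :
    errAt a b ≤ (a ^ 2 - b ^ 2) + 3 * (a ^ 2 - b ^ 2) ^ 2 := by
  have e : errAt a b = (a ^ 2 - b ^ 2) +
      (2 * a + b) / (b * (a + b) ^ 2) * (a ^ 2 - b ^ 2) ^ 2 := by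
    rw [errAt]; field_simp; ring
  rw [e]
  have : (2 * a + b) / (b * (a + b) ^ 2) ≤ 3 := by
    rw [div_le_iff₀ (by positivity)]
    nlinarith [mul_nonneg (sub_nonneg.2 ha) (sub_nonneg.2 hb), sq_nonneg (a - 1 / 2),
      mul_nonneg (mul_nonneg (sub_nonneg.2 ha) (sub_nonneg.2 ha)) (sub_nonneg.2 hb),
      mul_nonneg (mul_nonneg (sub_nonneg.2 hb) (sub_nonneg.2 ha)) (sub_nonneg.2 hb),
      mul_nonneg (mul_nonneg (sub_nonneg.2 hb) (sub_nonneg.2 hb)) (sub_nonneg.2 hb),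
      mul_nonneg (sub_nonneg.2 hb) (sub_nonneg.2 hb)]
  nlinarith [sq_nonneg (a ^ 2 - b ^ 2)]

/-- As a function of b² the error has slope -(a/b)³, of modulus at most 8a³ for b ≥ 1/2. -/
lemma errAt_sub_le {a b c : ℝ} (ha : 0 ≤ a) (hb : 1 / 2 ≤ b) (hbc : b ≤ c) :
    errAt a b - errAt a c ≤ 8 * a ^ 3 * (c ^ 2 - b ^ 2) := by
  have hc : 0 < c := by linarith
  have hb0 : 0 < b := by linarith
  have e : errAt a b - errAt a c = 2 * a ^ 3 / (b * c * (b + c)) * (c ^ 2 - b ^ 2) := by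
    rw [errAt, errAt]; field_simp; ring
  rw [e]
  refine mul_le_mul_of_nonneg_right ?_ (by nlinarith)
  rw [div_le_iff₀ (by positivity)]
  have h1 : 1 / 4 ≤ b * c := by nlinarith
  have h2 : 1 / 4 ≤ b * c * (b + c) := by nlinarith
  have h3 : 0 ≤ a ^ 3 := by positivity
  nlinarith

lemma abs_errAt_le_four {a b : ℝ} (ha : 1 / 2 ≤ a) (hb : 1 / 2 ≤ b) :
    |errAt a b| ≤ 8 * a ^ 3 * |b ^ 2 - a ^ 2| := by
  rcases le_total a b with h | h
  · refine (abs_errAt_le_of_le (by linarith) h).trans ?_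
    rw [abs_of_nonneg (by nlinarith)]
    have : 1 ≤ 8 * a ^ 3 := by
      have := pow_le_pow_left₀ (by norm_num) ha 3
      linarith
    exact le_mul_of_one_le_left (by nlinarith) this
  · have h1 := errAt_sub_le (by linarith : 0 ≤ a) hb h
    have e0 : errAt a a = 0 := by simp [errAt]
    have h2 : 0 ≤ errAt a b := by
      rw [errAt]
      have : 1 / a ≤ 1 / b := one_div_le_one_div_of_le (by linarith) h
      have h3 : 0 ≤ a ^ 3 := by positivity
      nlinarith
    rw [abs_of_nonneg h2, abs_sub_comm, abs_of_nonneg (by nlinarith)]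
    linarith

/-- The excess of the error over its linearization. -/
def excess (a z r : ℝ) : ℝ := 3 * (max (-z) 0) ^ 2 + (8 * a ^ 3 - 1) * |r|

lemma one_le_eight_mul {a : ℝ} (ha : 1 / 2 ≤ a) : 1 ≤ 8 * a ^ 3 := by
  have := pow_le_pow_left₀ (by norm_num) ha 3
  linarith

lemma excess_nonneg {a z r : ℝ} (ha : 1 / 2 ≤ a) : 0 ≤ excess a z r := by
  have := one_le_eight_mul ha
  have h2 := mul_nonneg (sub_nonneg.2 this) (abs_nonneg r)
  rw [excess]; positivity

/-- If the estimate falls below the true value, the error exceeds its linearization by at most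
`excess`. -/
lemma abs_errAt_le_of_neg {a b z r : ℝ} (ha : 1 / 2 ≤ a) (hb : 1 / 2 ≤ b) (hba : b ≤ a)
    (hZ : z + r ≤ b ^ 2 - a ^ 2) : |errAt a b| ≤ (a ^ 2 - b ^ 2) + excess a z r := by
  have h2 : 0 ≤ errAt a b := by
    rw [errAt]
    have : 1 / a ≤ 1 / b := one_div_le_one_div_of_le (by linarith) hba
    have h3 : 0 ≤ a ^ 3 := by positivity
    nlinarith
  have hl := one_le_eight_mul ha
  rw [abs_of_nonneg h2]
  set x := a ^ 2 - b ^ 2 with hx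
  have hx0 : 0 ≤ x := by nlinarith
  set w := max (-z) 0 with hw
  have hw0 : 0 ≤ w := le_max_right _ _
  have hzw : -z ≤ w := le_max_left _ _
  have hxw : x ≤ w + |r| := by have := neg_abs_le r; linarith
  rw [excess, ← hw]
  rcases le_total x w with h | h
  · have h1 := errAt_le_of_ge ha hb
    have h4 : x ^ 2 ≤ w ^ 2 := pow_le_pow_left₀ hx0 h 2
    have h5 := mul_nonneg (sub_nonneg.2 hl) (abs_nonneg r)
    rw [← hx] at h1
    linarith
  -- The shortfall exceeds the part w explained by z. The intermediate point c with c² = a² - w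
  -- separates it: up to c the quadratic expansion applies, and the remaining length x - w ≤ |r| is
  -- charged with the maximal slope.
  · have hc2 : 0 ≤ a ^ 2 - w := by nlinarith
    set c := Real.sqrt (a ^ 2 - w) with hc
    have hcs : c ^ 2 = a ^ 2 - w := Real.sq_sqrt hc2
    have hbc : b ≤ c := Real.le_sqrt_of_sq_le (by linarith)
    have h1 := errAt_le_of_ge ha (hb.trans hbc)
    have h3 := errAt_sub_le (by linarith : 0 ≤ a) hb hbc
    have e1 : a ^ 2 - c ^ 2 = w := by linarith
    have e2 : c ^ 2 - b ^ 2 = x - w := by linarith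
    rw [e1] at h1
    rw [e2] at h3
    have h5 : (8 * a ^ 3 - 1) * (x - w) ≤ (8 * a ^ 3 - 1) * |r| :=
      mul_le_mul_of_nonneg_left (by linarith) (by linarith)
    linarith

lemma abs_errAt_le {a b z r : ℝ} (ha : 1 / 2 ≤ a) (hb : 1 / 2 ≤ b)
    (hZ : z + r ≤ b ^ 2 - a ^ 2) : |errAt a b| ≤ |b ^ 2 - a ^ 2| + excess a z r := by
  rcases le_total a b with h | h
  · have := abs_errAt_le_of_le (by linarith) h
    have h2 := le_abs_self (b ^ 2 - a ^ 2)
    have h3 := excess_nonneg (a := a) (z := z) (r := r) ha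
    linarith
  · have := abs_errAt_le_of_neg ha hb h hZ
    have h2 := neg_le_abs (b ^ 2 - a ^ 2)
    linarith

/-- The product of linearization and excess is kept pointwise. This leads to the third moment of the
negative part of z, which is sharper than what the triangle inequality in L² would give. -/
lemma errAt_sq_le {a b z r : ℝ} (ha : 1 / 2 ≤ a) (hb : 1 / 2 ≤ b)
    (hZ : z + r ≤ b ^ 2 - a ^ 2) : errAt a b ^ 2 ≤ (b ^ 2 - a ^ 2) ^ 2 +
      (6 * max (-z) 0 ^ 3 + 6 * (|r| * max (-z) 0 ^ 2) + 2 * (8 * a ^ 3 - 1) * (|z + r| * |r|)) +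
      excess a z r ^ 2 := by
  have hl := one_le_eight_mul ha
  have hw0 : 0 ≤ max (-z) 0 := le_max_right _ _
  have hX : 0 ≤ 6 * max (-z) 0 ^ 3 + 6 * (|r| * max (-z) 0 ^ 2) +
      2 * (8 * a ^ 3 - 1) * (|z + r| * |r|) := by
    have := mul_nonneg (sub_nonneg.2 hl) (mul_nonneg (abs_nonneg (z + r)) (abs_nonneg r))
    have h2 := abs_nonneg r
    have : 0 ≤ 6 * max (-z) 0 ^ 3 + 6 * (|r| * max (-z) 0 ^ 2) := by positivity
    linarith
  rcases le_total a b with h | h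
  · have h1 := abs_errAt_le_of_le (by linarith) h
    have h2 := pow_le_pow_left₀ (abs_nonneg _) h1 2
    rw [sq_abs] at h2
    have := sq_nonneg (excess a z r)
    linarith
  · have h1 := abs_errAt_le_of_neg ha hb h hZ
    have h2 := pow_le_pow_left₀ (abs_nonneg _) h1 2
    rw [sq_abs] at h2
    have hx0 : 0 ≤ a ^ 2 - b ^ 2 := by nlinarith
    have hxZ : a ^ 2 - b ^ 2 ≤ |z + r| := by have := neg_le_abs (z + r); linarith
    have hxw : a ^ 2 - b ^ 2 ≤ max (-z) 0 + |r| := by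
      have := neg_abs_le r
      have := le_max_left (-z) 0
      linarith
    have h3 : 2 * (a ^ 2 - b ^ 2) * excess a z r ≤ 6 * max (-z) 0 ^ 3 +
        6 * (|r| * max (-z) 0 ^ 2) + 2 * (8 * a ^ 3 - 1) * (|z + r| * |r|) := by
      rw [excess]
      have i1 : (a ^ 2 - b ^ 2) * max (-z) 0 ^ 2 ≤ (max (-z) 0 + |r|) * max (-z) 0 ^ 2 :=
        mul_le_mul_of_nonneg_right hxw (sq_nonneg _)
      have i2 : (a ^ 2 - b ^ 2) * ((8 * a ^ 3 - 1) * |r|) ≤ |z + r| * ((8 * a ^ 3 - 1) * |r|) :=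
        mul_le_mul_of_nonneg_right hxZ (mul_nonneg (by linarith) (abs_nonneg r))
      nlinarith
    nlinarith

/-! ### A lower bound for the bound of the quadratic deviation -/

/-- The second moment of the quadratic part plus that of the linear part of the signs. -/
def bSig (θ : ℝ) : ℝ := 9 * (θ ^ 2 * (1 - θ ^ 2))

/-- A lower bound for the root of the main term of the bound. -/
def sBound (a θ : ℝ) (n : ℕ) : ℝ :=
  (3 : ℝ) ^ (1 / 4 : ℝ) * (Real.sqrt (aHat a θ) + Real.sqrt (bSig θ)) +
    3 / 2 * (|P1 θ n| / n) ^ (1 / 4 : ℝ)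

/-- In normalized units the two radicands of `P3` are the fourth moment of v and the variance of
3θu. -/
lemma P3_eq (a θ : ℝ) : P3 (a ^ 2) θ =
    (3 : ℝ) ^ (1 / 4 : ℝ) * (Real.sqrt (aHat a θ) + Real.sqrt (bSig θ)) := by
  have hπ := Real.pi_pos
  have e1 : Real.sqrt (bSig θ) = 3 * Real.sqrt (θ ^ 2 * (1 - θ ^ 2)) := by
    rw [bSig, Real.sqrt_mul (by norm_num), show (9 : ℝ) = 3 ^ 2 by norm_num,
      Real.sqrt_sq (by norm_num)]
  have e2 : Real.sqrt (aHat a θ) =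
      6 / Real.pi ^ 2 * Real.sqrt (Real.pi ^ 4 * Q4 (a ^ 2) θ + 3 * DV (a ^ 2) θ ^ 2) := by
    have h6 : 6 / Real.pi ^ 2 = Real.sqrt ((6 / Real.pi ^ 2) ^ 2) :=
      (Real.sqrt_sq (by positivity)).symm
    rw [h6, ← Real.sqrt_mul (by positivity)]
    congr 1
    rw [aHat, hHat, dHat, Q4, DV]
    field_simp
    ring
  rw [P3, e1, e2]
  ring

lemma sBound_nonneg (a θ : ℝ) (n : ℕ) : 0 ≤ sBound a θ n := by
  rw [sBound]; positivity

/-- `P3'` is made so that P₃⁴ + P₃' n^(-1/4) = F⁴, where F is P₃ plus the two fourth roots. With F²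
≤ P₃² + √(F⁴ - P₃⁴) the bound dominates the square of √m/(2a³) + 12F²/n. Dropping the term with P₂
from F leaves `sBound`. -/
lemma le_mseBound {a θ m : ℝ} {n : ℕ} (ha : 0 < a) (hn : 2 ≤ n) (hm : 0 ≤ m) :
    (1 / (2 * a ^ 3)) ^ 2 * (Real.sqrt m + 24 * a ^ 3 * (sBound a θ n ^ 2 / n)) ^ 2 ≤
      mseBound (a ^ 2) θ n m := by
  have hn' : (0 : ℝ) < n := by positivity
  set p := P3 (a ^ 2) θ with hp
  set F := P3 (a ^ 2) θ + 3 / 2 * (|P1 θ n| / (n : ℝ)) ^ (1 / 4 : ℝ)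
        + 6 / Real.pi ^ 2 * (|P2 (a ^ 2) θ n| / (n : ℝ)) ^ (1 / 4 : ℝ) with hF
  have hp0 : 0 ≤ p := by rw [hp, P3_eq]; positivity
  have hs : sBound a θ n ≤ F := by
    rw [hF, sBound, P3_eq]
    have : 0 ≤ 6 / Real.pi ^ 2 * (|P2 (a ^ 2) θ n| / (n : ℝ)) ^ (1 / 4 : ℝ) := by positivity
    linarith
  have hpF : p ≤ F := by
    have h1 : 0 ≤ 6 / Real.pi ^ 2 * (|P2 (a ^ 2) θ n| / (n : ℝ)) ^ (1 / 4 : ℝ) := by positivity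
    have h2 : 0 ≤ 3 / 2 * (|P1 θ n| / (n : ℝ)) ^ (1 / 4 : ℝ) := by positivity
    linarith
  have hF0 : 0 ≤ F := hp0.trans hpF
  have hN : (0 : ℝ) < (n : ℝ) ^ (1 / 4 : ℝ) := Real.rpow_pos_of_pos hn' _
  have hN8 : (0 : ℝ) < (n : ℝ) ^ (1 / 8 : ℝ) := Real.rpow_pos_of_pos hn' _
  have hN84 : ((n : ℝ) ^ (1 / 8 : ℝ)) ^ 2 = (n : ℝ) ^ (1 / 4 : ℝ) := by
    rw [← Real.rpow_natCast, ← Real.rpow_mul hn'.le]; norm_num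
  have hP3' : P3' (a ^ 2) θ n = (n : ℝ) ^ (1 / 4 : ℝ) * (F ^ 4 - p ^ 4) := by
    rw [P3', ← hF, ← hp]; ring
  have h4 : p ^ 4 ≤ F ^ 4 := pow_le_pow_left₀ hp0 hpF 4
  have hsq : Real.sqrt (P3' (a ^ 2) θ n) / (n : ℝ) ^ (1 / 8 : ℝ) = Real.sqrt (F ^ 4 - p ^ 4) := by
    rw [hP3', ← hN84, Real.sqrt_mul (sq_nonneg _), Real.sqrt_sq hN8.le]
    field_simp
  have hn94 : (n : ℝ) ^ (9 / 4 : ℝ) = n ^ 2 * (n : ℝ) ^ (1 / 4 : ℝ) := by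
    rw [← Real.rpow_natCast, ← Real.rpow_add hn']; norm_num
  have hquo : P3' (a ^ 2) θ n / (n : ℝ) ^ (9 / 4 : ℝ) = (F ^ 4 - p ^ 4) / n ^ 2 := by
    rw [hP3', hn94]; field_simp
  have hF2 : F ^ 2 ≤ p ^ 2 + Real.sqrt (F ^ 4 - p ^ 4) := by
    have h5 := Real.sqrt_nonneg (F ^ 4 - p ^ 4)
    have h6 := Real.sq_sqrt (sub_nonneg.2 h4)
    refine (sq_le_sq₀ (by positivity) (by positivity)).1 ?_
    nlinarith [mul_nonneg (sq_nonneg p) h5]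
  have hν : (a ^ 2) ^ (3 / 2 : ℝ) = a ^ 3 := by
    rw [← Real.rpow_natCast, ← Real.rpow_mul ha.le, ← Real.rpow_natCast]; norm_num
  have hs2 : sBound a θ n ^ 2 ≤ F ^ 2 := pow_le_pow_left₀ (sBound_nonneg _ _ _) hs 2
  have hs4 : sBound a θ n ^ 4 ≤ F ^ 4 := pow_le_pow_left₀ (sBound_nonneg _ _ _) hs 4
  rw [mseBound, hsq, hquo, hν, ← hp]
  have e1 : (1 / (2 * a ^ 3)) ^ 2 * (Real.sqrt m + 24 * a ^ 3 * (sBound a θ n ^ 2 / n)) ^ 2 =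
      m / (4 * (a ^ 2) ^ 3) + 12 / (n * a ^ 3) * Real.sqrt m * sBound a θ n ^ 2 +
        144 * (sBound a θ n ^ 4 / n ^ 2) := by
    obtain ⟨q, hq, rfl⟩ : ∃ q, 0 ≤ q ∧ m = q ^ 2 := ⟨_, Real.sqrt_nonneg m, (Real.sq_sqrt hm).symm⟩
    rw [Real.sqrt_sq hq]
    field_simp
    ring
  have e2 : p ^ 4 / (n : ℝ) ^ 2 + (F ^ 4 - p ^ 4) / (n : ℝ) ^ 2 = F ^ 4 / n ^ 2 := by
    rw [← add_div]; ring
  rw [e1, e2]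
  have i1 : 12 / (n * a ^ 3) * Real.sqrt m * sBound a θ n ^ 2 ≤
      12 / (n * a ^ 3) * Real.sqrt m * (p ^ 2 + Real.sqrt (F ^ 4 - p ^ 4)) :=
    mul_le_mul_of_nonneg_left (hs2.trans hF2) (by positivity)
  have i2 : sBound a θ n ^ 4 / (n : ℝ) ^ 2 ≤ F ^ 4 / n ^ 2 := by gcongr
  linarith

/-! ### Normal approximation -/

/-- The function `F` is approximated by quadratic polynomials up to a cubic error. -/
def HasCubicTaylor (F : ℝ → ℝ) (K : ℝ) : Prop :=
  ∃ F₁ F₂ : ℝ → ℝ, ∀ s x, |F (s + x) - F s - F₁ s * x - F₂ s * x ^ 2| ≤ K * |x| ^ 3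

section Lindeberg

variable {α : Type*} [MeasurableSpace α] {n : ℕ} (ρ : Measure α) [IsProbabilityMeasure ρ]

omit [IsProbabilityMeasure ρ] in
lemma Tame.comp_of_quadratic {μ : Measure α} [IsProbabilityMeasure μ] {g : α → ℝ} (hg : Tame g μ)
    {F : ℝ → ℝ} {c : ℝ} (hFc : Continuous F) (hFb : ∀ y, |F y| ≤ |(y - c) ^ 2|) :
    Tame (fun x => F (g x)) μ :=
  Tame.mono (g := fun x => (g x - c) ^ 2) (by fun_prop)
    (hFc.comp_aestronglyMeasurable hg.aestronglyMeasurable) fun x => hFb _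

lemma integral_le_const_of_le {f : α → ℝ} {c : ℝ} (hc : 0 ≤ c) (h : ∀ x, f x ≤ c) :
    ∫ x, f x ∂ρ ≤ c := by
  by_cases hi : Integrable f ρ
  · simpa using integral_mono hi (integrable_const c) h
  · rwa [integral_undef hi]

lemma HasCubicTaylor.nonneg {F : ℝ → ℝ} {K : ℝ} (hF : HasCubicTaylor F K) : 0 ≤ K := by
  obtain ⟨F₁, F₂, h⟩ := hF
  simpa using (abs_nonneg _).trans (h 0 1)

/-- One replacement step: linear and quadratic Taylor terms cancel because the first two moments
agree, and the cubic remainders are left. -/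
lemma integral_sub_le_of_moments {f g : α → ℝ} (hf : Tame f ρ) (hg : Tame g ρ)
    (h1 : ∫ p, f p ∂ρ = ∫ p, g p ∂ρ) (h2 : ∫ p, f p ^ 2 ∂ρ = ∫ p, g p ^ 2 ∂ρ) {F : ℝ → ℝ}
    {K c : ℝ} (hF : HasCubicTaylor F K) (hFc : Continuous F) (hFb : ∀ y, |F y| ≤ |(y - c) ^ 2|)
    (S : ℝ) : ∫ p, (F (S + g p) - F (S + f p)) ∂ρ ≤
      K * (∫ p, |f p| ^ 3 ∂ρ + ∫ p, |g p| ^ 3 ∂ρ) := by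
  obtain ⟨F₁, F₂, hF⟩ := hF
  have hb : ∀ y, F (S + g y) - F (S + f y) ≤
      F₁ S * (g y - f y) + F₂ S * (g y ^ 2 - f y ^ 2) + K * (|f y| ^ 3 + |g y| ^ 3) :=
    fun y => by
      have i1 := (abs_le.1 (hF S (g y))).2
      have i2 := (abs_le.1 (hF S (f y))).1
      linarith
  have i1 := Tame.comp_of_quadratic (Tame.add (Tame.const (μ := ρ) S) hg) hFc hFb
  have i2 := Tame.comp_of_quadratic (Tame.add (Tame.const (μ := ρ) S) hf) hFc hFb
  have ea := hf.abs
  have eb := hg.abs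
  refine (integral_mono (i1.sub i2).integrable (Tame.integrable (by fun_prop)) hb).trans
    (le_of_eq ?_)
  rw [integral_add (Tame.integrable (by fun_prop)) (Tame.integrable (by fun_prop)),
    integral_add (Tame.integrable (by fun_prop)) (Tame.integrable (by fun_prop)),
    integral_const_mul, integral_const_mul, integral_const_mul,
    integral_sub (Tame.integrable (by fun_prop)) (Tame.integrable (by fun_prop)),
    integral_sub (Tame.integrable (by fun_prop)) (Tame.integrable (by fun_prop)),
    integral_add (Tame.integrable (by fun_prop)) (Tame.integrable (by fun_prop)), h1, h2]
  ring

omit [IsProbabilityMeasure ρ] in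
lemma tame_fst {γ : Measure ℝ} [IsProbabilityMeasure γ] {f : α → ℝ} (hf : Tame f ρ) :
    Tame (fun q : α × ℝ => f q.1) (ρ.prod γ) := hf.comp measurePreserving_fst

lemma tame_snd {γ : Measure ℝ} [IsProbabilityMeasure γ] {f : ℝ → ℝ} (hf : Tame f γ) :
    Tame (fun q : α × ℝ => f q.2) (ρ.prod γ) := hf.comp measurePreserving_snd

/-- Replacing the summands one at a time by others with the same mean and variance. -/
lemma lindeberg {γ : Measure ℝ} [IsProbabilityMeasure γ] {f : α → ℝ} (hf : Tame f ρ)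
    (hγ : Tame (fun y => y) γ) (h1 : ∫ p, f p ∂ρ = ∫ y, y ∂γ)
    (h2 : ∫ p, f p ^ 2 ∂ρ = ∫ y, y ^ 2 ∂γ) {F : ℝ → ℝ} {K c : ℝ} (hF : HasCubicTaylor F K)
    (hFc : Continuous F) (hFb : ∀ y, |F y| ≤ |(y - c) ^ 2|) :
    ∫ x : Fin n → ℝ, F (∑ i, x i) ∂(Measure.pi fun _ => γ) -
      n * (K * (∫ p, |f p| ^ 3 ∂ρ + ∫ y, |y| ^ 3 ∂γ)) ≤
      ∫ x : Fin n → α, F (Sm f x) ∂(Measure.pi fun _ => ρ) := by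
  have hft := tame_fst ρ (γ := γ) hf
  have hgt := tame_snd ρ hγ
  set ε := K * (∫ p, |f p| ^ 3 ∂ρ + ∫ y, |y| ^ 3 ∂γ) with hε
  set μ : Measure (Fin n → α × ℝ) := Measure.pi fun _ => ρ.prod γ with hμ
  -- The k-th hybrid sum takes its first k summands from f and the others from γ.
  set H : ℕ → (Fin n → α × ℝ) → ℝ := fun k x => ∑ i : Fin n, if i.val < k then f (x i).1 else (x i).2
    with hH
  have hHt : ∀ k, Tame (H k) μ := fun k => Tame.sum _ fun i => by
    split_ifs
    · exact hft.eval (ρ.prod γ) i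
    · exact hgt.eval (ρ.prod γ) i
  have hε0 : 0 ≤ ε := mul_nonneg hF.nonneg (by positivity)
  have hstep : ∀ k, k < n → ∫ x, F (H k x) ∂μ - ε ≤ ∫ x, F (H (k + 1) x) ∂μ := by
    intro k hk
    have hint : Integrable (fun x => F (H k x) - F (H (k + 1) x)) μ :=
      (((hHt k).comp_of_quadratic hFc hFb).sub ((hHt (k + 1)).comp_of_quadratic hFc hFb)).integrable
    rw [sub_le_comm, ← integral_sub ((hHt k).comp_of_quadratic hFc hFb).integrable
      ((hHt (k + 1)).comp_of_quadratic hFc hFb).integrable,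
      hμ, integral_resample (ρ.prod γ) ⟨k, hk⟩ hint, ← hμ]
    have hin : ∀ x : Fin n → α × ℝ, ∫ y, (F (H k (Function.update x ⟨k, hk⟩ y)) -
        F (H (k + 1) (Function.update x ⟨k, hk⟩ y))) ∂(ρ.prod γ) ≤ ε := by
      intro x
      set S := ∑ i ∈ Finset.univ.erase (⟨k, hk⟩ : Fin n),
        if i.val < k then f (x i).1 else (x i).2 with hS
      have e1 : ∀ y, H k (Function.update x ⟨k, hk⟩ y) = S + y.2 := fun y => by
        simp only [hH]
        rw [← Finset.add_sum_erase _ _ (Finset.mem_univ (⟨k, hk⟩ : Fin n)), add_comm]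
        congr 1
        · refine Finset.sum_congr rfl fun j hj => ?_
          rw [Function.update_of_ne (Finset.ne_of_mem_erase hj)]
        · simp
      have e2 : ∀ y, H (k + 1) (Function.update x ⟨k, hk⟩ y) = S + f y.1 := fun y => by
        simp only [hH]
        rw [← Finset.add_sum_erase _ _ (Finset.mem_univ (⟨k, hk⟩ : Fin n)), add_comm]
        congr 1
        · refine Finset.sum_congr rfl fun j hj => ?_
          have hj' := Finset.ne_of_mem_erase hj
          rw [Function.update_of_ne hj']
          have : j.val ≠ k := fun h => hj' (Fin.ext h)
          by_cases hjk : j.val < k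
          · rw [if_pos hjk, if_pos (by omega)]
          · rw [if_neg hjk, if_neg (by omega)]
        · simp
      simp_rw [e1, e2]
      have q1 : ∀ g : α → ℝ, ∫ y : α × ℝ, g y.1 ∂(ρ.prod γ) = ∫ p, g p ∂ρ := fun g => by
        rw [integral_fun_fst]; simp
      have q2 : ∀ g : ℝ → ℝ, ∫ y : α × ℝ, g y.2 ∂(ρ.prod γ) = ∫ p, g p ∂γ := fun g => by
        rw [integral_fun_snd]; simp
      have := integral_sub_le_of_moments (ρ.prod γ) hft hgt (by rw [q1 f, q2 fun y => y, h1])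
        (by rw [q1 fun p => f p ^ 2, q2 fun y => y ^ 2, h2]) hF hFc hFb S
      rwa [q1 fun p => |f p| ^ 3, q2 fun y => |y| ^ 3] at this
    exact integral_le_const_of_le μ hε0 hin
  have hall : ∀ k, k ≤ n → ∫ x, F (H 0 x) ∂μ - k * ε ≤ ∫ x, F (H k x) ∂μ := by
    intro k
    induction k with
    | zero => simp
    | succ k ih =>
      intro hk
      have := ih (by omega)
      have := hstep k (by omega)
      push_cast
      linarith
  have hn := hall n le_rfl
  have m1 : MeasurePreserving (fun (x : Fin n → α × ℝ) i => (x i).1) μ (Measure.pi fun _ => ρ) :=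
    measurePreserving_pi (fun _ : Fin n => ρ.prod γ) (fun _ => ρ) fun _ => measurePreserving_fst
  have m2 : MeasurePreserving (fun (x : Fin n → α × ℝ) i => (x i).2) μ (Measure.pi fun _ => γ) :=
    measurePreserving_pi (fun _ : Fin n => ρ.prod γ) (fun _ => γ) fun _ => measurePreserving_snd
  have e0 : ∀ x, H 0 x = ∑ i, (x i).2 := fun x => by simp [hH]
  have en : ∀ x, H n x = Sm f fun i => (x i).1 := fun x => by simp [hH, Sm]
  simp_rw [e0, en] at hn
  have t1 := (hf.Sm (n := n) ρ).comp_of_quadratic hFc hFb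
  have t2 : Tame (fun x : Fin n → ℝ => F (∑ i, x i)) (Measure.pi fun _ => γ) :=
    (Tame.sum _ fun i => hγ.eval γ i).comp_of_quadratic hFc hFb
  rw [← m1.map_eq, ← m2.map_eq, integral_map m1.measurable.aemeasurable
    (by rw [m1.map_eq]; exact t1.aestronglyMeasurable), integral_map m2.measurable.aemeasurable
    (by rw [m2.map_eq]; exact t2.aestronglyMeasurable)]
  exact hn

end Lindeberg

/-- The average of `(u - s)₊²` over `0 ≤ s ≤ L`. -/
def smoothSq (L u : ℝ) : ℝ := (max u 0 ^ 3 - max (u - L) 0 ^ 3) / (3 * L)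

lemma smoothSq_le {L u : ℝ} (hL : 0 < L) : smoothSq L u ≤ max u 0 ^ 2 := by
  rw [smoothSq, div_le_iff₀ (by positivity)]
  rcases le_total u 0 with h | h
  · rw [max_eq_right h, max_eq_right (by linarith)]; simp
  rw [max_eq_left h]
  rcases le_total (u - L) 0 with h2 | h2
  · rw [max_eq_right h2]
    nlinarith [mul_nonneg (sq_nonneg u) hL.le, mul_nonneg (sq_nonneg u) (neg_nonneg.2 h2)]
  · rw [max_eq_left h2]
    nlinarith [mul_nonneg hL.le hL.le, mul_nonneg (mul_nonneg hL.le hL.le) h2,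
      mul_nonneg (mul_nonneg hL.le hL.le) h]

/-- Jensen's inequality: the average of a convex function is at least its value at the mean shift
L/2. -/
lemma le_smoothSq {L u : ℝ} (hL : 0 < L) : max (u - L / 2) 0 ^ 2 ≤ smoothSq L u := by
  rw [smoothSq, le_div_iff₀ (by positivity)]
  rcases le_total u 0 with h | h
  · rw [max_eq_right h, max_eq_right (by linarith), max_eq_right (by linarith)]; simp
  rw [max_eq_left h]
  rcases le_total (u - L) 0 with h2 | h2
  · rw [max_eq_right h2]
    rcases le_total (u - L / 2) 0 with h3 | h3
    · rw [max_eq_right h3]; simp; positivity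
    · rw [max_eq_left h3]
      nlinarith [pow_nonneg h3 3, mul_nonneg (sq_nonneg (u - L)) h3, mul_nonneg (sq_nonneg (u - L)) h,
        mul_nonneg (sq_nonneg L) hL.le, mul_nonneg (sq_nonneg (u - L)) hL.le, pow_pos hL 3]
  · rw [max_eq_left h2, max_eq_left (by linarith)]
    nlinarith [pow_pos hL 3]

/-- The third derivative of u₊³ lies between 0 and 6, so the cubic remainder is within |x|³/2 of
x³/2. In the difference of two such cubes the central terms x³/2 cancel, which halves the constant.
-/
lemma hasCubicTaylor_smoothSq {L : ℝ} (hL : 0 < L) (c : ℝ) :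
    HasCubicTaylor (fun y => smoothSq L (y - c)) (1 / (3 * L)) := by
  have key : ∀ s x : ℝ, |max (s + x) 0 ^ 3 - max s 0 ^ 3 - 3 * max s 0 ^ 2 * x -
      3 * max s 0 * x ^ 2 - x ^ 3 / 2| ≤ |x| ^ 3 / 2 := by
    intro s x
    have hx3 : |x| ^ 3 = |x ^ 3| := (abs_pow x 3).symm
    rcases le_total s 0 with h | h <;> rcases le_total (s + x) 0 with h2 | h2
    · rw [max_eq_right h, max_eq_right h2, hx3, show ((0 : ℝ) ^ 3 - 0 ^ 3 - 3 * 0 ^ 2 * x -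
        3 * 0 * x ^ 2 - x ^ 3 / 2) = -(x ^ 3 / 2) by ring, abs_neg, abs_div]
      simp
    · have hx : 0 ≤ x := by linarith
      have h3 : (s + x) ^ 3 ≤ x ^ 3 := pow_le_pow_left₀ h2 (by linarith) 3
      have h4 : 0 ≤ (s + x) ^ 3 := pow_nonneg h2 3
      rw [max_eq_right h, max_eq_left h2, abs_of_nonneg hx, abs_le]
      constructor <;> linarith
    · have hx : x ≤ 0 := by linarith
      have h3 : (-(s + x)) ^ 3 ≤ (-x) ^ 3 := pow_le_pow_left₀ (by linarith) (by linarith) 3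
      have h4 : 0 ≤ (-(s + x)) ^ 3 := pow_nonneg (by linarith) 3
      rw [max_eq_left h, max_eq_right h2, abs_of_nonpos hx, abs_le]
      constructor <;> linarith
    · rw [max_eq_left h, max_eq_left h2, hx3, show (s + x) ^ 3 - s ^ 3 - 3 * s ^ 2 * x -
        3 * s * x ^ 2 - x ^ 3 / 2 = x ^ 3 / 2 by ring, abs_div]
      simp
  refine ⟨fun s => (max (s - c) 0 ^ 2 - max (s - c - L) 0 ^ 2) / L,
    fun s => (max (s - c) 0 - max (s - c - L) 0) / L, fun s x => ?_⟩
  have h1 := key (s - c) x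
  have h2 := key (s - c - L) x
  have e : smoothSq L (s + x - c) - smoothSq L (s - c) -
      (max (s - c) 0 ^ 2 - max (s - c - L) 0 ^ 2) / L * x -
      (max (s - c) 0 - max (s - c - L) 0) / L * x ^ 2 =
      1 / (3 * L) * ((max (s - c + x) 0 ^ 3 - max (s - c) 0 ^ 3 - 3 * max (s - c) 0 ^ 2 * x -
        3 * max (s - c) 0 * x ^ 2 - x ^ 3 / 2) -
        (max (s - c - L + x) 0 ^ 3 - max (s - c - L) 0 ^ 3 - 3 * max (s - c - L) 0 ^ 2 * x -
        3 * max (s - c - L) 0 * x ^ 2 - x ^ 3 / 2)) := by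
    rw [smoothSq, smoothSq, show s + x - c = s - c + x by ring,
      show s - c + x - L = s - c - L + x by ring]
    field_simp
    ring
  rw [e, abs_mul, abs_of_pos (by positivity : (0 : ℝ) < 1 / (3 * L))]
  refine mul_le_mul_of_nonneg_left ?_ (by positivity)
  refine (abs_sub _ _).trans ?_
  linarith

/-! ### Truncated second moments of normal variables -/

lemma integral_Ioi_pow_mul_exp (k : ℕ) : ∫ y in Ioi (0 : ℝ), y ^ k * Real.exp (-(y ^ 2 / 2)) =
    (1 / 2 : ℝ) ^ (-((k : ℝ) + 1) / 2) * (1 / 2) * Real.Gamma (((k : ℝ) + 1) / 2) := by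
  rw [← integral_rpow_mul_exp_neg_mul_rpow (p := 2) (q := k) (b := 1 / 2) (by norm_num)
    (by have := k.cast_nonneg (α := ℝ); linarith) (by norm_num)]
  refine setIntegral_congr_fun measurableSet_Ioi fun y hy => ?_
  simp only [Real.rpow_natCast, Real.rpow_ofNat]
  ring_nf

lemma integral_Ioi_sq_mul_exp : ∫ y in Ioi (0 : ℝ), y ^ 2 * Real.exp (-(y ^ 2 / 2)) =
    Real.sqrt (2 * Real.pi) / 2 := by
  rw [integral_Ioi_pow_mul_exp]
  have e : ((2 : ℕ) : ℝ) + 1 = 3 := by norm_num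
  have eG : Real.Gamma (3 / 2) = Real.sqrt Real.pi / 2 := by
    rw [show (3 / 2 : ℝ) = 1 / 2 + 1 by norm_num, Real.Gamma_add_one (by norm_num),
      Real.Gamma_one_half_eq]
    ring
  have e2 : (1 / 2 : ℝ) ^ (-3 / 2 : ℝ) = 2 * Real.sqrt 2 := by
    rw [one_div, Real.inv_rpow (by norm_num), ← Real.rpow_neg (by norm_num), Real.sqrt_eq_rpow,
      show -(-3 / 2 : ℝ) = 1 + 1 / 2 by norm_num, Real.rpow_add (by norm_num), Real.rpow_one]
  rw [e, eG, e2, Real.sqrt_mul (by norm_num)]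
  ring

lemma integral_Ioi_cube_mul_exp : ∫ y in Ioi (0 : ℝ), y ^ 3 * Real.exp (-(y ^ 2 / 2)) = 2 := by
  rw [integral_Ioi_pow_mul_exp]
  have e : (((3 : ℕ) : ℝ) + 1) / 2 = 2 := by norm_num
  have e2 : -(((3 : ℕ) : ℝ) + 1) / 2 = -2 := by norm_num
  rw [e, e2, Real.Gamma_two, one_div, Real.inv_rpow (by norm_num), ← Real.rpow_neg (by norm_num)]
  norm_num

/-- The truncated second moment of the standard normal law. -/
lemma le_integral_Ioi_sq_mul_exp {x : ℝ} (hx : 0 ≤ x) :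
    Real.exp (-(x * (4 / Real.sqrt (2 * Real.pi)))) * (Real.sqrt (2 * Real.pi) / 2) ≤
    ∫ y in Ioi (0 : ℝ), y ^ 2 * Real.exp (-(y ^ 2 / 2)) * Real.exp (-(x * y)) := by
  set m := 4 / Real.sqrt (2 * Real.pi) with hm
  have hs : 0 < Real.sqrt (2 * Real.pi) := Real.sqrt_pos.2 (by positivity)
  have hi : ∀ k : ℕ, IntegrableOn (fun y : ℝ => y ^ k * Real.exp (-(y ^ 2 / 2))) (Ioi 0) := by
    intro k
    have := integrableOn_rpow_mul_exp_neg_mul_sq (b := 1 / 2) (by norm_num) (s := k)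
      (by have := k.cast_nonneg (α := ℝ); linarith)
    refine this.congr_fun (fun y _ => ?_) measurableSet_Ioi
    simp only [Real.rpow_natCast]
    ring_nf
  have e : Real.exp (-(x * m)) * (Real.sqrt (2 * Real.pi) / 2) =
      ∫ y in Ioi (0 : ℝ), (Real.exp (-(x * m)) * (1 + x * m) * (y ^ 2 * Real.exp (-(y ^ 2 / 2))) -
        Real.exp (-(x * m)) * x * (y ^ 3 * Real.exp (-(y ^ 2 / 2)))) := by
    rw [integral_sub ((hi 2).const_mul _) ((hi 3).const_mul _), integral_const_mul,
      integral_const_mul, integral_Ioi_sq_mul_exp, integral_Ioi_cube_mul_exp, hm]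
    field_simp
    ring
  rw [e]
  refine setIntegral_mono_on (((hi 2).const_mul _).sub ((hi 3).const_mul _)) ?_ measurableSet_Ioi
    fun y hy => ?_
  · refine Integrable.mono' (hi 2) (by fun_prop) ?_
    refine (ae_restrict_iff' measurableSet_Ioi).2 (Eventually.of_forall fun y hy => ?_)
    have hy' : 0 < y := hy
    rw [Real.norm_of_nonneg (by positivity)]
    refine mul_le_of_le_one_right (by positivity) ?_
    rw [Real.exp_le_one_iff]
    have := mul_nonneg hx hy'.le
    linarith
  -- Jensen's inequality by the tangent at m = 4/√(2π), the mean of y under the weight y² exp(-y²/2)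
  -- on the half-line.
  · have h1 := Real.add_one_le_exp (-(x * (y - m)))
    have h2 : Real.exp (-(x * y)) = Real.exp (-(x * m)) * Real.exp (-(x * (y - m))) := by
      rw [← Real.exp_add]; congr 1; ring
    have h3 : 0 ≤ y ^ 2 * Real.exp (-(y ^ 2 / 2)) * Real.exp (-(x * m)) := by positivity
    rw [h2]
    have := mul_le_mul_of_nonneg_left h1 h3
    calc _ = y ^ 2 * Real.exp (-(y ^ 2 / 2)) * Real.exp (-(x * m)) * (-(x * (y - m)) + 1) := by ring
      _ ≤ _ := this
      _ = _ := by ring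

lemma tame_id_gaussianReal (v : ℝ≥0) : Tame (fun y => y) (gaussianReal 0 v) :=
  fun p hp => memLp_id_gaussianReal' p hp

lemma gaussianReal_integral_sq_posPart {v : ℝ≥0} (hv : v ≠ 0) {x : ℝ} (hx : 0 ≤ x) :
    v / 2 * Real.exp (-(x ^ 2 / (2 * v) + 4 / Real.sqrt (2 * Real.pi) * (x / Real.sqrt v))) ≤
    ∫ y, max (y - x) 0 ^ 2 ∂(gaussianReal 0 v) := by
  have hv0 : (0 : ℝ) < v := by positivity
  set s := Real.sqrt v with hs
  have hs0 : 0 < s := Real.sqrt_pos.2 hv0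
  have hs2 : s ^ 2 = v := Real.sq_sqrt hv0.le
  have hmap : gaussianReal 0 v = (gaussianReal 0 1).map (s * ·) := by
    rw [gaussianReal_map_const_mul]
    congr 1
    · simp
    · ext; simp [hs2]
  have hp : 0 < Real.sqrt (2 * Real.pi) := Real.sqrt_pos.2 (by positivity)
  rw [hmap, integral_map (by fun_prop) (by fun_prop), integral_gaussianReal_eq_integral_smul one_ne_zero]
  set w := x / s with hw
  have hw0 : 0 ≤ w := by positivity
  have e1 : ∀ y : ℝ, gaussianPDFReal 0 1 y • max (s * y - x) 0 ^ 2 =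
      v * (Real.sqrt (2 * Real.pi))⁻¹ * (max (y - w) 0 ^ 2 * Real.exp (-(y ^ 2 / 2))) := by
    intro y
    have : max (s * y - x) 0 = s * max (y - w) 0 := by
      rw [mul_max_of_nonneg _ _ hs0.le, mul_zero, hw]
      congr 1
      field_simp
    rw [this, gaussianPDFReal, smul_eq_mul, ← hs2]
    simp
    ring_nf
  simp_rw [e1]
  rw [integral_const_mul]
  -- The shift by w turns the truncation into an exponential factor exp(-wy) on the half-line.
  have e2 : ∫ y : ℝ, max (y - w) 0 ^ 2 * Real.exp (-(y ^ 2 / 2)) =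
      Real.exp (-(w ^ 2 / 2)) *
        ∫ y in Ioi (0 : ℝ), y ^ 2 * Real.exp (-(y ^ 2 / 2)) * Real.exp (-(w * y)) := by
    rw [← integral_add_right_eq_self _ w, ← integral_indicator measurableSet_Ioi,
      ← integral_const_mul]
    refine integral_congr_ae (Eventually.of_forall fun y => ?_)
    simp only [add_sub_cancel_right, indicator]
    split_ifs with h
    · rw [max_eq_left (le_of_lt h)]
      rw [show -((y + w) ^ 2 / 2) = -(w ^ 2 / 2) + (-(y ^ 2 / 2) + -(w * y)) by ring, Real.exp_add,
        Real.exp_add]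
      ring
    · rw [max_eq_right (not_lt.1 h)]; simp
  rw [e2]
  have h := le_integral_Ioi_sq_mul_exp hw0
  have e3 : v / 2 * Real.exp (-(x ^ 2 / (2 * v) + 4 / Real.sqrt (2 * Real.pi) * w)) =
      v * (Real.sqrt (2 * Real.pi))⁻¹ * (Real.exp (-(w ^ 2 / 2)) *
        (Real.exp (-(w * (4 / Real.sqrt (2 * Real.pi)))) * (Real.sqrt (2 * Real.pi) / 2))) := by
    have : -(x ^ 2 / (2 * v) + 4 / Real.sqrt (2 * Real.pi) * w) =
        -(w ^ 2 / 2) + -(w * (4 / Real.sqrt (2 * Real.pi))) := by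
      rw [hw, ← hs2]; field_simp; ring
    rw [this, Real.exp_add]
    field_simp
  rw [e3]
  gcongr

/-- The third absolute moment of a centered normal law. -/
lemma integral_abs_cube_gaussianReal (v : ℝ≥0) :
    ∫ y, |y| ^ 3 ∂(gaussianReal 0 v) ≤ 1.6 * Real.sqrt v ^ 3 := by
  have hmap : gaussianReal 0 v = (gaussianReal 0 1).map (Real.sqrt v * ·) := by
    rw [gaussianReal_map_const_mul]
    congr 1
    · simp
    · ext; simp
  have hp : 0 < Real.sqrt (2 * Real.pi) := Real.sqrt_pos.2 (by positivity)
  rw [hmap, integral_map (by fun_prop) (by fun_prop)]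
  simp_rw [abs_mul, mul_pow]
  have hone : (1 : ℝ≥0) ≠ 0 := one_ne_zero
  rw [integral_const_mul, integral_gaussianReal_eq_integral_smul hone, mul_comm (1.6 : ℝ),
    abs_of_nonneg (Real.sqrt_nonneg _)]
  refine mul_le_mul_of_nonneg_left ?_ (pow_nonneg (Real.sqrt_nonneg _) 3)
  have e1 : ∀ y : ℝ, gaussianPDFReal 0 1 y • |y| ^ 3 =
      (Real.sqrt (2 * Real.pi))⁻¹ * (fun z => z ^ 3 * Real.exp (-(z ^ 2 / 2))) |y| := by
    intro y
    rw [gaussianPDFReal, smul_eq_mul]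
    simp
    ring_nf
  simp_rw [e1]
  rw [integral_const_mul, integral_comp_abs (f := fun z => z ^ 3 * Real.exp (-(z ^ 2 / 2))),
    integral_Ioi_cube_mul_exp, inv_mul_le_iff₀ hp]
  have : (2.5 : ℝ) ≤ Real.sqrt (2 * Real.pi) := by
    rw [Real.le_sqrt (by norm_num) (by positivity)]
    have := Real.pi_gt_d2
    norm_num at *
    linarith
  linarith

lemma map_sum_pi_gaussianReal (n : ℕ) (v : ℝ≥0) :
    (Measure.pi fun _ : Fin n => gaussianReal 0 v).map (fun x => ∑ i, x i) =
      gaussianReal 0 (n * v) := by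
  have : IsProbabilityMeasure ((Measure.pi fun _ : Fin n => gaussianReal 0 v).map
      (fun x => ∑ i, x i)) := Measure.isProbabilityMeasure_map (by fun_prop)
  refine Measure.ext_of_charFun ?_
  rw [charFun_map_sum_pi_eq_prod]
  ext t
  simp only [Finset.prod_const, Finset.card_univ, Fintype.card_fin, Pi.pow_apply,
    charFun_gaussianReal, ← Complex.exp_nat_mul]
  congr 1
  push_cast
  ring

/-- A lower bound for the truncated second moment of a sum of independent variables. -/
lemma le_integral_sq_posPart {α : Type*} [MeasurableSpace α] {n : ℕ} (ρ : Measure α)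
    [IsProbabilityMeasure ρ] {f : α → ℝ} (hf : Tame f ρ) (hn : 0 < n) (h0 : ∫ p, f p ∂ρ = 0)
    {s m L τ : ℝ} (hs : 0 < s) (h2 : ∫ p, f p ^ 2 ∂ρ = s ^ 2) (h3 : ∫ p, |f p| ^ 3 ∂ρ ≤ m)
    (hL : 0 < L) (hτ : 0 ≤ τ) :
    n * s ^ 2 / 2 * Real.exp (-((τ + L / 2) ^ 2 / (2 * (n * s ^ 2)) +
      4 / Real.sqrt (2 * Real.pi) * ((τ + L / 2) / (Real.sqrt n * s)))) -
      n / (3 * L) * (m + 1.6 * s ^ 3) ≤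
    ∫ x : Fin n → α, max (Sm f x - τ) 0 ^ 2 ∂(Measure.pi fun _ => ρ) := by
  have hn' : (0 : ℝ) < n := by exact_mod_cast hn
  set v : ℝ≥0 := (⟨s ^ 2, sq_nonneg s⟩ : ℝ≥0) with hv
  have hvs : (v : ℝ) = s ^ 2 := rfl
  have hvs' : Real.sqrt v = s := by rw [hvs, Real.sqrt_sq hs.le]
  have hv0 : (n : ℝ≥0) * v ≠ 0 := by
    have : (((n : ℝ≥0) * v : ℝ≥0) : ℝ) ≠ 0 := by
      rw [NNReal.coe_mul, hvs]; simp; exact ⟨hn.ne', hs.ne'⟩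
    exact_mod_cast this
  have hcont : Continuous fun y => smoothSq L (y - τ) := by
    unfold smoothSq; fun_prop
  have hnn : ∀ u, 0 ≤ smoothSq L u := fun u => (sq_nonneg _).trans (le_smoothSq hL)
  have hmaxsq : ∀ u : ℝ, max u 0 ^ 2 ≤ u ^ 2 := fun u => by
    rcases le_total u 0 with h | h
    · rw [max_eq_right h, zero_pow (by norm_num)]; positivity
    · rw [max_eq_left h]
  have hbd : ∀ y, |smoothSq L (y - τ)| ≤ |(y - τ) ^ 2| := fun y => by
    rw [abs_of_nonneg (hnn _), abs_of_nonneg (sq_nonneg _)]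
    exact (smoothSq_le hL).trans (hmaxsq _)
  have hγ2 : ∫ y, y ^ 2 ∂(gaussianReal 0 v) = s ^ 2 := by
    have := variance_fun_id_gaussianReal (μ := 0) (v := v)
    rw [variance_eq_integral (by fun_prop)] at this
    simpa [integral_id_gaussianReal, hvs] using this
  have key := lindeberg (n := n) ρ hf (tame_id_gaussianReal v)
    (by rw [h0, integral_id_gaussianReal]) (by rw [h2, hγ2]) (hasCubicTaylor_smoothSq hL τ) hcont hbd
  have h3' := integral_abs_cube_gaussianReal v
  rw [hvs'] at h3'
  have i1 : (n : ℝ) * (1 / (3 * L) * (∫ p, |f p| ^ 3 ∂ρ + ∫ y, |y| ^ 3 ∂(gaussianReal 0 v))) ≤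
      n / (3 * L) * (m + 1.6 * s ^ 3) := by
    rw [← mul_assoc, mul_one_div]
    gcongr
  have i2 : ∫ x : Fin n → α, smoothSq L (Sm f x - τ) ∂(Measure.pi fun _ => ρ) ≤
      ∫ x : Fin n → α, max (Sm f x - τ) 0 ^ 2 ∂(Measure.pi fun _ => ρ) := by
    have t := hf.Sm (n := n) ρ
    refine integral_mono (t.comp_of_quadratic hcont hbd).integrable ?_ fun x => smoothSq_le hL
    exact (((t.sub (Tame.const τ)).max (Tame.const 0)).pow 2).integrable
  have i3 : n * s ^ 2 / 2 * Real.exp (-((τ + L / 2) ^ 2 / (2 * (n * s ^ 2)) +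
      4 / Real.sqrt (2 * Real.pi) * ((τ + L / 2) / (Real.sqrt n * s)))) ≤
      ∫ x : Fin n → ℝ, smoothSq L (∑ i, x i - τ) ∂(Measure.pi fun _ => gaussianReal 0 v) := by
    have g := gaussianReal_integral_sq_posPart hv0 (x := τ + L / 2) (by positivity)
    have e : Real.sqrt (((n : ℝ≥0) * v : ℝ≥0) : ℝ) = Real.sqrt n * s := by
      rw [NNReal.coe_mul, Real.sqrt_mul (by positivity), hvs']; simp
    rw [e, NNReal.coe_mul, hvs, NNReal.coe_natCast, ← map_sum_pi_gaussianReal,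
      integral_map (by fun_prop) (by fun_prop)] at g
    refine g.trans ?_
    have t : Tame (fun x : Fin n → ℝ => ∑ i, x i) (Measure.pi fun _ => gaussianReal 0 v) :=
      Tame.sum _ fun i => (tame_id_gaussianReal v).eval _ i
    refine integral_mono ?_ (t.comp_of_quadratic hcont hbd).integrable fun x => ?_
    · exact (((t.sub (Tame.const _)).max (Tame.const 0)).pow 2).integrable
    · have := le_smoothSq (u := ∑ i, x i - τ) hL
      rwa [sub_sub] at this
  linarith

/-! ### Upper tails of sums of variables which are bounded above -/

section Tails

variable {α : Type*} [MeasurableSpace α] {n : ℕ} (ρ : Measure α) [IsProbabilityMeasure ρ]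

/-- The k-th power of t ≤ exp(t - 1) at t = hy/k; equality holds at y = k/h. -/
lemma posPart_pow_le_exp {k : ℕ} (hk : 0 < k) {h : ℝ} (hh : 0 < h) (y : ℝ) :
    max y 0 ^ k ≤ (k / (Real.exp 1 * h)) ^ k * Real.exp (h * y) := by
  have hk' : (0 : ℝ) < k := by exact_mod_cast hk
  rcases le_total y 0 with hy | hy
  · rw [max_eq_right hy, zero_pow hk.ne']; positivity
  · rw [max_eq_left hy]
    have h1 := Real.add_one_le_exp (h * y / k - 1)
    have h2 : y ≤ k / (Real.exp 1 * h) * Real.exp (h * y / k) := by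
      have e : Real.exp (h * y / k - 1) = Real.exp (h * y / k) / Real.exp 1 := Real.exp_sub _ _
      rw [e, sub_add_cancel] at h1
      have : y = k / h * (h * y / k) := by field_simp
      calc y = k / h * (h * y / k) := this
        _ ≤ k / h * (Real.exp (h * y / k) / Real.exp 1) := by gcongr
        _ = _ := by field_simp
    calc y ^ k ≤ (k / (Real.exp 1 * h) * Real.exp (h * y / k)) ^ k := pow_le_pow_left₀ hy h2 k
      _ = _ := by
        rw [mul_pow, ← Real.exp_nat_mul]
        congr 2
        field_simp

lemma integral_exp_Sm (f : α → ℝ) (h : ℝ) :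
    ∫ x : Fin n → α, Real.exp (h * Sm f x) ∂(Measure.pi fun _ => ρ) =
      (∫ p, Real.exp (h * f p) ∂ρ) ^ n := by
  have e : ∀ x : Fin n → α, Real.exp (h * Sm f x) = ∏ i, Real.exp (h * f (x i)) := fun x => by
    rw [Sm, Finset.mul_sum, Real.exp_sum]
  simp_rw [e]
  have := integral_fintype_prod_eq_prod (μ := fun _ : Fin n => ρ) (𝕜 := ℝ)
    fun (_ : Fin n) p => Real.exp (h * f p)
  simpa using this

variable {ρ}

lemma integrable_exp_Sm {f : α → ℝ} (hf : AEStronglyMeasurable f ρ) {B h : ℝ} (hh : 0 ≤ h)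
    (hB : ∀ p, f p ≤ B) :
    Integrable (fun x : Fin n → α => Real.exp (h * Sm f x)) (Measure.pi fun _ => ρ) := by
  have hm : AEStronglyMeasurable (fun x : Fin n → α => Sm f x) (Measure.pi fun _ => ρ) :=
    Finset.aestronglyMeasurable_fun_sum _ fun i _ =>
      hf.comp_measurePreserving (measurePreserving_eval (fun _ : Fin n => ρ) i)
  refine Integrable.mono' (integrable_const (Real.exp (h * (n * B))))
    (Real.continuous_exp.comp_aestronglyMeasurable (hm.const_mul h)) (Eventually.of_forall fun x => ?_)
  rw [Real.norm_of_nonneg (Real.exp_nonneg _), Real.exp_le_exp]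
  refine mul_le_mul_of_nonneg_left ?_ hh
  calc Sm f x ≤ ∑ _i : Fin n, B := Finset.sum_le_sum fun i _ => hB _
    _ = n * B := by simp

/-- Moments of the positive part of a sum from its exponential moments. -/
lemma integral_posPart_pow_le {f : α → ℝ} (hf : AEStronglyMeasurable f ρ) {B h τ W : ℝ} {k : ℕ}
    (hk : 0 < k) (hh : 0 < h) (hB : ∀ p, f p ≤ B) (hW : ∫ p, Real.exp (h * f p) ∂ρ ≤ Real.exp W) :
    ∫ x : Fin n → α, max (Sm f x - τ) 0 ^ k ∂(Measure.pi fun _ => ρ) ≤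
      (k / (Real.exp 1 * h)) ^ k * Real.exp (n * W - h * τ) := by
  have hi := integrable_exp_Sm (n := n) hf hh.le hB
  have hpt : ∀ x : Fin n → α, max (Sm f x - τ) 0 ^ k ≤
      (k / (Real.exp 1 * h)) ^ k * Real.exp (-(h * τ)) * Real.exp (h * Sm f x) := fun x => by
    refine (posPart_pow_le_exp hk hh _).trans (le_of_eq ?_)
    rw [mul_assoc, ← Real.exp_add]
    ring_nf
  refine (integral_mono_of_nonneg (Eventually.of_forall fun x => by positivity)
    (hi.const_mul _) (Eventually.of_forall hpt)).trans ?_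
  rw [integral_const_mul, integral_exp_Sm, mul_assoc]
  refine mul_le_mul_of_nonneg_left ?_ (by positivity)
  rw [sub_eq_neg_add, Real.exp_add, Real.exp_nat_mul]
  gcongr

/-- Moments of the positive part of a sum of variables with sub-Gaussian upper tails. -/
lemma integral_posPart_pow_le_of_subgaussian {f : α → ℝ} (hf : AEStronglyMeasurable f ρ)
    {B V : ℝ} {k : ℕ} (hn : 0 < n) (hk : 0 < k) (hV : 0 < V) (hB : ∀ p, f p ≤ B)
    (hW : ∫ p, Real.exp (Real.sqrt (k / (n * V)) * f p) ∂ρ ≤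
      Real.exp (Real.sqrt (k / (n * V)) ^ 2 * V / 2)) :
    ∫ x : Fin n → α, max (Sm f x) 0 ^ k ∂(Measure.pi fun _ => ρ) ≤
      Real.sqrt (k * (n * V) / Real.exp 1) ^ k := by
  have hk' : (0 : ℝ) < k := by exact_mod_cast hk
  have hn' : (0 : ℝ) < n := by exact_mod_cast hn
  -- This h minimizes h^(-k) exp(nh²V/2).
  set h := Real.sqrt (k / (n * V)) with hh
  have hh0 : 0 < h := Real.sqrt_pos.2 (by positivity)
  have hh2 : h ^ 2 = k / (n * V) := Real.sq_sqrt (by positivity)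
  have := integral_posPart_pow_le (n := n) (τ := 0) hf hk hh0 hB hW
  simp only [sub_zero, mul_zero] at this
  refine this.trans (le_of_eq ?_)
  have e1 : n * (h ^ 2 * V / 2) = k * (1 / 2) := by rw [hh2]; field_simp
  rw [e1, Real.exp_nat_mul, ← mul_pow]
  congr 1
  refine ((Real.sqrt_eq_iff_mul_self_eq (by positivity) (by positivity)).2 (Eq.symm ?_)).symm
  have e2 : Real.exp (1 / 2) * Real.exp (1 / 2) = Real.exp 1 := by rw [← Real.exp_add]; norm_num
  have e3 : h * h = k / (n * V) := by rw [← hh2]; ring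
  calc k / (Real.exp 1 * h) * Real.exp (1 / 2) * (k / (Real.exp 1 * h) * Real.exp (1 / 2)) =
      k ^ 2 / (Real.exp 1 ^ 2 * (h * h)) * (Real.exp (1 / 2) * Real.exp (1 / 2)) := by
        field_simp
    _ = _ := by rw [e2, e3]; field_simp

/-- The second derivative of exp between 0 and y is at most E. Only an upper bound for y matters, as
suits variables bounded above. -/
lemma exp_le_quadratic {y E : ℝ} (hE : 1 ≤ E) (hy : Real.exp y ≤ E) :
    Real.exp y ≤ 1 + y + y ^ 2 / 2 * E := by
  have hd : ∀ z : ℝ, HasDerivAt (fun z => 1 + z + z ^ 2 / 2 * E - Real.exp z)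
      (1 + z * E - Real.exp z) z := fun z => by
    have := ((((hasDerivAt_id z).const_add 1).add (((hasDerivAt_pow 2 z).div_const 2).mul_const E)).sub
      (Real.hasDerivAt_exp z))
    refine HasDerivAt.congr_deriv (f := fun z => 1 + z + z ^ 2 / 2 * E - Real.exp z) this ?_
    norm_num
  set g : ℝ → ℝ := fun z => 1 + z + z ^ 2 / 2 * E - Real.exp z with hg
  have hg0 : g 0 = 0 := by simp [hg]
  have hcont : Continuous g := by rw [hg]; fun_prop
  suffices 0 ≤ g y by simp only [hg] at this; linarith
  rcases le_total 0 y with h0 | h0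
  · have hm : MonotoneOn g (Icc 0 y) := by
      refine monotoneOn_of_deriv_nonneg (convex_Icc 0 y) hcont.continuousOn
        (fun z _ => (hd z).differentiableAt.differentiableWithinAt) fun z hz => ?_
      rw [interior_Icc] at hz
      rw [(hd z).deriv]
      have h2 : Real.exp z ≤ E := (Real.exp_le_exp.2 hz.2.le).trans hy
      have h3 := Real.add_one_le_exp (-z)
      rw [Real.exp_neg] at h3
      have h4 : Real.exp z - 1 ≤ z * Real.exp z := by
        have := mul_le_mul_of_nonneg_right h3 (Real.exp_pos z).le
        rw [inv_mul_cancel₀ (Real.exp_pos z).ne'] at this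
        linarith
      have := mul_le_mul_of_nonneg_left h2 hz.1.le
      linarith
    have := hm (left_mem_Icc.2 h0) (right_mem_Icc.2 h0) h0
    linarith
  · have hm : AntitoneOn g (Icc y 0) := by
      refine antitoneOn_of_deriv_nonpos (convex_Icc y 0) hcont.continuousOn
        (fun z _ => (hd z).differentiableAt.differentiableWithinAt) fun z hz => ?_
      rw [interior_Icc] at hz
      rw [(hd z).deriv]
      have h3 := Real.add_one_le_exp z
      have := mul_le_mul_of_nonpos_left hE hz.2.le
      linarith
    have := hm (left_mem_Icc.2 h0) (right_mem_Icc.2 h0) h0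
    linarith

/-- Exponential moments of centred variables bounded above. -/
lemma integral_exp_le {f : α → ℝ} (hf : Tame f ρ) {B h E s : ℝ} (hh : 0 ≤ h) (hE : 1 ≤ E)
    (hB : ∀ p, f p ≤ B) (hBE : Real.exp (h * B) ≤ E) (h0 : ∫ p, f p ∂ρ = 0)
    (h2 : ∫ p, f p ^ 2 ∂ρ = s) : ∫ p, Real.exp (h * f p) ∂ρ ≤ Real.exp (h ^ 2 * (s * E) / 2) := by
  have hpt : ∀ p, Real.exp (h * f p) ≤ 1 + h * f p + h ^ 2 / 2 * E * f p ^ 2 := fun p => by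
    refine (exp_le_quadratic hE (le_trans ?_ hBE)).trans (le_of_eq (by ring))
    exact Real.exp_le_exp.2 (mul_le_mul_of_nonneg_left (hB p) hh)
  refine (integral_mono_of_nonneg (Eventually.of_forall fun x => (Real.exp_pos _).le)
    (Tame.integrable (by fun_prop)) (Eventually.of_forall hpt)).trans ?_
  rw [integral_add (Tame.integrable (by fun_prop)) (Tame.integrable (by fun_prop)),
    integral_add (Tame.integrable (by fun_prop)) (Tame.integrable (by fun_prop)),
    integral_const_mul, integral_const_mul, h0, h2]
  simp only [integral_const, probReal_univ, one_smul, mul_zero, add_zero]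
  have := Real.add_one_le_exp (h ^ 2 * (s * E) / 2)
  linarith

end Tails

section LowerTails

variable {n : ℕ} {ρ : Measure (Bool × ℝ)} [IsProbabilityMeasure ρ] {a θ : ℝ}

/-- Moments of the negative part of the linear part of the estimator of `ν`. -/
lemma PairLaw.integral_neg_z1_pow (h : PairLaw ρ a θ) (hθ : 0 ≤ θ) (hn : 0 < n) {k : ℕ} (hk : 0 < k)
    {s E : ℝ} (hs : 0 < s) (hs2 : s ^ 2 = sSq a θ) (hE : 1 ≤ E)
    (hBE : Real.exp (Real.sqrt k / (Real.sqrt n * s) * (dHat a θ + 3 * θ * (1 + θ))) ≤ E) :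
    ∫ x : Fin n → Bool × ℝ, max (-z1 a θ x) 0 ^ k ∂(Measure.pi fun _ => ρ) ≤
      Real.sqrt (k * (s ^ 2 * E) / (n * Real.exp 1)) ^ k := by
  have hn' : (0 : ℝ) < n := by exact_mod_cast hn
  have hk' : (0 : ℝ) < k := by exact_mod_cast hk
  set B := dHat a θ + 3 * θ * (1 + θ) with hB
  have hf := h.tame_yy.neg
  have hbd : ∀ p : Bool × ℝ, -yy a θ p ≤ B := fun p => by
    have h1 : -1 ≤ sg p.1 := neg_le_of_abs_le (abs_sg p.1).le
    have h2 := mul_le_mul_of_nonneg_left h1 hθ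
    have := sq_nonneg p.2
    rw [yy, uu, hB]
    nlinarith
  set V := s ^ 2 * E with hV
  have hV0 : 0 < V := by positivity
  -- The factor E in V pays for the boundedness correction. As E ≥ 1, it only decreases η, so the
  -- hypothesis on E, stated without that factor, suffices.
  set η := Real.sqrt (k / (n * V)) with hη
  have hη0 : 0 ≤ η := Real.sqrt_nonneg _
  have hηle : η ≤ Real.sqrt k / (Real.sqrt n * s) := by
    rw [hη, Real.sqrt_div' _ (by positivity), Real.sqrt_mul (by positivity), hV,
      Real.sqrt_mul (by positivity), Real.sqrt_sq hs.le]
    have : 1 ≤ Real.sqrt E := Real.one_le_sqrt.2 hE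
    have hsn : 0 < Real.sqrt n := Real.sqrt_pos.2 hn'
    gcongr
    nlinarith
  have hηE : Real.exp (η * B) ≤ E := by
    rcases le_total 0 B with h0 | h0
    · exact (Real.exp_le_exp.2 (mul_le_mul_of_nonneg_right hηle h0)).trans hBE
    · exact (Real.exp_le_one_iff.2 (mul_nonpos_of_nonneg_of_nonpos hη0 h0)).trans hE
  have hm := integral_exp_le hf hη0 hE hbd hηE (by rw [integral_neg, h.int_yy, neg_zero])
    (s := s ^ 2) (by simp_rw [neg_sq]; rw [h.int_yy_sq, hs2])
  have key := integral_posPart_pow_le_of_subgaussian hf.aestronglyMeasurable hn hk hV0 hbd hm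
  have e : ∀ x : Fin n → Bool × ℝ, max (-z1 a θ x) 0 ^ k =
      max (Sm (fun p => -yy a θ p) x) 0 ^ k / n ^ k := fun x => by
    rw [← div_pow, ← max_div_div_right hn'.le]
    simp only [z1, Sm, Finset.sum_neg_distrib, neg_div, zero_div]
  simp_rw [e]
  rw [integral_div, div_le_iff₀ (by positivity), ← mul_pow]
  refine key.trans (le_of_eq ?_)
  congr 1
  rw [← Real.sqrt_sq hn'.le, ← Real.sqrt_mul (by positivity), Real.sqrt_sq hn'.le]
  congr 1
  field_simp

/-- The fourth moment of the negative part of the contribution of the moduli. -/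
lemma PairLaw.integral_posPart_four (h : PairLaw ρ a θ) (hn : 0 < n)
    (hA : 0 < aHat a θ) :
    ∫ x : Fin n → Bool × ℝ, max (Sm (fun p => dHat a θ - p.2 ^ 2) x / n) 0 ^ 4
      ∂(Measure.pi fun _ => ρ) ≤ (4 / Real.exp 1 * aHat a θ / n) ^ 2 := by
  have hn' : (0 : ℝ) < n := by exact_mod_cast hn
  have ht := h.tame
  have hf : Tame (fun p => dHat a θ - p.2 ^ 2) ρ := by fun_prop
  have hmgf : ∀ η : ℝ, 0 ≤ η → ∫ p, Real.exp (η * (dHat a θ - p.2 ^ 2)) ∂ρ ≤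
      Real.exp (η ^ 2 * aHat a θ / 2) := by
    intro η hη
    -- For exp(-x) with x ≥ 0 the quadratic bound needs no correction factor. The price is the
    -- fourth moment `aHat` instead of the variance of v².
    have hpt : ∀ p : Bool × ℝ, Real.exp (η * (dHat a θ - p.2 ^ 2)) ≤
        Real.exp (η * dHat a θ) * (1 + (-η) * p.2 ^ 2 + η ^ 2 / 2 * p.2 ^ 4) := fun p => by
      rw [mul_sub, sub_eq_add_neg, Real.exp_add]
      refine mul_le_mul_of_nonneg_left ?_ (Real.exp_nonneg _)
      have hp : 0 ≤ η * p.2 ^ 2 := by positivity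
      refine (exp_le_quadratic le_rfl (Real.exp_le_one_iff.2 (by linarith))).trans (le_of_eq (by ring))
    refine (integral_mono_of_nonneg (Eventually.of_forall fun x => (Real.exp_pos _).le)
      (Tame.integrable (by fun_prop)) (Eventually.of_forall hpt)).trans ?_
    rw [integral_const_mul, integral_add (Tame.integrable (by fun_prop))
      (Tame.integrable (by fun_prop)), integral_add (Tame.integrable (by fun_prop))
      (Tame.integrable (by fun_prop)), integral_const_mul, integral_const_mul, h.eV2, h.eV4]
    simp only [integral_const, probReal_univ, one_smul]
    have := Real.add_one_le_exp (-(η * dHat a θ) + η ^ 2 * aHat a θ / 2)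
    calc Real.exp (η * dHat a θ) * (1 + -η * dHat a θ + η ^ 2 / 2 * aHat a θ) ≤
        Real.exp (η * dHat a θ) * Real.exp (-(η * dHat a θ) + η ^ 2 * aHat a θ / 2) := by
          refine mul_le_mul_of_nonneg_left ?_ (Real.exp_nonneg _)
          linarith
      _ = _ := by rw [← Real.exp_add]; ring_nf
  have key := integral_posPart_pow_le_of_subgaussian (k := 4) hf.aestronglyMeasurable hn (by norm_num)
    hA (B := dHat a θ) (fun p => by have := sq_nonneg p.2; linarith) (hmgf _ (Real.sqrt_nonneg _))
  have e : ∀ x : Fin n → Bool × ℝ, max (Sm (fun p => dHat a θ - p.2 ^ 2) x / n) 0 ^ 4 =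
      max (Sm (fun p => dHat a θ - p.2 ^ 2) x) 0 ^ 4 / n ^ 4 := fun x => by
    rw [← div_pow, ← max_div_div_right hn'.le, zero_div]
  simp_rw [e]
  rw [integral_div, div_le_iff₀ (by positivity)]
  refine key.trans (le_of_eq ?_)
  rw [show ∀ y : ℝ, Real.sqrt y ^ 4 = (Real.sqrt y ^ 2) ^ 2 from fun y => by ring,
    Real.sq_sqrt (by positivity)]
  push_cast
  field_simp

end LowerTails

/-! ### The truncation near the boundary of the parameter domain -/

/-- The boundary value of `√ν`. -/
def kap (θ : ℝ) : ℝ := (1 + θ) / 2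

/-- The variance of `κ u - y`. -/
def pSq (a θ : ℝ) : ℝ := sSq a θ + kap θ ^ 2 * (1 - θ ^ 2) - 4 * kap θ * θ * (1 - θ ^ 2)

section Polynomials

variable {a θ : ℝ}

lemma dHat_mono {b : ℝ} (hb : 0 ≤ b) (hab : b ≤ a) : dHat b θ ≤ dHat a θ := by
  rw [dHat, dHat]; nlinarith

lemma dHat_kap_nonneg (h0 : 0 ≤ θ) (h1 : θ ≤ 1) : 0 ≤ dHat (kap θ) θ := by
  rw [dHat, kap]; nlinarith

lemma sSq_mono {b : ℝ} (hb : 0 ≤ b) (hab : b ≤ a) (hd : 0 ≤ dHat b θ) : sSq b θ ≤ sSq a θ := by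
  have h1 := dHat_mono (θ := θ) hb hab
  have h4 : b ^ 4 ≤ a ^ 4 := pow_le_pow_left₀ hb hab 4
  rw [sSq, sSq, hHat, hHat]
  nlinarith [pow_le_pow_left₀ hd h1 2]

lemma pSq_mono {b : ℝ} (hb : 0 ≤ b) (hab : b ≤ a) (hd : 0 ≤ dHat b θ) : pSq b θ ≤ pSq a θ := by
  have := sSq_mono hb hab hd
  rw [pSq, pSq]; linarith

/-- Certificates for polynomial inequalities on [0, c]: the difference of the two sides is a
combination of Bernstein monomials with nonnegative coefficients. Inequalities are checked in this
way at a = κ and carried to larger a by monotonicity. -/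
lemma bernstein_nonneg {c x : ℝ} (h0 : 0 ≤ x) (h1 : x ≤ c) (i j : ℕ) : 0 ≤ x ^ i * (c - x) ^ j :=
  mul_nonneg (pow_nonneg h0 i) (pow_nonneg (sub_nonneg.2 h1) j)

lemma le_pSq_kap (h0 : 0 ≤ θ) (h1 : θ ≤ 3 / 5) : (19 / 10 - θ / 4) ^ 2 ≤ pSq (kap θ) θ := by
  have b := bernstein_nonneg h0 h1
  rw [pSq, sSq, hHat, dHat, kap]
  linarith [b 0 4, b 1 3, b 2 2, b 3 1, b 4 0]

/-- A bound for the third absolute moment of `κ u - y`. -/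
def pCube (a θ : ℝ) : ℝ := cSix a θ + (dHat a θ + 1 / 2 + 2 * θ) ^ 3

lemma pCube_kap_le (h0 : 0 ≤ θ) (h1 : θ ≤ 3 / 5) :
    pCube (kap θ) θ + 8 / 5 * pSq (kap θ) θ * (19 / 10 - θ / 4) ≤
      420 * (1 - θ) * (19 / 10 - θ / 4) * kap θ ^ 3 := by
  have b := bernstein_nonneg h0 h1
  rw [pCube, cSix, kHat, pSq, sSq, hHat, dHat, kap]
  linarith [b 0 6, b 1 5, b 2 4, b 3 3, b 4 2, b 5 1, b 6 0]

/-- The case a = κ is `pCube_kap_le`. For larger a the increment of each piece on the left is at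
most a constant times a² - κ², while a³ - κ³ ≥ (3/2)κ(a² - κ²). The inequality `slope` compares the
two rates. -/
lemma pCube_le (h0 : 0 ≤ θ) (h1 : θ ≤ 3 / 5) (hκ : kap θ ≤ a) (ha : a ≤ 1) :
    pCube a θ + 8 / 5 * pSq a θ * (19 / 10 - θ / 4) ≤
      420 * (1 - θ) * (19 / 10 - θ / 4) * a ^ 3 := by
  have hk0 : 0 ≤ kap θ := by rw [kap]; linarith
  have hk1 : kap θ ≤ 1 := hκ.trans ha
  set p := a ^ 2 with hp
  set q := kap θ ^ 2 with hq
  have hq0 : 0 ≤ q := sq_nonneg _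
  have hq1 : q ≤ 1 := pow_le_one₀ hk0 hk1
  have hp1 : p ≤ 1 := pow_le_one₀ (hk0.trans hκ) ha
  have he : 0 ≤ p - q := by have := pow_le_pow_left₀ hk0 hκ 2; linarith
  set D := dHat (kap θ) θ with hD
  have hD0 : 0 ≤ D := dHat_kap_nonneg h0 (by linarith)
  have hDa : dHat a θ = D + (p - q) := by rw [hD, dHat, dHat]; ring
  set M := 3 / 2 * (1 - θ ^ 2) with hM
  have hDM : D + (p - q) ≤ M := by rw [hD, dHat]; linarith
  set H := hHat (kap θ) θ with hH
  have hHa : hHat a θ = H + 12 / 5 * (p + q) * (p - q) := by rw [hH, hHat, hHat, hp, hq]; ring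
  have hHM : 0 ≤ H := by
    rw [hH, hHat, kap]
    have b := bernstein_nonneg h0 h1
    linarith [b 0 4, b 1 3, b 2 2, b 3 1, b 4 0]
  set c := 1 / 2 + 2 * θ with hc
  have hc0 : 0 ≤ c := by rw [hc]; linarith
  have cube : ∀ {x M' : ℝ}, 0 ≤ x → x + (p - q) ≤ M' → (x + (p - q)) ^ 3 ≤
      x ^ 3 + (M' ^ 2 + M' * x + x ^ 2) * (p - q) := fun {x M'} hx hM => by
    have e : (x + (p - q)) ^ 3 =
      x ^ 3 + ((x + (p - q)) ^ 2 + (x + (p - q)) * x + x ^ 2) * (p - q) := by ring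
    rw [e]
    gcongr
  have t1 : p ^ 3 ≤ q ^ 3 + (1 ^ 2 + 1 * q + q ^ 2) * (p - q) := by
    have := cube hq0 (M' := 1) (by linarith)
    rwa [add_sub_cancel] at this
  have t2 := cube hD0 hDM
  have t3 := cube (x := D + c) (by positivity) (M' := M + c) (by linarith)
  have t4 : (H + 12 / 5 * (p + q) * (p - q)) * (D + (p - q)) ≤
      H * D + (12 / 5 * (1 + q) * M + H) * (p - q) := by
    have : 12 / 5 * (p + q) * (D + (p - q)) ≤ 12 / 5 * (1 + q) * M := by
      have : 0 ≤ p := sq_nonneg _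
      gcongr
    nlinarith only [mul_le_mul_of_nonneg_right this he]
  have t5 : pSq a θ ≤ pSq (kap θ) θ + (12 / 5 * (1 + q) + 2 * (M + D)) * (p - q) := by
    have e : pSq a θ = pSq (kap θ) θ + (12 / 5 * (p + q) + 2 * ((D + (p - q)) + D)) * (p - q) := by
      rw [pSq, pSq, sSq, sSq, hHa, hDa, ← hD, ← hH]; ring
    rw [e]
    gcongr
  have t6 : 3 / 2 * kap θ * (p - q) ≤ a ^ 3 - kap θ ^ 3 := by
    rw [hp, hq]
    linarith [mul_nonneg (sq_nonneg (a - kap θ)) (by linarith : 0 ≤ a + kap θ / 2)]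
  have hR : 0 ≤ 420 * (1 - θ) * (19 / 10 - θ / 4) := by
    have : 0 ≤ 1 - θ := by linarith
    have : 0 ≤ 19 / 10 - θ / 4 := by linarith
    positivity
  have slope : 192 / 7 * (1 ^ 2 + 1 * q + q ^ 2) + 25 * (12 / 5 * (1 + q) * M + H) +
      35 * (M ^ 2 + M * D + D ^ 2) + ((M + c) ^ 2 + (M + c) * (D + c) + (D + c) ^ 2) +
      8 / 5 * (12 / 5 * (1 + q) + 2 * (M + D)) * (19 / 10 - θ / 4) ≤
      420 * (1 - θ) * (19 / 10 - θ / 4) * (3 / 2 * kap θ) := by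
    have b := bernstein_nonneg h0 h1
    rw [hD, hM, hc, hH, hHat, dHat, hq, kap]
    linarith [b 0 4, b 1 3, b 2 2, b 3 1, b 4 0]
  have main := pCube_kap_le h0 h1
  have e1 : pCube a θ = 54 * (1 - θ ^ 6) + 192 / 7 * (p ^ 3 - 1) +
      25 * ((H + 12 / 5 * (p + q) * (p - q)) * (D + (p - q))) + 35 * (D + (p - q)) ^ 3 +
      (D + c + (p - q)) ^ 3 := by
    rw [pCube, cSix, kHat, hHa, hDa, hp]; ring
  have e2 : pCube (kap θ) θ = 54 * (1 - θ ^ 6) + 192 / 7 * (q ^ 3 - 1) +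
      25 * (H * D) + 35 * D ^ 3 + (D + c) ^ 3 := by
    rw [pCube, cSix, kHat, ← hH, ← hD, hq]; ring
  rw [e2] at main
  rw [e1]
  have s1 := mul_le_mul_of_nonneg_left t6 hR
  have s2 := mul_le_mul_of_nonneg_right slope he
  have s3 := mul_le_mul_of_nonneg_right t5 (by linarith : 0 ≤ 8 / 5 * (19 / 10 - θ / 4))
  linarith

end Polynomials

/-! ### Comparison of the truncated second moments -/

lemma le_exp_neg_of_mono {b c D : ℝ} (hb : b ≤ 3 / 5) (hc : c ≤ 67 / 1000) (hD : 0 ≤ D) :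
    Real.exp (-(3 / 5 * D + 67 / 1000 * D ^ 2)) ≤ Real.exp (-(b * D + c * D ^ 2)) := by
  rw [Real.exp_le_exp]
  nlinarith [mul_le_mul_of_nonneg_right hb hD, mul_le_mul_of_nonneg_right hc (sq_nonneg D)]

/-- Comparison of the losses and the gains caused by the truncation. -/
lemma truncation_comparison {K b c D : ℝ} (hK : 181 / 100 ≤ K) (hb : b ≤ 3 / 5)
    (hc : c ≤ 67 / 1000) (hD : 0 ≤ D) {m : ℝ} (h1 : m ≤ 2 / Real.exp 1 * Real.exp (-(Real.sqrt 2 * D)))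
    (h2 : m ≤ 2 / Real.exp 1 * Real.exp (-(D ^ 2 / 2))) :
    m + min 1 (2 * m) ≤ K * Real.exp (-(b * D + c * D ^ 2)) := by
  have hR : 181 / 100 * Real.exp (-(3 / 5 * D + 67 / 1000 * D ^ 2)) ≤
      K * Real.exp (-(b * D + c * D ^ 2)) :=
    mul_le_mul hK (le_exp_neg_of_mono hb hc hD) (Real.exp_nonneg _) (by linarith)
  refine le_trans ?_ hR
  have he := Real.exp_one_gt_d9
  have hs2 : (1.4142 : ℝ) ≤ Real.sqrt 2 := Real.le_sqrt_of_sq_le (by norm_num)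
  have hs2' : Real.sqrt 2 ^ 2 = 2 := Real.sq_sqrt (by norm_num)
  have hpre : 2 / Real.exp 1 ≤ 0.7358 := by
    rw [div_le_iff₀ (Real.exp_pos 1)]; linarith
  -- For small D the cap 1 in the minimum is used. Otherwise the left side is at most 3m, where the
  -- bound exp(-√2 D) serves up to D = 4 and exp(-D²/2) beyond. The margin 41/200 in the exponent
  -- makes 3·(2/e) drop below 181/100.
  rcases le_total D (53 / 200) with hs | hs
  · have i1 : Real.exp (-(Real.sqrt 2 * D)) ≤ 1 - Real.sqrt 2 * D + D ^ 2 := by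
      have := exp_le_quadratic (y := -(Real.sqrt 2 * D)) le_rfl
        (Real.exp_le_one_iff.2 (by have : 0 ≤ Real.sqrt 2 * D := by positivity
                                   linarith))
      nlinarith
    have i2 := Real.add_one_le_exp (-(3 / 5 * D + 67 / 1000 * D ^ 2))
    have i3 : m ≤ 0.7358 * (1 - 1.4142 * D + D ^ 2) := by
      refine h1.trans (mul_le_mul hpre (i1.trans ?_) (Real.exp_nonneg _) (by norm_num))
      nlinarith
    have i4 : min 1 (2 * m) ≤ 1 := min_le_left _ _
    nlinarith
  · have i4 : m + min 1 (2 * m) ≤ 3 * m := by have := min_le_right 1 (2 * m); linarith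
    refine i4.trans ?_
    have fin : ∀ {y : ℝ}, m ≤ 2 / Real.exp 1 * Real.exp (-y) →
        3 / 5 * D + 67 / 1000 * D ^ 2 + 41 / 200 ≤ y →
        3 * m ≤ 181 / 100 * Real.exp (-(3 / 5 * D + 67 / 1000 * D ^ 2)) := by
      intro y hm hy
      have j1 : Real.exp (-y) ≤ Real.exp (-(3 / 5 * D + 67 / 1000 * D ^ 2)) * Real.exp (-(41 / 200)) := by
        rw [← Real.exp_add, Real.exp_le_exp]; linarith
      have j2 : Real.exp (-(41 / 200)) ≤ 1 + -(41 / 200) + (-(41 / 200)) ^ 2 / 2 * 1 :=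
        exp_le_quadratic le_rfl (Real.exp_le_one_iff.2 (by norm_num))
      have j3 : m ≤ 0.7358 * (Real.exp (-(3 / 5 * D + 67 / 1000 * D ^ 2)) * (1 - 41 / 200 + (41 / 200) ^ 2 / 2)) := by
        refine hm.trans (mul_le_mul hpre (j1.trans ?_) (Real.exp_nonneg _) (by norm_num))
        refine mul_le_mul_of_nonneg_left ?_ (Real.exp_nonneg _)
        norm_num at j2 ⊢
        exact j2
      have := Real.exp_pos (-(3 / 5 * D + 67 / 1000 * D ^ 2))
      linarith
    rcases le_total D 4 with h4 | h4
    · refine fin h1 ?_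
      nlinarith
    · refine fin h2 ?_
      nlinarith

lemma sinh_le_mul_cosh {h : ℝ} (hh : 0 ≤ h) : Real.sinh h ≤ h * Real.cosh h := by
  have hd : ∀ z : ℝ, HasDerivAt (fun z => z * Real.cosh z - Real.sinh z) (z * Real.sinh z) z :=
    fun z => by
      have := ((hasDerivAt_id z).mul (Real.hasDerivAt_cosh z)).sub (Real.hasDerivAt_sinh z)
      refine HasDerivAt.congr_deriv (f := fun z => z * Real.cosh z - Real.sinh z) this ?_
      simp
  have hm : MonotoneOn (fun z => z * Real.cosh z - Real.sinh z) (Ici 0) := by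
    refine monotoneOn_of_deriv_nonneg (convex_Ici 0) (by fun_prop)
      (fun z _ => (hd z).differentiableAt.differentiableWithinAt) fun z hz => ?_
    rw [interior_Ici] at hz
    rw [(hd z).deriv]
    exact mul_nonneg (le_of_lt hz) (Real.sinh_nonneg_iff.2 (le_of_lt hz))
  have := hm self_mem_Ici (mem_Ici.2 hh) hh
  simp at this
  linarith

/-- For a sign of mean θ ≥ 0 the upper tail is sub-Gaussian with the true variance 1 - θ²: the
quotient of the two sides decreases, since sinh z ≤ z cosh z. -/
lemma cosh_add_mul_sinh_le {θ h : ℝ} (h0 : 0 ≤ θ) (h1 : θ ≤ 1) (hh : 0 ≤ h) :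
    Real.cosh h + θ * Real.sinh h ≤ Real.exp (h * θ + h ^ 2 * (1 - θ ^ 2) / 2) := by
  set E : ℝ → ℝ := fun z => Real.exp (-(z * θ + z ^ 2 * (1 - θ ^ 2) / 2)) with hE
  set g : ℝ → ℝ := fun z => (Real.cosh z + θ * Real.sinh z) * E z with hg
  have hdE : ∀ z, HasDerivAt E (E z * (-(θ + z * (1 - θ ^ 2)))) z := fun z => by
    have := (((hasDerivAt_id z).mul_const θ).add
      (((hasDerivAt_pow 2 z).mul_const (1 - θ ^ 2)).div_const 2)).neg.exp
    refine HasDerivAt.congr_deriv (f := E) this ?_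
    simp [hE]
    ring
  have hd : ∀ z, HasDerivAt g ((Real.sinh z + θ * Real.cosh z) * E z +
      (Real.cosh z + θ * Real.sinh z) * (E z * (-(θ + z * (1 - θ ^ 2))))) z := fun z =>
    ((Real.hasDerivAt_cosh z).add ((Real.hasDerivAt_sinh z).const_mul θ)).mul (hdE z)
  have hm : AntitoneOn g (Ici 0) := by
    refine antitoneOn_of_deriv_nonpos (convex_Ici 0)
      (fun z _ => (hd z).continuousAt.continuousWithinAt)
      (fun z _ => (hd z).differentiableAt.differentiableWithinAt) fun z hz => ?_
    rw [interior_Ici] at hz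
    have hz' : 0 ≤ z := le_of_lt hz
    rw [(hd z).deriv]
    have e : (Real.sinh z + θ * Real.cosh z) * E z +
      (Real.cosh z + θ * Real.sinh z) * (E z * (-(θ + z * (1 - θ ^ 2)))) =
      -(E z * (1 - θ ^ 2) * (z * Real.cosh z - Real.sinh z + z * θ * Real.sinh z)) := by ring
    rw [e, neg_nonpos]
    have i1 := sinh_le_mul_cosh hz'
    have i2 : 0 ≤ Real.sinh z := Real.sinh_nonneg_iff.2 hz'
    have i3 : 0 ≤ 1 - θ ^ 2 := by nlinarith
    have i4 : 0 ≤ E z := Real.exp_nonneg _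
    have i5 : 0 ≤ z * θ * Real.sinh z := by positivity
    exact mul_nonneg (mul_nonneg i4 i3) (by linarith)
  have := hm self_mem_Ici (mem_Ici.2 hh) hh
  simp only [hg, hE] at this
  rw [Real.exp_neg, ← div_eq_mul_inv, div_le_iff₀ (Real.exp_pos _)] at this
  simpa using this

/-! ### The linearized truncation -/

section Truncation

variable {n : ℕ} {ρ : Measure (Bool × ℝ)} [IsProbabilityMeasure ρ] {a θ : ℝ}

lemma exp_mul_sg (h : ℝ) (b : Bool) : Real.exp (h * sg b) = Real.cosh h + sg b * Real.sinh h := by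
  cases b
  · rw [sg, if_neg (by simp), mul_neg_one, ← Real.cosh_sub_sinh]; ring
  · rw [sg, if_pos rfl, mul_one, ← Real.cosh_add_sinh]; ring

lemma PairLaw.integral_exp_sg (h : PairLaw ρ a θ) (η : ℝ) :
    ∫ p, Real.exp (η * sg p.1) ∂ρ = Real.cosh η + θ * Real.sinh η := by
  simp_rw [exp_mul_sg]
  rw [integral_add (integrable_const _) (tame_sg.integrable.mul_const _), integral_mul_const, h.eU]
  simp

lemma PairLaw.integral_exp_uu (h : PairLaw ρ a θ) (h0 : 0 ≤ θ) (h1 : θ ≤ 1) {η : ℝ} (hη : 0 ≤ η) :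
    ∫ p, Real.exp (η * uu θ p) ∂ρ ≤ Real.exp (η ^ 2 * (1 - θ ^ 2) / 2) := by
  have e : ∀ p : Bool × ℝ, Real.exp (η * uu θ p) = Real.exp (-(η * θ)) * Real.exp (η * sg p.1) :=
    fun p => by rw [← Real.exp_add, uu]; ring_nf
  simp_rw [e]
  rw [integral_const_mul, h.integral_exp_sg]
  refine (mul_le_mul_of_nonneg_left (cosh_add_mul_sinh_le h0 h1 hη) (Real.exp_nonneg _)).trans ?_
  rw [← Real.exp_add]
  exact (congrArg Real.exp (by ring)).le

lemma PairLaw.integral_exp_neg_uu (h : PairLaw ρ a θ) (h0 : 0 ≤ θ) (h1 : θ ≤ 1) {η : ℝ}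
    (hη : 0 ≤ η) :
    ∫ p, Real.exp (η * (-uu θ p - 2 * θ)) ∂ρ ≤ Real.exp (η ^ 2 * (1 - θ ^ 2) / 2) := by
  have e : ∀ p : Bool × ℝ, Real.exp (η * (-uu θ p - 2 * θ)) =
      Real.exp (-(η * θ)) * Real.exp ((-η) * sg p.1) :=
    fun p => by rw [← Real.exp_add, uu]; ring_nf
  simp_rw [e]
  rw [integral_const_mul, h.integral_exp_sg, Real.cosh_neg, Real.sinh_neg]
  have i2 : 0 ≤ θ * Real.sinh η := mul_nonneg h0 (Real.sinh_nonneg_iff.2 hη)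
  refine (mul_le_mul_of_nonneg_left (le_trans (by linarith) (cosh_add_mul_sinh_le h0 h1 hη))
    (Real.exp_nonneg _)).trans ?_
  rw [← Real.exp_add]
  exact (congrArg Real.exp (by ring)).le

/-- Truncated second moments of sums with sub-Gaussian upper tails. -/
lemma integral_sq_posPart_le {f : Bool × ℝ → ℝ} (hf : AEStronglyMeasurable f ρ) {B V D : ℝ}
    (hn : 0 < n) (hV : 0 < V) (hD : 0 ≤ D) (hB : ∀ p, f p ≤ B)
    (hW : ∀ η, 0 ≤ η → ∫ p, Real.exp (η * f p) ∂ρ ≤ Real.exp (η ^ 2 * V / 2)) :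
    ∫ x : Fin n → Bool × ℝ, max (Sm f x - D * Real.sqrt (n * V)) 0 ^ 2 ∂(Measure.pi fun _ => ρ) ≤
        n * V * (2 / Real.exp 1 * Real.exp (-(Real.sqrt 2 * D))) ∧
    ∫ x : Fin n → Bool × ℝ, max (Sm f x - D * Real.sqrt (n * V)) 0 ^ 2 ∂(Measure.pi fun _ => ρ) ≤
        n * V * (2 / Real.exp 1 * Real.exp (-(D ^ 2 / 2))) := by
  have hn' : (0 : ℝ) < n := by exact_mod_cast hn
  set S := Real.sqrt (n * V) with hS
  have hS0 : 0 < S := Real.sqrt_pos.2 (by positivity)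
  have hS2 : S ^ 2 = n * V := Real.sq_sqrt (by positivity)
  have h2 : Real.sqrt 2 ^ 2 = 2 := Real.sq_sqrt (by norm_num)
  have h2' : 0 < Real.sqrt 2 := Real.sqrt_pos.2 (by norm_num)
  have key : ∀ η, 0 < η → ∫ x : Fin n → Bool × ℝ, max (Sm f x - D * S) 0 ^ 2
      ∂(Measure.pi fun _ => ρ) ≤ n * V * (4 / (Real.exp 1 ^ 2 * η ^ 2) * Real.exp (η ^ 2 / 2 - η * D)) := by
    intro η hη
    refine (integral_posPart_pow_le (n := n) (τ := D * S) hf two_pos (div_pos hη hS0) hB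
      (hW _ (div_pos hη hS0).le)).trans (le_of_eq ?_)
    have e1 : n * ((η / S) ^ 2 * V / 2) - η / S * (D * S) = η ^ 2 / 2 - η * D := by
      rw [div_pow, hS2]; field_simp
    rw [e1, ← hS2]
    push_cast
    field_simp
    norm_num
  have he := Real.exp_pos 1
  constructor
  · refine (key _ h2').trans (le_of_eq ?_)
    rw [h2, sub_eq_add_neg, Real.exp_add, show (2 : ℝ) / 2 = 1 by norm_num]
    field_simp
    norm_num
  · refine (key (D + Real.sqrt 2) (by positivity)).trans ?_
    refine mul_le_mul_of_nonneg_left ?_ (by positivity)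
    have e1 : (D + Real.sqrt 2) ^ 2 / 2 - (D + Real.sqrt 2) * D = 1 + -(D ^ 2 / 2) := by
      linear_combination h2 / 2
    rw [e1, Real.exp_add, ← mul_assoc]
    refine mul_le_mul_of_nonneg_right ?_ (Real.exp_nonneg _)
    rw [div_mul_eq_mul_div, div_le_div_iff₀ (by positivity) he]
    have : 2 ≤ (D + Real.sqrt 2) ^ 2 := by nlinarith [mul_nonneg hD h2'.le]
    nlinarith [pow_pos he 2]

/-- If z ≤ b and b ≥ 0, the difference of the two sides is (b+z)²/2. The losses thus depend on the
truncation levels b and c alone, and the term (b - z)₊² is the gain that has to compensate them. By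
b + c ≤ 0 at most one level is positive. -/
lemma max_sq_sub_sq_le {z b c : ℝ} (hbc : b + c ≤ 0) :
    max z (max b c) ^ 2 - z ^ 2 ≤ 2 * max b 0 ^ 2 + max c 0 ^ 2 - max (b - z) 0 ^ 2 / 2 := by
  rcases le_total b 0 with hb | hb
  · rw [max_eq_right hb]
    rcases le_total c 0 with hc | hc
    · rw [max_eq_right hc]
      rcases le_total z (max b c) with hz | hz
      · rw [max_eq_right hz]
        have h0 : max b c ≤ 0 := max_le hb hc
        have hb' : b ≤ max b c := le_max_left _ _
        rcases le_total (b - z) 0 with h | h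
        · rw [max_eq_right h]; nlinarith
        · rw [max_eq_left h]; nlinarith
      · rw [max_eq_left hz, max_eq_right (by have := le_max_left b c; linarith)]
        simp
    · rw [max_eq_left hc, max_eq_right (hb.trans hc)]
      rcases le_total z c with hz | hz
      · rw [max_eq_right hz]
        rcases le_total (b - z) 0 with h | h
        · rw [max_eq_right h]; nlinarith
        · rw [max_eq_left h]; nlinarith
      · rw [max_eq_left hz, max_eq_right (by linarith)]
        nlinarith
  · rw [max_eq_left hb, max_eq_right (by linarith : c ≤ 0), max_eq_left (by linarith : c ≤ b)]
    rcases le_total z b with hz | hz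
    · rw [max_eq_right hz, max_eq_left (by linarith)]
      nlinarith [sq_nonneg (b + z)]
    · rw [max_eq_left hz, max_eq_right (by linarith)]
      nlinarith

lemma PairLaw.tame_pp (h : PairLaw ρ a θ) : Tame (fun q => kap θ * uu θ q - yy a θ q) ρ := by
  have := h.tame_yy
  fun_prop

lemma PairLaw.int_pp_sq (h : PairLaw ρ a θ) :
    ∫ q, (kap θ * uu θ q - yy a θ q) ^ 2 ∂ρ = pSq a θ := by
  have hy := h.tame_yy
  have e : ∀ q : Bool × ℝ, (kap θ * uu θ q - yy a θ q) ^ 2 = kap θ ^ 2 * uu θ q ^ 2 +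
      (-(2 * kap θ)) * (yy a θ q * uu θ q) + yy a θ q ^ 2 := fun q => by ring
  simp_rw [e]
  rw [integral_add, integral_add, integral_const_mul, integral_const_mul, h.int_uu_sq, h.int_yy_uu,
    h.int_yy_sq]
  · rw [pSq]; ring
  all_goals exact Tame.integrable (by fun_prop)

lemma PairLaw.int_pp (h : PairLaw ρ a θ) : ∫ q, (kap θ * uu θ q - yy a θ q) ∂ρ = 0 := by
  have hy := h.tame_yy
  rw [integral_sub (Tame.integrable (by fun_prop)) hy.integrable, integral_const_mul, h.int_uu,
    h.int_yy]
  ring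

/-- The variable equals w - v² with 0 ≤ w ≤ c, so its absolute cube is at most v⁶ + c³; the sixth
moment of v is bounded by `cSix`. -/
lemma PairLaw.int_pp_cube (h : PairLaw ρ a θ) (h0 : 0 ≤ θ) (h1 : θ ≤ 3 / 5) (hκ : kap θ ≤ a) :
    ∫ q, |kap θ * uu θ q - yy a θ q| ^ 3 ∂ρ ≤ pCube a θ := by
  have ht := h.tame
  have hk0 : 0 ≤ kap θ := by rw [kap]; linarith
  have hd0 := dHat_mono (θ := θ) hk0 hκ
  set c := dHat a θ + 1 / 2 + 2 * θ with hc
  have hdk : (1 / 2 - 5 / 2 * θ) * (1 + θ) ≤ dHat (kap θ) θ ∧ (5 / 2 * θ - 1 / 2) * (1 - θ) ≤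
      dHat (kap θ) θ := by
    constructor <;> rw [dHat, kap] <;> nlinarith
  have hpt : ∀ q : Bool × ℝ, |kap θ * uu θ q - yy a θ q| ^ 3 ≤ q.2 ^ 6 + c ^ 3 := fun q => by
    have hx := sq_nonneg q.2
    have e : kap θ * uu θ q - yy a θ q = (1 / 2 - 5 / 2 * θ) * uu θ q + dHat a θ - q.2 ^ 2 := by
      rw [yy, kap]; ring
    have hw : 0 ≤ (1 / 2 - 5 / 2 * θ) * uu θ q + dHat a θ ∧
        (1 / 2 - 5 / 2 * θ) * uu θ q + dHat a θ ≤ c := by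
      rw [uu, hc]
      rcases q with ⟨_ | _, v⟩ <;> simp only [sg] <;> simp <;> constructor <;>
        nlinarith [hdk.1, hdk.2]
    rw [e]
    set w := (1 / 2 - 5 / 2 * θ) * uu θ q + dHat a θ
    rcases le_total w (q.2 ^ 2) with hle | hle
    · rw [abs_of_nonpos (by linarith)]
      have : (-(w - q.2 ^ 2)) ^ 3 ≤ (q.2 ^ 2) ^ 3 :=
        pow_le_pow_left₀ (by linarith) (by linarith [hw.1]) 3
      have : 0 ≤ c ^ 3 := pow_nonneg (hw.1.trans hw.2) 3
      linarith
    · rw [abs_of_nonneg (by linarith)]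
      have : (w - q.2 ^ 2) ^ 3 ≤ c ^ 3 := pow_le_pow_left₀ (by linarith) (by linarith [hw.2]) 3
      have : 0 ≤ q.2 ^ 6 := by positivity
      linarith
  have hp := h.tame_pp.abs
  refine (integral_mono (Tame.integrable (by fun_prop)) (Tame.integrable (by fun_prop)) hpt).trans ?_
  rw [integral_add (Tame.integrable (by fun_prop)) (integrable_const _)]
  simp only [integral_const, probReal_univ, one_smul]
  rw [pCube, ← hc]
  linarith [h.eV6]

/-- This and the next two inequalities yield K ≥ 1.81, b ≤ 3/5 and c ≤ 0.067 in
`exists_truncation_constants`. There 1/4 - 77θ/200 is half the smoothing width in units of √n times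
the standard deviation, and 399/250 bounds 4/√(2π). -/
lemma le_pSq_kap_mul (h0 : 0 ≤ θ) (h1 : θ ≤ 3 / 5) :
    181 / 25 * (kap θ ^ 2 * (1 - θ ^ 2)) ≤ pSq (kap θ) θ *
      (1 - ((1 / 4 - 77 / 200 * θ) ^ 2 / 2 + 399 / 250 * (1 / 4 - 77 / 200 * θ)) / 2) ^ 2 := by
  have b := bernstein_nonneg h0 h1
  rw [pSq, sSq, hHat, dHat, kap]
  linarith [b 0 8, b 1 7, b 2 6, b 3 5, b 4 4, b 5 3, b 6 2, b 7 1, b 8 0]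

lemma kap_mul_le_pSq_kap (h0 : 0 ≤ θ) (h1 : θ ≤ 3 / 5) :
    kap θ ^ 2 * (1 - θ ^ 2) * (399 / 250 + (1 / 4 - 77 / 200 * θ)) ^ 2 ≤
      9 / 25 * pSq (kap θ) θ := by
  have b := bernstein_nonneg h0 h1
  rw [pSq, sSq, hHat, dHat, kap]
  linarith [b 0 6, b 1 5, b 2 4, b 3 3, b 4 2, b 5 1, b 6 0]

lemma kap_le_pSq_kap (h0 : 0 ≤ θ) (h1 : θ ≤ 3 / 5) :
    kap θ ^ 2 * (1 - θ ^ 2) ≤ 67 / 500 * pSq (kap θ) θ := by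
  have b := bernstein_nonneg h0 h1
  rw [pSq, sSq, hHat, dHat, kap]
  linarith [b 0 4, b 1 3, b 2 2, b 3 1, b 4 0]

/-- The error of the normal approximation in the units of the final expansion; 35/2 + 125θ is the
constant that the third order terms can still absorb. -/
lemma pCube_div_le (h0 : 0 ≤ θ) (h1 : θ ≤ 3 / 5) (hκ : kap θ ≤ a) (ha : a ≤ 1) {s : ℝ}
    (hm : 0 ≤ pCube a θ) (hs : 19 / 10 - θ / 4 ≤ s) (hs2 : s ^ 2 = pSq a θ) :
    (pCube a θ + 1.6 * s ^ 3) / (6 * (1 / 4 - 77 / 200 * θ) * s) ≤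
      16 * a ^ 3 * (35 / 2 + 125 * θ) := by
  have hk : 1 / 2 ≤ kap θ := by rw [kap]; linarith
  have ha0 : 0 < a ^ 3 := pow_pos (by linarith) 3
  have hell : 0 < 1 / 4 - 77 / 200 * θ := by linarith
  have hw : 0 < 19 / 10 - θ / 4 := by linarith
  have hs0 : 0 < s := hw.trans_le hs
  have i1 := pCube_le h0 h1 hκ ha
  rw [← hs2] at i1
  have i2 : pCube a θ + 8 / 5 * s ^ 3 ≤ 420 * (1 - θ) * a ^ 3 * s := by
    have j1 : 8 / 5 * s ^ 2 ≤ 420 * (1 - θ) * a ^ 3 := by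
      refine le_of_mul_le_mul_right ?_ hw
      linarith
    linarith [mul_le_mul_of_nonneg_right hs (sub_nonneg.2 j1)]
  have i3 : 35 / 4 * (1 - θ) ≤ 2 * (1 / 4 - 77 / 200 * θ) * (35 / 2 + 125 * θ) := by
    have := bernstein_nonneg h0 h1 1 1
    linarith
  rw [div_le_iff₀ (by positivity)]
  have i4 := mul_le_mul_of_nonneg_right i3 (by positivity : 0 ≤ a ^ 3 * s)
  norm_num
  linarith

/-- The comparison of the exponents in the lower bound for the truncated second moment. -/
lemma exists_truncation_constants {N S ell s W m0 m b3 p p0 ω D : ℝ} (hN : 0 < N) (hS0 : 0 < S)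
    (hS2 : S ^ 2 = N) (hell0 : 0 < ell) (hell1 : ell ≤ 1 / 4) (hm00 : 0 ≤ m0)
    (hm0' : m0 ≤ 399 / 250) (hs0 : 0 < s) (hs2 : s ^ 2 = p) (hW0 : 0 < W) (hW2 : W ^ 2 = ω)
    (hmono : p0 ≤ p) (q1 : 181 / 25 * ω ≤ p0 * (1 - (ell ^ 2 / 2 + 399 / 250 * ell) / 2) ^ 2)
    (q2 : ω * (399 / 250 + ell) ^ 2 ≤ 9 / 25 * p0) (q3 : ω ≤ 67 / 500 * p0)
    (herr : (m + 1.6 * s ^ 3) / (6 * ell * s) ≤ b3) :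
    ∃ K b c : ℝ, 181 / 100 ≤ K ∧ b ≤ 3 / 5 ∧ c ≤ 67 / 1000 ∧
      2 * N * ω * (K * Real.exp (-(b * D + c * D ^ 2))) - N * b3 / S ≤
      N * s ^ 2 / 2 * Real.exp (-((D * (S * W) + 2 * ell * (S * s) / 2) ^ 2 / (2 * (N * s ^ 2)) +
        m0 * ((D * (S * W) + 2 * ell * (S * s) / 2) / (S * s)))) -
        N / (3 * (2 * ell * (S * s))) * (m + 1.6 * s ^ 3) := by
  have hω0 : 0 < ω := by rw [← hW2]; positivity
  have hp0 : 0 < p := by rw [← hs2]; positivity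
  have hr2 : (W / s) ^ 2 = ω / p := by rw [div_pow, hW2, hs2]
  have hr0 : 0 < W / s := div_pos hW0 hs0
  -- With r = W/s these are the constant, linear and quadratic parts in D of the exponent (rD +
  -- ℓ)²/2 + m₀(rD + ℓ).
  refine ⟨p / (4 * ω) * Real.exp (-(ell ^ 2 / 2 + m0 * ell)), W / s * (ell + m0), (W / s) ^ 2 / 2,
    ?_, ?_, ?_, ?_⟩
  · obtain ⟨y, hy⟩ : ∃ y, y = ell ^ 2 / 2 + 399 / 250 * ell := ⟨_, rfl⟩
    rw [← hy] at q1
    have hy1 : y ≤ 2 := by rw [hy]; nlinarith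
    have e1 : (1 - y / 2) ^ 2 ≤ Real.exp (-(ell ^ 2 / 2 + m0 * ell)) := by
      have i1 := Real.add_one_le_exp (-(y / 2))
      have i2 : (1 - y / 2) ^ 2 ≤ Real.exp (-(y / 2)) ^ 2 :=
        pow_le_pow_left₀ (by linarith) (by linarith) 2
      refine i2.trans ?_
      rw [← Real.exp_nat_mul, Real.exp_le_exp]
      push_cast
      nlinarith
    have e2 : 181 / 25 * ω ≤ p * (1 - y / 2) ^ 2 :=
      q1.trans (mul_le_mul_of_nonneg_right hmono (sq_nonneg _))
    rw [div_mul_eq_mul_div, le_div_iff₀ (by positivity)]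
    have := mul_le_mul_of_nonneg_left e1 hp0.le
    linarith
  · refine abs_le_of_sq_le_sq' ?_ (by norm_num) |>.2
    rw [mul_pow, hr2, div_mul_eq_mul_div, div_le_iff₀ hp0]
    have i1 : (ell + m0) ^ 2 ≤ (399 / 250 + ell) ^ 2 :=
      pow_le_pow_left₀ (by positivity) (by linarith) 2
    have i3 := mul_le_mul_of_nonneg_left i1 hω0.le
    norm_num
    linarith
  · rw [hr2, div_div, div_le_iff₀ (by positivity)]
    linarith
  · refine sub_le_sub (le_of_eq ?_) ?_
    · have e1 : (D * (S * W) + 2 * ell * (S * s) / 2) ^ 2 / (2 * (N * s ^ 2)) =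
          (W / s * D + ell) ^ 2 / 2 := by
        rw [← hS2]; field_simp
      have e2 : (D * (S * W) + 2 * ell * (S * s) / 2) / (S * s) =
          W / s * D + ell := by
        field_simp
      rw [e1, e2, mul_assoc (p / (4 * ω)), ← Real.exp_add, hs2]
      have e3 : -(ell ^ 2 / 2 + m0 * ell) + -(W / s * (ell + m0) * D + (W / s) ^ 2 / 2 * D ^ 2) =
          -((W / s * D + ell) ^ 2 / 2 + m0 * (W / s * D + ell)) := by ring
      rw [e3]
      field_simp
      norm_num
    · have e : N / (3 * (2 * ell * (S * s))) * (m + 1.6 * s ^ 3) =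
          N * ((m + 1.6 * s ^ 3) / (6 * ell * s)) / S := by
        field_simp
        ring
      rw [e]
      gcongr

/-- The gain from below: `le_integral_sq_posPart` for κu - y, with smoothing width proportional to
√n times its standard deviation, so that the error is of relative order n^(-1/2). -/
lemma exists_le_integral_truncated (h : PairLaw ρ a θ) (h0 : 0 ≤ θ) (h1 : θ ≤ 3 / 5)
    (hκ : kap θ ≤ a) (ha : a ≤ 1) (hn : 0 < n) {D : ℝ} (hD : 0 ≤ D) :
    ∃ K b c : ℝ, 181 / 100 ≤ K ∧ b ≤ 3 / 5 ∧ c ≤ 67 / 1000 ∧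
      2 * n * (kap θ ^ 2 * (1 - θ ^ 2)) * (K * Real.exp (-(b * D + c * D ^ 2))) -
        n * (16 * a ^ 3 * (35 / 2 + 125 * θ)) / Real.sqrt n ≤
      ∫ x : Fin n → Bool × ℝ, max (Sm (fun q => kap θ * uu θ q - yy a θ q) x -
        D * (Real.sqrt n * Real.sqrt (kap θ ^ 2 * (1 - θ ^ 2)))) 0 ^ 2 ∂(Measure.pi fun _ => ρ) := by
  have hN : (0 : ℝ) < n := by exact_mod_cast hn
  have hS0 : 0 < Real.sqrt n := Real.sqrt_pos.2 hN
  have hS2 : Real.sqrt n ^ 2 = n := Real.sq_sqrt hN.le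
  have hκ0 : 1 / 2 ≤ kap θ := by rw [kap]; linarith
  have hd0 := dHat_kap_nonneg h0 (by linarith : θ ≤ 1)
  have hmono := pSq_mono (θ := θ) (by linarith : 0 ≤ kap θ) hκ hd0
  have hw0 : 0 < 19 / 10 - θ / 4 := by linarith
  have hwp : (19 / 10 - θ / 4) ^ 2 ≤ pSq a θ := (le_pSq_kap h0 h1).trans hmono
  have q1 := le_pSq_kap_mul h0 h1
  have q2 := kap_mul_le_pSq_kap h0 h1
  have q3 := kap_le_pSq_kap h0 h1
  have hω0 : 0 < kap θ ^ 2 * (1 - θ ^ 2) := by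
    have : 0 < 1 - θ ^ 2 := by nlinarith
    positivity
  obtain ⟨s, hs⟩ : ∃ s, s = Real.sqrt (pSq a θ) := ⟨_, rfl⟩
  have hws : 19 / 10 - θ / 4 ≤ s := hs ▸ Real.le_sqrt_of_sq_le hwp
  have hs0 : 0 < s := hw0.trans_le hws
  have hs2 : s ^ 2 = pSq a θ := by rw [hs]; exact Real.sq_sqrt ((sq_nonneg _).trans hwp)
  have hell0 : 0 < 1 / 4 - 77 / 200 * θ := by linarith
  have hell1 : 1 / 4 - 77 / 200 * θ ≤ 1 / 4 := by linarith
  have hm0' : 4 / Real.sqrt (2 * Real.pi) ≤ 399 / 250 := by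
    have hpi := Real.pi_gt_d4
    have h2 : (1000 / 399 : ℝ) ≤ Real.sqrt (2 * Real.pi) :=
      Real.le_sqrt_of_sq_le (by norm_num at hpi ⊢; linarith)
    rw [div_le_iff₀ (by linarith)]; linarith
  have hcube := h.int_pp_cube h0 h1 hκ
  have hm : 0 ≤ pCube a θ := (integral_nonneg fun q => by positivity).trans hcube
  obtain ⟨K, b, c, hK, hb, hc, hle⟩ := exists_truncation_constants (D := D) hN hS0 hS2 hell0 hell1
    (by positivity) hm0' hs0 hs2 (Real.sqrt_pos.2 hω0) (Real.sq_sqrt hω0.le) hmono q1 q2 q3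
    (pCube_div_le h0 h1 hκ ha hm hws hs2)
  exact ⟨K, b, c, hK, hb, hc, hle.trans (le_integral_sq_posPart ρ h.tame_pp hn h.int_pp
    (L := 2 * (1 / 4 - 77 / 200 * θ) * (Real.sqrt n * s)) hs0 (h.int_pp_sq.trans hs2.symm) hcube
    (by positivity) (by positivity))⟩

/-- The two positive parts are never both nonzero, and the sum of their squares is at most the
square of the sum of the u's. Hence the second moments E₁ and E₂ satisfy E₁ + E₂ ≤ n(1-θ²), and 2E₁
+ E₂ = E₁ + (E₁ + E₂) explains the minimum with 1. -/
lemma exists_integral_truncated_le (h : PairLaw ρ a θ) (h0 : 0 ≤ θ) (h1 : θ < 1)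
    (hn : 0 < n) {D : ℝ} (hD : 0 ≤ D) :
    ∃ m : ℝ, m ≤ 2 / Real.exp 1 * Real.exp (-(Real.sqrt 2 * D)) ∧
      m ≤ 2 / Real.exp 1 * Real.exp (-(D ^ 2 / 2)) ∧
      2 * ∫ x : Fin n → Bool × ℝ, max (Sm (uu θ) x - D * Real.sqrt (n * (1 - θ ^ 2))) 0 ^ 2
        ∂(Measure.pi fun _ => ρ) +
      ∫ x : Fin n → Bool × ℝ, max (Sm (fun q => -uu θ q - 2 * θ) x -
        D * Real.sqrt (n * (1 - θ ^ 2))) 0 ^ 2 ∂(Measure.pi fun _ => ρ) ≤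
      n * (1 - θ ^ 2) * (m + min 1 (2 * m)) := by
  have hN : (0 : ℝ) < n := by exact_mod_cast hn
  have hV0 : 0 < 1 - θ ^ 2 := by nlinarith
  have hu := tame_uu ρ θ
  have hfb : Tame (fun q => -uu θ q - 2 * θ) ρ := by fun_prop
  obtain ⟨ha1, ha2⟩ := integral_sq_posPart_le (n := n) hu.aestronglyMeasurable
    (B := 1 - θ) hn hV0 hD (fun q => by rw [uu]; linarith [(abs_le.1 (abs_sg q.1).le).2])
    (fun η hη => h.integral_exp_uu h0 h1.le hη)
  obtain ⟨hb1, hb2⟩ := integral_sq_posPart_le (n := n) hfb.aestronglyMeasurable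
    (B := 1) hn hV0 hD (fun q => by rw [uu]; linarith [(abs_le.1 (abs_sg q.1).le).1])
    (fun η hη => h.integral_exp_neg_uu h0 h1.le hη)
  have hc0 : 0 ≤ D * Real.sqrt (n * (1 - θ ^ 2)) := by positivity
  generalize D * Real.sqrt (n * (1 - θ ^ 2)) = c at *
  have hta : Tame (fun x : Fin n → Bool × ℝ => max (Sm (uu θ) x - c) 0 ^ 2)
      (Measure.pi fun _ => ρ) := by
    have := hu.Sm (n := n) ρ
    fun_prop
  have htb : Tame (fun x : Fin n → Bool × ℝ => max (Sm (fun q => -uu θ q - 2 * θ) x - c) 0 ^ 2)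
      (Measure.pi fun _ => ρ) := by
    have := hfb.Sm (n := n) ρ
    fun_prop
  have hsum : ∫ x : Fin n → Bool × ℝ, max (Sm (uu θ) x - c) 0 ^ 2 ∂(Measure.pi fun _ => ρ) +
      ∫ x : Fin n → Bool × ℝ, max (Sm (fun q => -uu θ q - 2 * θ) x - c) 0 ^ 2
        ∂(Measure.pi fun _ => ρ) ≤ n * (1 - θ ^ 2) := by
    rw [← integral_add hta.integrable htb.integrable, ← h.int_uu_sq,
      ← integral_Sm_sq ρ hu h.int_uu]
    refine integral_mono (hta.add htb).integrable ((hu.Sm ρ).pow 2).integrable fun x => ?_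
    have e : Sm (fun q => -uu θ q - 2 * θ) x = -Sm (uu θ) x - 2 * θ * n := by
      simp [Sm, Finset.sum_sub_distrib, mul_comm]
    have i : 0 ≤ 2 * θ * n := by positivity
    simp only [e]
    rcases le_total (Sm (uu θ) x) c with h | h
    · rw [max_eq_right (by linarith)]
      rcases le_total (-Sm (uu θ) x - 2 * θ * n - c) 0 with h' | h'
      · rw [max_eq_right h']; nlinarith
      · rw [max_eq_left h']; nlinarith
    · rw [max_eq_left (by linarith), max_eq_right (by linarith)]
      nlinarith
  generalize ∫ x : Fin n → Bool × ℝ, max (Sm (uu θ) x - c) 0 ^ 2 ∂(Measure.pi fun _ => ρ) = Ea at *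
  generalize ∫ x : Fin n → Bool × ℝ, max (Sm (fun q => -uu θ q - 2 * θ) x - c) 0 ^ 2
        ∂(Measure.pi fun _ => ρ) = Eb at *
  have hnV : 0 < n * (1 - θ ^ 2) := by positivity
  refine ⟨max Ea Eb / (n * (1 - θ ^ 2)), ?_, ?_, ?_⟩
  · rw [div_le_iff₀ hnV, mul_comm]; exact max_le ha1 hb1
  · rw [div_le_iff₀ hnV, mul_comm]; exact max_le ha2 hb2
  · rw [mul_add, mul_div_cancel₀ _ hnV.ne', mul_min_of_nonneg _ _ hnV.le, mul_left_comm,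
      mul_div_cancel₀ _ hnV.ne', mul_one]
    have i1 := le_max_left Ea Eb
    have i2 := le_max_right Ea Eb
    rcases min_choice (n * (1 - θ ^ 2)) (2 * max Ea Eb) with h | h <;> rw [h] <;> linarith

/-- The second moment of the linearized truncated estimate exceeds the one of the untruncated
estimate only in the third order. -/
lemma PairLaw.integral_max_sq_le (h : PairLaw ρ a θ) (h0 : 0 ≤ θ) (h1 : θ ≤ 3 / 5)
    (hκ : kap θ ≤ a) (ha : a ≤ 1) (hn : 2 ≤ n) :
    ∫ x : Fin n → Bool × ℝ, max (z1 a θ x) (kap θ * |θ + dl θ x| - kap θ * θ - (a ^ 2 - kap θ ^ 2)) ^ 2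
      ∂(Measure.pi fun _ => ρ) ≤
    sSq a θ / n + 8 * a ^ 3 * (35 / 2 + 125 * θ) / (n * Real.sqrt n) := by
  have hn0 : 0 < n := by omega
  have hN : (0 : ℝ) < n := by exact_mod_cast hn0
  have hS0 : 0 < Real.sqrt n := Real.sqrt_pos.2 hN
  have hS2 : Real.sqrt n ^ 2 = n := Real.sq_sqrt hN.le
  have hκ0 : 1 / 2 ≤ kap θ := by rw [kap]; linarith
  have hV0 : 0 < 1 - θ ^ 2 := by nlinarith
  have hd0 : 0 ≤ a ^ 2 - kap θ ^ 2 := by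
    have := pow_le_pow_left₀ (by linarith : 0 ≤ kap θ) hκ 2; linarith
  have hW : Real.sqrt (kap θ ^ 2 * (1 - θ ^ 2)) = kap θ * Real.sqrt (1 - θ ^ 2) := by
    rw [Real.sqrt_mul (sq_nonneg _), Real.sqrt_sq (by linarith)]
  have hV0' : 0 < Real.sqrt (1 - θ ^ 2) := Real.sqrt_pos.2 hV0
  have hD0 : 0 ≤ n * (a ^ 2 - kap θ ^ 2) / (Real.sqrt n * (kap θ * Real.sqrt (1 - θ ^ 2))) := by
    positivity
  -- D is the distance a² - κ² from the boundary, measured in standard deviations of κδ.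
  obtain ⟨D, hD⟩ : ∃ D, D = n * (a ^ 2 - kap θ ^ 2) / (Real.sqrt n * (kap θ * Real.sqrt (1 - θ ^ 2))) :=
    ⟨_, rfl⟩
  rw [← hD] at hD0
  obtain ⟨K, b, c, hK, hb, hc, hgain⟩ := exists_le_integral_truncated h h0 h1 hκ ha hn0 hD0
  obtain ⟨m, hm1, hm2, hloss⟩ := exists_integral_truncated_le h h0 (by linarith) hn0 hD0
  have hcomp := truncation_comparison hK hb hc hD0 hm1 hm2
  have eD1 : D * (Real.sqrt n * Real.sqrt (kap θ ^ 2 * (1 - θ ^ 2))) = n * (a ^ 2 - kap θ ^ 2) := by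
    rw [hW, hD]; field_simp
  have eD2 : D * Real.sqrt (n * (1 - θ ^ 2)) = n * ((a ^ 2 - kap θ ^ 2) / kap θ) := by
    rw [Real.sqrt_mul hN.le, hD]; field_simp
  rw [eD1] at hgain
  rw [eD2] at hloss
  clear eD1 eD2 hD hm1 hm2
  generalize K * Real.exp (-(b * D + c * D ^ 2)) = G at *
  generalize hb3 : 35 / 2 + 125 * θ = b3 at *
  have tu := tame_uu ρ θ
  have ty := h.tame_yy
  have tp := h.tame_pp
  have t1 : Tame (fun x : Fin n → Bool × ℝ =>
      max (Sm (uu θ) x - n * ((a ^ 2 - kap θ ^ 2) / kap θ)) 0 ^ 2) (Measure.pi fun _ => ρ) := by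
    have := tu.Sm (n := n) ρ
    fun_prop
  have t2 : Tame (fun x : Fin n → Bool × ℝ => max (Sm (fun q => -uu θ q - 2 * θ) x -
      n * ((a ^ 2 - kap θ ^ 2) / kap θ)) 0 ^ 2) (Measure.pi fun _ => ρ) := by
    have : Tame (fun q => -uu θ q - 2 * θ) ρ := by fun_prop
    have := this.Sm (n := n) ρ
    fun_prop
  have t3 : Tame (fun x : Fin n → Bool × ℝ => max (Sm (fun q => kap θ * uu θ q - yy a θ q) x -
      n * (a ^ 2 - kap θ ^ 2)) 0 ^ 2) (Measure.pi fun _ => ρ) := by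
    have := tp.Sm (n := n) ρ
    fun_prop
  have tz := h.tame_z1 (n := n)
  have td := tame_dl (n := n) ρ θ
  have hpt : ∀ x : Fin n → Bool × ℝ,
      max (z1 a θ x) (kap θ * |θ + dl θ x| - kap θ * θ - (a ^ 2 - kap θ ^ 2)) ^ 2 ≤
      z1 a θ x ^ 2 + ((kap θ / n) ^ 2 * (2 *
      max (Sm (uu θ) x - n * ((a ^ 2 - kap θ ^ 2) / kap θ)) 0 ^ 2 +
      max (Sm (fun q => -uu θ q - 2 * θ) x - n * ((a ^ 2 - kap θ ^ 2) / kap θ)) 0 ^ 2) -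
      1 / (2 * n ^ 2) * max (Sm (fun q => kap θ * uu θ q - yy a θ q) x -
      n * (a ^ 2 - kap θ ^ 2)) 0 ^ 2) := fun x => by
    have key := max_sq_sub_sq_le (z := z1 a θ x) (b := kap θ * dl θ x - (a ^ 2 - kap θ ^ 2))
      (c := -(kap θ * dl θ x) - 2 * kap θ * θ - (a ^ 2 - kap θ ^ 2)) (by
        have : 0 ≤ kap θ * θ := by positivity
        linarith)
    have e1 : kap θ * |θ + dl θ x| - kap θ * θ - (a ^ 2 - kap θ ^ 2) =
        max (kap θ * dl θ x - (a ^ 2 - kap θ ^ 2))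
          (-(kap θ * dl θ x) - 2 * kap θ * θ - (a ^ 2 - kap θ ^ 2)) := by
      rcases le_total 0 (θ + dl θ x) with h' | h'
      · rw [abs_of_nonneg h', max_eq_left (by nlinarith)]; ring
      · rw [abs_of_nonpos h', max_eq_right (by nlinarith)]; ring
    have scale : ∀ {u v k : ℝ}, 0 ≤ k → u = k * v → max u 0 ^ 2 = k ^ 2 * max v 0 ^ 2 :=
      fun {u v k} hk he => by
        rw [he, ← mul_pow, mul_max_of_nonneg _ _ hk, mul_zero]
    have hkn : 0 ≤ kap θ / n := by positivity
    have e2 : max (kap θ * dl θ x - (a ^ 2 - kap θ ^ 2)) 0 ^ 2 = (kap θ / n) ^ 2 *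
        max (Sm (uu θ) x - n * ((a ^ 2 - kap θ ^ 2) / kap θ)) 0 ^ 2 := by
      refine scale hkn ?_
      rw [dl]; field_simp
    have e3 : max (-(kap θ * dl θ x) - 2 * kap θ * θ - (a ^ 2 - kap θ ^ 2)) 0 ^ 2 =
        (kap θ / n) ^ 2 * max (Sm (fun q => -uu θ q - 2 * θ) x -
          n * ((a ^ 2 - kap θ ^ 2) / kap θ)) 0 ^ 2 := by
      refine scale hkn ?_
      have : Sm (fun q => -uu θ q - 2 * θ) x = -Sm (uu θ) x - 2 * θ * n := by
        simp [Sm, Finset.sum_sub_distrib, mul_comm]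
      rw [this, dl]; field_simp
    have e4 : max (kap θ * dl θ x - (a ^ 2 - kap θ ^ 2) - z1 a θ x) 0 ^ 2 = (1 / n) ^ 2 *
        max (Sm (fun q => kap θ * uu θ q - yy a θ q) x - n * (a ^ 2 - kap θ ^ 2)) 0 ^ 2 := by
      refine scale (by positivity) ?_
      have : Sm (fun q => kap θ * uu θ q - yy a θ q) x = kap θ * Sm (uu θ) x - Sm (yy a θ) x := by
        simp [Sm, Finset.sum_sub_distrib, Finset.mul_sum]
      rw [this, dl, z1]; field_simp; ring
    rw [e2, e3, e4] at key
    rw [e1]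
    have e5 : 1 / (2 * (n : ℝ) ^ 2) = (1 / n) ^ 2 / 2 := by field_simp
    rw [e5]
    linarith
  refine (integral_mono (Tame.integrable (by fun_prop)) (Tame.integrable (by fun_prop)) hpt).trans ?_
  rw [integral_add (Tame.integrable (by fun_prop)) (Tame.integrable (by fun_prop)),
    integral_sub (Tame.integrable (by fun_prop)) (Tame.integrable (by fun_prop)),
    integral_const_mul, integral_const_mul,
    integral_add (Tame.integrable (by fun_prop)) (Tame.integrable (by fun_prop)),
    integral_const_mul, h.int_z1_sq hn]
  gcongr
  have j1 := mul_le_mul_of_nonneg_left (hloss.trans (mul_le_mul_of_nonneg_left hcomp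
    (by positivity))) (by positivity : 0 ≤ (kap θ / n) ^ 2)
  have j2 := mul_le_mul_of_nonneg_left hgain (by positivity : 0 ≤ 1 / (2 * (n : ℝ) ^ 2))
  have j3 : 1 / (2 * (n : ℝ) ^ 2) * (2 * n * (kap θ ^ 2 * (1 - θ ^ 2)) * G -
      n * (16 * a ^ 3 * b3) / Real.sqrt n) =
      (kap θ / n) ^ 2 * (n * (1 - θ ^ 2) * G) - 8 * a ^ 3 * b3 / (n * Real.sqrt n) := by
    field_simp
    ring
  linarith

end Truncation

/-! ### The deviation of the truncated estimator and the excess of the error -/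

section Deviation

variable {n : ℕ} {ρ : Measure (Bool × ℝ)} [IsProbabilityMeasure ρ] {a θ : ℝ}

/-- The deviation of the truncated estimator of `ν`. -/
def mm (a θ : ℝ) (x : Fin n → Bool × ℝ) : ℝ :=
  max (z1 a θ x + rr θ x) ((1 + |θ + dl θ x|) ^ 2 / 4 - a ^ 2)

/-- The square root of the truncated estimator of `ν`. -/
def bt (a θ : ℝ) (x : Fin n → Bool × ℝ) : ℝ := Real.sqrt (a ^ 2 + mm a θ x)

lemma quarter_le_add_mm (x : Fin n → Bool × ℝ) : 1 / 4 ≤ a ^ 2 + mm a θ x := by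
  have h1 : (1 + |θ + dl θ x|) ^ 2 / 4 - a ^ 2 ≤ mm a θ x := le_max_right _ _
  have h2 := abs_nonneg (θ + dl θ x)
  nlinarith

lemma half_le_bt (x : Fin n → Bool × ℝ) : 1 / 2 ≤ bt a θ x :=
  Real.le_sqrt_of_sq_le (by have := quarter_le_add_mm (a := a) (θ := θ) x; linarith)

lemma bt_sq (x : Fin n → Bool × ℝ) : bt a θ x ^ 2 = a ^ 2 + mm a θ x :=
  Real.sq_sqrt (by have := quarter_le_add_mm (a := a) (θ := θ) x; linarith)

lemma bt_sq_sub (x : Fin n → Bool × ℝ) : bt a θ x ^ 2 - a ^ 2 = mm a θ x := by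
  rw [bt_sq]; ring

lemma le_bt_sq_sub (x : Fin n → Bool × ℝ) : z1 a θ x + rr θ x ≤ bt a θ x ^ 2 - a ^ 2 := by
  rw [bt_sq_sub]; exact le_max_left _ _

lemma abs_add_dl_le (hn : 0 < n) (x : Fin n → Bool × ℝ) : |θ + dl θ x| ≤ 1 := by
  have hn' : (0 : ℝ) < n := by exact_mod_cast hn
  have e : θ + dl θ x = (∑ i, sg (x i).1) / n := by
    simp only [dl, Sm, uu, Finset.sum_sub_distrib]
    simp
    field_simp
    ring
  rw [e, abs_div, abs_of_pos hn', div_le_one hn']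
  refine (Finset.abs_sum_le_sum_abs _ _).trans ?_
  simp [abs_sg]

lemma PairLaw.tame_mm (h : PairLaw ρ a θ) : Tame (mm (n := n) a θ) (Measure.pi fun _ => ρ) := by
  have h1 := h.tame_z1 (n := n)
  have h2 := h.tame_rr (n := n)
  have h3 := tame_dl (n := n) ρ θ
  unfold mm
  fun_prop

lemma PairLaw.tame_err (h : PairLaw ρ a θ) (ha : 1 / 2 ≤ a) :
    Tame (fun x : Fin n → Bool × ℝ => errAt a (bt a θ x)) (Measure.pi fun _ => ρ) := by
  have h1 := h.tame_mm (n := n)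
  refine Tame.mono (g := fun x => 8 * a ^ 3 * mm a θ x) (by fun_prop) ?_ fun x => ?_
  · refine AEMeasurable.aestronglyMeasurable ?_
    have hb : AEMeasurable (fun x : Fin n → Bool × ℝ => bt a θ x) (Measure.pi fun _ => ρ) :=
      (h1.aestronglyMeasurable.aemeasurable.const_add _).sqrt
    unfold errAt
    fun_prop
  · refine (abs_errAt_le_four ha (half_le_bt x)).trans ?_
    rw [bt_sq_sub, abs_mul, abs_of_nonneg (by have := one_le_eight_mul ha; linarith : 0 ≤ 8 * a ^ 3)]

lemma PairLaw.l2_err_le (h : PairLaw ρ a θ) (ha : 1 / 2 ≤ a) :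
    l2 (fun x : Fin n → Bool × ℝ => errAt a (bt a θ x)) (Measure.pi fun _ => ρ) ≤
      l2 (mm (n := n) a θ) (Measure.pi fun _ => ρ) +
        l2 (fun x : Fin n → Bool × ℝ => excess a (z1 a θ x) (rr θ x)) (Measure.pi fun _ => ρ) := by
  have h1 := h.tame_z1 (n := n)
  have h2 := h.tame_rr (n := n)
  have h3 := h.tame_mm (n := n)
  have h4 : Tame (fun x : Fin n → Bool × ℝ => excess a (z1 a θ x) (rr θ x))
      (Measure.pi fun _ => ρ) := by unfold excess; fun_prop
  have := l2_add_le h3.abs h4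
  have e : l2 (fun x : Fin n → Bool × ℝ => |mm a θ x|) (Measure.pi fun _ => ρ) =
      l2 (mm (n := n) a θ) (Measure.pi fun _ => ρ) := by simp [l2, sq_abs]
  rw [← e]
  refine (l2_mono (h.tame_err ha) (h3.abs.add h4) fun x => ?_).trans this
  have := abs_errAt_le ha (half_le_bt (a := a) (θ := θ) x) (le_bt_sq_sub x)
  rw [bt_sq_sub] at this
  exact this.trans (le_abs_self _)

lemma PairLaw.l2_excess_le (h : PairLaw ρ a θ) (ha : 1 / 2 ≤ a) :
    l2 (fun x : Fin n → Bool × ℝ => excess a (z1 a θ x) (rr θ x)) (Measure.pi fun _ => ρ) ≤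
      3 * l2 (fun x : Fin n → Bool × ℝ => max (-z1 a θ x) 0 ^ 2) (Measure.pi fun _ => ρ) +
        (8 * a ^ 3 - 1) * l2 (rr (n := n) θ) (Measure.pi fun _ => ρ) := by
  have h1 := h.tame_z1 (n := n)
  have h2 := h.tame_rr (n := n)
  have := one_le_eight_mul ha
  unfold excess
  refine (l2_add_le (f := fun x : Fin n → Bool × ℝ => 3 * max (-z1 a θ x) 0 ^ 2)
    (g := fun x => (8 * a ^ 3 - 1) * |rr θ x|) (by fun_prop) (by fun_prop)).trans (le_of_eq ?_)
  rw [l2_const_mul, l2_const_mul, abs_of_pos (by norm_num : (0 : ℝ) < 3),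
    abs_of_nonneg (by linarith : 0 ≤ 8 * a ^ 3 - 1)]
  simp [l2, sq_abs]

/-- The factor c replaces n(n-1) by n²: c = 1.4143 serves all n ≥ 2, and c = 1.00255 serves n ≥ 200.
-/
lemma PairLaw.l2_rr_le (h : PairLaw ρ a θ) (hn : 2 ≤ n) {c : ℝ} (hc0 : 0 ≤ c)
    (hc : n ≤ c ^ 2 * ((n : ℝ) - 1)) :
    l2 (rr (n := n) θ) (Measure.pi fun _ => ρ) ≤
      c * Real.sqrt (2 * (9 / 4 * (1 - θ ^ 2) ^ 2 + dHat a θ ^ 2)) / n := by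
  have hn' : (2 : ℝ) ≤ n := by exact_mod_cast hn
  have hη : 0 ≤ 2 * (9 / 4 * (1 - θ ^ 2) ^ 2 + dHat a θ ^ 2) := by positivity
  refine Real.sqrt_le_iff.2 ⟨by positivity, (h.int_rr_sq_le hn).trans ?_⟩
  rw [div_pow, mul_pow, Real.sq_sqrt hη, div_le_div_iff₀ (by nlinarith) (by positivity)]
  have := mul_le_mul_of_nonneg_left hc (by positivity :
    0 ≤ 2 * (9 / 4 * (1 - θ ^ 2) ^ 2 + dHat a θ ^ 2) * n)
  linarith

lemma PairLaw.l2_dl_sq (h : PairLaw ρ a θ) (hn : 2 ≤ n) :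
    l2 (fun x : Fin n → Bool × ℝ => dl θ x ^ 2) (Measure.pi fun _ => ρ) =
      Real.sqrt (3 * (1 - θ ^ 2) ^ 2 + (1 - θ ^ 2) * (6 * θ ^ 2 - 2) / n) / n := by
  have e : ∀ x : Fin n → Bool × ℝ, (dl θ x ^ 2) ^ 2 = dl θ x ^ 4 := fun x => by ring
  rw [l2]
  simp_rw [e]
  rw [h.int_dl_four hn, Real.sqrt_div' _ (by positivity), Real.sqrt_sq (by positivity)]

/-- Minkowski's inequality in L⁴ separates moduli and signs. The moduli contribute through
sub-Gaussian moments (1.4716 exceeds 4/e), the signs through the exact fourth moment of δ. -/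
lemma PairLaw.l2_neg_z1_sq_le (h : PairLaw ρ a θ) (h0 : 0 ≤ θ) (hn : 2 ≤ n) (hA : 0 ≤ aHat a θ)
    (hA0 : aHat a θ = 0 → dHat a θ = 0) :
    l2 (fun x : Fin n → Bool × ℝ => max (-z1 a θ x) 0 ^ 2) (Measure.pi fun _ => ρ) ≤
      (Real.sqrt (1.4716 * aHat a θ) + 3 * θ * Real.sqrt (Real.sqrt (3 * (1 - θ ^ 2) ^ 2 +
        (1 - θ ^ 2) * (6 * θ ^ 2 - 2) / n))) ^ 2 / n := by
  have hn' : (0 : ℝ) < n := by positivity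
  have h1 := h.tame_z1 (n := n)
  have ht := h.tame
  have hf : Tame (fun p => dHat a θ - p.2 ^ 2) ρ := by fun_prop
  have hS := hf.Sm (n := n) ρ
  have hd := tame_dl (n := n) ρ θ
  have hp : Tame (fun x : Fin n → Bool × ℝ => max (Sm (fun p => dHat a θ - p.2 ^ 2) x / n) 0)
      (Measure.pi fun _ => ρ) := by fun_prop
  have hq : Tame (fun x : Fin n → Bool × ℝ => 3 * θ * |dl θ x|) (Measure.pi fun _ => ρ) := by
    fun_prop
  have hpt : ∀ x : Fin n → Bool × ℝ, max (-z1 a θ x) 0 ≤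
      max (Sm (fun p => dHat a θ - p.2 ^ 2) x / n) 0 + 3 * θ * |dl θ x| := fun x => by
    have e : -z1 a θ x = Sm (fun p => dHat a θ - p.2 ^ 2) x / n - 3 * θ * dl θ x := by
      have : Sm (yy a θ) x = 3 * θ * Sm (uu θ) x - Sm (fun p => dHat a θ - p.2 ^ 2) x := by
        simp only [Sm, Finset.mul_sum, ← Finset.sum_sub_distrib]
        exact Finset.sum_congr rfl fun i _ => by rw [yy]; ring
      rw [z1, dl, this]; field_simp; ring
    have h2 := mul_le_mul_of_nonneg_left (neg_abs_le (dl θ x)) (by positivity : 0 ≤ 3 * θ)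
    have h3 := mul_nonneg (by positivity : 0 ≤ 3 * θ) (abs_nonneg (dl θ x))
    refine max_le ?_ (add_nonneg (le_max_right _ _) h3)
    have := le_max_left (Sm (fun p => dHat a θ - p.2 ^ 2) x / n) 0
    linarith
  have hP : l2 (fun x : Fin n → Bool × ℝ => max (Sm (fun p => dHat a θ - p.2 ^ 2) x / n) 0 ^ 2)
      (Measure.pi fun _ => ρ) ≤ 1.4716 * aHat a θ / n := by
    have e4 : ∀ x : Fin n → Bool × ℝ, (max (Sm (fun p => dHat a θ - p.2 ^ 2) x / n) 0 ^ 2) ^ 2 =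
      max (Sm (fun p => dHat a θ - p.2 ^ 2) x / n) 0 ^ 4 := fun x => by ring
    rw [l2]
    simp_rw [e4]
    rcases hA.eq_or_lt with hA' | hA'
    · have hd0 := hA0 hA'.symm
      have : ∀ x : Fin n → Bool × ℝ, max (Sm (fun p => dHat a θ - p.2 ^ 2) x / n) 0 ^ 4 = 0 :=
        fun x => by
          rw [max_eq_right, zero_pow (by norm_num)]
          refine div_nonpos_of_nonpos_of_nonneg ?_ hn'.le
          exact Finset.sum_nonpos fun i _ => by rw [hd0]; nlinarith [sq_nonneg (x i).2]
      simp_rw [this]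
      rw [← hA']
      simp
    · refine Real.sqrt_le_iff.2 ⟨by positivity, (h.integral_posPart_four (by omega) hA').trans ?_⟩
      have he := Real.exp_one_gt_d9
      have : 4 / Real.exp 1 ≤ 1.4716 := by
        rw [div_le_iff₀ (Real.exp_pos 1)]; linarith
      gcongr
  have hQ : l2 (fun x : Fin n → Bool × ℝ => (3 * θ * |dl θ x|) ^ 2) (Measure.pi fun _ => ρ) =
      (3 * θ) ^ 2 * (Real.sqrt (3 * (1 - θ ^ 2) ^ 2 + (1 - θ ^ 2) * (6 * θ ^ 2 - 2) / n) / n) := by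
    rw [← h.l2_dl_sq hn]
    simp_rw [mul_pow, sq_abs]
    rw [l2_const_mul, abs_of_nonneg (by positivity)]
  refine (l2_mono (g := fun x => (max (Sm (fun p => dHat a θ - p.2 ^ 2) x / n) 0 +
    3 * θ * |dl θ x|) ^ 2) (by fun_prop) (by fun_prop) fun x => ?_).trans
    ((l2_add_sq_le hp hq (Real.sqrt_nonneg _) (Real.sqrt_nonneg _)
    (Real.sq_sqrt l2_nonneg).ge (Real.sq_sqrt l2_nonneg).ge).trans ?_)
  · have := hpt x
    rw [abs_of_nonneg (by positivity), abs_of_nonneg (by positivity)]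
    exact pow_le_pow_left₀ (le_max_right _ _) this 2
  · rw [hQ, Real.sqrt_mul (by positivity), Real.sqrt_sq (by positivity)]
    have e : ∀ y : ℝ, Real.sqrt (y / n) = Real.sqrt y / Real.sqrt n := fun y =>
      Real.sqrt_div' y hn'.le
    have := Real.sqrt_le_sqrt hP
    rw [e] at this ⊢
    have hs : 0 < Real.sqrt n := Real.sqrt_pos.2 hn'
    have e2 : ∀ u v : ℝ, (u + v) ^ 2 / n = (u / Real.sqrt n + v / Real.sqrt n) ^ 2 := fun u v => by
      rw [← add_div, div_pow, Real.sq_sqrt hn'.le]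
    rw [e2, mul_div_assoc (3 * θ)]
    gcongr

/-- Here 1.732 bounds √3 from below, and the mixed product with the fourth root of |P₁|/n is
discarded. -/
lemma le_sBound_sq (hA : 0 ≤ aHat a θ) (hB : 0 ≤ bSig θ) :
    1.732 * (aHat a θ + bSig θ + 2 * Real.sqrt (aHat a θ * bSig θ)) +
      9 / 4 * Real.sqrt (|P1 θ n| / n) ≤ sBound a θ n ^ 2 := by
  have h3 : ((3 : ℝ) ^ (1 / 4 : ℝ)) ^ 2 = Real.sqrt 3 := by
    rw [← Real.rpow_natCast, ← Real.rpow_mul (by norm_num), Real.sqrt_eq_rpow]; norm_num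
  have hP : ((|P1 θ n| / (n : ℝ)) ^ (1 / 4 : ℝ)) ^ 2 = Real.sqrt (|P1 θ n| / n) := by
    rw [← Real.rpow_natCast, ← Real.rpow_mul (by positivity), Real.sqrt_eq_rpow]; norm_num
  have h3' : (1.732 : ℝ) ≤ Real.sqrt 3 := Real.le_sqrt_of_sq_le (by norm_num)
  rw [sBound, Real.sqrt_mul hA]
  have e1 := Real.sq_sqrt hA
  have e2 := Real.sq_sqrt hB
  have i1 := Real.sqrt_nonneg (aHat a θ)
  have i2 := Real.sqrt_nonneg (bSig θ)
  have i3 : 0 ≤ (3 : ℝ) ^ (1 / 4 : ℝ) := by positivity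
  have i4 : 0 ≤ (|P1 θ n| / (n : ℝ)) ^ (1 / 4 : ℝ) := by positivity
  set u := Real.sqrt (aHat a θ)
  set v := Real.sqrt (bSig θ)
  set c := (3 : ℝ) ^ (1 / 4 : ℝ)
  set w := (|P1 θ n| / (n : ℝ)) ^ (1 / 4 : ℝ)
  have e : (c * (u + v) + 3 / 2 * w) ^ 2 = c ^ 2 * (u + v) ^ 2 + 9 / 4 * w ^ 2 +
    3 * (c * (u + v) * w) := by ring
  have j1 := mul_le_mul_of_nonneg_right h3' (sq_nonneg (u + v))
  have j2 : 0 ≤ c * (u + v) * w := by positivity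
  rw [e, h3, hP, ← e1, ← e2]
  linarith

/-- For strong asymmetry the fourth moment of δ exceeds its Gaussian value by a term of relative
order 1/n, which matters when 1 - θ² is small. The contribution of |P₁| ≥ 9 to the bound pays for
it. -/
lemma P1_le (hθ : 1 / 2 ≤ θ ^ 2) (h1 : θ ^ 2 ≤ 1) (hn : 2 ≤ n) : P1 θ n ≤ -9 := by
  have hn' : (2 : ℝ) ≤ n := by exact_mod_cast hn
  obtain ⟨t, ht⟩ : ∃ t, t = θ ^ 2 := ⟨_, rfl⟩
  obtain ⟨w, hw⟩ : ∃ w, w = 1 / ((n : ℝ) - 1) := ⟨_, rfl⟩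
  have hw0 : 0 ≤ w := by rw [hw]; exact div_nonneg zero_le_one (by linarith)
  have hw1 : w ≤ 1 := by rw [hw, div_le_one (by linarith)]; linarith
  have e : P1 θ n = 16 * (15 * t - 71 * t ^ 2 + 26 * t ^ 3 - 45 * t ^ 4) +
      12 * w * (5 - 96 * t + 302 * t ^ 2 - 356 * t ^ 3 + 155 * t ^ 4) +
      4 * w ^ 2 * (-33 + 436 * t - 1238 * t ^ 2 + 1300 * t ^ 3 - 465 * t ^ 4) +
      16 * w ^ 3 * (5 - 52 * t + 134 * t ^ 2 - 132 * t ^ 3 + 45 * t ^ 4) := by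
    have : (n : ℝ) - 1 ≠ 0 := by linarith
    rw [P1, hw, ht]
    field_simp
  rw [← ht] at hθ h1
  have b : ∀ i j : ℕ, 0 ≤ (t - 1 / 2) ^ i * (1 - t) ^ j := fun i j =>
    mul_nonneg (pow_nonneg (by linarith) i) (pow_nonneg (by linarith) j)
  have p1 : 15 * t - 71 * t ^ 2 + 26 * t ^ 3 - 45 * t ^ 4 ≤ -(9 + 50 * (t - 1 / 2)) := by
    linarith [b 0 4, b 1 3, b 2 2, b 3 1, b 4 0]
  have p2 : 5 - 96 * t + 302 * t ^ 2 - 356 * t ^ 3 + 155 * t ^ 4 ≤ 1 + 20 * (t - 1 / 2) := by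
    linarith [b 0 4, b 1 3, b 2 2, b 3 1, b 4 0]
  have p3 : -33 + 436 * t - 1238 * t ^ 2 + 1300 * t ^ 3 - 465 * t ^ 4 ≤ 10 := by
    linarith [b 0 4, b 1 3, b 2 2, b 3 1, b 4 0]
  have p4 : 5 - 52 * t + 134 * t ^ 2 - 132 * t ^ 3 + 45 * t ^ 4 ≤ 2 := by
    linarith [b 0 4, b 1 3, b 2 2, b 3 1, b 4 0]
  have i2 := mul_le_mul_of_nonneg_left p2 hw0
  have i3 := mul_le_mul_of_nonneg_left p3 (sq_nonneg w)
  have i4 := mul_le_mul_of_nonneg_left p4 (pow_nonneg hw0 3)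
  have j2 : w * (1 + 20 * (t - 1 / 2)) ≤ 1 + 20 * (t - 1 / 2) :=
    mul_le_of_le_one_left (by linarith) hw1
  have j3 : w ^ 2 ≤ 1 := pow_le_one₀ hw0 hw1
  have j4 : w ^ 3 ≤ 1 := pow_le_one₀ hw0 hw1
  rw [e]
  linarith

end Deviation

section Deviation

variable {n : ℕ} {ρ : Measure (Bool × ℝ)} [IsProbabilityMeasure ρ] {a θ : ℝ}

/-! ### The linearized truncation for large asymmetry -/

/-- The conditional means of v² given the signs + and - are D - θ(1-θ) and D + θ(1+θ), so the
centred slopes drop out. -/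
lemma PairLaw.integral_affine (h : PairLaw ρ a θ) (α₁ α₂ β₁ β₂ : ℝ) :
    ∫ p, ((1 + sg p.1) / 2 * (α₁ + β₁ * (p.2 ^ 2 - (dHat a θ - θ * (1 - θ)))) +
      (1 - sg p.1) / 2 * (α₂ + β₂ * (p.2 ^ 2 - (dHat a θ + θ * (1 + θ))))) ∂ρ =
    (1 + θ) / 2 * α₁ + (1 - θ) / 2 * α₂ := by
  have ht := h.tame
  have hs := tame_sg (ρ := ρ)
  have e : ∀ p : Bool × ℝ, (1 + sg p.1) / 2 * (α₁ + β₁ * (p.2 ^ 2 - (dHat a θ - θ * (1 - θ)))) +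
      (1 - sg p.1) / 2 * (α₂ + β₂ * (p.2 ^ 2 - (dHat a θ + θ * (1 + θ)))) =
      (α₁ - β₁ * (dHat a θ - θ * (1 - θ)) + α₂ - β₂ * (dHat a θ + θ * (1 + θ))) / 2 +
      (α₁ - β₁ * (dHat a θ - θ * (1 - θ)) - α₂ + β₂ * (dHat a θ + θ * (1 + θ))) / 2 * sg p.1 +
      (β₁ + β₂) / 2 * p.2 ^ 2 + (β₁ - β₂) / 2 * (sg p.1 * p.2 ^ 2) := fun p => by ring
  simp_rw [e]
  rw [integral_add, integral_add, integral_add, integral_const_mul, integral_const_mul,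
    integral_const_mul, h.eU, h.eV2, h.eUV2]
  · simp only [integral_const, probReal_univ, one_smul]
    ring
  all_goals exact Tame.integrable (by fun_prop)

lemma sub_posPart_mul_le (c m x : ℝ) : max (c - x) 0 * (x - m) ≤ max (c - m) 0 * (x - m) := by
  rcases le_total x m with h | h
  · have : max (c - m) 0 ≤ max (c - x) 0 := max_le_max (by linarith) le_rfl
    nlinarith
  · have : max (c - x) 0 ≤ max (c - m) 0 := max_le_max (by linarith) le_rfl
    nlinarith

/-- Given the sign, the first factor increases and the second decreases in v², so by association the
fluctuations of v² about its conditional mean contribute nonpositively. The remaining constants are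
(1-θ)(κ+2θ) on the positive and -(1+θ)(κ+2θ) on the negative side, of equal weight after
multiplication by the probabilities. The comparison c₁ ≤ c₂ - m₂ of the levels decides the sign;
this needs θ²/2 + 4θ ≥ 5/2, which holds for θ ≥ 3/5. -/
lemma PairLaw.integral_posPart_mul_nonpos (h : PairLaw ρ a θ) (h0 : 3 / 5 ≤ θ) (h1 : θ ≤ 1)
    (hκ : kap θ ≤ a) (ha : a ≤ 1) (s : ℝ) :
    ∫ p, (kap θ * uu θ p + yy a θ p) * max (kap θ * uu θ p - yy a θ p - s) 0 ∂ρ ≤ 0 := by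
  have hk0 : 0 ≤ kap θ := by rw [kap]; linarith
  have hy := h.tame_yy
  have ht := h.tame
  have hs := tame_sg (ρ := ρ)
  have hd : dHat a θ ≤ 3 / 2 * (1 - θ ^ 2) := by
    have := pow_le_one₀ (n := 2) (hk0.trans hκ) ha
    rw [dHat]; linarith
  set Δ := dHat a θ with hΔ
  set c₁ := (kap θ - 3 * θ) * (1 - θ) + Δ - s with hc₁
  set c₂ := (3 * θ - kap θ) * (1 + θ) + Δ - s with hc₂
  set m₁ := Δ - θ * (1 - θ) with hm₁
  set m₂ := Δ + θ * (1 + θ) with hm₂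
  have hcc : c₁ ≤ c₂ - m₂ := by
    rw [hc₁, hc₂, hm₂, kap]
    nlinarith
  -- A supporting line of the positive part at the conditional mean m₂, with slope 0 or 1: Jensen's
  -- inequality on the negative side.
  obtain ⟨ε, hε0, hε⟩ : ∃ ε : ℝ, (∀ x, ε * (c₂ - x) ≤ max (c₂ - x) 0) ∧
      max (c₂ - m₂) 0 = ε * (c₂ - m₂) := by
    rcases le_total (c₂ - m₂) 0 with hc | hc
    · exact ⟨0, fun x => by simp, by rw [max_eq_right hc]; simp⟩
    · exact ⟨1, fun x => by simp, by rw [max_eq_left hc]; simp⟩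
  have hpt : ∀ p : Bool × ℝ,
      (kap θ * uu θ p + yy a θ p) * max (kap θ * uu θ p - yy a θ p - s) 0 ≤
      (1 + sg p.1) / 2 * ((1 - θ) * (kap θ + 2 * θ) * max c₁ 0 +
        max (c₁ - m₁) 0 * (p.2 ^ 2 - m₁)) +
      (1 - sg p.1) / 2 * (-((1 + θ) * (kap θ + 2 * θ) * (ε * (c₂ - m₂))) +
        (max (c₂ - m₂) 0 + (1 + θ) * (kap θ + 2 * θ) * ε) * (p.2 ^ 2 - m₂)) := fun p => by
    rcases p with ⟨b, v⟩
    have hx := sq_nonneg v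
    cases b
    · have e1 : kap θ * uu θ (false, v) + yy a θ (false, v) =
          -((1 + θ) * (kap θ + 2 * θ)) + (v ^ 2 - m₂) := by
        simp only [yy, uu, sg, ← hΔ, hm₂]; simp; ring
      have e2 : kap θ * uu θ (false, v) - yy a θ (false, v) - s = c₂ - v ^ 2 := by
        simp only [yy, uu, sg, ← hΔ, hc₂]; simp; ring
      have i1 := sub_posPart_mul_le c₂ m₂ (v ^ 2)
      have i2 := mul_le_mul_of_nonneg_left (hε0 (v ^ 2))
        (mul_nonneg (by linarith : 0 ≤ 1 + θ) (by linarith : 0 ≤ kap θ + 2 * θ))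
      rw [e1, e2]
      simp [sg]
      linarith
    · have e1 : kap θ * uu θ (true, v) + yy a θ (true, v) =
          (1 - θ) * (kap θ + 2 * θ) + (v ^ 2 - m₁) := by
        simp only [yy, uu, sg, ← hΔ, hm₁]; simp; ring
      have e2 : kap θ * uu θ (true, v) - yy a θ (true, v) - s = c₁ - v ^ 2 := by
        simp only [yy, uu, sg, ← hΔ, hc₁]; simp; ring
      have i1 := sub_posPart_mul_le c₁ m₁ (v ^ 2)
      have i2 : max (c₁ - v ^ 2) 0 ≤ max c₁ 0 := max_le_max (by linarith) le_rfl
      have i3 := mul_le_mul_of_nonneg_left i2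
        (mul_nonneg (by linarith : 0 ≤ 1 - θ) (by linarith : 0 ≤ kap θ + 2 * θ))
      rw [e1, e2]
      simp [sg]
      linarith
  refine (integral_mono (Tame.integrable (by fun_prop)) (Tame.integrable (by fun_prop)) hpt).trans ?_
  rw [h.integral_affine, ← hε]
  have i1 : max c₁ 0 ≤ max (c₂ - m₂) 0 := max_le_max hcc le_rfl
  have i2 : 0 ≤ (1 + θ) * (1 - θ) * (kap θ + 2 * θ) / 2 := by
    have : 0 ≤ (1 + θ) * (1 - θ) := mul_nonneg (by linarith) (by linarith)
    have : 0 ≤ kap θ + 2 * θ := by linarith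
    positivity
  have := mul_le_mul_of_nonneg_left i1 i2
  linarith

/-- Put b = κδ and d = a² - κ² ≥ 0. Then max(z₁, b-d)² - z₁² = (b - d + z₁)(b - d - z₁)₊ ≤ (b +
z₁)(b - d - z₁)₊. The first factor is a sum over the sample, and resampling makes each of its terms
an instance of the preceding inequality. -/
lemma PairLaw.integral_max_linear_sq_le (h : PairLaw ρ a θ) (h0 : 3 / 5 ≤ θ) (h1 : θ ≤ 1)
    (hκ : kap θ ≤ a) (ha : a ≤ 1) (hn : 2 ≤ n) :
    ∫ x : Fin n → Bool × ℝ, max (z1 a θ x) (kap θ * dl θ x - (a ^ 2 - kap θ ^ 2)) ^ 2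
      ∂(Measure.pi fun _ => ρ) ≤ sSq a θ / n := by
  have hn' : (0 : ℝ) < n := by positivity
  have hk0 : 0 ≤ kap θ := by rw [kap]; linarith
  have hd0 : 0 ≤ a ^ 2 - kap θ ^ 2 := by
    have := pow_le_pow_left₀ hk0 hκ 2; linarith
  have hp := h.tame_pp
  have hy := h.tame_yy
  have hq : Tame (fun p => kap θ * uu θ p + yy a θ p) ρ := by fun_prop
  have hS := hp.Sm (n := n) ρ
  have hQ := hq.Sm (n := n) ρ
  have hz := h.tame_z1 (n := n)
  have hdl := tame_dl (n := n) ρ θ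
  have hG : Tame (fun x : Fin n → Bool × ℝ => max (Sm (fun q => kap θ * uu θ q - yy a θ q) x -
      n * (a ^ 2 - kap θ ^ 2)) 0) (Measure.pi fun _ => ρ) := by fun_prop
  have hpt : ∀ x : Fin n → Bool × ℝ,
      max (z1 a θ x) (kap θ * dl θ x - (a ^ 2 - kap θ ^ 2)) ^ 2 ≤ z1 a θ x ^ 2 +
      (1 / n) ^ 2 * (Sm (fun p => kap θ * uu θ p + yy a θ p) x *
        max (Sm (fun q => kap θ * uu θ q - yy a θ q) x - n * (a ^ 2 - kap θ ^ 2)) 0) := fun x => by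
    have e1 : Sm (fun q => kap θ * uu θ q - yy a θ q) x - n * (a ^ 2 - kap θ ^ 2) =
        n * (kap θ * dl θ x - (a ^ 2 - kap θ ^ 2) - z1 a θ x) := by
      have : Sm (fun q => kap θ * uu θ q - yy a θ q) x = kap θ * Sm (uu θ) x - Sm (yy a θ) x := by
        simp [Sm, Finset.sum_sub_distrib, Finset.mul_sum]
      rw [this, dl, z1]; field_simp; ring
    have e2 : Sm (fun q => kap θ * uu θ q + yy a θ q) x = n * (kap θ * dl θ x + z1 a θ x) := by
      have : Sm (fun q => kap θ * uu θ q + yy a θ q) x = kap θ * Sm (uu θ) x + Sm (yy a θ) x := by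
        simp [Sm, Finset.sum_add_distrib, Finset.mul_sum]
      rw [this, dl, z1]; field_simp
    have e3 : ∀ v : ℝ, max (n * v) 0 = n * max v 0 := fun v => by
      rw [mul_max_of_nonneg _ _ hn'.le, mul_zero]
    rw [e1, e2, e3]
    have e4 : (1 / (n : ℝ)) ^ 2 * (n * (kap θ * dl θ x + z1 a θ x) *
        (n * max (kap θ * dl θ x - (a ^ 2 - kap θ ^ 2) - z1 a θ x) 0)) =
        (kap θ * dl θ x + z1 a θ x) * max (kap θ * dl θ x - (a ^ 2 - kap θ ^ 2) - z1 a θ x) 0 := by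
      field_simp
    rw [e4]
    rcases le_total (z1 a θ x) (kap θ * dl θ x - (a ^ 2 - kap θ ^ 2)) with h' | h'
    · rw [max_eq_right h', max_eq_left (by linarith)]
      nlinarith
    · rw [max_eq_left h', max_eq_right (by linarith)]
      simp
  refine (integral_mono (Tame.integrable (by fun_prop)) (Tame.integrable (by fun_prop)) hpt).trans ?_
  rw [integral_add (Tame.integrable (by fun_prop)) (Tame.integrable (by fun_prop)),
    integral_const_mul, h.int_z1_sq hn, integral_Sm_mul ρ hq hG]
  have : ∑ i : Fin n, ∫ x, (∫ y, (kap θ * uu θ y + yy a θ y) *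
      max (Sm (fun q => kap θ * uu θ q - yy a θ q) (Function.update x i y) -
        n * (a ^ 2 - kap θ ^ 2)) 0 ∂ρ) ∂(Measure.pi fun _ => ρ) ≤ 0 := by
    refine Finset.sum_nonpos fun i _ => integral_nonpos fun x => ?_
    have e : ∀ y, Sm (fun q => kap θ * uu θ q - yy a θ q) (Function.update x i y) -
        n * (a ^ 2 - kap θ ^ 2) = kap θ * uu θ y - yy a θ y -
        (n * (a ^ 2 - kap θ ^ 2) - Sm (fun q => kap θ * uu θ q - yy a θ q) x +
          (kap θ * uu θ (x i) - yy a θ (x i))) := fun y => by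
      rw [Sm_update]; ring
    simp_rw [e]
    exact h.integral_posPart_mul_nonpos h0 h1 hκ ha _
  have h2 : 0 ≤ (1 / (n : ℝ)) ^ 2 := by positivity
  nlinarith

/-! ### The truncation is close to its linearization -/

lemma abs_max_sub_max_le {u v w r e : ℝ} (he : |w - v| ≤ e) :
    |max (u + r) w - max u v| ≤ |r| + e := by
  refine (abs_max_sub_max_le_max _ _ _ _).trans (max_le ?_ ?_)
  · rw [add_sub_cancel_left]; linarith [(abs_nonneg _).trans he]
  · linarith [abs_nonneg r]

/-- If θ + δ ≥ 0 the linearization error is δ²/4. Otherwise it is δ²/4 + |δ| - θ, and |δ| - 3/5 ≤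
(5/12)δ² gives the constant 2/3. -/
lemma abs_mm_sub_linear_le (h0 : 3 / 5 ≤ θ) (x : Fin n → Bool × ℝ) :
    |mm a θ x - max (z1 a θ x) (kap θ * dl θ x - (a ^ 2 - kap θ ^ 2))| ≤
      |rr θ x| + 2 / 3 * dl θ x ^ 2 := by
  refine abs_max_sub_max_le ?_
  set δ := dl θ x
  have e : (1 + |θ + δ|) ^ 2 / 4 - a ^ 2 - (kap θ * δ - (a ^ 2 - kap θ ^ 2)) =
      ((1 + |θ + δ|) ^ 2 - (1 + θ) ^ 2 - 2 * (1 + θ) * δ) / 4 := by rw [kap]; ring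
  rw [e]
  rcases le_total 0 (θ + δ) with h | h
  · rw [abs_of_nonneg h, abs_of_nonneg (by nlinarith [sq_nonneg δ])]
    nlinarith [sq_nonneg δ]
  · rw [abs_of_nonpos h, abs_of_nonneg (by nlinarith)]
    nlinarith [sq_nonneg (δ + 2 * θ), sq_nonneg δ]

lemma abs_mm_sub_max_le (h0 : 0 ≤ θ) (x : Fin n → Bool × ℝ) :
    |mm a θ x - max (z1 a θ x) (kap θ * |θ + dl θ x| - kap θ * θ - (a ^ 2 - kap θ ^ 2))| ≤
      |rr θ x| + 1 / 4 * dl θ x ^ 2 := by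
  refine abs_max_sub_max_le ?_
  set δ := dl θ x
  have e : (1 + |θ + δ|) ^ 2 / 4 - a ^ 2 - (kap θ * |θ + δ| - kap θ * θ - (a ^ 2 - kap θ ^ 2)) =
      (|θ + δ| - θ) ^ 2 / 4 := by rw [kap]; ring
  rw [e, abs_of_nonneg (by positivity)]
  have h1 : |(|θ + δ| - |θ|)| ≤ |δ| := by
    have := abs_abs_sub_abs_le_abs_sub (θ + δ) θ
    rwa [add_sub_cancel_left] at this
  rw [abs_of_nonneg h0] at h1
  have := sq_le_sq.2 h1
  linarith

/-! ### The bound for the quadratic deviation: strong asymmetry and large `ν` -/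

lemma sqrt_dl_four_le (h1 : θ ^ 2 ≤ 1 / 2) (hn : 2 ≤ n) :
    Real.sqrt (3 * (1 - θ ^ 2) ^ 2 + (1 - θ ^ 2) * (6 * θ ^ 2 - 2) / n) ≤ 2 * (1 - θ ^ 2) := by
  have hn' : (2 : ℝ) ≤ n := by exact_mod_cast hn
  refine Real.sqrt_le_iff.2 ⟨by linarith, ?_⟩
  have : (1 - θ ^ 2) * (6 * θ ^ 2 - 2) / n ≤ (1 - θ ^ 2) ^ 2 := by
    rw [div_le_iff₀ (by linarith)]
    nlinarith [mul_nonneg (sq_nonneg (1 - θ ^ 2)) (by linarith : 0 ≤ (n : ℝ) - 2)]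
  linarith

/-- The correction of order 1/n under the root is at most (2/9)|P₁|/n since |P₁| ≥ 9, and 0.4715²
exceeds 2/9. -/
lemma sqrt_dl_four_le_of_half_le (h0 : 1 / 2 ≤ θ ^ 2) (h1 : θ ^ 2 ≤ 1) (hn : 2 ≤ n) :
    Real.sqrt (3 * (1 - θ ^ 2) ^ 2 + (1 - θ ^ 2) * (6 * θ ^ 2 - 2) / n) ≤
      1.7321 * (1 - θ ^ 2) + 0.4715 * Real.sqrt (|P1 θ n| / n) := by
  have hn' : (2 : ℝ) ≤ n := by exact_mod_cast hn
  have hP : 9 ≤ |P1 θ n| := by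
    have := P1_le h0 h1 hn
    rw [abs_of_neg (by linarith)]; linarith
  have hV : 0 ≤ 1 - θ ^ 2 := by linarith
  have i1 : (1 - θ ^ 2) * (6 * θ ^ 2 - 2) / n ≤ 2 / 9 * (|P1 θ n| / n) := by
    rw [← mul_div_assoc]
    exact div_le_div_of_nonneg_right (by nlinarith) (by linarith)
  have hq := Real.sqrt_nonneg (|P1 θ n| / n)
  refine Real.sqrt_le_iff.2 ⟨by positivity, ?_⟩
  have hq2 := Real.sq_sqrt (by positivity : 0 ≤ |P1 θ n| / n)
  nlinarith [mul_nonneg hV hq, sq_nonneg (1 - θ ^ 2)]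

/-- The criterion by which the quadratic deviation is bounded if the truncation is of lower
order. -/
lemma PairLaw.l2_err_le_of_l2_mm_le (h : PairLaw ρ a θ) (h0 : 0 ≤ θ) (h1 : θ ≤ 1)
    (ha : 1 / 2 ≤ a) (hn : 2 ≤ n) (hA : 0 ≤ aHat a θ) (hA0 : aHat a θ = 0 → dHat a θ = 0) {c : ℝ}
    (hc : l2 (mm (n := n) a θ) (Measure.pi fun _ => ρ) ≤
      Real.sqrt (∫ x : Fin n → Bool × ℝ, (z1 a θ x + rr θ x) ^ 2 ∂(Measure.pi fun _ => ρ)) + c / n)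
    (hnum : c + 3 * (Real.sqrt (1.4716 * aHat a θ) + 3 * θ * Real.sqrt (Real.sqrt
        (3 * (1 - θ ^ 2) ^ 2 + (1 - θ ^ 2) * (6 * θ ^ 2 - 2) / n))) ^ 2 +
      (8 * a ^ 3 - 1) * (1.4143 * Real.sqrt (2 * (9 / 4 * (1 - θ ^ 2) ^ 2 + dHat a θ ^ 2))) ≤
      24 * a ^ 3 * (1.732 * (aHat a θ + bSig θ + 2 * Real.sqrt (aHat a θ * bSig θ)) +
        9 / 4 * Real.sqrt (|P1 θ n| / n))) :
    l2 (fun x : Fin n → Bool × ℝ => errAt a (bt a θ x)) (Measure.pi fun _ => ρ) ≤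
      Real.sqrt (∫ x : Fin n → Bool × ℝ, (z1 a θ x + rr θ x) ^ 2 ∂(Measure.pi fun _ => ρ)) +
        24 * a ^ 3 * (sBound a θ n ^ 2 / n) := by
  have hn' : (2 : ℝ) ≤ n := by exact_mod_cast hn
  have hl := one_le_eight_mul ha
  have hB : 0 ≤ bSig θ := by
    rw [bSig]; have : 0 ≤ 1 - θ ^ 2 := by nlinarith
    positivity
  have e1 := h.l2_err_le (n := n) ha
  have e2 := h.l2_excess_le (n := n) ha
  have e3 := h.l2_neg_z1_sq_le h0 hn hA hA0
  have e4 := mul_le_mul_of_nonneg_left (h.l2_rr_le hn (c := 1.4143) (by norm_num)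
    (by norm_num; linarith)) (sub_nonneg.2 hl)
  have e5 := mul_le_mul_of_nonneg_left (le_sBound_sq (n := n) hA hB)
    (by positivity : 0 ≤ 24 * a ^ 3)
  have e6 := div_le_div_of_nonneg_right (hnum.trans e5) (by linarith : (0 : ℝ) ≤ n)
  generalize (Real.sqrt (1.4716 * aHat a θ) + 3 * θ * Real.sqrt (Real.sqrt
        (3 * (1 - θ ^ 2) ^ 2 + (1 - θ ^ 2) * (6 * θ ^ 2 - 2) / n))) ^ 2 = Z at *
  rw [add_div, add_div, mul_div_assoc, mul_div_assoc, mul_div_assoc (24 * a ^ 3)] at e6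
  linarith

lemma sq_sqrt_add_le (hA : 0 ≤ aHat a θ) {y : ℝ} (hy : 0 ≤ y) :
    3 * (Real.sqrt (1.4716 * aHat a θ) + 3 * θ * Real.sqrt y) ^ 2 ≤
      8.8296 * aHat a θ + 54 * θ ^ 2 * y := by
  have e1 := Real.sq_sqrt (by positivity : 0 ≤ 1.4716 * aHat a θ)
  have e2 := Real.sq_sqrt hy
  have e3 := sq_nonneg (Real.sqrt (1.4716 * aHat a θ) - 3 * θ * Real.sqrt y)
  have e4 : (Real.sqrt (1.4716 * aHat a θ) + 3 * θ * Real.sqrt y) ^ 2 +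
      (Real.sqrt (1.4716 * aHat a θ) - 3 * θ * Real.sqrt y) ^ 2 =
      2 * Real.sqrt (1.4716 * aHat a θ) ^ 2 + 18 * θ ^ 2 * Real.sqrt y ^ 2 := by ring
  rw [e1, e2] at e4
  linarith

/-- Since |θ̃| ≤ 1, the truncation level is at most 1 ≤ ν. Truncation then moves the estimate only
towards ν, so its deviation does not exceed that of ν̂. -/
lemma PairLaw.l2_err_le_of_one_le (h : PairLaw ρ a θ) (h0 : 0 ≤ θ) (h1 : θ ≤ 1)
    (ha : 1 ≤ a) (hn : 2 ≤ n) :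
    l2 (fun x : Fin n → Bool × ℝ => errAt a (bt a θ x)) (Measure.pi fun _ => ρ) ≤
      Real.sqrt (∫ x : Fin n → Bool × ℝ, (z1 a θ x + rr θ x) ^ 2 ∂(Measure.pi fun _ => ρ)) +
        24 * a ^ 3 * (sBound a θ n ^ 2 / n) := by
  have hn' : (2 : ℝ) ≤ n := by exact_mod_cast hn
  have ht1 : θ ^ 2 ≤ 1 := by nlinarith
  have ha2 : 1 ≤ a ^ 2 := one_le_pow₀ ha
  have hV : 0 ≤ 1 - θ ^ 2 := by linarith
  have hd0 : 3 / 2 * (1 - θ ^ 2) ≤ dHat a θ := by rw [dHat]; linarith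
  have hA3 : 3 * dHat a θ ≤ aHat a θ := by
    have : 3 * dHat a θ ≤ hHat a θ := by rw [dHat, hHat]; nlinarith [sq_nonneg (a ^ 2 - 1)]
    rw [aHat]; nlinarith [sq_nonneg (dHat a θ)]
  have hA : 0 ≤ aHat a θ := by linarith
  have hB : bSig θ = 9 * (θ ^ 2 * (1 - θ ^ 2)) := rfl
  have hB0 : 0 ≤ bSig θ := by rw [hB]; positivity
  refine h.l2_err_le_of_l2_mm_le h0 h1 (by linarith) hn hA (fun h => by linarith) (c := 0) ?_ ?_
  · rw [zero_div, add_zero]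
    have h1 := h.tame_z1 (n := n)
    have h2 := h.tame_rr (n := n)
    refine l2_mono h.tame_mm (h1.add h2) fun x => ?_
    have hx := abs_add_dl_le (θ := θ) (by omega : 0 < n) x
    have hx0 := abs_nonneg (θ + dl θ x)
    have hT : (1 + |θ + dl θ x|) ^ 2 / 4 - a ^ 2 ≤ 0 := by nlinarith
    rw [mm]
    generalize (1 + |θ + dl θ x|) ^ 2 / 4 - a ^ 2 = T at *
    rcases le_total (z1 a θ x + rr θ x) T with hle | hle
    · rw [max_eq_right hle, abs_of_nonpos hT, abs_of_nonpos (by linarith)]; linarith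
    · rw [max_eq_left hle]
  · have hl : 8 ≤ 8 * a ^ 3 := by have := one_le_pow₀ (n := 3) ha; linarith
    have hD4 := Real.sqrt_nonneg (3 * (1 - θ ^ 2) ^ 2 + (1 - θ ^ 2) * (6 * θ ^ 2 - 2) / n)
    refine (add_le_add_left (add_le_add_right (sq_sqrt_add_le hA hD4) _) _).trans ?_
    have hρ : Real.sqrt (2 * (9 / 4 * (1 - θ ^ 2) ^ 2 + dHat a θ ^ 2)) ≤ 2 * dHat a θ :=
      Real.sqrt_le_iff.2 ⟨by linarith, by nlinarith⟩
    have hAB := Real.sqrt_nonneg (aHat a θ * bSig θ)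
    have hq := Real.sqrt_nonneg (|P1 θ n| / n)
    have key : 54 * θ ^ 2 * Real.sqrt (3 * (1 - θ ^ 2) ^ 2 + (1 - θ ^ 2) * (6 * θ ^ 2 - 2) / n) ≤
        12 * bSig θ + 30 * Real.sqrt (|P1 θ n| / n) := by
      rw [hB]
      rcases le_total (θ ^ 2) (1 / 2) with ht | ht
      · have := mul_le_mul_of_nonneg_left (sqrt_dl_four_le ht hn)
          (by positivity : 0 ≤ 54 * θ ^ 2)
        linarith
      · have := mul_le_mul_of_nonneg_left (sqrt_dl_four_le_of_half_le ht ht1 hn)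
          (by positivity : 0 ≤ 54 * θ ^ 2)
        have := mul_le_mul_of_nonneg_right ht1 hq
        have := mul_nonneg (sq_nonneg θ) hV
        linarith
    generalize Real.sqrt (3 * (1 - θ ^ 2) ^ 2 + (1 - θ ^ 2) * (6 * θ ^ 2 - 2) / n) = D4 at *
    generalize Real.sqrt (2 * (9 / 4 * (1 - θ ^ 2) ^ 2 + dHat a θ ^ 2)) = R at *
    generalize Real.sqrt (aHat a θ * bSig θ) = C at *
    generalize Real.sqrt (|P1 θ n| / n) = q at *
    have f1 := mul_le_mul_of_nonneg_left (show 1.4143 * R ≤ 0.943 * aHat a θ by linarith)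
      (by linarith : 0 ≤ 8 * a ^ 3 - 1)
    have f2 := mul_le_mul_of_nonneg_right hl hA
    have f3 := mul_le_mul_of_nonneg_right hl hB0
    have f4 := mul_le_mul_of_nonneg_right hl hAB
    have f5 := mul_le_mul_of_nonneg_right hl hq
    linarith

/-- By `PairLaw.integral_max_linear_sq_le` the linearized truncation costs nothing. The distance
from it has order 1/n and fits the constants because 8a³ ≥ 4.096 here. -/
lemma PairLaw.l2_err_le_of_asymmetric (h : PairLaw ρ a θ) (h0 : 3 / 5 ≤ θ) (h1 : θ ≤ 1)
    (hκ : kap θ ≤ a) (ha : a ≤ 1) (hn : 2 ≤ n) :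
    l2 (fun x : Fin n → Bool × ℝ => errAt a (bt a θ x)) (Measure.pi fun _ => ρ) ≤
      Real.sqrt (∫ x : Fin n → Bool × ℝ, (z1 a θ x + rr θ x) ^ 2 ∂(Measure.pi fun _ => ρ)) +
        24 * a ^ 3 * (sBound a θ n ^ 2 / n) := by
  have hn' : (2 : ℝ) ≤ n := by exact_mod_cast hn
  have ht1 : θ ^ 2 ≤ 1 := by nlinarith
  have ht0 : 9 / 25 ≤ θ ^ 2 := by nlinarith
  have hV : 0 ≤ 1 - θ ^ 2 := by linarith
  have hk0 : 4 / 5 ≤ kap θ := by rw [kap]; linarith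
  have hdk := dHat_kap_nonneg (by linarith : 0 ≤ θ) h1
  have hdm := dHat_mono (θ := θ) (by linarith : 0 ≤ kap θ) hκ
  have hd1 : dHat a θ ≤ 3 / 2 * (1 - θ ^ 2) := by
    have := pow_le_one₀ (n := 2) (by linarith : 0 ≤ a) ha
    rw [dHat]; linarith
  have hA3 : (3 / 2 + 9 / 2 * θ ^ 2) * (1 - θ ^ 2) ≤ aHat a θ := by
    have i1 : (3 / 2 + 9 / 2 * θ ^ 2) * (1 - θ ^ 2) ≤ aHat (kap θ) θ := by
      have b : ∀ i j : ℕ, 0 ≤ (θ - 3 / 5) ^ i * (1 - θ) ^ j := fun i j =>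
        mul_nonneg (pow_nonneg (by linarith) i) (pow_nonneg (by linarith) j)
      rw [aHat, hHat, dHat, kap]
      linarith [b 0 4, b 1 3, b 2 2, b 3 1, b 4 0]
    refine i1.trans ?_
    have h4 : kap θ ^ 4 ≤ a ^ 4 := pow_le_pow_left₀ (by linarith) hκ 4
    have h2 := pow_le_pow_left₀ hdk hdm 2
    rw [aHat, aHat, hHat, hHat]
    linarith
  have hA3' : 3 * (1 - θ ^ 2) ≤ aHat a θ := by nlinarith
  have hA : 0 ≤ aHat a θ := by linarith
  have hB : bSig θ = 9 * (θ ^ 2 * (1 - θ ^ 2)) := rfl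
  have hB0 : 0 ≤ bSig θ := by rw [hB]; positivity
  have hD4 := Real.sqrt_nonneg (3 * (1 - θ ^ 2) ^ 2 + (1 - θ ^ 2) * (6 * θ ^ 2 - 2) / n)
  have hl : 4.096 ≤ 8 * a ^ 3 := by
    have := pow_le_pow_left₀ (by norm_num) (hk0.trans hκ) 3
    linarith
  refine h.l2_err_le_of_l2_mm_le (by linarith) h1 (by linarith) hn hA (fun h => by linarith)
    (c := 1.4143 * Real.sqrt (2 * (9 / 4 * (1 - θ ^ 2) ^ 2 + dHat a θ ^ 2)) +
      2 / 3 * Real.sqrt (3 * (1 - θ ^ 2) ^ 2 + (1 - θ ^ 2) * (6 * θ ^ 2 - 2) / n)) ?_ ?_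
  · have t1 := h.tame_z1 (n := n)
    have t2 := h.tame_rr (n := n)
    have t3 := tame_dl (n := n) ρ θ
    have t4 := h.tame_mm (n := n)
    have t5 : Tame (fun x : Fin n → Bool × ℝ =>
        max (z1 a θ x) (kap θ * dl θ x - (a ^ 2 - kap θ ^ 2))) (Measure.pi fun _ => ρ) := by fun_prop
    have s1 := l2_add_le t5 (t4.sub t5)
    simp only [add_sub_cancel] at s1
    have s2 := l2_mono (t4.sub t5) (t2.abs.add ((Tame.const (2 / 3)).mul (t3.pow 2)))
      fun x => (abs_mm_sub_linear_le h0 x).trans (le_abs_self _)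
    have s3 := l2_add_le t2.abs ((Tame.const (2 / 3)).mul (t3.pow 2))
    rw [l2_const_mul, h.l2_dl_sq hn, abs_of_pos (by norm_num)] at s3
    have s4 : l2 (fun x : Fin n → Bool × ℝ => |rr θ x|) (Measure.pi fun _ => ρ) =
      l2 (rr (n := n) θ) (Measure.pi fun _ => ρ) := by simp [l2, sq_abs]
    have s5 := h.l2_rr_le hn (c := 1.4143) (by norm_num) (by norm_num; linarith)
    have s6 : l2 (fun x : Fin n → Bool × ℝ =>
        max (z1 a θ x) (kap θ * dl θ x - (a ^ 2 - kap θ ^ 2))) (Measure.pi fun _ => ρ) ≤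
        Real.sqrt (∫ x : Fin n → Bool × ℝ, (z1 a θ x + rr θ x) ^ 2 ∂(Measure.pi fun _ => ρ)) := by
      refine Real.sqrt_le_sqrt ((h.integral_max_linear_sq_le h0 h1 hκ ha hn).trans ?_)
      rw [h.int_z1_add_rr_sq hn]
      linarith [integral_nonneg (μ := Measure.pi fun _ => ρ)
        (f := fun x : Fin n → Bool × ℝ => rr θ x ^ 2) fun x => sq_nonneg _]
    rw [add_div, mul_div_assoc (2 / 3)]
    rw [s4] at s3
    exact s1.trans (by linarith)
  · refine (add_le_add_left (add_le_add_right (sq_sqrt_add_le hA hD4) _) _).trans ?_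
    have hρ : Real.sqrt (2 * (9 / 4 * (1 - θ ^ 2) ^ 2 + dHat a θ ^ 2)) ≤ 3 * (1 - θ ^ 2) :=
      Real.sqrt_le_iff.2 ⟨by linarith, by nlinarith⟩
    have hAB : (6 * θ ^ 2 + 1) * (1 - θ ^ 2) ≤ Real.sqrt (aHat a θ * bSig θ) := by
      refine Real.le_sqrt_of_sq_le ?_
      have : (6 * θ ^ 2 + 1) ^ 2 ≤ (3 / 2 + 9 / 2 * θ ^ 2) * (9 * θ ^ 2) := by nlinarith
      have i1 := mul_le_mul_of_nonneg_right this (sq_nonneg (1 - θ ^ 2))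
      have i2 := mul_le_mul_of_nonneg_right hA3 hB0
      rw [hB] at i2 ⊢
      linarith
    have hq := Real.sqrt_nonneg (|P1 θ n| / n)
    have key : (54 * θ ^ 2 + 2 / 3) * Real.sqrt (3 * (1 - θ ^ 2) ^ 2 +
        (1 - θ ^ 2) * (6 * θ ^ 2 - 2) / n) ≤
        (108 * θ ^ 2 + 4 / 3) * (1 - θ ^ 2) + 27 * Real.sqrt (|P1 θ n| / n) := by
      rcases le_total (θ ^ 2) (1 / 2) with ht | ht
      · have := mul_le_mul_of_nonneg_left (sqrt_dl_four_le ht hn)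
          (by positivity : 0 ≤ 54 * θ ^ 2 + 2 / 3)
        linarith
      · have := mul_le_mul_of_nonneg_left (sqrt_dl_four_le_of_half_le ht ht1 hn)
          (by positivity : 0 ≤ 54 * θ ^ 2 + 2 / 3)
        have := mul_le_mul_of_nonneg_right ht1 hq
        have := mul_nonneg (sq_nonneg θ) hV
        linarith
    generalize Real.sqrt (3 * (1 - θ ^ 2) ^ 2 + (1 - θ ^ 2) * (6 * θ ^ 2 - 2) / n) = D4 at *
    generalize Real.sqrt (2 * (9 / 4 * (1 - θ ^ 2) ^ 2 + dHat a θ ^ 2)) = R at *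
    generalize Real.sqrt (aHat a θ * bSig θ) = C at *
    generalize Real.sqrt (|P1 θ n| / n) = q at *
    have hC0 : 0 ≤ C := le_trans (by positivity) hAB
    have f1 := mul_le_mul_of_nonneg_left (show 1.4143 * R ≤ 4.243 * (1 - θ ^ 2) by linarith)
      (by linarith : 0 ≤ 8 * a ^ 3)
    have f2 := mul_le_mul_of_nonneg_right hl
      (show 0 ≤ 5.196 * aHat a θ - 4.243 * (1 - θ ^ 2) by linarith)
    have f3 := mul_le_mul_of_nonneg_right hl hB0
    have f4 := mul_le_mul_of_nonneg_right hl hC0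
    have f5 := mul_le_mul_of_nonneg_right hl hq
    have f6 := mul_nonneg (sq_nonneg θ) hV
    rw [hB] at f3 ⊢
    linarith

end Deviation

section Deviation

variable {n : ℕ} {ρ : Measure (Bool × ℝ)} [IsProbabilityMeasure ρ] {a θ : ℝ}

/-! ### Weak asymmetry -/

lemma dHat_eq_add (a b θ : ℝ) : dHat a θ = dHat b θ + (a ^ 2 - b ^ 2) := by
  rw [dHat, dHat]; ring

lemma hHat_eq_add (a b θ : ℝ) : hHat a θ =
    hHat b θ + 12 / 5 * (2 * b ^ 2 * (a ^ 2 - b ^ 2) + (a ^ 2 - b ^ 2) ^ 2) := by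
  rw [hHat, hHat]; ring

lemma half_le_dHat_kap (h0 : 0 ≤ θ) (h1 : θ ≤ 3 / 5) : 3 / 5 ≤ dHat (kap θ) θ := by
  rw [dHat, kap]; nlinarith

lemma aHat_mono (h0 : 0 ≤ θ) (h1 : θ ≤ 3 / 5) (hκ : kap θ ≤ a) : aHat (kap θ) θ ≤ aHat a θ := by
  have hk0 : 0 ≤ kap θ := by rw [kap]; linarith
  have hd := half_le_dHat_kap h0 h1
  have hdm := dHat_mono (θ := θ) hk0 hκ
  have h4 : kap θ ^ 4 ≤ a ^ 4 := pow_le_pow_left₀ hk0 hκ 4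
  have h2 := pow_le_pow_left₀ (by linarith : 0 ≤ dHat (kap θ) θ) hdm 2
  rw [aHat, aHat, hHat, hHat]
  linarith

lemma le_aHat_add_bSig (h0 : 0 ≤ θ) (h1 : θ ≤ 3 / 5) (hκ : kap θ ≤ a) :
    63 / 16 ≤ aHat a θ + bSig θ := by
  have i1 : 63 / 16 ≤ aHat (kap θ) θ + bSig θ := by
    have b := bernstein_nonneg h0 h1
    rw [aHat, hHat, dHat, bSig, kap]
    linarith [b 1 3, b 2 2, b 3 1, b 4 0]
  linarith [aHat_mono h0 h1 hκ]

lemma sSq_le_aHat_add_bSig (h0 : 0 ≤ θ) (h1 : θ ≤ 3 / 5) (hκ : kap θ ≤ a) :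
    7 * sSq a θ ≤ 6 * (aHat a θ + bSig θ) := by
  have hk0 : 0 ≤ kap θ := by rw [kap]; linarith
  have hk1 : kap θ ^ 2 ≤ 16 / 25 := by rw [kap]; nlinarith
  have he : 0 ≤ a ^ 2 - kap θ ^ 2 := by have := pow_le_pow_left₀ hk0 hκ 2; linarith
  have hd := half_le_dHat_kap h0 h1
  have i1 : hHat (kap θ) θ ≤ 4 * dHat (kap θ) θ ^ 2 + 33 * θ ^ 2 * (1 - θ ^ 2) := by
    have b := bernstein_nonneg h0 h1
    rw [hHat, dHat, kap]
    linarith [b 1 3, b 2 2, b 3 1, b 4 0]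
  have i2 : hHat a θ ≤ 4 * dHat a θ ^ 2 + 33 * θ ^ 2 * (1 - θ ^ 2) := by
    rw [hHat_eq_add a (kap θ), dHat_eq_add a (kap θ)]
    have j1 := mul_le_mul_of_nonneg_right hd he
    have j2 := mul_le_mul_of_nonneg_right hk1 he
    nlinarith [sq_nonneg (a ^ 2 - kap θ ^ 2)]
  rw [sSq, aHat, bSig]
  linarith

/-- At a = κ this is a polynomial inequality. In passing to larger a the right side gains at least
6D·(a² - κ²) inside its bracket, D taken at κ, which outweighs the growth of the variance on the
left. -/
lemma quadratic_part_le (h0 : 0 ≤ θ) (h1 : θ ≤ 3 / 5) (hκ : kap θ ≤ a) (ha : a ≤ 1) :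
    Real.sqrt (2 * (9 / 4 * (1 - θ ^ 2) ^ 2 + dHat a θ ^ 2)) ≤ 0.604 * (aHat a θ + bSig θ) := by
  have hk0 : 0 ≤ kap θ := by rw [kap]; linarith
  have he : 0 ≤ a ^ 2 - kap θ ^ 2 := by have := pow_le_pow_left₀ hk0 hκ 2; linarith
  have he1 : a ^ 2 - kap θ ^ 2 ≤ 1 := by
    have := pow_le_one₀ (n := 2) (hk0.trans hκ) ha
    linarith [sq_nonneg (kap θ)]
  have hd := half_le_dHat_kap h0 h1
  have hQ := le_aHat_add_bSig h0 h1 (le_refl (kap θ))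
  have i1 : 2 * (9 / 4 * (1 - θ ^ 2) ^ 2 + dHat (kap θ) θ ^ 2) ≤
      0.3648 * (aHat (kap θ) θ + bSig θ) ^ 2 := by
    have b := bernstein_nonneg h0 h1
    rw [aHat, hHat, dHat, bSig, kap]
    linarith [b 0 8, b 1 7, b 2 6, b 3 5, b 4 4, b 5 3, b 6 2, b 7 1, b 8 0]
  have i2 : aHat (kap θ) θ + bSig θ + 6 * dHat (kap θ) θ * (a ^ 2 - kap θ ^ 2) ≤
      aHat a θ + bSig θ := by
    have : 0 ≤ 24 / 5 * kap θ ^ 2 * (a ^ 2 - kap θ ^ 2) := by positivity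
    rw [aHat, aHat, hHat_eq_add a (kap θ), dHat_eq_add a (kap θ)]
    nlinarith [sq_nonneg (a ^ 2 - kap θ ^ 2)]
  have i3 := dHat_eq_add a (kap θ) θ
  generalize aHat (kap θ) θ + bSig θ = Qk at *
  generalize aHat a θ + bSig θ = Q at *
  generalize dHat (kap θ) θ = Dk at *
  generalize a ^ 2 - kap θ ^ 2 = e at *
  have hDe : 0 ≤ Dk * e := by nlinarith
  have i4 : (Qk + 6 * Dk * e) ^ 2 ≤ Q ^ 2 :=
    pow_le_pow_left₀ (by nlinarith) i2 2
  refine Real.sqrt_le_iff.2 ⟨by nlinarith, ?_⟩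
  rw [i3]
  have j1 := mul_le_mul_of_nonneg_right hQ hDe
  have j2 : e ^ 2 ≤ 5 / 3 * (Dk * e) := by nlinarith
  nlinarith [sq_nonneg (Dk * e)]

lemma le_sSq (h0 : 0 ≤ θ) (h1 : θ ≤ 3 / 5) (hκ : kap θ ≤ a) : (1.81 : ℝ) ^ 2 ≤ sSq a θ := by
  have hk0 : 0 ≤ kap θ := by rw [kap]; linarith
  refine le_trans ?_ (sSq_mono hk0 hκ (by linarith [half_le_dHat_kap h0 h1]))
  have b := bernstein_nonneg h0 h1
  rw [sSq, hHat, dHat, kap]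
  linarith [b 0 4, b 1 3, b 2 2, b 3 1, b 4 0]

lemma le_sqrt_aHat_mul_bSig (h0 : 0 ≤ θ) (h1 : θ ≤ 3 / 5) (hκ : kap θ ≤ a) :
    3.324 * θ ≤ Real.sqrt (aHat a θ * bSig θ) := by
  have hV : 0 ≤ 1 - θ ^ 2 := by nlinarith
  have i1 : 1.23 ≤ aHat (kap θ) θ * (1 - θ ^ 2) := by
    have b := bernstein_nonneg h0 h1
    rw [aHat, hHat, dHat, kap]
    linarith [b 0 6, b 1 5, b 2 4, b 3 3, b 4 2, b 5 1, b 6 0]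
  have i2 := i1.trans (mul_le_mul_of_nonneg_right (aHat_mono h0 h1 hκ) hV)
  refine Real.le_sqrt_of_sq_le ?_
  have i3 := mul_le_mul_of_nonneg_right i2 (sq_nonneg θ)
  rw [bSig]
  nlinarith

lemma le_eight_mul_cube (h0 : 0 ≤ θ) (hκ : kap θ ≤ a) :
    1 + 3 * θ + 3 * θ ^ 2 + 6 * (a ^ 2 - kap θ ^ 2) ≤ 8 * a ^ 3 := by
  have hk : 1 / 2 ≤ kap θ := by rw [kap]; linarith
  have e : 1 + 3 * θ + 3 * θ ^ 2 + θ ^ 3 = 8 * kap θ ^ 3 := by rw [kap]; ring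
  have : 0 ≤ θ ^ 3 := pow_nonneg h0 3
  have : 12 * kap θ * (a ^ 2 - kap θ ^ 2) ≤ 8 * a ^ 3 - 8 * kap θ ^ 3 := by
    linarith [mul_nonneg (sq_nonneg (a - kap θ)) (by linarith : 0 ≤ 8 * a + 4 * kap θ)]
  have he : 0 ≤ a ^ 2 - kap θ ^ 2 := by
    have := pow_le_pow_left₀ (by linarith : 0 ≤ kap θ) hκ 2; linarith
  nlinarith

lemma sqrt_dl_four_le_of_le (h0 : 0 ≤ θ) (h1 : θ ≤ 3 / 5) (hn : 2 ≤ n) :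
    Real.sqrt (3 * (1 - θ ^ 2) ^ 2 + (1 - θ ^ 2) * (6 * θ ^ 2 - 2) / n) ≤ 1.768 * (1 - θ ^ 2) := by
  have hn' : (2 : ℝ) ≤ n := by exact_mod_cast hn
  have ht : θ ^ 2 ≤ 9 / 25 := by nlinarith
  refine Real.sqrt_le_iff.2 ⟨by linarith, ?_⟩
  have : (1 - θ ^ 2) * (6 * θ ^ 2 - 2) / n ≤ 1 / 8 * (1 - θ ^ 2) ^ 2 := by
    rw [div_le_iff₀ (by linarith)]
    nlinarith [mul_nonneg (sq_nonneg (1 - θ ^ 2)) (by linarith : 0 ≤ (n : ℝ) - 2)]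
  nlinarith [sq_nonneg (1 - θ ^ 2)]

/-- The square of a maximum exceeds the square of its first entry at most by the squared positive
part of the second. The truncation level exceeds ν by at most (3+θ)|δ|/4. -/
lemma mm_sq_le (h0 : 0 ≤ θ) (hκ : kap θ ≤ a) (hn : 0 < n) (x : Fin n → Bool × ℝ) :
    mm a θ x ^ 2 ≤ (z1 a θ x + rr θ x) ^ 2 + (3 + θ) ^ 2 / 16 * dl θ x ^ 2 := by
  have hk0 : 0 ≤ kap θ := by rw [kap]; linarith
  have hT : (1 + |θ + dl θ x|) ^ 2 / 4 - a ^ 2 ≤ (3 + θ) / 4 * |dl θ x| := by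
    have i1 := pow_le_pow_left₀ hk0 hκ 2
    have i2 := abs_add_dl_le (θ := θ) hn x
    have i3 : |θ + dl θ x| ≤ θ + |dl θ x| := by
      have := abs_add_le θ (dl θ x); rwa [abs_of_nonneg h0] at this
    have i4 := abs_nonneg (θ + dl θ x)
    have i5 := abs_nonneg (dl θ x)
    have e : (1 + |θ + dl θ x|) ^ 2 / 4 - kap θ ^ 2 =
        (|θ + dl θ x| - θ) * (2 + |θ + dl θ x| + θ) / 4 := by rw [kap]; ring
    rcases le_total |θ + dl θ x| θ with h | h
    · nlinarith
    · nlinarith [mul_le_mul (by linarith : |θ + dl θ x| - θ ≤ |dl θ x|)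
        (by linarith : 2 + |θ + dl θ x| + θ ≤ 3 + θ) (by linarith) i5]
  rw [mm]
  have e : (3 + θ) ^ 2 / 16 * dl θ x ^ 2 = ((3 + θ) / 4 * |dl θ x|) ^ 2 := by
    rw [mul_pow, sq_abs]; ring
  rw [e]
  generalize (1 + |θ + dl θ x|) ^ 2 / 4 - a ^ 2 = T at *
  rcases le_total (z1 a θ x + rr θ x) T with hle | hle
  · rw [max_eq_right hle]
    rcases le_total 0 T with h | h
    · nlinarith [pow_le_pow_left₀ h hT 2]
    · nlinarith [sq_nonneg ((3 + θ) / 4 * |dl θ x|)]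
  · rw [max_eq_left hle]
    linarith [sq_nonneg ((3 + θ) / 4 * |dl θ x|)]

lemma PairLaw.l2_mm_le (h : PairLaw ρ a θ) (h0 : 0 ≤ θ) (h1 : θ ≤ 3 / 5) (hκ : kap θ ≤ a)
    (hn : 2 ≤ n) (hn2 : n ≤ 200) :
    l2 (mm (n := n) a θ) (Measure.pi fun _ => ρ) ≤
      Real.sqrt (∫ x : Fin n → Bool × ℝ, (z1 a θ x + rr θ x) ^ 2 ∂(Measure.pi fun _ => ρ)) +
        0.245 * (3 + θ) ^ 2 * (1 - θ ^ 2) / n := by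
  have hn' : (2 : ℝ) ≤ n := by exact_mod_cast hn
  have hn2' : (n : ℝ) ≤ 200 := by exact_mod_cast hn2
  have hn0 : (0 : ℝ) < n := by linarith
  have t1 := h.tame_z1 (n := n)
  have t2 := h.tame_rr (n := n)
  have t3 := tame_dl (n := n) ρ θ
  have t4 := h.tame_mm (n := n)
  have hV : 0 ≤ 1 - θ ^ 2 := by nlinarith
  have hm : 1.81 ^ 2 / n ≤ ∫ x : Fin n → Bool × ℝ, (z1 a θ x + rr θ x) ^ 2
      ∂(Measure.pi fun _ => ρ) := by
    rw [h.int_z1_add_rr_sq hn]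
    have := integral_nonneg (μ := Measure.pi fun _ => ρ)
        (f := fun x : Fin n → Bool × ℝ => rr θ x ^ 2) fun x => sq_nonneg _
    have := div_le_div_of_nonneg_right (le_sSq h0 h1 hκ) hn0.le
    linarith
  have hle : ∫ x : Fin n → Bool × ℝ, mm a θ x ^ 2 ∂(Measure.pi fun _ => ρ) ≤
      (∫ x : Fin n → Bool × ℝ, (z1 a θ x + rr θ x) ^ 2 ∂(Measure.pi fun _ => ρ)) +
        (3 + θ) ^ 2 / 16 * ((1 - θ ^ 2) / n) := by
    rw [← h.int_dl_sq hn, ← integral_const_mul, ← integral_add (Tame.integrable (by fun_prop))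
      (Tame.integrable (by fun_prop))]
    exact integral_mono (Tame.integrable (by fun_prop)) (Tame.integrable (by fun_prop))
      fun x => mm_sq_le h0 hκ (by omega) x
  generalize ∫ x : Fin n → Bool × ℝ, (z1 a θ x + rr θ x) ^ 2 ∂(Measure.pi fun _ => ρ) = m at *
  have hm0 : 0 ≤ m := le_trans (by positivity) hm
  refine Real.sqrt_le_iff.2 ⟨by positivity, hle.trans ?_⟩
  -- For n ≤ 200 the root of m is at least 1.81/√200. This trades the loss of order n^(-1/2) for one
  -- of order 1/n: 2·0.1279·0.245 ≥ 1/16.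
  have hq : 0.1279 ≤ Real.sqrt m := by
    refine Real.le_sqrt_of_sq_le (le_trans ?_ hm)
    rw [le_div_iff₀ hn0]
    norm_num
    linarith
  have e : 0.245 * (3 + θ) ^ 2 * (1 - θ ^ 2) / n = 0.245 * (3 + θ) ^ 2 * ((1 - θ ^ 2) / n) := by ring
  have hc : 0 ≤ (3 + θ) ^ 2 * ((1 - θ ^ 2) / n) := by positivity
  rw [e]
  nlinarith [Real.sq_sqrt hm0, mul_le_mul_of_nonneg_right hq hc]

/-- The numerical reserve is smallest near θ = 0, a = 1/2, where it is the gap between 3·1.4716 and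
3·1.732 times `aHat`; the crude truncation loss fits into it. -/
lemma PairLaw.l2_err_le_of_small (h : PairLaw ρ a θ) (h0 : 0 ≤ θ) (h1 : θ ≤ 3 / 5)
    (hκ : kap θ ≤ a) (ha : a ≤ 1) (hn : 2 ≤ n) (hn2 : n ≤ 200) :
    l2 (fun x : Fin n → Bool × ℝ => errAt a (bt a θ x)) (Measure.pi fun _ => ρ) ≤
      Real.sqrt (∫ x : Fin n → Bool × ℝ, (z1 a θ x + rr θ x) ^ 2 ∂(Measure.pi fun _ => ρ)) +
        24 * a ^ 3 * (sBound a θ n ^ 2 / n) := by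
  have hk : 1 / 2 ≤ kap θ := by rw [kap]; linarith
  have hV : 0 ≤ 1 - θ ^ 2 := by nlinarith
  have hd := dHat_mono (θ := θ) (by linarith : 0 ≤ kap θ) hκ
  have hd' := half_le_dHat_kap h0 h1
  have hB0 : 0 ≤ bSig θ := by rw [bSig]; positivity
  have hA0 : 0 < aHat a θ := by
    refine lt_of_lt_of_le ?_ (aHat_mono h0 h1 hκ)
    have b := bernstein_nonneg h0 h1
    rw [aHat, hHat, dHat, kap]
    linarith [b 0 4, b 1 3, b 2 2, b 3 1, b 4 0]
  refine h.l2_err_le_of_l2_mm_le h0 (by linarith) (hk.trans hκ) hn hA0.le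
    (fun h => absurd h hA0.ne') (h.l2_mm_le h0 h1 hκ hn hn2) ?_
  have hQ := le_aHat_add_bSig h0 h1 hκ
  have hR := quadratic_part_le h0 h1 hκ ha
  have hl := le_eight_mul_cube h0 hκ
  have he : 0 ≤ a ^ 2 - kap θ ^ 2 := by
    have := pow_le_pow_left₀ (by linarith : 0 ≤ kap θ) hκ 2; linarith
  have hl1 : 1 + 3 * θ ≤ 8 * a ^ 3 := by nlinarith
  have hq := Real.sqrt_nonneg (|P1 θ n| / n)
  have hAB : Real.sqrt (aHat a θ * bSig θ) =
      3 * θ * (Real.sqrt (aHat a θ) * Real.sqrt (1 - θ ^ 2)) := by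
    rw [bSig, show aHat a θ * (9 * (θ ^ 2 * (1 - θ ^ 2))) =
      (3 * θ) ^ 2 * (aHat a θ * (1 - θ ^ 2)) by ring, Real.sqrt_mul (sq_nonneg _),
      Real.sqrt_sq (by positivity), Real.sqrt_mul hA0.le]
  have hZ : (Real.sqrt (1.4716 * aHat a θ) + 3 * θ * Real.sqrt (Real.sqrt
      (3 * (1 - θ ^ 2) ^ 2 + (1 - θ ^ 2) * (6 * θ ^ 2 - 2) / n))) ^ 2 ≤
      1.4716 * aHat a θ + 1.768 * bSig θ + 3.4 * Real.sqrt (aHat a θ * bSig θ) := by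
    have i1 : Real.sqrt (Real.sqrt
      (3 * (1 - θ ^ 2) ^ 2 + (1 - θ ^ 2) * (6 * θ ^ 2 - 2) / n)) ≤
      Real.sqrt 1.768 * Real.sqrt (1 - θ ^ 2) := by
      rw [← Real.sqrt_mul (by norm_num)]
      exact Real.sqrt_le_sqrt (sqrt_dl_four_le_of_le h0 h1 hn)
    have i2 := pow_le_pow_left₀ (by positivity) (add_le_add_right (mul_le_mul_of_nonneg_left i1
      (by positivity : 0 ≤ 3 * θ)) (Real.sqrt (1.4716 * aHat a θ))) 2
    refine i2.trans ?_
    rw [hAB, Real.sqrt_mul (by norm_num)]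
    have j1 := Real.sq_sqrt hA0.le
    have j2 := Real.sq_sqrt hV
    have j3 : Real.sqrt 1.4716 ^ 2 = 1.4716 := Real.sq_sqrt (by norm_num)
    have j4 : Real.sqrt 1.768 ^ 2 = 1.768 := Real.sq_sqrt (by norm_num)
    have j5 : Real.sqrt 1.4716 * Real.sqrt 1.768 ≤ 1.7 := by
      rw [← Real.sqrt_mul (by norm_num)]
      exact Real.sqrt_le_iff.2 ⟨by norm_num, by norm_num⟩
    have j6 := mul_le_mul_of_nonneg_right j5
      (by positivity : 0 ≤ 3 * θ * (Real.sqrt (aHat a θ) * Real.sqrt (1 - θ ^ 2)))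
    have e : (Real.sqrt 1.4716 * Real.sqrt (aHat a θ) +
        3 * θ * (Real.sqrt 1.768 * Real.sqrt (1 - θ ^ 2))) ^ 2 =
        Real.sqrt 1.4716 ^ 2 * Real.sqrt (aHat a θ) ^ 2 +
        Real.sqrt 1.768 ^ 2 * (9 * (θ ^ 2 * Real.sqrt (1 - θ ^ 2) ^ 2)) +
        2 * (Real.sqrt 1.4716 * Real.sqrt 1.768 *
          (3 * θ * (Real.sqrt (aHat a θ) * Real.sqrt (1 - θ ^ 2)))) := by ring
    rw [e, j1, j2, j3, j4, bSig]
    linarith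
  have hBt : bSig θ ≤ 9 * θ * (3 / 5) := by
    rw [bSig]; nlinarith [mul_nonneg h0 hV, pow_nonneg h0 3]
  have hc : 0.245 * (3 + θ) ^ 2 * (1 - θ ^ 2) ≤ 2.21 + 2 * θ := by
    nlinarith [mul_nonneg (sq_nonneg (3 + θ)) (sq_nonneg θ)]
  have hAB0 := Real.sqrt_nonneg (aHat a θ * bSig θ)
  generalize (Real.sqrt (1.4716 * aHat a θ) + 3 * θ * Real.sqrt (Real.sqrt
      (3 * (1 - θ ^ 2) ^ 2 + (1 - θ ^ 2) * (6 * θ ^ 2 - 2) / n))) ^ 2 = Z at *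
  generalize Real.sqrt (2 * (9 / 4 * (1 - θ ^ 2) ^ 2 + dHat a θ ^ 2)) = R at *
  generalize Real.sqrt (aHat a θ * bSig θ) = C at *
  generalize Real.sqrt (|P1 θ n| / n) = q at *
  generalize 0.245 * (3 + θ) ^ 2 * (1 - θ ^ 2) = c at *
  have f1 := mul_le_mul_of_nonneg_left (show 1.4143 * R ≤ 0.855 * (aHat a θ + bSig θ) by linarith)
    (by linarith : 0 ≤ 8 * a ^ 3 - 1)
  have f2 := mul_le_mul_of_nonneg_left hQ (by linarith : 0 ≤ 8 * a ^ 3 - 1)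
  have f3 := mul_nonneg (by linarith : 0 ≤ 8 * a ^ 3 - 1) hAB0
  have f4 := mul_nonneg (by linarith : 0 ≤ 8 * a ^ 3) hq
  linarith

end Deviation

/-! ### Weak asymmetry and large samples -/

section Deviation

variable {n : ℕ} {ρ : Measure (Bool × ℝ)} [IsProbabilityMeasure ρ] {a θ : ℝ}

/-- Controls the boundedness correction in the exponential moments. With X = 4.55θ + a² - κ² both y
and 8a³ are compared with affine functions of X, and exp w ≤ 1/(1-w) is used at half the exponent.
The number 25.59 is below 1.81·√200. -/
lemma exp_linear_le (h0 : 0 ≤ θ) (h1 : θ ≤ 3 / 5) (hκ : kap θ ≤ a) (ha : a ≤ 1) {y : ℝ}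
    (hy : 25.59 * y ≤ dHat a θ + 3 * θ * (1 + θ)) :
    Real.exp (2.6 * y) ≤ 1.085 * (8 * a ^ 3) := by
  have hk0 : 0 ≤ kap θ := by rw [kap]; linarith
  have hl := le_eight_mul_cube h0 hκ
  have he : 0 ≤ a ^ 2 - kap θ ^ 2 := by have := pow_le_pow_left₀ hk0 hκ 2; linarith
  have he1 : a ^ 2 - kap θ ^ 2 ≤ 3 / 4 := by
    have := pow_le_one₀ (n := 2) (hk0.trans hκ) ha
    have : 1 / 4 ≤ kap θ ^ 2 := by rw [kap]; nlinarith
    linarith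
  have hd : dHat a θ + 3 * θ * (1 + θ) ≤ 3 / 4 + (4.55 * θ + (a ^ 2 - kap θ ^ 2)) := by
    rw [dHat_eq_add a (kap θ), dHat, kap]; nlinarith
  obtain ⟨X, hX⟩ : ∃ X, X = 4.55 * θ + (a ^ 2 - kap θ ^ 2) := ⟨_, rfl⟩
  rw [← hX] at hd
  have hX0 : 0 ≤ X := by rw [hX]; linarith
  have hX1 : X ≤ 7 / 2 := by rw [hX]; linarith
  have hlX : 1 + 0.65 * X ≤ 8 * a ^ 3 := by rw [hX]; nlinarith
  have hw : 2.6 * y / 2 ≤ 0.0382 + 0.0509 * X := by linarith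
  have i1 : Real.exp (2.6 * y) ≤ Real.exp (0.0382 + 0.0509 * X) ^ 2 := by
    rw [← Real.exp_nat_mul, Real.exp_le_exp]; push_cast; linarith
  have i2 : Real.exp (0.0382 + 0.0509 * X) * (0.9618 - 0.0509 * X) ≤ 1 := by
    have := Real.add_one_le_exp (-(0.0382 + 0.0509 * X))
    have h2 := mul_le_mul_of_nonneg_left this (Real.exp_nonneg (0.0382 + 0.0509 * X))
    rw [← Real.exp_add, add_neg_cancel, Real.exp_zero] at h2
    linarith
  have hE := Real.exp_pos (0.0382 + 0.0509 * X)
  generalize Real.exp (0.0382 + 0.0509 * X) = E at *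
  have i3 : E ^ 2 * (0.9618 - 0.0509 * X) ^ 2 ≤ 1 := by
    rw [← mul_pow]; exact pow_le_one₀ (by nlinarith) i2
  have i4 : 1 ≤ 1.085 * (1 + 0.65 * X) * (0.9618 - 0.0509 * X) ^ 2 := by
    nlinarith [mul_nonneg hX0 (sub_nonneg.2 hX1), mul_nonneg (mul_nonneg hX0 hX0) hX0]
  have i5 : 0 < (0.9618 - 0.0509 * X) ^ 2 := by
    have : 0 < 0.9618 - 0.0509 * X := by linarith
    positivity
  have i6 : E ^ 2 ≤ 1.085 * (1 + 0.65 * X) := le_of_mul_le_mul_right (i3.trans i4) i5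
  linarith

/-- Moments of the lower tail of the linear part. -/
lemma PairLaw.neg_z1_moments (h : PairLaw ρ a θ) (h0 : 0 ≤ θ) (h1 : θ ≤ 3 / 5) (hκ : kap θ ≤ a)
    (ha : a ≤ 1) (hn : 200 ≤ n) {σ ε : ℝ} (hσ : 1.81 ≤ σ) (hσ2 : σ ^ 2 = sSq a θ) (hε : 0 < ε)
    (hε2 : ε ^ 2 * n = 1) :
    ∫ x : Fin n → Bool × ℝ, max (-z1 a θ x) 0 ^ 3 ∂(Measure.pi fun _ => ρ) ≤
      1.1596 * σ ^ 3 * (1.085 * (8 * a ^ 3)) * ε ^ 3 ∧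
    l2 (fun x : Fin n → Bool × ℝ => max (-z1 a θ x) 0 ^ 2) (Measure.pi fun _ => ρ) ≤
      1.4716 * σ ^ 2 * (1.085 * (8 * a ^ 3)) * ε ^ 2 := by
  have hn' : (200 : ℝ) ≤ n := by exact_mod_cast hn
  have hn0 : 0 < n := by omega
  have hN : (0 : ℝ) < n := by linarith
  have hσ0 : 0 < σ := by linarith
  have hk0 : 0 ≤ kap θ := by rw [kap]; linarith
  have hd : 3 / 5 ≤ dHat a θ := (half_le_dHat_kap h0 h1).trans (dHat_mono hk0 hκ)
  have hB0 : 0 ≤ dHat a θ + 3 * θ * (1 + θ) := by positivity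
  have hS : 14.142 ≤ Real.sqrt n := Real.le_sqrt_of_sq_le (by norm_num; linarith)
  have hSε : Real.sqrt n * ε = 1 := by
    have : (Real.sqrt n * ε) ^ 2 = 1 := by
      rw [mul_pow, Real.sq_sqrt hN.le]; linarith
    have h0 : 0 ≤ Real.sqrt n * ε := by positivity
    nlinarith
  obtain ⟨y, hy⟩ : ∃ y, y = (dHat a θ + 3 * θ * (1 + θ)) / (Real.sqrt n * σ) := ⟨_, rfl⟩
  have hy0 : 0 ≤ y := by rw [hy]; positivity
  have hy1 : 25.59 * y ≤ dHat a θ + 3 * θ * (1 + θ) := by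
    rw [hy, mul_div_assoc', div_le_iff₀ (by positivity)]
    nlinarith [mul_le_mul hS hσ (by norm_num) (by positivity)]
  have hF := exp_linear_le h0 h1 hκ ha hy1
  generalize hF' : 1.085 * (8 * a ^ 3) = F at *
  have harg : ∀ k : ℝ, k / (Real.sqrt n * σ) * (dHat a θ + 3 * θ * (1 + θ)) = k * y := fun k => by
    rw [hy]; ring
  have he := Real.exp_one_gt_d9
  have he0 := Real.exp_pos 1
  have hne : ∀ {k c E : ℝ}, 0 ≤ c → 0 ≤ E → k / Real.exp 1 ≤ c ^ 2 →
      Real.sqrt (k * (σ ^ 2 * E ^ 2) / (n * Real.exp 1)) ≤ c * σ * E * ε := by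
    intro k c E hc hE hk
    refine Real.sqrt_le_iff.2 ⟨by positivity, ?_⟩
    have e1 : k * (σ ^ 2 * E ^ 2) / (n * Real.exp 1) = k / Real.exp 1 * (σ ^ 2 * E ^ 2 * ε ^ 2) := by
      field_simp
      linear_combination (-(k * E ^ 2)) * hε2
    rw [e1, mul_pow, mul_pow, mul_pow]
    have := mul_le_mul_of_nonneg_right hk (by positivity : 0 ≤ σ ^ 2 * E ^ 2 * ε ^ 2)
    linarith
  have hs3 : Real.sqrt 3 ≤ 1.7321 := Real.sqrt_le_iff.2 ⟨by norm_num, by norm_num⟩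
  constructor
  -- Here 0.8661 ≥ √3/2, so E ≥ exp(√3 y); the correction enters as E^(3/2), with exponent 3·0.8661
  -- ≤ 2.6.
  · have key := h.integral_neg_z1_pow h0 hn0 (k := 3) (by norm_num) hσ0 hσ2
      (E := Real.exp (0.8661 * y) ^ 2) (one_le_pow₀ (Real.one_le_exp (by positivity)))
      (by
        push_cast
        rw [harg, ← Real.exp_nat_mul, Real.exp_le_exp]
        push_cast
        nlinarith)
    push_cast at key
    refine key.trans ((pow_le_pow_left₀ (Real.sqrt_nonneg _) (hne (c := 1.05056) (by norm_num)
      (Real.exp_nonneg _) ?_) 3).trans ?_)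
    · rw [div_le_iff₀ he0]; norm_num; linarith
    · have e1 : Real.exp (0.8661 * y) ^ 3 ≤ F := by
        refine le_trans ?_ hF
        rw [← Real.exp_nat_mul, Real.exp_le_exp]
        push_cast
        nlinarith
      have e2 := mul_le_mul_of_nonneg_left e1 (by positivity : 0 ≤ σ ^ 3 * ε ^ 3)
      have e3 : (1.05056 * σ * Real.exp (0.8661 * y) * ε) ^ 3 =
        1.05056 ^ 3 * (σ ^ 3 * ε ^ 3 * Real.exp (0.8661 * y) ^ 3) := by ring
      rw [e3]
      have e4 : 0 ≤ σ ^ 3 * ε ^ 3 * Real.exp (0.8661 * y) ^ 3 := by positivity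
      nlinarith
  · have key := h.integral_neg_z1_pow h0 hn0 (k := 4) (by norm_num) hσ0 hσ2
      (E := Real.exp y ^ 2) (one_le_pow₀ (Real.one_le_exp hy0))
      (by
        push_cast
        rw [harg, ← Real.exp_nat_mul, Real.exp_le_exp]
        push_cast
        rw [show (4 : ℝ) = 2 ^ 2 by norm_num, Real.sqrt_sq (by norm_num)])
    push_cast at key
    have key2 := key.trans (pow_le_pow_left₀ (Real.sqrt_nonneg _) (hne (k := 4) (c := 1.21308)
      (by norm_num) (Real.exp_nonneg y) (by rw [div_le_iff₀ he0]; norm_num; linarith)) 4)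
    have e4 : ∀ x : Fin n → Bool × ℝ, (max (-z1 a θ x) 0 ^ 2) ^ 2 = max (-z1 a θ x) 0 ^ 4 :=
      fun x => by ring
    have hF0 : 0 ≤ F := (Real.exp_nonneg _).trans hF
    rw [l2]
    simp_rw [e4]
    refine Real.sqrt_le_iff.2 ⟨by positivity, key2.trans ?_⟩
    have e5 : (1.21308 * σ * Real.exp y * ε) ^ 4 = (1.21308 ^ 2 * σ ^ 2 * Real.exp y ^ 2 * ε ^ 2) ^ 2 := by
      ring
    rw [e5]
    have e6 : Real.exp y ^ 2 ≤ F := by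
      refine le_trans ?_ hF
      rw [← Real.exp_nat_mul, Real.exp_le_exp]
      push_cast
      linarith
    refine pow_le_pow_left₀ (by positivity) ?_ 2
    gcongr
    norm_num

/-- The second moment of the deviation of the truncated estimator of `ν`. -/
lemma PairLaw.l2_mm_le_of_large (h : PairLaw ρ a θ) (h0 : 0 ≤ θ) (h1 : θ ≤ 3 / 5) (hκ : kap θ ≤ a)
    (ha : a ≤ 1) (hn : 2 ≤ n) {σ ε R : ℝ} (hσ2 : σ ^ 2 = sSq a θ) (hε : 0 < ε)
    (hε2 : ε ^ 2 * n = 1) (hR : l2 (rr (n := n) θ) (Measure.pi fun _ => ρ) ≤ R) :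
    l2 (mm (n := n) a θ) (Measure.pi fun _ => ρ) ≤
      Real.sqrt (σ ^ 2 * ε ^ 2 + 8 * a ^ 3 * (35 / 2 + 125 * θ) * ε ^ 3) +
        (R + 0.442 * (1 - θ ^ 2) * ε ^ 2) := by
  have hN : (0 : ℝ) < n := by positivity
  have hne : (1 : ℝ) / n = ε ^ 2 := by field_simp; linarith
  have hSε : 1 / Real.sqrt n = ε := by
    rw [← Real.sqrt_one, ← Real.sqrt_div zero_le_one, hne, Real.sqrt_sq hε.le]
  have t1 := h.tame_z1 (n := n)
  have t2 := h.tame_rr (n := n)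
  have t3 := tame_dl (n := n) ρ θ
  have t4 := h.tame_mm (n := n)
  have t5 : Tame (fun x : Fin n → Bool × ℝ => max (z1 a θ x)
      (kap θ * |θ + dl θ x| - kap θ * θ - (a ^ 2 - kap θ ^ 2))) (Measure.pi fun _ => ρ) := by fun_prop
  have s1 := l2_add_le t5 (t4.sub t5)
  simp only [add_sub_cancel] at s1
  have s2 := l2_mono (t4.sub t5) (t2.abs.add ((Tame.const (1 / 4)).mul (t3.pow 2)))
    fun x => (abs_mm_sub_max_le h0 x).trans (le_abs_self _)
  have s3 := l2_add_le t2.abs ((Tame.const (1 / 4)).mul (t3.pow 2))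
  rw [l2_const_mul, h.l2_dl_sq hn, abs_of_pos (by norm_num)] at s3
  have s4 : l2 (fun x : Fin n → Bool × ℝ => |rr θ x|) (Measure.pi fun _ => ρ) =
    l2 (rr (n := n) θ) (Measure.pi fun _ => ρ) := by simp [l2, sq_abs]
  have s5 := div_le_div_of_nonneg_right (sqrt_dl_four_le_of_le h0 h1 hn) hN.le
  have s6 : l2 (fun x : Fin n → Bool × ℝ => max (z1 a θ x)
      (kap θ * |θ + dl θ x| - kap θ * θ - (a ^ 2 - kap θ ^ 2))) (Measure.pi fun _ => ρ) ≤
      Real.sqrt (σ ^ 2 * ε ^ 2 + 8 * a ^ 3 * (35 / 2 + 125 * θ) * ε ^ 3) := by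
    refine Real.sqrt_le_sqrt ((h.integral_max_sq_le h0 h1 hκ ha hn).trans (le_of_eq ?_))
    have e1 : sSq a θ / n = σ ^ 2 * ε ^ 2 := by rw [← hne, hσ2]; ring
    have e2 : ∀ v : ℝ, v / (n * Real.sqrt n) = v * ε ^ 3 := fun v => by
      rw [pow_succ, ← hne, ← hSε]; field_simp
    rw [e1, e2]
  have s7 : 1.768 * (1 - θ ^ 2) / n = 1.768 * (1 - θ ^ 2) * ε ^ 2 := by rw [← hne]; ring
  rw [s7] at s5
  rw [s4] at s3
  linarith

/-- The comparison of the expansions of the quadratic deviation and of its bound. -/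
lemma expansion_le {l σ Q C b ε : ℝ} (hl : 1 ≤ l) (hσ : 1.81 ≤ σ) (hQ : 63 / 16 ≤ Q) (hC : 0 ≤ C)
    (hσQ : 7 * σ ^ 2 ≤ 6 * Q) (hb0 : 0 ≤ b) (hbl : b ≤ 25.5 * l) (hbQ : b ≤ 2.4856 * (σ * Q) + 20.784 * (σ * C))
    (hε : 0 < ε) :
    (Real.sqrt (σ ^ 2 * ε ^ 2 + l * b * ε ^ 3) + 0.7179 * Q * ε ^ 2) ^ 2 +
      6 * (1.1596 * σ ^ 3 * (1.085 * l) * ε ^ 3) +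
      6 * (0.6056 * Q * ε ^ 2 * (1.4716 * σ ^ 2 * (1.085 * l) * ε ^ 2)) +
      2 * (l - 1) * ((σ * ε + 0.6056 * Q * ε ^ 2) * (0.6056 * Q * ε ^ 2)) +
      (3 * (1.4716 * σ ^ 2 * (1.085 * l) * ε ^ 2) + (l - 1) * (0.6056 * Q * ε ^ 2)) ^ 2 ≤
    σ ^ 2 * ε ^ 2 + 2 * (σ * ε) * (5.196 * l * (Q + 2 * C) * ε ^ 2) +
      (5.196 * l * (Q + 2 * C) * ε ^ 2) ^ 2 := by
  have hσ0 : 0 < σ := by linarith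
  have hQ0 : 0 < Q := by linarith
  have hl0 : 0 < l := by linarith
  have hs : Real.sqrt (σ ^ 2 * ε ^ 2 + l * b * ε ^ 3) ≤ σ * ε + l * b * ε ^ 2 / (2 * σ) := by
    refine Real.sqrt_le_iff.2 ⟨by positivity, ?_⟩
    have : (σ * ε + l * b * ε ^ 2 / (2 * σ)) ^ 2 =
        σ ^ 2 * ε ^ 2 + l * b * ε ^ 3 + (l * b * ε ^ 2 / (2 * σ)) ^ 2 := by
      field_simp; ring
    rw [this]
    linarith [sq_nonneg (l * b * ε ^ 2 / (2 * σ))]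
  have hs2 : Real.sqrt (σ ^ 2 * ε ^ 2 + l * b * ε ^ 3) ^ 2 = σ ^ 2 * ε ^ 2 + l * b * ε ^ 3 :=
    Real.sq_sqrt (by positivity)
  -- the terms of third order
  have hσ3 : 7 * (l * σ ^ 3) ≤ 6 * (l * (σ * Q)) := by
    have := mul_le_mul_of_nonneg_left hσQ (by positivity : 0 ≤ l * σ)
    linarith
  have hT1 : l * b + 1.4358 * (σ * Q) + 6 * (1.1596 * σ ^ 3 * (1.085 * l)) +
      1.2112 * (l - 1) * (σ * Q) ≤ 10.392 * l * σ * (Q + 2 * C) := by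
    have i1 := mul_le_mul_of_nonneg_left hbQ hl0.le
    have i2 := mul_le_mul_of_nonneg_right hl (by positivity : 0 ≤ σ * Q)
    have i3 : 0 ≤ l * (σ * Q) := by positivity
    linarith
  -- the terms of fourth order
  have hQσ : σ ^ 2 ≤ 0.85715 * Q := by linarith
  have hlb : l * b / σ * (0.7179 * Q) ≤ 2.57 * l ^ 2 * Q ^ 2 := by
    rw [div_mul_eq_mul_div, div_le_iff₀ hσ0]
    have i1 := mul_le_mul_of_nonneg_left hbl (by positivity : 0 ≤ l * Q)
    have i2 : 7.126 ≤ σ * Q := by nlinarith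
    have i3 := mul_le_mul_of_nonneg_right i2 (by positivity : 0 ≤ l ^ 2 * Q)
    have i4 : 0 ≤ l ^ 2 * Q := by positivity
    linarith
  have hsq : (3 * (1.4716 * σ ^ 2 * (1.085 * l)) + (l - 1) * (0.6056 * Q)) ^ 2 ≤
      ((4.7114 * l - 0.6056) * Q) ^ 2 := by
    have i1 := mul_le_mul_of_nonneg_right hQσ hl0.le
    have i2 : 0 ≤ (l - 1) * (0.6056 * Q) := mul_nonneg (by linarith) (by linarith)
    refine pow_le_pow_left₀ (by positivity) ?_ 2
    have i3 : 0 ≤ l * Q := by positivity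
    linarith
  have hT2 : l * b / σ * (0.7179 * Q) + (0.7179 * Q) ^ 2 +
      6 * (0.6056 * Q * (1.4716 * σ ^ 2 * (1.085 * l))) + 2 * (l - 1) * (0.6056 * Q) ^ 2 +
      (3 * (1.4716 * σ ^ 2 * (1.085 * l)) + (l - 1) * (0.6056 * Q)) ^ 2 ≤
      (5.196 * l * (Q + 2 * C)) ^ 2 := by
    have i1 := mul_le_mul_of_nonneg_right hQσ (by positivity : 0 ≤ l * Q)
    have i2 : (5.196 * l * Q) ^ 2 ≤ (5.196 * l * (Q + 2 * C)) ^ 2 := by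
      refine pow_le_pow_left₀ (by positivity) ?_ 2
      have : 0 ≤ l * C := by positivity
      linarith
    have i3 : Q ^ 2 ≤ l ^ 2 * Q ^ 2 := le_mul_of_one_le_left (sq_nonneg Q) (one_le_pow₀ hl)
    have i4 : l * Q ^ 2 ≤ l ^ 2 * Q ^ 2 := by
      have := mul_le_mul_of_nonneg_right hl (by positivity : 0 ≤ l * Q ^ 2)
      linarith
    have i5 : 0 ≤ l ^ 2 * Q ^ 2 := by positivity
    have i6 : 0 ≤ l * Q ^ 2 := by positivity
    linarith
  have j1 := mul_le_mul_of_nonneg_right hs (by positivity : 0 ≤ 2 * (0.7179 * Q * ε ^ 2))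
  have j2 := mul_le_mul_of_nonneg_right hT1 (by positivity : 0 ≤ ε ^ 3)
  have j3 := mul_le_mul_of_nonneg_right hT2 (by positivity : 0 ≤ ε ^ 4)
  have e1 : (σ * ε + l * b * ε ^ 2 / (2 * σ)) * (2 * (0.7179 * Q * ε ^ 2)) =
      1.4358 * (σ * Q) * ε ^ 3 + l * b / σ * (0.7179 * Q) * ε ^ 4 := by
    field_simp; ring
  rw [e1] at j1
  generalize l * b / σ * (0.7179 * Q) = w at *
  generalize Real.sqrt (σ ^ 2 * ε ^ 2 + l * b * ε ^ 3) = S at *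
  nlinarith only [j1, j2, j3, hs2]

/-- A bound for the quadratic deviation which is sharp in the leading order. -/
lemma PairLaw.integral_err_sq_le (h : PairLaw ρ a θ) (ha2 : 1 / 2 ≤ a) :
    ∫ x : Fin n → Bool × ℝ, errAt a (bt a θ x) ^ 2 ∂(Measure.pi fun _ => ρ) ≤
        l2 (mm (n := n) a θ) (Measure.pi fun _ => ρ) ^ 2 +
        (6 * (∫ x : Fin n → Bool × ℝ, max (-z1 a θ x) 0 ^ 3 ∂(Measure.pi fun _ => ρ)) +
        6 * (l2 (rr (n := n) θ) (Measure.pi fun _ => ρ) *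
          l2 (fun x : Fin n → Bool × ℝ => max (-z1 a θ x) 0 ^ 2) (Measure.pi fun _ => ρ)) +
        2 * (8 * a ^ 3 - 1) * (Real.sqrt (∫ x : Fin n → Bool × ℝ, (z1 a θ x + rr θ x) ^ 2
          ∂(Measure.pi fun _ => ρ)) * l2 (rr (n := n) θ) (Measure.pi fun _ => ρ))) +
        l2 (fun x : Fin n → Bool × ℝ => excess a (z1 a θ x) (rr θ x)) (Measure.pi fun _ => ρ) ^ 2 := by
  have t1 := h.tame_z1 (n := n)
  have t2 := h.tame_rr (n := n)
  have t3 := h.tame_mm (n := n)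
  have t4 := h.tame_err (n := n) ha2
  have t5 : Tame (fun x : Fin n → Bool × ℝ => excess a (z1 a θ x) (rr θ x))
      (Measure.pi fun _ => ρ) := by unfold excess; fun_prop
  have eabs : ∀ f : (Fin n → Bool × ℝ) → ℝ, l2 (fun x => |f x|) (Measure.pi fun _ => ρ) =
    l2 f (Measure.pi fun _ => ρ) := fun f => by simp [l2, sq_abs]
  have i1 := integral_mul_le_l2 t2.abs (g := fun x : Fin n → Bool × ℝ => max (-z1 a θ x) 0 ^ 2)
    (by fun_prop)
  have i2 := integral_mul_le_l2 (t1.add t2).abs t2.abs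
  rw [eabs] at i1
  rw [eabs, eabs] at i2
  refine (integral_mono (t4.pow 2).integrable (Tame.integrable ?_)
    fun x => errAt_sq_le ha2 (half_le_bt (a := a) (θ := θ) x) (le_bt_sq_sub x)).trans ?_
  · simp only [bt_sq_sub]
    fun_prop
  · simp only [bt_sq_sub]
    rw [integral_add (Tame.integrable (by fun_prop)) (Tame.integrable (by fun_prop)),
      integral_add (Tame.integrable (by fun_prop)) (Tame.integrable (by fun_prop)),
      integral_add (Tame.integrable (by fun_prop)) (Tame.integrable (by fun_prop)),
      integral_add (Tame.integrable (by fun_prop)) (Tame.integrable (by fun_prop)),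
      integral_const_mul, integral_const_mul, integral_const_mul, l2_sq, l2_sq]
    have := mul_le_mul_of_nonneg_left i2
      (by linarith [one_le_eight_mul ha2] : 0 ≤ 2 * (8 * a ^ 3 - 1))
    rw [l2] at this
    linarith

/-- Monotonicity in all arguments: the numerical inequality for the estimates implies the one for
the actual norms. -/
lemma deviation_le_of_expansion {M m3 R z q X Y l M' m3' R' z' q' S P : ℝ} (hl : 1 ≤ l)
    (hM0 : 0 ≤ M) (hR0 : 0 ≤ R) (hz0 : 0 ≤ z) (hX0 : 0 ≤ X) (hP0 : 0 ≤ P) (hS0 : 0 ≤ S)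
    (hM : M ≤ M') (h3 : m3 ≤ m3') (hR : R ≤ R') (hz : z ≤ z') (hS : S ≤ q) (hq : q ≤ q')
    (hX : X ≤ 3 * z + (l - 1) * R) (hP : P ≤ Y)
    (h : M' ^ 2 + 6 * m3' + 6 * (R' * z') + 2 * (l - 1) * (q' * R') +
      (3 * z' + (l - 1) * R') ^ 2 ≤ S ^ 2 + 2 * S * P + P ^ 2) :
    M ^ 2 + (6 * m3 + 6 * (R * z) + 2 * (l - 1) * (q * R)) + X ^ 2 ≤ (q + Y) ^ 2 := by
  have g1 := pow_le_pow_left₀ hM0 hM 2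
  have g2 := mul_le_mul hR hz hz0 (hR0.trans hR)
  have g3 := mul_le_mul_of_nonneg_left (mul_le_mul hq hR hR0 ((hS0.trans hS).trans hq))
    (by linarith : 0 ≤ 2 * (l - 1))
  have g4 := pow_le_pow_left₀ hX0 (hX.trans (add_le_add (mul_le_mul_of_nonneg_left hz
    (by norm_num : (0 : ℝ) ≤ 3)) (mul_le_mul_of_nonneg_left hR
    (by linarith : 0 ≤ l - 1)))) 2
  have g5 := pow_le_pow_left₀ (add_nonneg hS0 hP0) (add_le_add hS hP) 2
  rw [add_sq] at g5
  linarith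

/-- With ε = n^(-1/2) both sides agree in order ε². In order ε³ the truncation cost 35/2 + 125θ is
affordable only because `PairLaw.integral_err_sq_le` uses the third moment of the negative part
(1.1596) rather than an L² product (1.4716). -/
lemma PairLaw.l2_err_le_of_large (h : PairLaw ρ a θ) (h0 : 0 ≤ θ) (h1 : θ ≤ 3 / 5)
    (hκ : kap θ ≤ a) (ha : a ≤ 1) (hn : 200 ≤ n) :
    l2 (fun x : Fin n → Bool × ℝ => errAt a (bt a θ x)) (Measure.pi fun _ => ρ) ≤
      Real.sqrt (∫ x : Fin n → Bool × ℝ, (z1 a θ x + rr θ x) ^ 2 ∂(Measure.pi fun _ => ρ)) +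
        24 * a ^ 3 * (sBound a θ n ^ 2 / n) := by
  have hn2 : 2 ≤ n := by omega
  have hn' : (200 : ℝ) ≤ n := by exact_mod_cast hn
  have hN : (0 : ℝ) < n := by linarith
  have hk : 1 / 2 ≤ kap θ := by rw [kap]; linarith
  have ha2 : 1 / 2 ≤ a := hk.trans hκ
  have hV : 0 ≤ 1 - θ ^ 2 := by nlinarith
  have hl := one_le_eight_mul ha2
  have hQ := le_aHat_add_bSig h0 h1 hκ
  have hA : 0 ≤ aHat a θ := by
    refine le_trans ?_ (aHat_mono h0 h1 hκ)
    have b := bernstein_nonneg h0 h1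
    rw [aHat, hHat, dHat, kap]
    linarith [b 0 4, b 1 3, b 2 2, b 3 1, b 4 0]
  have hB : 0 ≤ bSig θ := by rw [bSig]; positivity
  obtain ⟨ε, hε, hε2⟩ : ∃ ε : ℝ, 0 < ε ∧ ε ^ 2 * n = 1 :=
    ⟨1 / Real.sqrt n, by positivity, by rw [div_pow, Real.sq_sqrt hN.le]; field_simp⟩
  have hne : (1 : ℝ) / n = ε ^ 2 := by field_simp; linarith
  obtain ⟨σ, hσ, hσ2⟩ : ∃ σ : ℝ, 1.81 ≤ σ ∧ σ ^ 2 = sSq a θ :=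
    ⟨Real.sqrt (sSq a θ), Real.le_sqrt_of_sq_le (le_sSq h0 h1 hκ),
      Real.sq_sqrt ((sq_nonneg _).trans (le_sSq h0 h1 hκ))⟩
  have hσ0 : 0 < σ := by linarith
  have hσQ : 7 * σ ^ 2 ≤ 6 * (aHat a θ + bSig θ) := hσ2 ▸ sSq_le_aHat_add_bSig h0 h1 hκ
  have hR : l2 (rr (n := n) θ) (Measure.pi fun _ => ρ) ≤ 0.6056 * (aHat a θ + bSig θ) * ε ^ 2 := by
    refine (h.l2_rr_le hn2 (c := 1.00255) (by norm_num) (by norm_num; linarith)).trans ?_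
    have := quadratic_part_le h0 h1 hκ ha
    rw [← hne, mul_one_div]
    exact div_le_div_of_nonneg_right (by linarith) hN.le
  obtain ⟨hz3, hz4⟩ := h.neg_z1_moments h0 h1 hκ ha hn hσ hσ2 hε hε2
  have hM := h.l2_mm_le_of_large h0 h1 hκ ha hn2 hσ2 hε hε2 hR
  have hM' : l2 (mm (n := n) a θ) (Measure.pi fun _ => ρ) ≤
      Real.sqrt (σ ^ 2 * ε ^ 2 + 8 * a ^ 3 * (35 / 2 + 125 * θ) * ε ^ 3) +
        0.7179 * (aHat a θ + bSig θ) * ε ^ 2 := by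
    have : 0.442 * (1 - θ ^ 2) ≤ 0.1123 * (aHat a θ + bSig θ) := by nlinarith
    have := mul_le_mul_of_nonneg_right this (sq_nonneg ε)
    linarith
  have hX := h.l2_excess_le (n := n) ha2
  have hY : 5.196 * (8 * a ^ 3) * (aHat a θ + bSig θ + 2 * Real.sqrt (aHat a θ * bSig θ)) * ε ^ 2 ≤
      24 * a ^ 3 * (sBound a θ n ^ 2 / n) := by
    have i1 := le_sBound_sq (n := n) hA hB
    have i2 := Real.sqrt_nonneg (|P1 θ n| / n)
    have i3 := mul_le_mul_of_nonneg_left (show 1.732 * (aHat a θ + bSig θ +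
      2 * Real.sqrt (aHat a θ * bSig θ)) ≤ sBound a θ n ^ 2 by linarith)
      (by positivity : 0 ≤ 24 * a ^ 3 * ε ^ 2)
    rw [div_eq_mul_one_div, hne]
    linarith
  have key := h.integral_err_sq_le (n := n) ha2
  have hq1 : σ * ε ≤ Real.sqrt (∫ x : Fin n → Bool × ℝ, (z1 a θ x + rr θ x) ^ 2
      ∂(Measure.pi fun _ => ρ)) := by
    refine Real.le_sqrt_of_sq_le ?_
    rw [h.int_z1_add_rr_sq hn2, mul_pow, hσ2, ← hne, mul_one_div]
    linarith [integral_nonneg (μ := Measure.pi fun _ => ρ)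
        (f := fun x : Fin n → Bool × ℝ => rr θ x ^ 2) fun x => sq_nonneg _]
  have hq2 : Real.sqrt (∫ x : Fin n → Bool × ℝ, (z1 a θ x + rr θ x) ^ 2
      ∂(Measure.pi fun _ => ρ)) ≤ σ * ε + 0.6056 * (aHat a θ + bSig θ) * ε ^ 2 := by
    refine le_trans ?_ (add_le_add_right hR _)
    refine Real.sqrt_le_iff.2 ⟨add_nonneg (by positivity) l2_nonneg, ?_⟩
    have e : (σ * ε) ^ 2 = sSq a θ / n := by rw [mul_pow, hσ2, ← hne, mul_one_div]
    rw [h.int_z1_add_rr_sq hn2, ← l2_sq, add_sq, e]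
    have := l2_nonneg (f := rr (n := n) θ) (μ := Measure.pi fun _ => ρ)
    have : 0 ≤ 2 * (σ * ε) * l2 (rr (n := n) θ) (Measure.pi fun _ => ρ) := by positivity
    linarith
  have hb : 35 / 2 + 125 * θ ≤ 25.5 * (8 * a ^ 3) := by
    have := le_eight_mul_cube h0 hκ
    have he : 0 ≤ a ^ 2 - kap θ ^ 2 := by
      have := pow_le_pow_left₀ (by linarith : 0 ≤ kap θ) hκ 2; linarith
    nlinarith [sq_nonneg (θ - 0.317)]
  have hbQ : 35 / 2 + 125 * θ ≤ 2.4856 * (σ * (aHat a θ + bSig θ)) +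
      20.784 * (σ * Real.sqrt (aHat a θ * bSig θ)) := by
    have i1 := mul_le_mul hσ hQ (by norm_num) hσ0.le
    have i2 := mul_le_mul hσ (le_sqrt_aHat_mul_bSig h0 h1 hκ) (by positivity) hσ0.le
    linarith
  have hC := Real.sqrt_nonneg (aHat a θ * bSig θ)
  have fin := expansion_le hl hσ hQ hC hσQ (by positivity) hb hbQ hε
  have hY0 : 0 ≤ 24 * a ^ 3 * (sBound a θ n ^ 2 / n) := by positivity
  have hP0 : 0 ≤ 5.196 * (8 * a ^ 3) * (aHat a θ + bSig θ +
    2 * Real.sqrt (aHat a θ * bSig θ)) * ε ^ 2 := by positivity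
  refine Real.sqrt_le_iff.2 ⟨by positivity, key.trans (deviation_le_of_expansion hl l2_nonneg
    l2_nonneg l2_nonneg l2_nonneg hP0 (by positivity) hM' hz3 hR hz4 hq1 hq2 hX hY ?_)⟩
  rw [mul_pow]
  exact fin

end Deviation

/-! ### Union of the cases and transfer to stable samples -/

section Transfer

variable {n : ℕ} {ρ : Measure (Bool × ℝ)} [IsProbabilityMeasure ρ] {a θ : ℝ}

lemma PairLaw.l2_err_le_sqrt_add (h : PairLaw ρ a θ) (h0 : 0 ≤ θ) (h1 : θ ≤ 1) (hκ : kap θ ≤ a)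
    (hn : 2 ≤ n) :
    l2 (fun x : Fin n → Bool × ℝ => errAt a (bt a θ x)) (Measure.pi fun _ => ρ) ≤
      Real.sqrt (∫ x : Fin n → Bool × ℝ, (z1 a θ x + rr θ x) ^ 2 ∂(Measure.pi fun _ => ρ)) +
        24 * a ^ 3 * (sBound a θ n ^ 2 / n) := by
  rcases le_total 1 a with ha | ha
  · exact h.l2_err_le_of_one_le h0 h1 ha hn
  rcases le_total (3 / 5) θ with ht | ht
  · exact h.l2_err_le_of_asymmetric ht h1 hκ ha hn
  rcases le_total n 200 with hn2 | hn2
  · exact h.l2_err_le_of_small h0 ht hκ ha hn hn2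
  · exact h.l2_err_le_of_large h0 ht hκ ha hn2

/-- The error is Lipschitz in ν̃ with constant 8a³, and the deviation of ν̃ has order n^(-1/2) in L²
by the crude bound `mm_sq_le`. -/
lemma PairLaw.integral_abs_err_le (h : PairLaw ρ a θ) (h0 : 0 ≤ θ) (hκ : kap θ ≤ a)
    (hn : 2 ≤ n) :
    ∫ x : Fin n → Bool × ℝ, |errAt a (bt a θ x)| ∂(Measure.pi fun _ => ρ) ≤
      8 * a ^ 3 * Real.sqrt ((sSq a θ + 2 * (9 / 4 * (1 - θ ^ 2) ^ 2 + dHat a θ ^ 2) +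
        (3 + θ) ^ 2 / 16 * (1 - θ ^ 2)) / n) := by
  have ha : 1 / 2 ≤ a := by rw [kap] at hκ; linarith
  have hn' : (2 : ℝ) ≤ n := by exact_mod_cast hn
  have hm := h.tame_mm (n := n)
  have hz := h.tame_z1 (n := n)
  have hr := h.tame_rr (n := n)
  have hd := tame_dl (n := n) ρ θ
  have he := h.tame_err (n := n) ha
  have h2 : l2 (mm (n := n) a θ) (Measure.pi fun _ => ρ) ≤
      Real.sqrt ((sSq a θ + 2 * (9 / 4 * (1 - θ ^ 2) ^ 2 + dHat a θ ^ 2) +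
        (3 + θ) ^ 2 / 16 * (1 - θ ^ 2)) / n) := by
    refine Real.sqrt_le_sqrt ?_
    have i1 : ∫ x : Fin n → Bool × ℝ, mm a θ x ^ 2 ∂(Measure.pi fun _ => ρ) ≤
        ∫ x : Fin n → Bool × ℝ, ((z1 a θ x + rr θ x) ^ 2 + (3 + θ) ^ 2 / 16 * dl θ x ^ 2)
          ∂(Measure.pi fun _ => ρ) :=
      integral_mono (hm.pow 2).integrable (Tame.integrable (by fun_prop))
        fun x => mm_sq_le h0 hκ (by omega) x
    rw [integral_add (Tame.integrable (by fun_prop)) (Tame.integrable (by fun_prop)),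
      integral_const_mul, h.int_dl_sq hn, h.int_z1_add_rr_sq hn] at i1
    have i2 := h.int_rr_sq_le hn
    have i3 : 2 * (9 / 4 * (1 - θ ^ 2) ^ 2 + dHat a θ ^ 2) / ((n : ℝ) * ((n : ℝ) - 1)) ≤
        2 * (9 / 4 * (1 - θ ^ 2) ^ 2 + dHat a θ ^ 2) / n :=
      div_le_div_of_nonneg_left (by positivity) (by positivity) (by nlinarith)
    rw [add_div, add_div, mul_div_assoc ((3 + θ) ^ 2 / 16)]
    linarith
  have i1 : ∫ x : Fin n → Bool × ℝ, |errAt a (bt a θ x)| ∂(Measure.pi fun _ => ρ) ≤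
      ∫ x : Fin n → Bool × ℝ, 8 * a ^ 3 * (|mm a θ x| * 1) ∂(Measure.pi fun _ => ρ) :=
    integral_mono he.abs.integrable (Tame.integrable (by fun_prop)) fun x => by
      have := abs_errAt_le_four ha (half_le_bt (a := a) (θ := θ) x)
      rw [bt_sq_sub] at this
      simpa using this
  rw [integral_const_mul] at i1
  refine i1.trans (mul_le_mul_of_nonneg_left (le_trans ?_ h2) (by positivity))
  have i2 := integral_mul_le_l2 (μ := Measure.pi fun _ : Fin n => ρ) hm.abs (Tame.const 1)
  have e1 : l2 (fun x : Fin n → Bool × ℝ => |mm a θ x|) (Measure.pi fun _ => ρ) =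
      l2 (mm (n := n) a θ) (Measure.pi fun _ => ρ) := by simp [l2, sq_abs]
  have e2 : l2 (fun _ : Fin n → Bool × ℝ => (1 : ℝ)) (Measure.pi fun _ => ρ) = 1 := by simp [l2]
  rwa [e1, e2, mul_one] at i2

lemma nuTilde_eq {xs : Fin n → ℝ} {x : Fin n → Bool × ℝ}
    (h1 : |thetaTilde xs| = |θ + dl θ x|) (h2 : nuHat xs = a ^ 2 + (z1 a θ x + rr θ x)) :
    nuTilde xs = a ^ 2 + mm a θ x := by
  rw [nuTilde, h1, h2, mm, ← max_add_add_left]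
  congr 1
  ring

lemma Sm_flip_uu (x : Fin n → Bool × ℝ) :
    Sm (uu (-θ)) (fun i => flip (x i)) = -Sm (uu θ) x := by
  rw [Sm, Sm, ← Finset.sum_neg_distrib]
  refine Finset.sum_congr rfl fun i _ => ?_
  rw [uu, uu, flip, sg_not]
  ring

lemma dl_flip (x : Fin n → Bool × ℝ) : dl (-θ) (fun i => flip (x i)) = -dl θ x := by
  rw [dl, dl, Sm_flip_uu, neg_div]

lemma z1_flip (x : Fin n → Bool × ℝ) : z1 a (-θ) (fun i => flip (x i)) = z1 a θ x := by
  rw [z1, z1]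
  congr 1
  refine Finset.sum_congr rfl fun i _ => ?_
  simp only [yy, uu, flip, sg_not, dHat]
  ring

lemma rr_flip (x : Fin n → Bool × ℝ) : rr (-θ) (fun i => flip (x i)) = rr θ x := by
  rw [rr, rr]
  congr 1
  refine Finset.sum_congr rfl fun i _ => ?_
  simp only [hh, uu, flip, sg_not]
  ring

/-- A stable sample can be replaced by a sample of signs and normalized log-moduli whose law
has a nonnegative asymmetry. -/
lemma IsStableSample.exists_pairLaw {Ω : Type*} [MeasurableSpace Ω] {P : Measure Ω}
    [IsProbabilityMeasure P] {ν τ : ℝ} {X : Fin n → Ω → ℝ} (hν : 1 / 4 ≤ ν)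
    (hθ : |θ| ≤ min 1 (2 * Real.sqrt ν - 1)) (hn : 2 ≤ n) (hX : IsStableSample P ν θ τ X) :
    ∃ (ρ : Measure (Bool × ℝ)) (_ : IsProbabilityMeasure ρ) (Φ : Ω → Fin n → Bool × ℝ),
      PairLaw ρ (Real.sqrt ν) |θ| ∧ MeasurePreserving Φ P (Measure.pi fun _ => ρ) ∧
      ∀ᵐ ω ∂P, nuHat (fun i => X i ω) =
          ν + (z1 (Real.sqrt ν) |θ| (Φ ω) + rr |θ| (Φ ω)) ∧
        alphaTilde (fun i => X i ω) = 1 / bt (Real.sqrt ν) |θ| (Φ ω) := by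
  have ha : 0 < Real.sqrt ν := Real.sqrt_pos.2 (by linarith)
  have hsq : Real.sqrt ν ^ 2 = ν := Real.sq_sqrt (by linarith)
  set i0 : Fin n := ⟨0, by omega⟩
  set μ := P.map (X i0) with hμ
  have hprob : ∀ i, IsProbabilityMeasure (P.map (X i)) := fun i =>
    Measure.isProbabilityMeasure_map (hX.measurable i).aemeasurable
  have hprobμ : IsProbabilityMeasure μ := hprob i0
  have hlaw : ∀ i, P.map (X i) = μ := fun i => by
    have := hprob i
    exact Measure.ext_of_charFun (by ext k; rw [hX.charFun_eq, hμ, hX.charFun_eq])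
  obtain ⟨ℓ, hℓ⟩ := exists_logLaw μ hν hθ (hX.charFun_eq i0)
  have hne : ∀ᵐ ω ∂P, ∀ i, X i ω ≠ 0 := by
    refine ae_all_iff.2 fun i => ?_
    have h0 : ∀ᵐ x ∂(P.map (X i)), x ≠ 0 := by
      rw [hlaw i]
      exact measure_eq_zero_iff_ae_notMem.1 hℓ.zero
    exact ae_of_ae_map (hX.measurable i).aemeasurable h0
  have key : ∀ g : ℝ → Bool × ℝ, Measurable g →
      MeasurePreserving (fun ω i => g (X i ω)) P (Measure.pi fun _ => μ.map g) := fun g hg => by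
    have hm : ∀ i, Measurable fun ω => g (X i ω) := fun i => hg.comp (hX.measurable i)
    refine ⟨measurable_pi_lambda _ hm, ?_⟩
    have hi := hX.indep.comp (fun _ => g) fun _ => hg
    rw [(iIndepFun_iff_map_fun_eq_pi_map fun i => (hm i).aemeasurable).1 hi]
    congr 1
    ext1 i
    rw [← hlaw i, Measure.map_map hg (hX.measurable i)]
    rfl
  have hp := hℓ.pairLaw ha
  have hmp := measurable_pairOf ℓ
  have fin : ∀ {xs : Fin n → ℝ} {x : Fin n → Bool × ℝ}, |thetaTilde xs| = |(|θ| + dl |θ| x)| →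
      nuHat xs = Real.sqrt ν ^ 2 + (z1 (Real.sqrt ν) |θ| x + rr |θ| x) →
      nuHat xs = ν + (z1 (Real.sqrt ν) |θ| x + rr |θ| x) ∧
        alphaTilde xs = 1 / bt (Real.sqrt ν) |θ| x := fun h1 h2 =>
    ⟨by rw [h2, hsq], by rw [alphaTilde, nuTilde_eq h1 h2, bt]⟩
  have hpm : IsProbabilityMeasure (μ.map (pairOf ℓ)) :=
    Measure.isProbabilityMeasure_map hmp.aemeasurable
  -- For negative θ the signs are exchanged. Both ν̂ and |θ̃| are invariant, hence so is α̃.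
  rcases le_total 0 θ with h0 | h0
  · refine ⟨μ.map (pairOf ℓ), hpm, fun ω i => pairOf ℓ (X i ω), ?_, key _ hmp, ?_⟩
    · rwa [abs_of_nonneg h0]
    · filter_upwards [hne] with ω hω
      obtain ⟨e1, e2⟩ := estimators_eq (a := Real.sqrt ν) (θ := θ) hn ℓ (fun i => X i ω) hω
      refine fin ?_ ?_ <;> rw [abs_of_nonneg h0]
      · rw [e1]
      · rw [e2]
  · have hfm := measurable_flip.comp hmp
    refine ⟨μ.map (flip ∘ pairOf ℓ), Measure.isProbabilityMeasure_map hfm.aemeasurable,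
      fun ω i => flip (pairOf ℓ (X i ω)), ?_, key _ hfm, ?_⟩
    · rw [abs_of_nonpos h0, ← Measure.map_map measurable_flip hmp]
      exact hp.flip
    · filter_upwards [hne] with ω hω
      obtain ⟨e1, e2⟩ := estimators_eq (a := Real.sqrt ν) (θ := θ) hn ℓ (fun i => X i ω) hω
      refine fin ?_ ?_ <;> rw [abs_of_nonpos h0]
      · rw [e1, dl_flip, ← neg_add, abs_neg]
      · rw [e2, z1_flip, rr_flip]

lemma mseBound_abs (ν θ : ℝ) (n : ℕ) (m : ℝ) : mseBound ν |θ| n m = mseBound ν θ n m := by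
  have e2 : |θ| ^ 2 = θ ^ 2 := sq_abs θ
  have e4 : |θ| ^ 4 = θ ^ 4 := Even.pow_abs (by decide) θ
  have e6 : |θ| ^ 6 = θ ^ 6 := Even.pow_abs (by decide) θ
  have e8 : |θ| ^ 8 = θ ^ 8 := Even.pow_abs (by decide) θ
  simp only [mseBound, P3', P3, P2, P1, Q4, Q6, Q8, DV, e2, e4, e6, e8]

end Transfer

/-! ### Bias and quadratic deviation for stable samples -/

section Moments

variable {n : ℕ} {θ ν τ : ℝ} {Ω : Type*} [MeasurableSpace Ω] {P : Measure Ω}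
  [IsProbabilityMeasure P] {X : Fin n → Ω → ℝ}

lemma kap_abs_le (hθ : |θ| ≤ min 1 (2 * Real.sqrt ν - 1)) : kap |θ| ≤ Real.sqrt ν := by
  have := hθ.trans (min_le_right _ _)
  rw [kap]
  linarith

lemma one_div_sub_one_div {a b : ℝ} (ha : 0 < a) :
    1 / b - 1 / a = 1 / (2 * a ^ 3) * errAt a b := by
  rw [errAt]
  field_simp

/-- The bias is at most the first absolute moment of the error. The factor 4 is 8a³ divided by the
normalization 2a³, and the constant involves neither n nor τ. -/
theorem IsStableSample.bias_le (hν : 1 / 4 ≤ ν) (hθ : |θ| ≤ min 1 (2 * Real.sqrt ν - 1))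
    (hn : 2 ≤ n) (hX : IsStableSample P ν θ τ X) :
    Integrable (fun ω => alphaTilde (fun i => X i ω)) P ∧
    |(∫ ω, alphaTilde (fun i => X i ω) ∂P) - 1 / Real.sqrt ν| ≤
      4 * Real.sqrt (sSq (Real.sqrt ν) |θ| + 2 * (9 / 4 * (1 - |θ| ^ 2) ^ 2 +
        dHat (Real.sqrt ν) |θ| ^ 2) + (3 + |θ|) ^ 2 / 16 * (1 - |θ| ^ 2)) / Real.sqrt n := by
  have ha : 0 < Real.sqrt ν := Real.sqrt_pos.2 (by linarith)
  have hκ := kap_abs_le hθ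
  have h0 := abs_nonneg θ
  have ha2 : 1 / 2 ≤ Real.sqrt ν := by rw [kap] at hκ; linarith
  obtain ⟨ρ, _, Φ, hρ, hΦ, hae⟩ := hX.exists_pairLaw hν hθ hn
  set a := Real.sqrt ν with hadef
  have hT := (hρ.tame_err (n := n) ha2).comp hΦ
  have hE : (fun ω => alphaTilde (fun i => X i ω)) =ᵐ[P]
      fun ω => 1 / (2 * a ^ 3) * errAt a (bt a |θ| (Φ ω)) + 1 / a := by
    filter_upwards [hae] with ω hω
    rw [hω.2, ← one_div_sub_one_div ha]
    ring
  have hI : Tame (fun ω => 1 / (2 * a ^ 3) * errAt a (bt a |θ| (Φ ω)) + 1 / a) P :=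
    ((Tame.const _).mul hT).add (Tame.const _)
  refine ⟨hI.integrable.congr hE.symm, ?_⟩
  rw [integral_congr_ae hE, integral_add (((Tame.const _).mul hT).integrable)
    (integrable_const _), integral_const_mul]
  simp only [integral_const, probReal_univ, smul_eq_mul, one_mul, add_sub_cancel_right]
  rw [abs_mul, abs_of_pos (by positivity : 0 < 1 / (2 * a ^ 3))]
  have hb := hρ.integral_abs_err_le (n := n) h0 hκ hn
  rw [← hΦ.map_eq, integral_map hΦ.measurable.aemeasurable] at hb
  swap
  · rw [hΦ.map_eq]
    exact (hρ.tame_err ha2).abs.aestronglyMeasurable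
  have h1 := abs_integral_le_integral_abs (f := fun ω => errAt a (bt a |θ| (Φ ω))) (μ := P)
  rw [Real.sqrt_div' _ (Nat.cast_nonneg n)] at hb
  refine (mul_le_mul_of_nonneg_left (h1.trans hb) (by positivity)).trans (le_of_eq ?_)
  field_simp
  ring

/-- The estimate for |θ| in normalized variables, squared and combined with `le_mseBound`; the bound
is even in θ. -/
theorem IsStableSample.mse_le (hν : 1 / 4 ≤ ν) (hθ : |θ| ≤ min 1 (2 * Real.sqrt ν - 1))
    (hn : 2 ≤ n) (hX : IsStableSample P ν θ τ X) :
    Integrable (fun ω => (nuHat (fun i => X i ω) - ν) ^ 2) P ∧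
    Integrable (fun ω => (alphaTilde (fun i => X i ω) - 1 / Real.sqrt ν) ^ 2) P ∧
    ∫ ω, (alphaTilde (fun i => X i ω) - 1 / Real.sqrt ν) ^ 2 ∂P ≤
      mseBound ν θ n (∫ ω, (nuHat (fun i => X i ω) - ν) ^ 2 ∂P) := by
  have ha : 0 < Real.sqrt ν := Real.sqrt_pos.2 (by linarith)
  have hsq : Real.sqrt ν ^ 2 = ν := Real.sq_sqrt (by linarith)
  have hκ := kap_abs_le hθ
  have h0 := abs_nonneg θ
  have ha2 : 1 / 2 ≤ Real.sqrt ν := by rw [kap] at hκ; linarith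
  obtain ⟨ρ, _, Φ, hρ, hΦ, hae⟩ := hX.exists_pairLaw hν hθ hn
  have hbound := fun m => le_mseBound (a := Real.sqrt ν) (θ := |θ|) (n := n) (m := m) ha hn
  rw [hsq] at hbound
  set a := Real.sqrt ν with hadef
  have hz := hρ.tame_z1 (n := n)
  have hr := hρ.tame_rr (n := n)
  have he := hρ.tame_err (n := n) ha2
  have hN : (fun ω => (nuHat (fun i => X i ω) - ν) ^ 2) =ᵐ[P]
      fun ω => (z1 a |θ| (Φ ω) + rr |θ| (Φ ω)) ^ 2 := by
    filter_upwards [hae] with ω hω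
    rw [hω.1]
    ring
  have hE : (fun ω => (alphaTilde (fun i => X i ω) - 1 / a) ^ 2) =ᵐ[P]
      fun ω => (1 / (2 * a ^ 3)) ^ 2 * errAt a (bt a |θ| (Φ ω)) ^ 2 := by
    filter_upwards [hae] with ω hω
    rw [hω.2, one_div_sub_one_div ha]
    ring
  have hzr : Tame (fun x : Fin n → Bool × ℝ => (z1 a |θ| x + rr |θ| x) ^ 2)
      (Measure.pi fun _ => ρ) := by fun_prop
  have he2 := he.pow 2
  have int_comp : ∀ {f : (Fin n → Bool × ℝ) → ℝ}, Tame f (Measure.pi fun _ => ρ) →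
      ∫ ω, f (Φ ω) ∂P = ∫ x, f x ∂(Measure.pi fun _ => ρ) := fun {f} hf => by
    rw [← hΦ.map_eq, integral_map hΦ.measurable.aemeasurable]
    rw [hΦ.map_eq]
    exact hf.aestronglyMeasurable
  refine ⟨(hzr.comp hΦ).integrable.congr hN.symm,
    ((he2.comp hΦ).integrable.const_mul _).congr hE.symm, ?_⟩
  rw [integral_congr_ae hN, integral_congr_ae hE, integral_const_mul, int_comp he2, int_comp hzr,
    ← l2_sq, ← mseBound_abs]
  refine le_trans (mul_le_mul_of_nonneg_left (pow_le_pow_left₀ l2_nonneg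
    (hρ.l2_err_le_sqrt_add h0 (hθ.trans (min_le_left _ _)) hκ hn) 2) (by positivity))
    (hbound _ (integral_nonneg fun _ => sq_nonneg _))

end Moments

end StableEstimation

end

theorem theorem1p1 (ν θ : ℝ) (hν : 1 / 4 ≤ ν) (hθ : |θ| ≤ min 1 (2 * Real.sqrt ν - 1)) :
    -- asymptotic unbiasedness of order `1/√n`
    (∃ C : ℝ, ∀ (n : ℕ) (τ : ℝ) (Ω : Type*) [MeasurableSpace Ω] (P : Measure Ω)
      [IsProbabilityMeasure P] (X : Fin n → Ω → ℝ), 2 ≤ n →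
      StableEstimation.IsStableSample P ν θ τ X →
        Integrable (fun ω => StableEstimation.alphaTilde (fun i => X i ω)) P ∧
        |(∫ ω, StableEstimation.alphaTilde (fun i => X i ω) ∂P) - 1 / Real.sqrt ν|
          ≤ C / Real.sqrt (n : ℝ)) ∧
    -- the bound for the quadratic deviation
    (∀ (n : ℕ) (τ : ℝ) (Ω : Type*) [MeasurableSpace Ω] (P : Measure Ω)
      [IsProbabilityMeasure P] (X : Fin n → Ω → ℝ), 2 ≤ n →
      StableEstimation.IsStableSample P ν θ τ X →
        Integrable (fun ω => (StableEstimation.nuHat (fun i => X i ω) - ν) ^ 2) P ∧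
        Integrable
          (fun ω => (StableEstimation.alphaTilde (fun i => X i ω) - 1 / Real.sqrt ν) ^ 2) P ∧
        ∫ ω, (StableEstimation.alphaTilde (fun i => X i ω) - 1 / Real.sqrt ν) ^ 2 ∂P
          ≤ StableEstimation.mseBound ν θ n
              (∫ ω, (StableEstimation.nuHat (fun i => X i ω) - ν) ^ 2 ∂P)) :=
  ⟨⟨_, fun _ _ _ _ _ _ _ hn hX => hX.bias_le hν hθ hn⟩,
    fun _ _ _ _ _ _ _ hn hX => hX.mse_le hν hθ hn⟩
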